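/- **Theorem (deformation formula).** Let $\nu\ge 1$, and let $\mathcal M$ be a finite-dimensional unital algebra of complex square matrices with a submultiplicative norm such that $|\mathbb 1|=1$. For $\lambda,\mu\in\mathbb C^\nu$ write $\lambda\cdot\mu=\sum_j\lambda_j\mu_j$. For $T>0$ let $D_T=\{t\in\mathbb C:|t|<T\}$, $D_T^+=\{t\in D_T:\operatorname{Re}t>0\}$, $\bar D_T^+=\{t\in D_T:\operatorname{Re}t\ge 0\}$. *Unperturbed operator.* Let $A,B,C$ be $\nu\times\nu$ complex matrix-valued functions, analytic near $0\in\mathbb C$, with $A(t),C(t)$ symmetric and $A(0)$ real positive definite. Assume that $A$, $iB$ and $C$ are real-valued on $i\mathbb R$ near $0$. Let $$P_0=\sum_{j,k}A_{jk}(t)\Big(\partial_{x_j}+\sum_l B_{jl}(t)x_l\Big)\Big(\partial_{x_k}+\sum_{l} B_{kl}(t)x_{l}\Big)-\sum_{j,k}C_{jk}(t)x_jx_k .$$ Put $E=\dot AA^{-1}+2A({}^{t}B-B)$ and $F=4AC-2A\dot B$. For small complex $t$ let $\tilde q^\flat_t,\tilde q^\sharp_t$ be the matrix-valued solutions on $[0,1]$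 of $$\ddot q(s)=tE(ts)\dot q(s)+t^2F(ts)q(s)$$ with $\tilde q^\flat_t(0)=0,\ \tilde q^\flat_t(1)=\mathbb 1$ and $\tilde q^\sharp_t(0)=\mathbb 1,\ \tilde q^\sharp_t(1)=0$. For $x,y\in\mathbb C^\nu$ put $\tilde q^\natural_t=\tilde q^\flat_t x+\tilde q^\sharp_t y$, and for $s,s'\in[0,1]$ put $$\tilde K_t(s,s')=\int_{\max(s,s')}^1\tilde q^\flat_{t\tau}\!\left(\tfrac s\tau\right)A(t\tau)\;{}^{t}\tilde q^\flat_{t\tau}\!\left(\tfrac{s'}\tau\right)d\tau .$$ Let $$\Phi(x,y,t)=\int_0^1\Big(\tfrac14\,\dot q\cdot A^{-1}(ts)\dot q+t\,\dot q\cdot B(ts)q+t^2\,q\cdot C(ts)q\Big)\Big|_{q=\tilde q^\natural_t(s)}ds,$$ $$\theta(t)=\frac{\nu}{2t}+\operatorname{Tr}(A(t)B(t))-\frac1t\sum_{j,k}A_{jk}(t)\,\partial_{x_j}\partial_{x_k}\Phi$$ (the derivatives $\partial_{x_j}\partial_{x_k}\Phi$ depend on $t$ only), and $$p^0_t(x,y)=\frac{1}{(\det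 A(0))^{1/2}(4\pi t)^{\nu/2}}\exp\Big(t\int_0^1\theta(ts)\,ds-\frac1t\Phi(x,y,t)\Big),$$ with the principal branch of the powers. *Potential.* Let $T_b>0$, let $f$ be a measurable $\mathcal M$-valued function on $D_{T_b}\times\mathbb R^\nu$, analytic in the first variable, and let $\mu_*$ be a positive Borel measure on $\mathbb R^\nu$ such that $$\int_{\mathbb R^\nu}e^{R|\xi|}\sup_{|t|<T_b}|f(t,\xi)|\,d\mu_*(\xi)<\infty\qquad\text{for every }R>0 .$$ Let $c(t,x)=\int_{\mathbb R^\nu}e^{ix\cdot\xi}f(t,\xi)\,d\mu_*(\xi)$ for $|t|<T_b$, $x\in\mathbb C^\nu$. *The series.* For $\nu\times\nu$ matrices $(Q_{jk})_{1\le j,k\le n}$, the operator $\exp\big(\sum_{j,k}\partial_{z_j}\cdot Q_{jk}\partial_{z_k}\big)$ acts on functions of $z=(z_1,\dots,z_n)\in\mathbb C^{\nu n}$ that are Fourier transforms of $\mathcal M$-valued measures on $\mathbb R^{\nu n}$ with exponential moments of all orders: it maps $$\int e^{i\sum_j z_j\cdot\xi_j}\,dm(\xi)\quad\text{to}\quad\int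 e^{i\sum_j z_j\cdot\xi_j}\,e^{-\sum_{j,k}\xi_j\cdot Q_{jk}\xi_k}\,dm(\xi),$$ whenever $e^{-\sum_{j,k}\xi_j\cdot Q_{jk}\xi_k}\,dm(\xi)$ also has exponential moments of all orders. Set $$p^{conj}=\mathbb 1+\sum_{n\ge1}v_n,$$ $$v_n(t,x,y)=t^n\int_{0<s_1<\dots<s_n<1}\Big[e^{t\sum_{j,k}\partial_{z_j}\cdot\tilde K_t(s_j,s_k)\partial_{z_k}}\,c(s_nt,z_n)\cdots c(s_1t,z_1)\Big]\Big|_{z_j=\tilde q^\natural_t(s_j),\;1\le j\le n}\,d^ns .$$ *Conclusion.* There exists $T_c\in(0,T_b]$ with the following properties. 1. For $t\in\bar D^+_{T_c}$ and $x,y\in\mathbb C^\nu$: $\tilde q^\flat_t$ and $\tilde q^\sharp_t$ exist and are unique, the operators above apply to the products of potentials, the integrals defining $v_n(t,x,y)$ converge absolutely, and so does the series defining $p^{conj}(t,x,y)$. 2. $p^{conj}$ is analytic on $D^+_{T_c}\times\mathbb C^{2\nu}$. 3. $t\mapsto p^{conj}(t,\cdot,\cdot)$ is a $C^\infty$ function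 on $\bar D^+_{T_c}$ with values in the Fréchet space of entire functions on $\mathbb C^{2\nu}$. 4. $p^{conj}\in C^\infty_{b,1}(i\,]-T_c,T_c[\,\times\mathbb R^{2\nu})$, that is, $p^{conj}$ is smooth there and for all $\alpha\in\mathbb N$, $\beta\in\mathbb N^{2\nu}$ there is a constant $M>0$ with $|\partial_t^\alpha\partial_{(x,y)}^\beta p^{conj}|\le M(1+|(x,y)|)^\alpha$ on $i\,]-T_c,T_c[\,\times\mathbb R^{2\nu}$. 5. The function $u=p^0\,p^{conj}$ satisfies $\partial_tu=(P_0+c(t,x))u$ for $t\in\bar D^+_{T_c}\setminus\{0\}$ and $x,y\in\mathbb C^\nu$ (at points with $\operatorname{Re}t=0$, $\partial_t$ is the complex derivative within $\bar D^+_{T_c}$), and $u|_{t=0^+}=\delta_{x=y}$: for every continuous compactly supported $\varphi:\mathbb R^\nu\to\mathbb C$, as $t\to0^+$ along the positive reals, $\int\varphi(x)u(t,x,y)\,dx\to\varphi(y)\mathbb 1$ for every $y\in\mathbb R^\nu$ and $\int\varphi(y)u(t,x,y)\,dy\to\varphi(x)\mathbb 1$ for every $x\in\mathbb R^\nu$.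 -/

import Mathlib

open MeasureTheory Filter Topology
open scoped ContDiff

namespace HeatDeformation

noncomputable section

/-! ### Discs and spaces of functions -/

/-- The open half-disc of the complex numbers `t` with `|t| < T` and `Re t > 0`. -/
def halfDisc (T : ℝ) : Set ℂ := {t | ‖t‖ < T ∧ 0 < t.re}

/-- The half-disc of the complex numbers `t` with `|t| < T` and `Re t ≥ 0`. -/
def halfDiscBar (T : ℝ) : Set ℂ := {t | ‖t‖ < T ∧ 0 ≤ t.re}

/-- `S` is a smooth function on `D` with values in the Fréchet space of entire `F`-valued functions
on `X`, whose topology is that of uniform convergence on compact sets: each `S t`, `t ∈ D`, is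
entire, and for every compact `K` the curve of restrictions `t ↦ S t |_K` is smooth on `D` as a map
into the Banach space of continuous functions on `K` (real differentiability, one-sided at the
boundary points of `D`). -/
def SmoothEntireValued {X F : Type*} [NormedAddCommGroup X] [NormedSpace ℂ X]
    [NormedAddCommGroup F] [NormedSpace ℂ F] (D : Set ℂ) (S : ℂ → X → F) : Prop :=
  (∀ t ∈ D, AnalyticOnNhd ℂ (S t) Set.univ) ∧
    ∃ G : ℂ → C(X, F), (∀ t ∈ D, ∀ z, G t z = S t z) ∧
      ∀ K : TopologicalSpace.Compacts X,
        ContDiffOn ℝ ∞ (fun t => (G t).restrict (K : Set X)) D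

/-- The space `C^∞_{b,1}` on `i(-T,T) × V`: smooth functions `S` such that every derivative of
order `a` in `t` and of order `b` in `x` is bounded by a constant times `(1 + |x|) ^ a`. -/
def CInftyB1 {V F : Type*} [NormedAddCommGroup V] [NormedSpace ℝ V]
    [NormedAddCommGroup F] [NormedSpace ℝ F] (T : ℝ) (S : ℂ → V → F) : Prop :=
  ContDiffOn ℝ ∞ (fun p : ℝ × V => S (Complex.I * p.1) p.2) (Set.Ioo (-T) T ×ˢ Set.univ) ∧
    ∀ a b : ℕ, ∃ M : ℝ, 0 < M ∧ ∀ τ ∈ Set.Ioo (-T) T, ∀ x : V,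
      ‖iteratedFDeriv ℝ b
          (fun x' : V => iteratedDeriv a (fun τ' : ℝ => S (Complex.I * τ') x') τ) x‖
        ≤ M * (1 + ‖x‖) ^ a

/-- The inclusion of `ℝ^ν` in `ℂ^ν`. -/
def toC {ν : ℕ} (x : EuclideanSpace ℝ (Fin ν)) : Fin ν → ℂ := fun i => (x i : ℂ)

/-- The bilinear product `z · ξ` for `z ∈ ℂ^ν` and `ξ ∈ ℝ^ν`. -/
def cdot {ν : ℕ} (z : Fin ν → ℂ) (ξ : EuclideanSpace ℝ (Fin ν)) : ℂ := z ⬝ᵥ toC ξ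

/-! ### The exponential of a second-order constant coefficient operator -/

section ExpOperator

variable {ν n : ℕ} {𝓜 : Type*} [NormedRing 𝓜] [NormedAlgebra ℂ 𝓜]

/-- `∑_{j,k} ξ_j · Q_{j,k} ξ_k`. -/
def quadForm (Q : Fin n → Fin n → Matrix (Fin ν) (Fin ν) ℂ)
    (ξ : Fin n → EuclideanSpace ℝ (Fin ν)) : ℂ :=
  ∑ j, ∑ k, toC (ξ j) ⬝ᵥ (Q j k).mulVec (toC (ξ k))

/-- The Fourier transform `z ↦ ∫ exp (i (z_1 · ξ_1 + ⋯ + z_n · ξ_n)) g(ξ) dm(ξ)` of the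
matrix-valued measure `g dm`, as a function on `(ℂ^ν)^n`. -/
def fourierMeasure (m : Measure (Fin n → EuclideanSpace ℝ (Fin ν)))
    (g : (Fin n → EuclideanSpace ℝ (Fin ν)) → 𝓜) (z : Fin n → Fin ν → ℂ) : 𝓜 :=
  ∫ ξ, Complex.exp (Complex.I * ∑ j, cdot (z j) (ξ j)) • g ξ ∂m

/-- The matrix-valued measure `g dm` has exponential moments of all orders. -/
def HasExpMoments (m : Measure (Fin n → EuclideanSpace ℝ (Fin ν)))
    (g : (Fin n → EuclideanSpace ℝ (Fin ν)) → 𝓜) : Prop :=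
  ∀ R : ℝ, Integrable (fun ξ => (Real.exp (R * ‖ξ‖) : ℂ) • g ξ) m

/-- `ψ` is the image of `φ` under `exp (∑_{j,k} ∂_{z_j} · Q_{j,k} ∂_{z_k})`. The operator is defined
on the Fourier transforms of matrix-valued measures with exponential moments, and it acts on each
exponential in the usual way, `exp (i z·ξ) ↦ exp (-∑_{j,k} ξ_j · Q_{j,k} ξ_k) exp (i z·ξ)`. -/
def IsExpQuad (Q : Fin n → Fin n → Matrix (Fin ν) (Fin ν) ℂ)
    (φ ψ : (Fin n → Fin ν → ℂ) → 𝓜) : Prop :=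
  ∃ (m : Measure (Fin n → EuclideanSpace ℝ (Fin ν)))
    (g : (Fin n → EuclideanSpace ℝ (Fin ν)) → 𝓜),
    IsFiniteMeasure m ∧ HasExpMoments m g ∧
      HasExpMoments m (fun ξ => Complex.exp (-quadForm Q ξ) • g ξ) ∧
      φ = fourierMeasure m g ∧
      ψ = fourierMeasure m (fun ξ => Complex.exp (-quadForm Q ξ) • g ξ)

/-- The function `exp (∑_{j,k} ∂_{z_j} · Q_{j,k} ∂_{z_k}) φ`, for `φ` in the domain of the
operator. -/
def expQuad (Q : Fin n → Fin n → Matrix (Fin ν) (Fin ν) ℂ)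
    (φ : (Fin n → Fin ν → ℂ) → 𝓜) : (Fin n → Fin ν → ℂ) → 𝓜 :=
  Classical.epsilon (IsExpQuad Q φ)

theorem ae_eq_zero_of_fourier_real {m : Measure (Fin n → EuclideanSpace ℝ (Fin ν))}
    {h : (Fin n → EuclideanSpace ℝ (Fin ν)) → ℝ} (hh : Integrable h m)
    (h0 : ∀ w : Fin n → EuclideanSpace ℝ (Fin ν),
      ∫ ξ, Complex.exp (Complex.I * ∑ j, cdot (toC (w j)) (ξ j)) * (h ξ : ℂ) ∂m = 0) :
    h =ᵐ[m] 0 := by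
  let L : (Fin n → EuclideanSpace ℝ (Fin ν)) →ₗ[ℝ]
      (Fin n → EuclideanSpace ℝ (Fin ν)) →ₗ[ℝ] ℝ :=
    LinearMap.mk₂ ℝ (fun v w => ∑ j, ∑ i, w j i * v j i)
      (by intros; simp [mul_add, Finset.sum_add_distrib])
      (by intros; simp [Finset.mul_sum, mul_left_comm])
      (by intros; simp [add_mul, Finset.sum_add_distrib])
      (by intros; simp [Finset.mul_sum, mul_assoc])
  have hLval : ∀ v w, L v w = ∑ j, ∑ i, w j i * v j i := fun v w => rfl
  have hL : Continuous fun p : (Fin n → EuclideanSpace ℝ (Fin ν)) ×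
      (Fin n → EuclideanSpace ℝ (Fin ν)) => L p.1 p.2 := by
    simp only [hLval]; fun_prop
  have hL' : ∀ v ≠ 0, L v ≠ 0 := by
    intro v hv hLv
    apply hv
    have h1 : ∑ j, ∑ i, v j i * v j i = 0 := by rw [← hLval v v, hLv]; rfl
    ext j i
    have h2 := (Finset.sum_eq_zero_iff_of_nonneg
      (fun j _ => Finset.sum_nonneg fun i _ => mul_self_nonneg (v j i))).1 h1 j (Finset.mem_univ _)
    have h3 := (Finset.sum_eq_zero_iff_of_nonneg
      (fun i _ => mul_self_nonneg (v j i))).1 h2 i (Finset.mem_univ _)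
    simpa using h3
  have hchar : ∀ w v, BoundedContinuousFunction.char Real.continuous_probChar hL w v
      = Complex.exp (Complex.I * ∑ j, cdot (toC (w j)) (v j)) := by
    intro w v
    simp [BoundedContinuousFunction.char, Real.probChar_apply, hLval, cdot, toC, dotProduct,
      mul_comm]
  have hfin : ∀ k : (Fin n → EuclideanSpace ℝ (Fin ν)) → ℝ, Integrable k m →
      IsFiniteMeasure (m.withDensity fun ξ => ENNReal.ofReal (k ξ)) := fun k hk =>
    isFiniteMeasure_withDensity_ofReal hk.2
  have := hfin h hh
  have := hfin (fun ξ => -h ξ) hh.neg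
  have hint : ∀ (k : (Fin n → EuclideanSpace ℝ (Fin ν)) → ℝ), Integrable k m → ∀ w,
      Integrable (fun v => (k v : ℂ) *
        BoundedContinuousFunction.char Real.continuous_probChar hL w v) m := by
    intro k hk w
    refine (hk.ofReal (𝕜 := ℂ)).mul_bdd (c := 1)
      (BoundedContinuousFunction.continuous _).aestronglyMeasurable ?_
    exact Eventually.of_forall fun v => (Circle.norm_coe _).le
  have hneg : AEMeasurable (fun ξ => ENNReal.ofReal (-h ξ)) m :=
    hh.1.aemeasurable.neg.ennreal_ofReal
  have key : m.withDensity (fun ξ => ENNReal.ofReal (h ξ))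
      = m.withDensity (fun ξ => ENNReal.ofReal (-h ξ)) := by
    refine ext_of_integral_char_eq Real.continuous_probChar Real.probChar_ne_one hL' hL
      fun w => ?_
    rw [integral_withDensity_eq_integral_toReal_smul₀ hh.1.aemeasurable.ennreal_ofReal
        (Eventually.of_forall fun _ => ENNReal.ofReal_lt_top),
      integral_withDensity_eq_integral_toReal_smul₀ hneg
        (Eventually.of_forall fun _ => ENNReal.ofReal_lt_top), ← sub_eq_zero]
    simp only [ENNReal.toReal_ofReal', Complex.real_smul]
    rw [← integral_sub (hint _ hh.pos_part w) (hint _ hh.neg_part w), ← h0 w]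
    refine integral_congr_ae (Eventually.of_forall fun v => ?_)
    simp only [hchar]
    rw [← sub_mul, mul_comm, ← Complex.ofReal_sub]
    congr 2
    rcases le_total 0 (h v) with h1 | h1 <;> simp [h1]
  rw [withDensity_eq_iff hh.1.aemeasurable.ennreal_ofReal hneg] at key
  · filter_upwards [key] with v hv
    rcases le_total 0 (h v) with h1 | h1
    · rw [ENNReal.ofReal_of_nonpos (by linarith : -h v ≤ 0), ENNReal.ofReal_eq_zero] at hv
      exact le_antisymm hv h1
    · rw [ENNReal.ofReal_of_nonpos h1, eq_comm, ENNReal.ofReal_eq_zero] at hv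
      exact le_antisymm h1 (by simpa using hv)
  · exact (lt_of_le_of_lt (lintegral_ofReal_le_lintegral_enorm _) hh.2).ne

theorem ae_eq_zero_of_fourier {m : Measure (Fin n → EuclideanSpace ℝ (Fin ν))}
    {h : (Fin n → EuclideanSpace ℝ (Fin ν)) → ℂ} (hh : Integrable h m)
    (h0 : ∀ w : Fin n → EuclideanSpace ℝ (Fin ν),
      ∫ ξ, Complex.exp (Complex.I * ∑ j, cdot (toC (w j)) (ξ j)) * h ξ ∂m = 0) :
    h =ᵐ[m] 0 := by
  have hb : ∀ (k : (Fin n → EuclideanSpace ℝ (Fin ν)) → ℂ), Integrable k m →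
      ∀ w : Fin n → EuclideanSpace ℝ (Fin ν), Integrable (fun ξ =>
        Complex.exp (Complex.I * ∑ j, cdot (toC (w j)) (ξ j)) * k ξ) m := by
    intro k hk w
    refine hk.bdd_mul (c := 1) (Continuous.aestronglyMeasurable ?_)
      (Eventually.of_forall fun v => ?_)
    · unfold cdot toC dotProduct; fun_prop
    · have : (∑ j, cdot (toC (w j)) (v j)) = ((∑ j, ∑ i, w j i * v j i : ℝ) : ℂ) := by
        simp [cdot, toC, dotProduct]
      rw [this, mul_comm, Complex.norm_exp_ofReal_mul_I]
  have hc : Integrable (fun ξ => (starRingEnd ℂ) (h ξ)) m :=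
    Complex.conjLIE.toContinuousLinearEquiv.toContinuousLinearMap.integrable_comp hh
  have h1 : ∀ w : Fin n → EuclideanSpace ℝ (Fin ν),
      ∫ ξ, Complex.exp (Complex.I * ∑ j, cdot (toC (w j)) (ξ j)) * (starRingEnd ℂ) (h ξ) ∂m
        = 0 := by
    intro w
    rw [← map_eq_zero (starRingEnd ℂ), ← integral_conj, ← h0 (-w)]
    refine integral_congr_ae (Eventually.of_forall fun v => ?_)
    simp [← Complex.exp_conj, cdot, toC, dotProduct]
  have hre : (fun ξ => (h ξ).re) =ᵐ[m] 0 := by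
    refine ae_eq_zero_of_fourier_real hh.re fun w => ?_
    have : ∀ ξ, Complex.exp (Complex.I * ∑ j, cdot (toC (w j)) (ξ j)) * ((h ξ).re : ℂ)
        = (1 / 2 : ℂ) * (Complex.exp (Complex.I * ∑ j, cdot (toC (w j)) (ξ j)) * h ξ
          + Complex.exp (Complex.I * ∑ j, cdot (toC (w j)) (ξ j)) * (starRingEnd ℂ) (h ξ)) := by
      intro ξ; rw [Complex.re_eq_add_conj]; ring
    simp only [this]
    rw [integral_const_mul, integral_add (hb _ hh w) (hb _ hc w), h0, h1]; simp
  have him : (fun ξ => (h ξ).im) =ᵐ[m] 0 := by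
    refine ae_eq_zero_of_fourier_real hh.im fun w => ?_
    have : ∀ ξ, Complex.exp (Complex.I * ∑ j, cdot (toC (w j)) (ξ j)) * ((h ξ).im : ℂ)
        = (1 / (2 * Complex.I) : ℂ) *
          (Complex.exp (Complex.I * ∑ j, cdot (toC (w j)) (ξ j)) * h ξ
          - Complex.exp (Complex.I * ∑ j, cdot (toC (w j)) (ξ j)) * (starRingEnd ℂ) (h ξ)) := by
      intro ξ; rw [Complex.im_eq_sub_conj]; ring
    simp only [this]
    rw [integral_const_mul, integral_sub (hb _ hh w) (hb _ hc w), h0, h1]; simp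
  filter_upwards [hre, him] with ξ h2 h3
  exact Complex.ext h2 h3

/-- The image of a function under the exponential of the operator is unique. -/
theorem IsExpQuad.unique [FiniteDimensional ℂ 𝓜] {Q : Fin n → Fin n → Matrix (Fin ν) (Fin ν) ℂ}
    {φ ψ₁ ψ₂ : (Fin n → Fin ν → ℂ) → 𝓜} (h₁ : IsExpQuad Q φ ψ₁) (h₂ : IsExpQuad Q φ ψ₂) :
    ψ₁ = ψ₂ := by
  obtain ⟨m₁, g₁, hm₁, hg₁, hQ₁, hφ₁, rfl⟩ := h₁
  obtain ⟨m₂, g₂, hm₂, hg₂, hQ₂, hφ₂, rfl⟩ := h₂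
  have : CompleteSpace 𝓜 := FiniteDimensional.complete ℂ 𝓜
  have : ProperSpace 𝓜 := FiniteDimensional.proper ℂ 𝓜
  have hac₁ : m₁ ≪ m₁ + m₂ := Measure.AbsolutelyContinuous.rfl.add_right _
  have hac₂ : m₂ ≪ m₁ + m₂ := by
    rw [add_comm]; exact Measure.AbsolutelyContinuous.rfl.add_right _
  set m := m₁ + m₂ with hm
  set r₁ := fun ξ => (m₁.rnDeriv m ξ).toReal with hr₁
  set r₂ := fun ξ => (m₂.rnDeriv m ξ).toReal with hr₂
  have mom : ∀ (μ : Measure (Fin n → EuclideanSpace ℝ (Fin ν)))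
      (g : (Fin n → EuclideanSpace ℝ (Fin ν)) → 𝓜), HasExpMoments μ g →
      ∀ z : Fin n → Fin ν → ℂ, Integrable
        (fun ξ => Complex.exp (Complex.I * ∑ j, cdot (z j) (ξ j)) • g ξ) μ := by
    intro μ g hg z
    have hgm : AEStronglyMeasurable g μ := by simpa using (hg 0).1
    refine (hg (∑ j, ∑ i, ‖z j i‖)).mono (AEStronglyMeasurable.smul
      (Continuous.aestronglyMeasurable (by unfold cdot toC dotProduct; fun_prop)) hgm)
      (Eventually.of_forall fun ξ => ?_)
    rw [norm_smul, norm_smul]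
    refine mul_le_mul_of_nonneg_right ?_ (norm_nonneg _)
    rw [Complex.norm_exp, Complex.norm_real, Real.norm_eq_abs, Real.abs_exp, Real.exp_le_exp]
    refine (Complex.re_le_norm _).trans ?_
    rw [norm_mul, Complex.norm_I, one_mul, Finset.sum_mul]
    refine (norm_sum_le _ _).trans (Finset.sum_le_sum fun j _ => ?_)
    rw [Finset.sum_mul]
    unfold cdot dotProduct
    refine (norm_sum_le _ _).trans (Finset.sum_le_sum fun i _ => ?_)
    rw [norm_mul]
    refine mul_le_mul_of_nonneg_left ?_ (norm_nonneg _)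
    rw [toC, Complex.norm_real]
    exact (PiLp.norm_apply_le (ξ j) i).trans (norm_le_pi_norm ξ j)
  have int₁ : Integrable (fun ξ => r₁ ξ • g₁ ξ) m :=
    (integrable_rnDeriv_smul_iff hac₁).2 (by simpa using hg₁ 0)
  have int₂ : Integrable (fun ξ => r₂ ξ • g₂ ξ) m :=
    (integrable_rnDeriv_smul_iff hac₂).2 (by simpa using hg₂ 0)
  have tr₁ : ∀ u : (Fin n → EuclideanSpace ℝ (Fin ν)) → 𝓜,
      ∫ ξ, u ξ ∂m₁ = ∫ ξ, r₁ ξ • u ξ ∂m := fun u => (integral_rnDeriv_smul hac₁).symm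
  have tr₂ : ∀ u : (Fin n → EuclideanSpace ℝ (Fin ν)) → 𝓜,
      ∫ ξ, u ξ ∂m₂ = ∫ ξ, r₂ ξ • u ξ ∂m := fun u => (integral_rnDeriv_smul hac₂).symm
  have hz : (fun ξ => r₁ ξ • g₁ ξ - r₂ ξ • g₂ ξ) =ᵐ[m] 0 := by
    refine ae_eq_zero_of_forall_dual ℂ fun ℓ => ?_
    refine ae_eq_zero_of_fourier (ℓ.integrable_comp (int₁.sub int₂)) fun w => ?_
    have e := congrFun (hφ₁.symm.trans hφ₂) fun j => toC (w j)
    unfold fourierMeasure at e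
    rw [tr₁, tr₂, ← sub_eq_zero,
      ← integral_sub ((integrable_rnDeriv_smul_iff hac₁).2 (mom _ _ hg₁ _))
        ((integrable_rnDeriv_smul_iff hac₂).2 (mom _ _ hg₂ _))] at e
    have e' := ℓ.integral_comp_comm
      (((integrable_rnDeriv_smul_iff hac₁).2 (mom _ _ hg₁ fun j => toC (w j))).sub
        ((integrable_rnDeriv_smul_iff hac₂).2 (mom _ _ hg₂ fun j => toC (w j))))
    simp only [Pi.sub_apply] at e'
    rw [e, map_zero] at e'
    rw [← e']
    refine integral_congr_ae (Eventually.of_forall fun ξ => ?_)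
    change _ * ℓ (r₁ ξ • g₁ ξ - r₂ ξ • g₂ ξ) = ℓ (r₁ ξ • _ - r₂ ξ • _)
    rw [smul_comm (r₁ ξ), smul_comm (r₂ ξ), ← smul_sub, map_smul, smul_eq_mul]
  funext z
  unfold fourierMeasure
  rw [tr₁, tr₂]
  refine integral_congr_ae ?_
  filter_upwards [hz] with ξ hξ
  have hξ' : r₁ ξ • g₁ ξ = r₂ ξ • g₂ ξ := sub_eq_zero.1 hξ
  simp only [smul_comm (r₁ ξ), smul_comm (r₂ ξ), hξ']

theorem expQuad_eq [FiniteDimensional ℂ 𝓜] {Q : Fin n → Fin n → Matrix (Fin ν) (Fin ν) ℂ}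
    {φ ψ : (Fin n → Fin ν → ℂ) → 𝓜} (h : IsExpQuad Q φ ψ) : expQuad Q φ = ψ :=
  (Classical.epsilon_spec (p := IsExpQuad Q φ) ⟨ψ, h⟩).unique h

end ExpOperator

/-! ### The classical objects attached to the unperturbed operator -/

section Classical

variable {ν : ℕ} (A B C : ℂ → Matrix (Fin ν) (Fin ν) ℂ)

/-- The entrywise derivative of a matrix-valued function of a complex variable. -/
def matDeriv (G : ℂ → Matrix (Fin ν) (Fin ν) ℂ) (t : ℂ) : Matrix (Fin ν) (Fin ν) ℂ :=
  Matrix.of fun j k => deriv (fun t' => G t' j k) t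

/-- `E = A' A⁻¹ + 2 A (ᵗB - B)`. -/
def coefE (t : ℂ) : Matrix (Fin ν) (Fin ν) ℂ :=
  matDeriv A t * (A t)⁻¹ + (2 : ℂ) • (A t * ((B t).transpose - B t))

/-- `F = 4 A C - 2 A B'`. -/
def coefF (t : ℂ) : Matrix (Fin ν) (Fin ν) ℂ :=
  (4 : ℂ) • (A t * C t) - (2 : ℂ) • (A t * matDeriv B t)

/-- `q` solves `q'' = t E(ts) q' + t² F(ts) q` on `[0,1]` with `q(0) = q₀`, `q(1) = q₁`
(matrix-valued; `p` is the first derivative of `q`). -/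
def IsBVPSol (t : ℂ) (q₀ q₁ : Matrix (Fin ν) (Fin ν) ℂ)
    (q : ℝ → Matrix (Fin ν) (Fin ν) ℂ) : Prop :=
  q 0 = q₀ ∧ q 1 = q₁ ∧ ∃ p : ℝ → Matrix (Fin ν) (Fin ν) ℂ,
    ∀ s ∈ Set.Icc (0 : ℝ) 1, ∀ j k,
      HasDerivWithinAt (fun s' => q s' j k) (p s j k) (Set.Icc 0 1) s ∧
      HasDerivWithinAt (fun s' => p s' j k)
        ((t • (coefE A B (t * s) * p s) + t ^ 2 • (coefF A B C (t * s) * q s)) j k)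
        (Set.Icc 0 1) s

/-- The boundary value problem has a solution, unique on `[0,1]`. -/
def BVPUniquelySolvable (t : ℂ) (q₀ q₁ : Matrix (Fin ν) (Fin ν) ℂ) : Prop :=
  ∃ q, IsBVPSol A B C t q₀ q₁ q ∧
    ∀ q', IsBVPSol A B C t q₀ q₁ q' → Set.EqOn q' q (Set.Icc 0 1)

/-- The solution with `q(0) = 0` and `q(1) = 1`. -/
def qFlat (t : ℂ) : ℝ → Matrix (Fin ν) (Fin ν) ℂ := Classical.epsilon (IsBVPSol A B C t 0 1)

/-- The solution with `q(0) = 1` and `q(1) = 0`. -/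
def qSharp (t : ℂ) : ℝ → Matrix (Fin ν) (Fin ν) ℂ := Classical.epsilon (IsBVPSol A B C t 1 0)

/-- The rescaled classical path from `y` (at `s = 0`) to `x` (at `s = 1`). -/
def qNat (t : ℂ) (x y : Fin ν → ℂ) (s : ℝ) : Fin ν → ℂ :=
  (qFlat A B C t s).mulVec x + (qSharp A B C t s).mulVec y

/-- `K_t(s,s') = ∫_{max(s,s')}^1 q_{tτ}(s/τ) A(tτ) ᵗq_{tτ}(s'/τ) dτ`, `q = qFlat`. -/
def propK (t : ℂ) (s s' : ℝ) : Matrix (Fin ν) (Fin ν) ℂ :=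
  Matrix.of fun j k => ∫ τ in (max s s')..1,
    (qFlat A B C (t * τ) (s / τ) * A (t * τ) * (qFlat A B C (t * τ) (s' / τ)).transpose) j k

/-- The reduced action `Φ(x,y,t)`: the integral over `[0,1]` of
`(1/4) q'·A⁻¹(ts) q' + t q'·B(ts) q + t² q·C(ts) q` along the classical path. -/
def reducedAction (x y : Fin ν → ℂ) (t : ℂ) : ℂ :=
  ∫ s in (0 : ℝ)..1,
    ((1 / 4 : ℂ) * (deriv (qNat A B C t x y) s ⬝ᵥ
        (A (t * s))⁻¹.mulVec (deriv (qNat A B C t x y) s))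
      + t * (deriv (qNat A B C t x y) s ⬝ᵥ (B (t * s)).mulVec (qNat A B C t x y s))
      + t ^ 2 * (qNat A B C t x y s ⬝ᵥ (C (t * s)).mulVec (qNat A B C t x y s)))

/-- The complex partial derivative `∂_{x_j}`. -/
def pd {F : Type*} [NormedAddCommGroup F] [NormedSpace ℂ F] (j : Fin ν)
    (w : (Fin ν → ℂ) → F) (x : Fin ν → ℂ) : F :=
  fderiv ℂ w x (Pi.single j 1)

/-- `θ(t) = ν/(2t) + Tr (A B) - (1/t) A · ∂_x² Φ` for `t ≠ 0`; as `Φ` is quadratic in `(x,y)`, the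
second derivatives do not depend on `(x,y)` and are taken at the origin. -/
def theta (t : ℂ) : ℂ :=
  (ν : ℂ) / (2 * t) + (A t * B t).trace
    - 1 / t * ∑ j, ∑ k, A t j k * pd j (pd k (fun x => reducedAction A B C x 0 t)) 0

/-- The unperturbed kernel
`p⁰_t(x,y) = det A(0)^{-1/2} (4πt)^{-ν/2} exp (∫_0^t θ - Φ(x,y,t)/t)`. -/
def pZero (t : ℂ) (x y : Fin ν → ℂ) : ℂ :=
  ((A 0).det ^ (1 / 2 : ℂ))⁻¹ * (((4 * (Real.pi : ℂ) * t) ^ (1 / 2 : ℂ)) ^ ν)⁻¹ *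
    Complex.exp (t * (∫ s in (0 : ℝ)..1, theta A B C (t * s))
      - 1 / t * reducedAction A B C x y t)

/-- `∂_{x_j} + ∑_l B_{j,l}(t) x_l`. -/
def covD {F : Type*} [NormedAddCommGroup F] [NormedSpace ℂ F] (t : ℂ) (j : Fin ν)
    (w : (Fin ν → ℂ) → F) (x : Fin ν → ℂ) : F :=
  pd j w x + ((B t).mulVec x) j • w x

/-- The operator `P₀ = A(t)·(∂_x + B(t)x)² - C(t)·x⊗x`. -/
def opP0 {F : Type*} [NormedAddCommGroup F] [NormedSpace ℂ F] (t : ℂ)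
    (w : (Fin ν → ℂ) → F) (x : Fin ν → ℂ) : F :=
  (∑ j, ∑ k, A t j k • covD B t j (covD B t k w) x) - (x ⬝ᵥ (C t).mulVec x) • w x

end Classical

/-! ### The potential and the deformation series -/

section Series

variable {ν : ℕ} {𝓜 : Type*} [NormedRing 𝓜] [NormedAlgebra ℂ 𝓜]

/-- `c(t,x) = ∫ exp (i x·ξ) f(t,ξ) dμ(ξ)`. -/
def potential (μ : Measure (EuclideanSpace ℝ (Fin ν))) (f : ℂ → EuclideanSpace ℝ (Fin ν) → 𝓜)
    (t : ℂ) (x : Fin ν → ℂ) : 𝓜 :=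
  ∫ ξ, Complex.exp (Complex.I * cdot x ξ) • f t ξ ∂μ

/-- The time-ordered product `z ↦ c(s_n t, z_n) ⋯ c(s_1 t, z_1)`. -/
def orderedProd (c : ℂ → (Fin ν → ℂ) → 𝓜) {n : ℕ} (t : ℂ) (s : Fin n → ℝ)
    (z : Fin n → Fin ν → ℂ) : 𝓜 :=
  (List.ofFn fun j => c (s j * t) (z j)).reverse.prod

/-- The simplex `0 < s_1 < ⋯ < s_n < 1`. -/
def openSimplex (n : ℕ) : Set (Fin n → ℝ) :=
  {s | StrictMono s ∧ ∀ j, s j ∈ Set.Ioo (0 : ℝ) 1}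

variable (A B C : ℂ → Matrix (Fin ν) (Fin ν) ℂ) (c : ℂ → (Fin ν → ℂ) → 𝓜)

/-- The integrand of `v_n`:
`exp (t ∑_{j,k} ∂_{z_j}·K_t(s_j,s_k) ∂_{z_k}) c(s_n t, z_n) ⋯ c(s_1 t, z_1)` evaluated at
`z_j = q_t(s_j)`, where `q_t` is the classical path from `y` to `x`. -/
def vIntegrand (n : ℕ) (t : ℂ) (x y : Fin ν → ℂ) (s : Fin n → ℝ) : 𝓜 :=
  expQuad (fun j k => t • propK A B C t (s j) (s k)) (orderedProd c t s)
    (fun j => qNat A B C t x y (s j))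

/-- `v_n(t,x,y)`. -/
def vTerm (n : ℕ) (t : ℂ) (x y : Fin ν → ℂ) : 𝓜 :=
  t ^ n • ∫ s in openSimplex n, vIntegrand A B C c n t x y s

/-- `p^conj = 1 + ∑_{n ≥ 1} v_n`. -/
def pConj (t : ℂ) (x y : Fin ν → ℂ) : 𝓜 :=
  1 + ∑' n : ℕ, vTerm A B C c (n + 1) t x y

/-- All the ingredients of `p^conj(t,x,y)` exist: the two boundary value problems are uniquely
solvable, the exponentials of differential operators apply to the products of potentials, the
iterated integrals converge absolutely, and so does the series. -/
def SeriesWellDefined (t : ℂ) (x y : Fin ν → ℂ) : Prop :=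
  BVPUniquelySolvable A B C t 0 1 ∧ BVPUniquelySolvable A B C t 1 0 ∧
    (∀ n : ℕ, 1 ≤ n →
      (∀ s ∈ openSimplex n, ∃ ψ,
        IsExpQuad (fun j k => t • propK A B C t (s j) (s k)) (orderedProd c t s) ψ) ∧
      IntegrableOn (vIntegrand A B C c n t x y) (openSimplex n)) ∧
    Summable fun n : ℕ => ‖vTerm A B C c (n + 1) t x y‖

end Series

end

end HeatDeformation

open HeatDeformation

namespace HeatDeformation

section SeveralVariables

/-! ### Holomorphic functions on complex normed spaces -/

variable {X : Type} [NormedAddCommGroup X] [NormedSpace ℂ X]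

theorem norm_fderiv_le_of_ball {F : Type*} [NormedAddCommGroup F] [NormedSpace ℂ F]
    {f : X → F} {O : Set X} (hO : IsOpen O) (hf : DifferentiableOn ℂ f O) {y : X} {ρ M : ℝ}
    (hρ : 0 < ρ) (hM0 : 0 ≤ M) (hsub : Metric.ball y ρ ⊆ O)
    (hM : ∀ z ∈ Metric.ball y ρ, ‖f z‖ ≤ M) :
    ‖fderiv ℂ f y‖ ≤ M / ρ := by
  refine ContinuousLinearMap.opNorm_le_bound _ (by positivity) fun v => ?_
  rcases eq_or_ne v 0 with rfl | hv
  · simp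
  have hv' : 0 < ‖v‖ := norm_pos_iff.2 hv
  have hmem : ∀ z : ℂ, ‖z‖ < ρ / ‖v‖ → y + z • v ∈ Metric.ball y ρ := by
    intro z hz
    rw [Metric.mem_ball, dist_eq_norm, add_sub_cancel_left, norm_smul]
    exact (lt_div_iff₀ hv').1 hz
  have hd : ∀ z : ℂ, ‖z‖ < ρ / ‖v‖ →
      HasDerivAt (fun z : ℂ => f (y + z • v)) (fderiv ℂ f (y + z • v) v) z := by
    intro z hz
    have h1 : HasFDerivAt f (fderiv ℂ f (y + z • v)) (y + z • v) :=
      (hf.differentiableAt (hO.mem_nhds (hsub (hmem z hz)))).hasFDerivAt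
    have h2 : HasDerivAt (fun z : ℂ => y + z • v) v z := by
      simpa using ((hasDerivAt_id z).smul_const v).const_add y
    exact h1.comp_hasDerivAt z h2
  have h0 : fderiv ℂ f y v = deriv (fun z : ℂ => f (y + z • v)) 0 := by
    have := (hd 0 (by simpa using div_pos hρ hv')).deriv
    simpa using this.symm
  rw [h0]
  have key : ∀ R : ℝ, 0 < R → R < ρ / ‖v‖ → ‖deriv (fun z : ℂ => f (y + z • v)) 0‖ ≤ M / R := by
    intro R hR hRρ
    refine Complex.norm_deriv_le_of_forall_mem_sphere_norm_le hR ?_ ?_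
    · refine DifferentiableOn.diffContOnCl fun z hz => ?_
      refine (hd z ?_).differentiableAt.differentiableWithinAt
      rw [closure_ball _ hR.ne', Metric.mem_closedBall, dist_zero_right] at hz
      exact hz.trans_lt hRρ
    · intro z hz
      refine hM _ (hmem z ?_)
      rw [mem_sphere_zero_iff_norm] at hz
      rwa [hz]
  have hlim : Tendsto (fun R : ℝ => M / R) (𝓝[<] (ρ / ‖v‖)) (𝓝 (M / (ρ / ‖v‖))) :=
    (tendsto_const_nhds.div tendsto_id (div_pos hρ hv').ne').mono_left nhdsWithin_le_nhds
  refine (ge_of_tendsto hlim ?_).trans (le_of_eq (by field_simp))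
  filter_upwards [Ioo_mem_nhdsLT (div_pos hρ hv')] with R hR
  exact key R hR.1 hR.2

theorem norm_iteratedFDeriv_le_of_ball_aux {r ρ : ℝ} (hr : 0 < r) (hρ : 0 < ρ) (p : X) {O : Set X}
    (hO : IsOpen O) (k : ℕ) :
    ∀ {F : Type*} [NormedAddCommGroup F] [NormedSpace ℂ F] {f : X → F} (_ : ContDiffOn ℂ ∞ f O)
      {M : ℝ} (_ : 0 ≤ M) (_ : Metric.ball p (k * ρ + r) ⊆ O)
      (_ : ∀ z ∈ Metric.ball p (k * ρ + r), ‖f z‖ ≤ M),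
      ‖iteratedFDeriv ℂ k f p‖ ≤ M / ρ ^ k := by
  induction k with
  | zero =>
    intro F _ _ f hf M hM0 hsub hM
    simpa using hM p (by simpa using hr)
  | succ k ih =>
    intro F _ _ f hf M hM0 hsub hM
    rw [← norm_iteratedFDeriv_fderiv]
    have hball : ∀ y ∈ Metric.ball p (k * ρ + r), Metric.ball y ρ ⊆ Metric.ball p
        ((k + 1 : ℕ) * ρ + r) := by
      intro y hy
      refine Metric.ball_subset_ball' ?_
      rw [Metric.mem_ball] at hy
      push_cast
      linarith
    have := ih (f := fderiv ℂ f) (hf.fderiv_of_isOpen hO (by simp)) (M := M / ρ)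
      (by positivity) (fun y hy => hsub (hball y hy (Metric.mem_ball_self hρ))) fun y hy =>
        norm_fderiv_le_of_ball hO (hf.differentiableOn (by simp)) hρ hM0
          ((hball y hy).trans hsub) fun z hz => hM z (hball y hy hz)
    refine this.trans (le_of_eq ?_)
    rw [pow_succ']
    field_simp

/-- Cauchy's estimates in several variables. -/
theorem norm_iteratedFDeriv_le_of_ball {F : Type*} [NormedAddCommGroup F] [NormedSpace ℂ F]
    {f : X → F} {O : Set X} (hO : IsOpen O) (hf : ContDiffOn ℂ ∞ f O) {p : X} {R M : ℝ}
    (hR : 0 < R) (hM0 : 0 ≤ M) (hsub : Metric.ball p R ⊆ O)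
    (hM : ∀ z ∈ Metric.ball p R, ‖f z‖ ≤ M) (k : ℕ) :
    ‖iteratedFDeriv ℂ k f p‖ ≤ M * ((k + 1) / R) ^ k := by
  have e : (k : ℝ) * (R / (k + 1)) + R / (k + 1) = R := by field_simp
  have := norm_iteratedFDeriv_le_of_ball_aux (r := R / (k + 1)) (ρ := R / (k + 1)) (by positivity)
    (by positivity) p hO k hf hM0 (by rwa [e]) (by rwa [e])
  refine this.trans (le_of_eq ?_)
  rw [div_pow, div_pow]
  field_simp

theorem iteratedDeriv_comp_line {O : Set X} (hO : IsOpen O) (p v : X) (k : ℕ) :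
    ∀ {F : Type*} [NormedAddCommGroup F] [NormedSpace ℂ F] {f : X → F} (_ : ContDiffOn ℂ ∞ f O)
      {z : ℂ} (_ : p + z • v ∈ O),
      iteratedDeriv k (fun z : ℂ => f (p + z • v)) z
        = iteratedFDeriv ℂ k f (p + z • v) fun _ => v := by
  induction k with
  | zero => intro F _ _ f hf z hz; simp
  | succ k ih =>
    intro F _ _ f hf z hz
    have hl : ∀ z : ℂ, HasDerivAt (fun z : ℂ => p + z • v) v z := fun z => by
      simpa using ((hasDerivAt_id z).smul_const v).const_add p
    have hopen : IsOpen {z : ℂ | p + z • v ∈ O} := hO.preimage (by fun_prop)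
    rw [iteratedDeriv_succ']
    have h1 : deriv (fun z : ℂ => f (p + z • v)) =ᶠ[𝓝 z]
        fun z => (fun y => fderiv ℂ f y v) (p + z • v) := by
      filter_upwards [hopen.mem_nhds hz] with z' hz'
      exact (((hf.differentiableOn (by simp)).differentiableAt
        (hO.mem_nhds hz')).hasFDerivAt.comp_hasDerivAt z' (hl z')).deriv
    have hfd : ContDiffOn ℂ ∞ (fderiv ℂ f) O := hf.fderiv_of_isOpen hO (by simp)
    rw [(h1.iteratedDeriv k).self_of_nhds, ih (hfd.clm_apply contDiffOn_const) hz,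
      iteratedFDeriv_succ_apply_right]
    have h2 := (ContinuousLinearMap.apply ℂ F v).iteratedFDeriv_comp_left (i := k)
      (hfd.contDiffAt (hO.mem_nhds hz)) (by exact_mod_cast le_top)
    have h3 := congrArg (fun L => L fun _ => v) h2
    have h4 : (Fin.init fun _ : Fin (k + 1) => v) = fun _ => v := rfl
    rw [h4]
    simpa [Function.comp_def] using h3

/-- A function of several complex variables that is smooth in the complex sense is analytic. -/
theorem analyticOnNhd_of_contDiffOn {F : Type*} [NormedAddCommGroup F] [NormedSpace ℂ F]
    [CompleteSpace F] {f : X → F} {O : Set X} (hO : IsOpen O) (hf : ContDiffOn ℂ ∞ f O) :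
    AnalyticOnNhd ℂ f O := by
  intro p hp
  have hc : ContinuousAt f p := hf.continuousOn.continuousAt (hO.mem_nhds hp)
  obtain ⟨R, hR, hRO⟩ := Metric.isOpen_iff.1 (hO.inter (isOpen_interior (s := f ⁻¹' Metric.ball (f p) 1))) p
    ⟨hp, mem_interior_iff_mem_nhds.2 (hc (Metric.ball_mem_nhds _ one_pos))⟩
  have hsub : Metric.ball p R ⊆ O := fun z hz => (hRO hz).1
  have hM : ∀ z ∈ Metric.ball p R, ‖f z‖ ≤ ‖f p‖ + 1 := by
    intro z hz
    have h1 : z ∈ f ⁻¹' Metric.ball (f p) 1 := interior_subset (hRO hz).2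
    rw [Set.mem_preimage] at h1
    rw [Metric.mem_ball, dist_eq_norm] at h1
    have h2 := norm_add_le (f p) (f z - f p)
    rw [add_sub_cancel] at h2
    linarith
  set M := ‖f p‖ + 1 with hMdef
  have hM0 : 0 ≤ M := by positivity
  let P : FormalMultilinearSeries ℂ X F := fun n => ((n.factorial : ℂ)⁻¹) • iteratedFDeriv ℂ n f p
  set r : NNReal := ⟨R / (2 * Real.exp 1), by positivity⟩ with hr
  have hr0 : 0 < r := by
    rw [← NNReal.coe_pos]; change 0 < R / (2 * Real.exp 1); positivity
  have hrR : (r : ℝ) ≤ R := by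
    change R / (2 * Real.exp 1) ≤ R
    refine div_le_self hR.le ?_
    nlinarith [Real.add_one_le_exp (1 : ℝ)]
  refine ⟨P, r, ?_, by exact_mod_cast hr0, ?_⟩
  · refine P.le_radius_of_bound (M * Real.exp 1) fun n => ?_
    have h1 := norm_iteratedFDeriv_le_of_ball hO hf hR hM0 hsub hM n
    have h2 : ((n : ℝ) + 1) ^ n / n.factorial ≤ Real.exp 1 ^ (n + 1) := by
      have := Real.pow_div_factorial_le_exp (x := (n : ℝ) + 1) (by positivity) n
      refine this.trans (le_of_eq ?_)
      rw [← Real.exp_nat_mul]; push_cast; simp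
    calc ‖P n‖ * (r : ℝ) ^ n = (n.factorial : ℝ)⁻¹ * ‖iteratedFDeriv ℂ n f p‖ * (r : ℝ) ^ n := by
          simp [P, norm_smul]
      _ ≤ (n.factorial : ℝ)⁻¹ * (M * ((n + 1) / R) ^ n) * (R / (2 * Real.exp 1)) ^ n := by
          gcongr
          exact le_rfl
      _ = M * (((n : ℝ) + 1) ^ n / n.factorial) * ((1 / (2 * Real.exp 1)) ^ n) := by
          simp only [div_pow, mul_pow, one_pow]
          field_simp
      _ ≤ M * Real.exp 1 ^ (n + 1) * ((1 / (2 * Real.exp 1)) ^ n) := by gcongr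
      _ = M * Real.exp 1 * (1 / 2) ^ n := by
          simp only [div_pow, mul_pow, pow_succ, one_pow]
          field_simp
      _ ≤ M * Real.exp 1 * 1 := by
          gcongr
          exact pow_le_one₀ (by norm_num) (by norm_num)
      _ = M * Real.exp 1 := mul_one _
  · intro y hy
    have hy' : ‖y‖ < R := by
      have h1 : ‖y‖ < (r : ℝ) := by
        simpa [Metric.mem_eball, edist_zero_right, enorm_eq_nnnorm] using hy
      exact h1.trans_le hrR
    have hd : DifferentiableOn ℂ (fun z : ℂ => f (p + z • y))
        (Metric.ball 0 (R / (‖y‖ + (R - ‖y‖) / 2))) := by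
      intro z hz
      have hy0 : 0 ≤ ‖y‖ := norm_nonneg y
      rw [Metric.mem_ball, dist_zero_right, lt_div_iff₀ (by linarith)] at hz
      have hz2 : p + z • y ∈ O := by
        refine hsub ?_
        rw [Metric.mem_ball, dist_eq_norm, add_sub_cancel_left, norm_smul]
        nlinarith [norm_nonneg z]
      have := (hf.differentiableOn (by simp)).differentiableAt (hO.mem_nhds hz2)
      exact (this.comp z (f := fun z : ℂ => p + z • y) (by fun_prop)).differentiableWithinAt
    have h1 := Complex.hasSum_taylorSeries_on_ball hd (z := 1) (by
      rw [Metric.mem_ball, dist_zero_right, norm_one, lt_div_iff₀ (by linarith [norm_nonneg y])]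
      linarith)
    have h2 : (fun n => P n fun _ => y) = fun n : ℕ => (n.factorial : ℂ)⁻¹ • ((1 : ℂ) - 0) ^ n •
        iteratedDeriv n (fun z : ℂ => f (p + z • y)) 0 := by
      funext n
      have := iteratedDeriv_comp_line hO p y n hf (z := 0) (by simpa using hp)
      rw [this]
      simp [P]
    rw [h2]
    simpa using h1

end SeveralVariables

end HeatDeformation

namespace HeatDeformation

section SmoothFamily

/-! ### Smooth dependence of series of integrals on a parameter -/

variable {X : Type} [NormedAddCommGroup X] [NormedSpace ℂ X]
  {Ω : ℕ → Type} [∀ n, MeasurableSpace (Ω n)]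

/-- A sequence of integrands that are smooth on the open set `O`, all of whose derivatives are
dominated, locally uniformly on `D`, by integrable functions with summable integrals. -/
structure SmoothFamily {F : Type*} [NormedAddCommGroup F] [NormedSpace ℂ F]
    (P : ∀ n, Measure (Ω n)) (O D : Set X) (I : ∀ n, X → Ω n → F) : Prop where
  isOpen : IsOpen O
  subset : D ⊆ O
  convex : Convex ℝ D
  meas : ∀ n, ∀ p ∈ O, AEStronglyMeasurable (I n p) (P n)
  smooth : ∀ n, ∀ᵐ w ∂P n, ContDiffOn ℂ ∞ (fun p => I n p w) O
  bound : ∀ k : ℕ, ∀ p₀ ∈ D, ∃ ε > 0, ∃ b : ∀ n, Ω n → ℝ, (∀ n, Integrable (b n) (P n)) ∧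
    Summable (fun n => ∫ w, b n w ∂P n) ∧
    ∀ n, ∀ᵐ w ∂P n, ∀ p ∈ D ∩ Metric.ball p₀ ε, ‖iteratedFDeriv ℂ k (fun p => I n p w) p‖ ≤ b n w

variable {F : Type*} [NormedAddCommGroup F] [NormedSpace ℂ F]
  {P : ∀ n, Measure (Ω n)} {O D : Set X} {I : ∀ n, X → Ω n → F}

theorem aestronglyMeasurable_clm [FiniteDimensional ℂ X] {α : Type*} [MeasurableSpace α]
    {m : Measure α} {L : α → X →L[ℂ] F} (h : ∀ v, AEStronglyMeasurable (fun a => L a v) m) :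
    AEStronglyMeasurable L m := by
  classical
  let e := Module.finBasis ℂ X
  have hL : L = fun a => ∑ i, (ContinuousLinearMap.smulRightL ℂ X F
      (LinearMap.toContinuousLinearMap (e.coord i))) (L a (e i)) := by
    funext a
    ext v
    rw [sum_apply]
    change L a v = ∑ i, (e.coord i v) • L a (e i)
    conv_lhs => rw [← e.sum_repr v]
    simp only [map_sum, map_smul, Module.Basis.coord_apply]
  rw [hL]
  refine Finset.aestronglyMeasurable_fun_sum _ fun i _ => ?_
  exact (ContinuousLinearMap.continuous _).comp_aestronglyMeasurable (h (e i))

theorem aestronglyMeasurable_fderiv [FiniteDimensional ℂ X] {α : Type*} [MeasurableSpace α]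
    {m : Measure α} (hO : IsOpen O) {J : X → α → F} (hJ : ∀ p ∈ O, AEStronglyMeasurable (J p) m)
    (hd : ∀ᵐ a ∂m, DifferentiableOn ℂ (fun p => J p a) O) {p : X} (hp : p ∈ O) :
    AEStronglyMeasurable (fun a => fderiv ℂ (fun p => J p a) p) m := by
  refine aestronglyMeasurable_clm fun v => ?_
  let c : ℕ → ℂ := fun k => ((k : ℂ) + 1)⁻¹
  have hc0 : ∀ k, c k ≠ 0 := fun k => inv_ne_zero (Nat.cast_add_one_ne_zero k)
  have hc : Tendsto c atTop (𝓝 0) := by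
    have := tendsto_one_div_add_atTop_nhds_zero_nat (𝕜 := ℂ)
    simpa [c, one_div] using this
  have hpO : ∀ᶠ k in atTop, p + c k • v ∈ O := by
    have : Tendsto (fun k => p + c k • v) atTop (𝓝 (p + (0 : ℂ) • v)) :=
      tendsto_const_nhds.add (hc.smul_const v)
    rw [zero_smul, add_zero] at this
    exact this (hO.mem_nhds hp)
  obtain ⟨N, hN⟩ := eventually_atTop.1 hpO
  refine aestronglyMeasurable_of_tendsto_ae atTop
    (f := fun k a => (c (N + k))⁻¹ • (J (p + c (N + k) • v) a - J p a)) (fun k => ?_) ?_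
  · exact ((hJ _ (hN _ (Nat.le_add_right _ _))).sub (hJ p hp)).const_smul _
  · filter_upwards [hd] with a ha
    have h1 : HasFDerivAt (fun p => J p a) (fderiv ℂ (fun p => J p a) p) p :=
      (ha.differentiableAt (hO.mem_nhds hp)).hasFDerivAt
    have h2 : HasDerivAt (fun z : ℂ => J (p + z • v) a) (fderiv ℂ (fun p => J p a) p v) 0 := by
      have hl : HasDerivAt (fun z : ℂ => p + z • v) v 0 := by
        simpa using ((hasDerivAt_id (0 : ℂ)).smul_const v).const_add p
      refine HasFDerivAt.comp_hasDerivAt (l := fun p => J p a) 0 ?_ hl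
      simpa using h1
    have h3 := hasDerivAt_iff_tendsto_slope.1 h2
    have h4 : Tendsto (fun k => c (N + k)) atTop (𝓝[≠] 0) := by
      refine tendsto_nhdsWithin_iff.2 ⟨?_, Eventually.of_forall fun k => hc0 _⟩
      have := (tendsto_add_atTop_iff_nat N).2 hc
      simpa [add_comm] using this
    have h5 := h3.comp h4
    refine h5.congr fun k => ?_
    simp [slope_def_module, Function.comp]

namespace SmoothFamily

theorem fderiv [FiniteDimensional ℂ X] (h : SmoothFamily P O D I) :
    SmoothFamily P O D fun n p w => fderiv ℂ (fun p => I n p w) p where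
  isOpen := h.isOpen
  subset := h.subset
  convex := h.convex
  meas n p hp := aestronglyMeasurable_fderiv h.isOpen (h.meas n)
    ((h.smooth n).mono fun w hw => hw.differentiableOn (by simp)) hp
  smooth n := (h.smooth n).mono fun w hw => hw.fderiv_of_isOpen h.isOpen (by simp)
  bound k p₀ hp₀ := by
    obtain ⟨ε, hε, b, hb, hs, hI⟩ := h.bound (k + 1) p₀ hp₀
    refine ⟨ε, hε, b, hb, hs, fun n => (hI n).mono fun w hw p hp => ?_⟩
    rw [show (fun p => _root_.fderiv ℂ (fun p => I n p w) p)
      = _root_.fderiv ℂ (fun p => I n p w) from rfl, norm_iteratedFDeriv_fderiv]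
    exact hw p hp

theorem clm_comp {G : Type*} [NormedAddCommGroup G] [NormedSpace ℂ G]
    (h : SmoothFamily P O D I) (T : F →L[ℂ] G) :
    SmoothFamily P O D fun n p w => T (I n p w) where
  isOpen := h.isOpen
  subset := h.subset
  convex := h.convex
  meas n p hp := T.continuous.comp_aestronglyMeasurable (h.meas n p hp)
  smooth n := (h.smooth n).mono fun w hw => T.contDiff.comp_contDiffOn hw
  bound k p₀ hp₀ := by
    obtain ⟨ε, hε, b, hb, hs, hI⟩ := h.bound k p₀ hp₀
    refine ⟨ε, hε, fun n w => ‖T‖ * b n w, fun n => (hb n).const_mul _, ?_, fun n => ?_⟩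
    · simp only [integral_const_mul]
      exact hs.mul_left _
    · filter_upwards [hI n, h.smooth n] with w hw hsm p hp
      exact (T.norm_iteratedFDeriv_comp_left (hsm.contDiffAt (h.isOpen.mem_nhds (h.subset hp.1)))
        (by exact_mod_cast le_top)).trans (mul_le_mul_of_nonneg_left (hw p hp) (norm_nonneg _))

theorem integrable (h : SmoothFamily P O D I) {p : X} (hp : p ∈ D) (n : ℕ) :
    Integrable (I n p) (P n) := by
  obtain ⟨ε, hε, b, hb, hs, hI⟩ := h.bound 0 p hp
  refine (hb n).mono' (h.meas n p (h.subset hp)) ?_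
  filter_upwards [hI n] with w hw
  simpa using hw p ⟨hp, Metric.mem_ball_self hε⟩

theorem summable_norm (h : SmoothFamily P O D I) {p : X} (hp : p ∈ D) :
    Summable fun n => ‖∫ w, I n p w ∂P n‖ := by
  obtain ⟨ε, hε, b, hb, hs, hI⟩ := h.bound 0 p hp
  refine hs.of_nonneg_of_le (fun _ => norm_nonneg _) fun n => ?_
  refine norm_integral_le_of_norm_le (hb n) ?_
  filter_upwards [hI n] with w hw
  simpa using hw p ⟨hp, Metric.mem_ball_self hε⟩

theorem norm_sub_le (h : SmoothFamily P O D I) {p₀ : X} {ε : ℝ} {b : ∀ n, Ω n → ℝ}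
    {n : ℕ} {w : Ω n} (hsm : ContDiffOn ℂ ∞ (fun p => I n p w) O)
    (hb : ∀ p ∈ D ∩ Metric.ball p₀ ε, ‖iteratedFDeriv ℂ 2 (fun p => I n p w) p‖ ≤ b n w)
    (hp₀ : p₀ ∈ D) {p : X} (hp : p ∈ D ∩ Metric.ball p₀ ε) :
    ‖I n p w - I n p₀ w - _root_.fderiv ℂ (fun p => I n p w) p₀ (p - p₀)‖
      ≤ b n w * (‖p - p₀‖ * ‖p - p₀‖) := by
  have hε : 0 < ε := (dist_nonneg).trans_lt hp.2
  have hconv : Convex ℝ (D ∩ Metric.ball p₀ ε) := h.convex.inter (convex_ball _ _)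
  have hdiff : ∀ q ∈ D ∩ Metric.ball p₀ ε, DifferentiableAt ℂ (fun p => I n p w) q := fun q hq =>
    (hsm.differentiableOn (by simp)).differentiableAt (h.isOpen.mem_nhds (h.subset hq.1))
  have hb0 : 0 ≤ b n w := (norm_nonneg _).trans (hb p hp)
  have h1 : ∀ q ∈ D ∩ Metric.ball p₀ ε, ‖_root_.fderiv ℂ (fun p => I n p w) q
      - _root_.fderiv ℂ (fun p => I n p w) p₀‖ ≤ b n w * ‖q - p₀‖ := by
    intro q hq
    refine hconv.norm_image_sub_le_of_norm_fderiv_le (𝕜 := ℂ) (fun q hq => ?_) (fun q hq => ?_)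
      ⟨hp₀, Metric.mem_ball_self hε⟩ hq
    · exact ((hsm.fderiv_of_isOpen (m := ∞) h.isOpen (by simp)).differentiableOn
        (by simp)).differentiableAt (h.isOpen.mem_nhds (h.subset hq.1))
    · have := hb q hq
      rw [← norm_iteratedFDeriv_fderiv, ← norm_iteratedFDeriv_fderiv] at this
      simpa using this
  have hball : ∀ q ∈ D ∩ Metric.ball p₀ ε ∩ Metric.closedBall p₀ ‖p - p₀‖,
      ‖_root_.fderiv ℂ (fun p => I n p w) q - _root_.fderiv ℂ (fun p => I n p w) p₀‖
        ≤ b n w * ‖p - p₀‖ := fun q hq => (h1 q hq.1).trans (by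
    gcongr
    simpa [dist_eq_norm] using hq.2)
  have := (hconv.inter (convex_closedBall p₀ ‖p - p₀‖)).norm_image_sub_le_of_norm_fderiv_le'
    (𝕜 := ℂ) (fun q hq => hdiff q hq.1) hball
    (x := p₀) (y := p) ⟨⟨hp₀, Metric.mem_ball_self hε⟩, by simp⟩ ⟨hp, by simp [dist_eq_norm]⟩
  rwa [mul_assoc] at this

theorem hasFDerivWithinAt [FiniteDimensional ℂ X] [CompleteSpace F] (h : SmoothFamily P O D I)
    {p₀ : X} (hp₀ : p₀ ∈ D) :
    HasFDerivWithinAt (fun p => ∑' n, ∫ w, I n p w ∂P n)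
      (∑' n, ∫ w, _root_.fderiv ℂ (fun p => I n p w) p₀ ∂P n) D p₀ := by
  obtain ⟨ε, hε, b, hb, hs, hI⟩ := h.bound 2 p₀ hp₀
  have hmain : ∀ p ∈ D ∩ Metric.ball p₀ ε,
      ‖(∑' n, ∫ w, I n p w ∂P n) - (∑' n, ∫ w, I n p₀ w ∂P n)
        - (∑' n, ∫ w, _root_.fderiv ℂ (fun p => I n p w) p₀ ∂P n) (p - p₀)‖
      ≤ (∑' n, ∫ w, b n w ∂P n) * (‖p - p₀‖ * ‖p - p₀‖) := by
    intro p hp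
    have s1 := (h.summable_norm hp.1).of_norm
    have s2 := (h.summable_norm hp₀).of_norm
    have s3 := (h.fderiv.summable_norm hp₀).of_norm
    have s4 : Summable fun n => (∫ w, _root_.fderiv ℂ (fun p => I n p w) p₀ ∂P n) (p - p₀) :=
      s3.mapL (ContinuousLinearMap.apply ℂ F (p - p₀))
    have e4 : (∑' n, ∫ w, _root_.fderiv ℂ (fun p => I n p w) p₀ ∂P n) (p - p₀)
        = ∑' n, (∫ w, _root_.fderiv ℂ (fun p => I n p w) p₀ ∂P n) (p - p₀) :=
      (ContinuousLinearMap.apply ℂ F (p - p₀)).map_tsum s3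
    rw [e4, ← s1.tsum_sub s2, ← (s1.sub s2).tsum_sub s4, ← hs.tsum_mul_right]
    refine tsum_of_norm_bounded ((hs.mul_right _).hasSum) fun n => ?_
    rw [ContinuousLinearMap.integral_apply (h.fderiv.integrable hp₀ n),
      ← integral_sub (h.integrable hp.1 n) (h.integrable hp₀ n),
      ← integral_sub (f := fun w => I n p w - I n p₀ w)
        (g := fun w => _root_.fderiv ℂ (fun p => I n p w) p₀ (p - p₀))
        ((h.integrable hp.1 n).sub (h.integrable hp₀ n))
        (((ContinuousLinearMap.apply ℂ F (p - p₀)).integrable_comp (h.fderiv.integrable hp₀ n))),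
      ← integral_mul_const]
    refine norm_integral_le_of_norm_le ((hb n).mul_const _) ?_
    filter_upwards [hI n, h.smooth n] with w hw hsm
    exact h.norm_sub_le hsm hw hp₀ hp
  rw [hasFDerivWithinAt_iff_isLittleO]
  refine Asymptotics.IsBigO.trans_isLittleO (g := fun p => ‖p - p₀‖ * ‖p - p₀‖) ?_ ?_
  · refine Asymptotics.IsBigO.of_bound (∑' n, ∫ w, b n w ∂P n) ?_
    filter_upwards [self_mem_nhdsWithin, mem_nhdsWithin_of_mem_nhds (Metric.ball_mem_nhds p₀ hε)]
      with p hp1 hp2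
    rw [Real.norm_of_nonneg (by positivity)]
    exact hmain p ⟨hp1, hp2⟩
  · have h1 : (fun p => ‖p - p₀‖) =o[𝓝[D] p₀] fun _ => (1 : ℝ) := by
      rw [Asymptotics.isLittleO_one_iff]
      have : Tendsto (fun p => ‖p - p₀‖) (𝓝 p₀) (𝓝 ‖p₀ - p₀‖) := by
        exact (continuous_id.sub continuous_const).norm.tendsto p₀
      rw [sub_self, norm_zero] at this
      exact this.mono_left nhdsWithin_le_nhds
    have h2 : (fun p => ‖p - p₀‖) =O[𝓝[D] p₀] fun p => p - p₀ :=
      (Asymptotics.isBigO_refl _ _).norm_left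
    have := h1.mul_isBigO h2.norm_right
    simpa using this.norm_right

end SmoothFamily

theorem SmoothFamily.contDiffOn_nat [FiniteDimensional ℂ X] (k : ℕ) :
    ∀ {F : Type*} [NormedAddCommGroup F] [NormedSpace ℂ F] [CompleteSpace F]
      {I : ∀ n, X → Ω n → F} (_ : SmoothFamily P O D I),
      ContDiffOn ℂ k (fun p => ∑' n, ∫ w, I n p w ∂P n) D := by
  induction k with
  | zero =>
    intro F _ _ _ I h
    exact contDiffOn_zero.2 fun p hp => (h.hasFDerivWithinAt hp).continuousWithinAt
  | succ k ih =>
    intro F _ _ _ I h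
    push_cast
    rw [contDiffOn_succ_iff_hasFDerivWithinAt (by simp)]
    intro p hp
    refine ⟨D, by rw [Set.insert_eq_of_mem hp]; exact self_mem_nhdsWithin, by simp,
      fun p => ∑' n, ∫ w, _root_.fderiv ℂ (fun p => I n p w) p ∂P n, fun q hq => ?_, ?_⟩
    · exact h.hasFDerivWithinAt hq
    · exact ih h.fderiv

/-- A series of integrals of a dominated smooth family is smooth, up to the boundary. -/
theorem SmoothFamily.contDiffOn [FiniteDimensional ℂ X] [CompleteSpace F]
    (h : SmoothFamily P O D I) :
    ContDiffOn ℂ ∞ (fun p => ∑' n, ∫ w, I n p w ∂P n) D :=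
  contDiffOn_infty.2 fun k => h.contDiffOn_nat k

end SmoothFamily

end HeatDeformation

namespace HeatDeformation

noncomputable section

section HalfDisc

/-! ### Half-discs -/

variable {T : ℝ}

theorem convex_halfDiscBar : Convex ℝ (halfDiscBar T) := by
  have : halfDiscBar T = Metric.ball 0 T ∩ {z : ℂ | 0 ≤ z.re} := by
    ext z; simp [halfDiscBar]
  rw [this]
  exact (convex_ball _ _).inter (convex_halfSpace_re_ge 0)

theorem isOpen_halfDisc : IsOpen (halfDisc T) :=
  (isOpen_lt continuous_norm continuous_const).inter
    (isOpen_lt continuous_const Complex.continuous_re)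

theorem halfDisc_subset_halfDiscBar : halfDisc T ⊆ halfDiscBar T := fun _ h => ⟨h.1, h.2.le⟩

theorem nonempty_interior_halfDiscBar (hT : 0 < T) : (interior (halfDiscBar T)).Nonempty := by
  refine ⟨((T / 2 : ℝ) : ℂ), ?_⟩
  refine interior_maximal halfDisc_subset_halfDiscBar isOpen_halfDisc ⟨?_, ?_⟩
  · rw [Complex.norm_real, Real.norm_of_nonneg (by positivity)]; linarith
  · rw [Complex.ofReal_re]; positivity

theorem uniqueDiffOn_halfDiscBar (hT : 0 < T) : UniqueDiffOn ℂ (halfDiscBar T) :=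
  uniqueDiffOn_convex_of_isRCLikeNormedField convex_halfDiscBar (nonempty_interior_halfDiscBar hT)

theorem I_mul_mem_halfDiscBar {τ : ℝ} (hτ : τ ∈ Set.Ioo (-T) T) :
    Complex.I * τ ∈ halfDiscBar T := by
  refine ⟨?_, by simp⟩
  rw [norm_mul, Complex.norm_I, one_mul, Complex.norm_real, Real.norm_eq_abs]
  exact abs_lt.2 hτ

theorem smul_mem_halfDiscBar {t : ℂ} (ht : t ∈ halfDiscBar T) {r : ℝ} (h0 : 0 ≤ r) (h1 : r ≤ 1) :
    (r : ℂ) * t ∈ halfDiscBar T := by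
  refine ⟨?_, ?_⟩
  · rw [norm_mul, Complex.norm_real, Real.norm_of_nonneg h0]
    exact (mul_le_of_le_one_left (norm_nonneg _) h1).trans_lt ht.1
  · rw [Complex.re_ofReal_mul]; exact mul_nonneg h0 ht.2

end HalfDisc

section Curves

/-! ### Curves of functions obtained from jointly smooth functions -/

variable {Z F : Type*} [NormedAddCommGroup Z] [NormedSpace ℂ Z]
  [NormedAddCommGroup F] [NormedSpace ℂ F] {D : Set ℂ} {H : ℂ → Z → F}

/-- The derivative in the first variable of a function on `D × Z`. -/
def timeDeriv (D : Set ℂ) (H : ℂ → Z → F) (t : ℂ) (z : Z) : F :=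
  fderivWithin ℂ (fun p : ℂ × Z => H p.1 p.2) (D ×ˢ Set.univ) (t, z) (1, 0)

theorem contDiffOn_timeDeriv (hD : UniqueDiffOn ℂ D)
    (hH : ContDiffOn ℂ ∞ (fun p : ℂ × Z => H p.1 p.2) (D ×ˢ Set.univ)) :
    ContDiffOn ℂ ∞ (fun p : ℂ × Z => timeDeriv D H p.1 p.2) (D ×ˢ Set.univ) :=
  (hH.fderivWithin (m := ∞) (hD.prod uniqueDiffOn_univ) (by simp)).clm_apply contDiffOn_const

theorem hasDerivWithinAt_timeDeriv
    (hH : ContDiffOn ℂ ∞ (fun p : ℂ × Z => H p.1 p.2) (D ×ˢ Set.univ)) {t : ℂ} (ht : t ∈ D)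
    (z : Z) : HasDerivWithinAt (fun t => H t z) (timeDeriv D H t z) D t := by
  have h1 : HasFDerivWithinAt (fun p : ℂ × Z => H p.1 p.2) _ (D ×ˢ Set.univ) (t, z) :=
    ((hH.differentiableOn (by simp)) (t, z) ⟨ht, trivial⟩).hasFDerivWithinAt
  have h2 : HasDerivWithinAt (fun t : ℂ => (t, z)) (1, 0) D t :=
    (hasDerivWithinAt_id t D).prodMk (hasDerivWithinAt_const t D z)
  have h3 : Set.MapsTo (fun t : ℂ => (t, z)) D (D ×ˢ Set.univ) := fun t' ht' => ⟨ht', trivial⟩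
  exact HasFDerivWithinAt.comp_hasDerivWithinAt (t := D ×ˢ Set.univ) t h1 h2 h3

theorem contDiff_slice
    (hH : ContDiffOn ℂ ∞ (fun p : ℂ × Z => H p.1 p.2) (D ×ˢ Set.univ)) {t : ℂ} (ht : t ∈ D) :
    ContDiff ℂ ∞ (H t) := by
  rw [← contDiffOn_univ]
  exact hH.comp (f := fun z : Z => (t, z)) (by fun_prop) fun z _ => ⟨ht, trivial⟩

theorem contDiffOn_iterate_timeDeriv (hD : UniqueDiffOn ℂ D)
    (hH : ContDiffOn ℂ ∞ (fun p : ℂ × Z => H p.1 p.2) (D ×ˢ Set.univ)) (a : ℕ) :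
    ContDiffOn ℂ ∞ (fun p : ℂ × Z => (timeDeriv D)^[a] H p.1 p.2) (D ×ˢ Set.univ) := by
  induction a with
  | zero => exact hH
  | succ a ih =>
    rw [Function.iterate_succ_apply']
    exact contDiffOn_timeDeriv hD ih

open Classical in
/-- The curve of restrictions to a compact set. -/
def restrictCurve (K : TopologicalSpace.Compacts Z) (H : ℂ → Z → F) (t : ℂ) : C(K, F) :=
  if h : Continuous (H t) then (⟨H t, h⟩ : C(Z, F)).restrict (K : Set Z) else 0

theorem restrictCurve_apply {K : TopologicalSpace.Compacts Z} {t : ℂ} (h : Continuous (H t))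
    (z : K) : restrictCurve K H t z = H t z := by
  rw [restrictCurve, dif_pos h]; rfl

theorem hasDerivWithinAt_restrictCurve (hDc : Convex ℝ D) (hD : UniqueDiffOn ℂ D)
    (K : TopologicalSpace.Compacts Z)
    (hH : ContDiffOn ℂ ∞ (fun p : ℂ × Z => H p.1 p.2) (D ×ˢ Set.univ)) {t₀ : ℂ} (ht₀ : t₀ ∈ D) :
    HasDerivWithinAt (restrictCurve K H) (restrictCurve K (timeDeriv D H) t₀) D t₀ := by
  have hH' := contDiffOn_timeDeriv hD hH
  rw [hasDerivWithinAt_iff_isLittleO, Asymptotics.isLittleO_iff]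
  intro ε hε
  have h1 : ∀ᶠ t in 𝓝 t₀, ∀ z ∈ (K : Set Z),
      t ∈ D → ‖timeDeriv D H t z - timeDeriv D H t₀ z‖ ≤ ε := by
    refine K.isCompact.eventually_forall_of_forall_eventually fun z _ => ?_
    have c1 := hH'.continuousOn (t₀, z) ⟨ht₀, trivial⟩
    have c2 : Continuous fun z : Z => timeDeriv D H t₀ z := (contDiff_slice hH' ht₀).continuous
    have e1 : ∀ᶠ p : ℂ × Z in 𝓝 (t₀, z), p ∈ D ×ˢ (Set.univ : Set Z) →
        dist (timeDeriv D H p.1 p.2) (timeDeriv D H t₀ z) < ε / 2 :=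
      eventually_nhdsWithin_iff.1 (c1 (Metric.ball_mem_nhds _ (half_pos hε)))
    have e2 : ∀ᶠ p : ℂ × Z in 𝓝 (t₀, z),
        dist (timeDeriv D H t₀ p.2) (timeDeriv D H t₀ z) < ε / 2 :=
      (c2.comp continuous_snd).continuousAt (x := (t₀, z)) (Metric.ball_mem_nhds _ (half_pos hε))
    filter_upwards [e1, e2] with p h1 h2 hp
    rw [← dist_eq_norm]
    have := dist_triangle_right (timeDeriv D H p.1 p.2) (timeDeriv D H t₀ p.2)
      (timeDeriv D H t₀ z)
    linarith [h1 ⟨hp, trivial⟩]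
  obtain ⟨δ, hδ, hball⟩ := Metric.eventually_nhds_iff_ball.1 h1
  filter_upwards [self_mem_nhdsWithin, mem_nhdsWithin_of_mem_nhds (Metric.ball_mem_nhds t₀ hδ)]
    with t ht htδ
  refine (ContinuousMap.norm_le _ (by positivity)).2 fun z => ?_
  rw [ContinuousMap.sub_apply, ContinuousMap.sub_apply, ContinuousMap.smul_apply,
    restrictCurve_apply (contDiff_slice hH ht).continuous,
    restrictCurve_apply (contDiff_slice hH ht₀).continuous,
    restrictCurve_apply (contDiff_slice hH' ht₀).continuous]
  have hconv : Convex ℝ (D ∩ Metric.ball t₀ δ) := hDc.inter (convex_ball _ _)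
  have := hconv.norm_image_sub_le_of_norm_hasFDerivWithin_le' (𝕜 := ℂ) (f := fun t => H t z)
    (f' := fun t => ContinuousLinearMap.toSpanSingleton ℂ (timeDeriv D H t z))
    (φ := ContinuousLinearMap.toSpanSingleton ℂ (timeDeriv D H t₀ z)) (C := ε)
    (fun t ht => ((hasDerivWithinAt_timeDeriv hH ht.1 _).mono
      Set.inter_subset_left).hasFDerivWithinAt)
    (fun t ht => by
      have : ∀ v w : F, ContinuousLinearMap.toSpanSingleton ℂ v
          - ContinuousLinearMap.toSpanSingleton ℂ w
          = ContinuousLinearMap.toSpanSingleton ℂ (v - w) := fun v w => by ext; simp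
      rw [this, ContinuousLinearMap.norm_toSpanSingleton]
      exact hball t ht.2 z z.2 ht.1)
    ⟨ht₀, Metric.mem_ball_self hδ⟩ ⟨ht, htδ⟩
  simpa using this

theorem contDiffOn_restrictCurve (hDc : Convex ℝ D) (hD : UniqueDiffOn ℂ D)
    (K : TopologicalSpace.Compacts Z) (k : ℕ) : ∀ {H : ℂ → Z → F}
    (_ : ContDiffOn ℂ ∞ (fun p : ℂ × Z => H p.1 p.2) (D ×ˢ Set.univ)),
    ContDiffOn ℂ k (restrictCurve K H) D := by
  induction k with
  | zero =>
    intro H hH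
    exact contDiffOn_zero.2 fun t ht =>
      (hasDerivWithinAt_restrictCurve hDc hD K hH ht).continuousWithinAt
  | succ k ih =>
    intro H hH
    push_cast
    rw [contDiffOn_succ_iff_derivWithin hD]
    refine ⟨fun t ht => (hasDerivWithinAt_restrictCurve hDc hD K hH ht).differentiableWithinAt,
      by simp, (ih (contDiffOn_timeDeriv hD hH)).congr fun t ht => ?_⟩
    exact (hasDerivWithinAt_restrictCurve hDc hD K hH ht).derivWithin (hD t ht)

/-- A jointly smooth function is a smooth curve of entire functions. -/
theorem smoothEntireValued_of_contDiffOn {Z : Type} [NormedAddCommGroup Z] [NormedSpace ℂ Z]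
    [CompleteSpace F] {H : ℂ → Z → F} (hDc : Convex ℝ D) (hD : UniqueDiffOn ℂ D)
    (hH : ContDiffOn ℂ ∞ (fun p : ℂ × Z => H p.1 p.2) (D ×ˢ Set.univ)) :
    SmoothEntireValued D H := by
  classical
  refine ⟨fun t ht => analyticOnNhd_of_contDiffOn isOpen_univ
    (contDiffOn_univ.2 (contDiff_slice hH ht)),
    fun t => if h : Continuous (H t) then ⟨H t, h⟩ else 0, fun t ht z => ?_, fun K => ?_⟩
  · simp only [dif_pos (contDiff_slice hH ht).continuous]; rfl
  · refine (contDiffOn_infty.2 fun k =>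
      ((contDiffOn_restrictCurve hDc hD K k hH).restrict_scalars ℝ)).congr fun t ht => ?_
    simp only [restrictCurve, dif_pos (contDiff_slice hH ht).continuous]

theorem iteratedDeriv_imaginary_axis {T : ℝ} (hT : 0 < T) (z : Z) (a : ℕ) : ∀ {H : ℂ → Z → F}
    (_ : ContDiffOn ℂ ∞ (fun p : ℂ × Z => H p.1 p.2) (halfDiscBar T ×ˢ Set.univ)) {τ : ℝ}
    (_ : τ ∈ Set.Ioo (-T) T),
    iteratedDeriv a (fun τ' : ℝ => H (Complex.I * τ') z) τ
      = Complex.I ^ a • (timeDeriv (halfDiscBar T))^[a] H (Complex.I * τ) z := by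
  induction a with
  | zero => intro H hH τ hτ; simp
  | succ a ih =>
    intro H hH τ hτ
    have hd : ∀ τ ∈ Set.Ioo (-T) T, HasDerivAt (fun τ' : ℝ => H (Complex.I * τ') z)
        (Complex.I • timeDeriv (halfDiscBar T) H (Complex.I * τ) z) τ := by
      intro τ hτ
      have h1 := (hasDerivWithinAt_timeDeriv hH (I_mul_mem_halfDiscBar hτ) z)
      have h2 : HasDerivWithinAt (fun τ' : ℝ => Complex.I * (τ' : ℂ)) Complex.I
          (Set.Ioo (-T) T) τ := by
        simpa using (Complex.ofRealCLM.hasDerivAt (x := τ)).const_mul Complex.I |>.hasDerivWithinAt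
      have h3 := h1.scomp τ h2 fun τ' hτ' => I_mul_mem_halfDiscBar hτ'
      exact h3.hasDerivAt (Ioo_mem_nhds hτ.1 hτ.2)
    rw [iteratedDeriv_succ']
    have h1 : deriv (fun τ' : ℝ => H (Complex.I * τ') z) =ᶠ[𝓝 τ]
        fun τ' : ℝ => Complex.I • timeDeriv (halfDiscBar T) H (Complex.I * τ') z := by
      filter_upwards [Ioo_mem_nhds hτ.1 hτ.2] with τ' hτ' using (hd τ' hτ').deriv
    rw [(h1.iteratedDeriv a).self_of_nhds, Function.iterate_succ_apply]
    have h2 := ih (H := fun t z => Complex.I • timeDeriv (halfDiscBar T) H t z)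
      (contDiffOn_const.smul (contDiffOn_timeDeriv (uniqueDiffOn_halfDiscBar hT) hH)) hτ
    rw [h2]
    clear h1 h2 hd ih
    have h3 : ∀ b : ℕ, ∀ τ ∈ halfDiscBar T, ∀ z,
        (timeDeriv (halfDiscBar T))^[b] (fun t z => Complex.I • timeDeriv (halfDiscBar T) H t z) τ z
        = Complex.I • (timeDeriv (halfDiscBar T))^[b] (timeDeriv (halfDiscBar T) H) τ z := by
      intro b
      induction b with
      | zero => intro t _ z; rfl
      | succ b ihb =>
        intro t ht z
        rw [Function.iterate_succ_apply', Function.iterate_succ_apply', timeDeriv,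
          fderivWithin_congr (f₁ := fun p => _) (f := fun p : ℂ × Z => Complex.I •
            (timeDeriv (halfDiscBar T))^[b] (timeDeriv (halfDiscBar T) H) p.1 p.2)
            (fun p hp => ihb p.1 hp.1 p.2) (ihb t ht z),
          fderivWithin_fun_const_smul]
        · rfl
        · exact (uniqueDiffOn_halfDiscBar hT).prod uniqueDiffOn_univ (t, z) ⟨ht, trivial⟩
        · exact ((contDiffOn_iterate_timeDeriv (uniqueDiffOn_halfDiscBar hT)
            (contDiffOn_timeDeriv (uniqueDiffOn_halfDiscBar hT) hH) b).differentiableOn (by simp))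
            (t, z) ⟨ht, trivial⟩
    rw [h3 a _ (I_mul_mem_halfDiscBar hτ), smul_smul, pow_succ]

end Curves

section RealSlice

/-! ### Restriction to real space variables -/

variable {ν : ℕ} {F : Type*} [NormedAddCommGroup F] [NormedSpace ℂ F]

/-- `toC` as a continuous linear map. -/
def toCL (ν : ℕ) : EuclideanSpace ℝ (Fin ν) →L[ℝ] (Fin ν → ℂ) :=
  ContinuousLinearMap.pi fun i => Complex.ofRealCLM.comp (EuclideanSpace.proj i)

theorem norm_toC_le (x : EuclideanSpace ℝ (Fin ν)) : ‖toC x‖ ≤ ‖x‖ := by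
  refine (pi_norm_le_iff_of_nonneg (norm_nonneg _)).2 fun i => ?_
  rw [toC, Complex.norm_real]
  exact PiLp.norm_apply_le x i

/-- `toC` on pairs, as a continuous linear map. -/
def toCL₂ (ν : ℕ) : EuclideanSpace ℝ (Fin ν) × EuclideanSpace ℝ (Fin ν) →L[ℝ]
    (Fin ν → ℂ) × (Fin ν → ℂ) := (toCL ν).prodMap (toCL ν)

theorem norm_toCL₂_apply_le (x : EuclideanSpace ℝ (Fin ν) × EuclideanSpace ℝ (Fin ν)) :
    ‖toCL₂ ν x‖ ≤ ‖x‖ :=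
  max_le_max (norm_toC_le x.1) (norm_toC_le x.2)

theorem norm_toCL₂_le : ‖toCL₂ ν‖ ≤ 1 :=
  ContinuousLinearMap.opNorm_le_bound _ zero_le_one fun x => by
    simpa using norm_toCL₂_apply_le x

/-- Polynomial bounds of the time derivatives near the real space give the bounds of `CInftyB1`. -/
theorem cInftyB1_of_bound {T : ℝ} (hT : 0 < T) {H : ℂ → (Fin ν → ℂ) × (Fin ν → ℂ) → F}
    (hH : ContDiffOn ℂ ∞ (fun p : ℂ × (Fin ν → ℂ) × (Fin ν → ℂ) => H p.1 p.2)
      (halfDiscBar T ×ˢ Set.univ))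
    (hb : ∀ a : ℕ, ∃ M : ℝ, 0 ≤ M ∧ ∀ τ ∈ Set.Ioo (-T) T,
      ∀ x : EuclideanSpace ℝ (Fin ν) × EuclideanSpace ℝ (Fin ν), ∀ z ∈ Metric.ball (toCL₂ ν x) 1,
        ‖iteratedDeriv a (fun τ' : ℝ => H (Complex.I * τ') z) τ‖ ≤ M * (1 + ‖x‖) ^ a) :
    CInftyB1 T fun (t : ℂ) (p : EuclideanSpace ℝ (Fin ν) × EuclideanSpace ℝ (Fin ν)) =>
      H t (toC p.1, toC p.2) := by
  constructor
  · have h1 : ContDiff ℝ ∞ fun p : ℝ × EuclideanSpace ℝ (Fin ν) × EuclideanSpace ℝ (Fin ν) =>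
        (Complex.I * (p.1 : ℂ), toCL₂ ν p.2) := by
      refine ContDiff.prodMk ?_ ((toCL₂ ν).contDiff.comp contDiff_snd)
      exact contDiff_const.mul (Complex.ofRealCLM.contDiff.comp contDiff_fst)
    exact (hH.restrict_scalars ℝ).comp h1.contDiffOn
      fun p hp => ⟨I_mul_mem_halfDiscBar hp.1, trivial⟩
  · intro a b
    obtain ⟨M, hM0, hM⟩ := hb a
    refine ⟨M * ((b + 1) / 1) ^ b + 1, by positivity, fun τ hτ x => ?_⟩
    set h : (Fin ν → ℂ) × (Fin ν → ℂ) → F := fun z =>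
      iteratedDeriv a (fun τ' : ℝ => H (Complex.I * τ') z) τ with hh
    have hsm : ContDiff ℂ ∞ h := by
      have : h = fun z => Complex.I ^ a •
          (timeDeriv (halfDiscBar T))^[a] H (Complex.I * τ) z := by
        funext z; exact iteratedDeriv_imaginary_axis hT z a hH hτ
      rw [this]
      exact (contDiff_slice (contDiffOn_iterate_timeDeriv (uniqueDiffOn_halfDiscBar hT) hH a)
        (I_mul_mem_halfDiscBar hτ)).const_smul _
    have h1 : iteratedFDeriv ℝ b (h ∘ toCL₂ ν) x
        = (iteratedFDeriv ℝ b h (toCL₂ ν x)).compContinuousLinearMap fun _ => toCL₂ ν :=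
      (toCL₂ ν).iteratedFDeriv_comp_right (hsm.restrict_scalars ℝ) x (by exact_mod_cast le_top)
    have h2 : ‖iteratedFDeriv ℝ b h (toCL₂ ν x)‖ = ‖iteratedFDeriv ℂ b h (toCL₂ ν x)‖ := by
      rw [← ((hsm.of_le (by exact_mod_cast le_top)).contDiffAt
        (n := b)).restrictScalars_iteratedFDeriv (𝕜 := ℝ)]
      exact ContinuousMultilinearMap.norm_restrictScalars _
    change ‖iteratedFDeriv ℝ b (h ∘ toCL₂ ν) x‖ ≤ _
    rw [h1]
    refine (ContinuousMultilinearMap.norm_compContinuousLinearMap_le _ _).trans ?_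
    have h3 := norm_iteratedFDeriv_le_of_ball isOpen_univ hsm.contDiffOn one_pos
      (M := M * (1 + ‖x‖) ^ a) (by positivity) (Set.subset_univ _) (hM τ hτ x) b
    rw [h2]
    calc _ ≤ M * (1 + ‖x‖) ^ a * ((b + 1) / 1) ^ b * 1 := by
          refine mul_le_mul h3 ?_ (by positivity) (by positivity)
          rw [Finset.prod_const]
          exact pow_le_one₀ (norm_nonneg _) norm_toCL₂_le
      _ ≤ (M * ((b + 1) / 1) ^ b + 1) * (1 + ‖x‖) ^ a := by
          have : 0 ≤ (1 + ‖x‖) ^ a := by positivity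
          nlinarith

end RealSlice

end

end HeatDeformation

namespace HeatDeformation

noncomputable section

section LinearODE

/-! ### Linear differential equations with analytic coefficients -/

variable {𝔸 : Type*} [NormedRing 𝔸] [NormedAlgebra ℂ 𝔸]

/-- The Taylor coefficients of the solution of `x' = M x`, `x(0) = 1`, from those of `M`. -/
def odeCoeff (M : ℕ → 𝔸) : ℕ → 𝔸
  | 0 => 1
  | n + 1 => ((n : ℂ) + 1)⁻¹ • ∑ k ∈ Finset.range (n + 1), M k * odeCoeff M (n - k)
decreasing_by omega

theorem norm_odeCoeff_le {M : ℕ → 𝔸} {K ρ : ℝ} (hK : 0 ≤ K) (hρ : 0 ≤ ρ)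
    (hM : ∀ n, ‖M n‖ ≤ K * ρ ^ n) (n : ℕ) : ‖odeCoeff M n‖ ≤ ‖(1 : 𝔸)‖ * (ρ + K) ^ n := by
  induction n using Nat.strong_induction_on with
  | _ n ih =>
    cases n with
    | zero => simp [odeCoeff]
    | succ n =>
      rw [odeCoeff, norm_smul]
      have h1 : ‖∑ k ∈ Finset.range (n + 1), M k * odeCoeff M (n - k)‖
          ≤ ∑ k ∈ Finset.range (n + 1), ‖(1 : 𝔸)‖ * (ρ + K) ^ n * K := by
        refine (norm_sum_le _ _).trans (Finset.sum_le_sum fun k hk => ?_)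
        have hkn : k ≤ n := by simpa [Nat.lt_succ_iff] using hk
        refine (norm_mul_le _ _).trans ?_
        calc ‖M k‖ * ‖odeCoeff M (n - k)‖
            ≤ (K * (ρ + K) ^ k) * (‖(1 : 𝔸)‖ * (ρ + K) ^ (n - k)) := by
              refine mul_le_mul ((hM k).trans ?_) (ih _ (by omega)) (norm_nonneg _) (by positivity)
              gcongr; linarith
          _ = ‖(1 : 𝔸)‖ * ((ρ + K) ^ k * (ρ + K) ^ (n - k)) * K := by ring
          _ = ‖(1 : 𝔸)‖ * (ρ + K) ^ n * K := by rw [← pow_add, Nat.add_sub_cancel' hkn]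
      rw [Finset.sum_const, Finset.card_range, nsmul_eq_mul] at h1
      have h2 : ‖((n : ℂ) + 1)⁻¹‖ = ((n : ℝ) + 1)⁻¹ := by
        rw [norm_inv]; congr 1
        exact_mod_cast Complex.norm_natCast (n + 1)
      rw [h2]
      push_cast at h1
      calc ((n : ℝ) + 1)⁻¹ * ‖∑ k ∈ Finset.range (n + 1), M k * odeCoeff M (n - k)‖
          ≤ ((n : ℝ) + 1)⁻¹ * (((n : ℝ) + 1) * (‖(1 : 𝔸)‖ * (ρ + K) ^ n * K)) := by gcongr
        _ = ‖(1 : 𝔸)‖ * (ρ + K) ^ n * K := by field_simp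
        _ ≤ ‖(1 : 𝔸)‖ * (ρ + K) ^ (n + 1) := by
          rw [pow_succ, ← mul_assoc]
          gcongr; linarith

/-- A linear differential equation with coefficients analytic at `0` has a holomorphic fundamental
solution near `0`. -/
theorem exists_fundamental_solution [CompleteSpace 𝔸] {M : ℂ → 𝔸} (hM : AnalyticAt ℂ M 0) :
    ∃ r > 0, ∃ x : ℂ → 𝔸, x 0 = 1 ∧ ∀ z ∈ Metric.ball (0 : ℂ) r, HasDerivAt x (M z * x z) z := by
  obtain ⟨p, hp⟩ := hM
  obtain ⟨K, ρ, hK, hρ, hb⟩ := p.le_mul_pow_of_radius_pos hp.radius_pos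
  have hcoef : ∀ n, ‖p.coeff n‖ ≤ K * ρ ^ n := fun n => by
    simpa [FormalMultilinearSeries.norm_apply_eq_norm_coef] using hb n
  rw [hasFPowerSeriesAt_iff] at hp
  obtain ⟨δ, hδ, hsum⟩ := Metric.eventually_nhds_iff_ball.1 hp
  set R := ρ + K with hR
  have hR0 : 0 < R := by positivity
  set a := odeCoeff p.coeff with ha
  have hab := norm_odeCoeff_le hK.le hρ.le hcoef
  set r := min δ (1 / (2 * R)) with hr
  have hr0 : 0 < r := lt_min hδ (by positivity)
  have hrR : r * R ≤ 1 / 2 := by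
    have := mul_le_mul_of_nonneg_right (min_le_right δ (1 / (2 * R))) hR0.le
    refine this.trans (le_of_eq ?_); field_simp
  have hzr : ∀ z ∈ Metric.ball (0 : ℂ) r, ‖z‖ * R ≤ 1 / 2 := fun z hz => by
    rw [Metric.mem_ball, dist_zero_right] at hz
    exact (mul_le_mul_of_nonneg_right hz.le hR0.le).trans hrR
  have hρR : ρ ≤ R := by rw [hR]; linarith
  refine ⟨r, hr0, fun z => ∑' n, z ^ n • a n, ?_, fun z hz => ?_⟩
  · dsimp only
    rw [tsum_eq_single 0 fun n hn => by simp [hn]]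
    simp [ha, odeCoeff]
  have s1 : Summable fun n => ‖z ^ n • p.coeff n‖ := by
    refine (summable_geometric_two.mul_left K).of_nonneg_of_le (fun _ => norm_nonneg _) fun n => ?_
    rw [norm_smul, norm_pow]
    calc ‖z‖ ^ n * ‖p.coeff n‖ ≤ ‖z‖ ^ n * (K * R ^ n) := by
          refine mul_le_mul_of_nonneg_left ((hcoef n).trans ?_) (by positivity)
          gcongr
      _ = K * (‖z‖ * R) ^ n := by rw [mul_pow]; ring
      _ ≤ K * (1 / 2) ^ n := by
          have := hzr z hz
          gcongr
  have s2 : Summable fun n => ‖z ^ n • a n‖ := by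
    refine (summable_geometric_two.mul_left ‖(1 : 𝔸)‖).of_nonneg_of_le (fun _ => norm_nonneg _)
      fun n => ?_
    rw [norm_smul, norm_pow]
    calc ‖z‖ ^ n * ‖a n‖ ≤ ‖z‖ ^ n * (‖(1 : 𝔸)‖ * R ^ n) := by
          have := hab n
          gcongr
      _ = ‖(1 : 𝔸)‖ * (‖z‖ * R) ^ n := by rw [mul_pow]; ring
      _ ≤ ‖(1 : 𝔸)‖ * (1 / 2) ^ n := by
          have := hzr z hz
          gcongr
  have hMz : M z = ∑' n, z ^ n • p.coeff n := by
    have := (hsum z (Metric.ball_subset_ball (min_le_left _ _) hz)).tsum_eq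
    rw [zero_add] at this
    exact this.symm
  have s5 : Summable fun n : ℕ => (n : ℝ) * (1 / 2) ^ n := by
    have := summable_pow_mul_geometric_of_norm_lt_one (R := ℝ) 1 (r := 1 / 2)
      (by rw [Real.norm_of_nonneg] <;> norm_num)
    simpa only [pow_one] using this
  have hder := hasDerivAt_tsum_of_isPreconnected (𝕜 := ℂ) (F := 𝔸)
    (u := fun n : ℕ => (n : ℝ) * (1 / 2) ^ n * (‖(1 : 𝔸)‖ / r))
    (g := fun n z => z ^ n • a n) (g' := fun n z => ((n : ℂ) * z ^ (n - 1)) • a n) (y₀ := 0)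
    (t := Metric.ball 0 r)
    (s5.mul_right _)
    Metric.isOpen_ball (convex_ball _ _).isPreconnected
    (fun n y _ => (hasDerivAt_pow n y).smul_const (a n))
    (fun n y hy => ?_) (Metric.mem_ball_self hr0) ?_ hz
  · suffices h : M z * ∑' n, z ^ n • a n = ∑' n : ℕ, ((n : ℂ) * z ^ (n - 1)) • a n by
      rw [← h] at hder
      exact hder
    rw [hMz, tsum_mul_tsum_eq_tsum_sum_antidiagonal_of_summable_norm s1 s2]
    have s3 := (summable_norm_sum_mul_antidiagonal_of_summable_norm s1 s2).of_norm
    have e : ∀ n : ℕ, (((n + 1 : ℕ) : ℂ) * z ^ (n + 1 - 1)) • a (n + 1)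
        = ∑ kl ∈ Finset.HasAntidiagonal.antidiagonal n, z ^ kl.1 • p.coeff kl.1 * z ^ kl.2 • a kl.2 := by
      intro n
      rw [ha, odeCoeff, ← ha, Finset.Nat.sum_antidiagonal_eq_sum_range_succ_mk, smul_smul,
        Finset.smul_sum]
      refine Finset.sum_congr rfl fun k hk => ?_
      have hkn : k ≤ n := by simpa [Nat.lt_succ_iff] using hk
      rw [smul_mul_smul_comm, ← pow_add, Nat.add_sub_cancel' hkn]
      congr 1
      have : (n : ℂ) + 1 ≠ 0 := Nat.cast_add_one_ne_zero n
      push_cast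
      field_simp
    have s4 : Summable fun n : ℕ => ((n : ℂ) * z ^ (n - 1)) • a n := by
      refine (summable_nat_add_iff 1).1 ?_
      simpa only [e] using s3
    rw [s4.tsum_eq_zero_add]
    simp only [e]
    simp
  · rw [norm_smul, norm_mul, norm_pow, Complex.norm_natCast]
    rcases Nat.eq_zero_or_pos n with rfl | hn
    · simp
    · rw [Metric.mem_ball, dist_zero_right] at hy
      calc (n : ℝ) * ‖y‖ ^ (n - 1) * ‖a n‖
          ≤ n * r ^ (n - 1) * (‖(1 : 𝔸)‖ * R ^ n) := by
            have := hab n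
            gcongr
        _ = n * (r * R) ^ n * (‖(1 : 𝔸)‖ / r) := by
            obtain ⟨m, rfl⟩ : ∃ m, n = m + 1 := ⟨n - 1, by omega⟩
            simp only [Nat.add_sub_cancel, mul_pow, pow_succ]
            field_simp
        _ ≤ n * (1 / 2) ^ n * (‖(1 : 𝔸)‖ / r) := by gcongr
  · refine summable_of_ne_finset_zero (s := {0}) fun n hn => ?_
    simp at hn
    simp [hn]

end LinearODE

section SecondOrder

variable {𝔸 : Type*} [NormedRing 𝔸] [NormedAlgebra ℂ 𝔸]

/-- The equation `q'' = E q' + F q` with analytic coefficients has holomorphic solutions with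
arbitrary initial data near `0`. -/
theorem exists_second_order_solution [CompleteSpace 𝔸] {E F : ℂ → 𝔸} (hE : AnalyticAt ℂ E 0)
    (hF : AnalyticAt ℂ F 0) (q₀ p₀ : 𝔸) :
    ∃ r > 0, ∃ q p : ℂ → 𝔸, q 0 = q₀ ∧ p 0 = p₀ ∧ ∀ z ∈ Metric.ball (0 : ℂ) r,
      HasDerivAt q (p z) z ∧ HasDerivAt p (E z * p z + F z * q z) z := by
  let L := ContinuousLinearMap.mul ℂ 𝔸
  let fstL := ContinuousLinearMap.fst ℂ 𝔸 𝔸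
  let sndL := ContinuousLinearMap.snd ℂ 𝔸 𝔸
  let inlL := ContinuousLinearMap.inl ℂ 𝔸 𝔸
  let inrL := ContinuousLinearMap.inr ℂ 𝔸 𝔸
  let pre₁ := (ContinuousLinearMap.compL ℂ (𝔸 × 𝔸) 𝔸 (𝔸 × 𝔸) inrL)
  let M : ℂ → (𝔸 × 𝔸 →L[ℂ] 𝔸 × 𝔸) := fun z => inlL.comp sndL +
    (pre₁ ((ContinuousLinearMap.compL ℂ (𝔸 × 𝔸) 𝔸 𝔸).flip sndL (L (E z))) +
    pre₁ ((ContinuousLinearMap.compL ℂ (𝔸 × 𝔸) 𝔸 𝔸).flip fstL (L (F z))))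
  have hM : AnalyticAt ℂ M 0 := by
    refine analyticAt_const.add (AnalyticAt.add ?_ ?_)
    · exact ((pre₁.comp (((ContinuousLinearMap.compL ℂ (𝔸 × 𝔸) 𝔸 𝔸).flip
        sndL).comp L)).analyticAt _).comp hE
    · exact ((pre₁.comp (((ContinuousLinearMap.compL ℂ (𝔸 × 𝔸) 𝔸 𝔸).flip
        fstL).comp L)).analyticAt _).comp hF
  have hMv : ∀ z v, M z v = (v.2, E z * v.2 + F z * v.1) := by
    intro z v
    simp [M, pre₁, L, inlL, inrL, fstL, sndL]
  obtain ⟨r, hr, x, hx0, hx⟩ := exists_fundamental_solution (𝔸 := 𝔸 × 𝔸 →L[ℂ] 𝔸 × 𝔸) hM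
  have hxv : ∀ z ∈ Metric.ball (0 : ℂ) r,
      HasDerivAt (fun z => x z (q₀, p₀)) (M z (x z (q₀, p₀))) z := fun z hz => by
    simpa using (hx z hz).clm_apply (hasDerivAt_const z (q₀, p₀))
  refine ⟨r, hr, fun z => (x z (q₀, p₀)).1, fun z => (x z (q₀, p₀)).2, by simp [hx0], by simp [hx0],
    fun z hz => ⟨?_, ?_⟩⟩
  · have := (fstL.hasFDerivAt).comp_hasDerivAt z (hxv z hz)
    rw [hMv] at this
    exact this
  · have := (sndL.hasFDerivAt).comp_hasDerivAt z (hxv z hz)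
    rw [hMv] at this
    exact this

/-- A solution of `q'' = E q' + F q` on `[0,1]` with vanishing initial data vanishes. -/
theorem eq_zero_of_second_order {E F : ℝ → 𝔸} {K : ℝ} (hE : ∀ s ∈ Set.Icc (0 : ℝ) 1, ‖E s‖ ≤ K)
    (hF : ∀ s ∈ Set.Icc (0 : ℝ) 1, ‖F s‖ ≤ K) {q p : ℝ → 𝔸}
    (hq : ∀ s ∈ Set.Icc (0 : ℝ) 1, HasDerivWithinAt q (p s) (Set.Icc 0 1) s)
    (hp : ∀ s ∈ Set.Icc (0 : ℝ) 1, HasDerivWithinAt p (E s * p s + F s * q s) (Set.Icc 0 1) s)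
    (hq0 : q 0 = 0) (hp0 : p 0 = 0) : ∀ s ∈ Set.Icc (0 : ℝ) 1, q s = 0 ∧ p s = 0 := by
  have hK : 0 ≤ K := (norm_nonneg _).trans (hE 0 (by simp))
  have key := eq_zero_of_abs_deriv_le_mul_abs_self_of_eq_zero_right (E := 𝔸 × 𝔸)
    (f := fun s => (q s, p s)) (f' := fun s => (p s, E s * p s + F s * q s)) (K := 1 + 2 * K)
    (a := 0) (b := 1) (fun s hs => ((hq s hs).prodMk (hp s hs)).continuousWithinAt)
    (fun s hs => ?_) (by simp [hq0, hp0]) (fun s hs => ?_)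
  · intro s hs
    simpa using key s hs
  · have h1 := (hq s ⟨hs.1, hs.2.le⟩).prodMk (hp s ⟨hs.1, hs.2.le⟩)
    refine (h1.mono_of_mem_nhdsWithin ?_)
    exact mem_of_superset (Icc_mem_nhdsGE hs.2) (Set.Icc_subset_Icc_left hs.1)
  · have hs' : s ∈ Set.Icc (0 : ℝ) 1 := ⟨hs.1, hs.2.le⟩
    have e1 : ‖q s‖ ≤ ‖(q s, p s)‖ := le_max_left _ _
    have e2 : ‖p s‖ ≤ ‖(q s, p s)‖ := le_max_right _ _
    have e3 := norm_nonneg (q s, p s)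
    refine max_le ?_ ?_
    · change ‖p s‖ ≤ _
      nlinarith
    · change ‖E s * p s + F s * q s‖ ≤ _
      have h1 := norm_add_le (E s * p s) (F s * q s)
      have h2 := norm_mul_le (E s) (p s)
      have h3 := norm_mul_le (F s) (q s)
      have h4 := mul_le_mul (hE s hs') e2 (norm_nonneg _) hK
      have h5 := mul_le_mul (hF s hs') e1 (norm_nonneg _) hK
      linarith

end SecondOrder

end

end HeatDeformation

namespace HeatDeformation

noncomputable section

open scoped Matrix.Norms.Operator

variable {ν : ℕ}

section MatrixCalculus

/-! ### Calculus of matrix-valued functions -/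

/-- The entries of a matrix, as continuous linear maps. -/
def entryCL (j k : Fin ν) : Matrix (Fin ν) (Fin ν) ℂ →L[ℂ] ℂ :=
  LinearMap.toContinuousLinearMap (Matrix.entryLinearMap ℂ ℂ j k)

/-- Transposition as a continuous linear map. -/
def transposeCL : Matrix (Fin ν) (Fin ν) ℂ →L[ℂ] Matrix (Fin ν) (Fin ν) ℂ :=
  LinearMap.toContinuousLinearMap (Matrix.transposeLinearEquiv (Fin ν) (Fin ν) ℂ ℂ).toLinearMap

theorem transposeCL_apply (M : Matrix (Fin ν) (Fin ν) ℂ) : transposeCL M = M.transpose := rfl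

theorem matrix_eq_sum (M : Matrix (Fin ν) (Fin ν) ℂ) :
    M = ∑ j, ∑ k, M j k • Matrix.single j k (1 : ℂ) := by
  conv_lhs => rw [Matrix.matrix_eq_sum_single M]
  simp [Matrix.smul_single]

theorem hasDerivWithinAt_matrix {M : ℝ → Matrix (Fin ν) (Fin ν) ℂ}
    {M' : Matrix (Fin ν) (Fin ν) ℂ} {S : Set ℝ} {s : ℝ} :
    HasDerivWithinAt M M' S s ↔ ∀ j k, HasDerivWithinAt (fun s => M s j k) (M' j k) S s := by
  constructor
  · intro h j k
    exact ((entryCL j k).restrictScalars ℝ).hasFDerivAt.comp_hasDerivWithinAt s h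
  · intro h
    have : M = fun s => ∑ j, ∑ k, M s j k • Matrix.single j k (1 : ℂ) :=
      funext fun s => matrix_eq_sum (M s)
    rw [this, matrix_eq_sum M']
    exact HasDerivWithinAt.fun_sum fun j _ => HasDerivWithinAt.fun_sum fun k _ =>
      (h j k).smul_const _

theorem analyticAt_matrix {M : ℂ → Matrix (Fin ν) (Fin ν) ℂ} {z : ℂ}
    (h : ∀ j k, AnalyticAt ℂ (fun z => M z j k) z) : AnalyticAt ℂ M z := by
  have : M = fun s => ∑ j, ∑ k, M s j k • Matrix.single j k (1 : ℂ) :=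
    funext fun s => matrix_eq_sum (M s)
  rw [this]
  exact Finset.analyticAt_fun_sum _ fun j _ => Finset.analyticAt_fun_sum _ fun k _ =>
    (h j k).smul analyticAt_const

theorem matDeriv_eq {M : ℂ → Matrix (Fin ν) (Fin ν) ℂ} {z : ℂ} (h : DifferentiableAt ℂ M z) :
    matDeriv M z = deriv M z := by
  ext j k
  exact ((entryCL j k).hasFDerivAt.comp_hasDerivAt z h.hasDerivAt).deriv

theorem hasDerivAt_matDeriv {M : ℂ → Matrix (Fin ν) (Fin ν) ℂ} {z : ℂ}
    (h : DifferentiableAt ℂ M z) : HasDerivAt M (matDeriv M z) z := by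
  have := h.hasDerivAt
  rw [matDeriv_eq h]
  exact this

/-- Entrywise complex conjugation. -/
def conjMat : Matrix (Fin ν) (Fin ν) ℂ →+* Matrix (Fin ν) (Fin ν) ℂ :=
  (starRingEnd ℂ).mapMatrix

theorem conjMat_apply (M : Matrix (Fin ν) (Fin ν) ℂ) (j k : Fin ν) :
    conjMat M j k = (starRingEnd ℂ) (M j k) := rfl

theorem conjMat_smul (c : ℂ) (M : Matrix (Fin ν) (Fin ν) ℂ) :
    conjMat (c • M) = (starRingEnd ℂ) c • conjMat M := by
  ext j k; simp [conjMat_apply]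

theorem conjMat_transpose (M : Matrix (Fin ν) (Fin ν) ℂ) :
    conjMat M.transpose = (conjMat M).transpose := rfl

theorem conjMat_inv {M : Matrix (Fin ν) (Fin ν) ℂ} (h : IsUnit M) :
    conjMat M⁻¹ = (conjMat M)⁻¹ := by
  refine (Matrix.inv_eq_left_inv ?_).symm
  rw [← map_mul, Matrix.nonsing_inv_mul _ ((Matrix.isUnit_iff_isUnit_det _).1 h), map_one]

theorem hasDerivWithinAt_conjMat {M : ℝ → Matrix (Fin ν) (Fin ν) ℂ}
    {M' : Matrix (Fin ν) (Fin ν) ℂ} {S : Set ℝ} {s : ℝ} (h : HasDerivWithinAt M M' S s) :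
    HasDerivWithinAt (fun s => conjMat (M s)) (conjMat M') S s := by
  rw [hasDerivWithinAt_matrix] at h ⊢
  intro j k
  exact Complex.conjCLE.toContinuousLinearMap.hasFDerivAt.comp_hasDerivWithinAt s (h j k)

theorem conjMat_matDeriv {M : ℂ → Matrix (Fin ν) (Fin ν) ℂ} {r : ℝ} {c : ℂ}
    (hM : DifferentiableOn ℂ M (Metric.ball 0 r))
    (hr : ∀ τ : ℝ, |τ| < r → conjMat (M (Complex.I * τ)) = c • M (Complex.I * τ)) {τ : ℝ}
    (hτ : |τ| < r) : conjMat (matDeriv M (Complex.I * τ)) = -c • matDeriv M (Complex.I * τ) := by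
  have hmem : Complex.I * τ ∈ Metric.ball (0 : ℂ) r := by simpa using hτ
  have h1 : HasDerivAt M (matDeriv M (Complex.I * τ)) (Complex.I * τ) :=
    hasDerivAt_matDeriv (hM.differentiableAt (Metric.isOpen_ball.mem_nhds hmem))
  have h2 : HasDerivAt (fun τ : ℝ => Complex.I * (τ : ℂ)) Complex.I τ := by
    simpa using (Complex.ofRealCLM.hasDerivAt (x := τ)).const_mul Complex.I
  have h3 : HasDerivAt (fun τ : ℝ => M (Complex.I * (τ : ℂ)))
      (Complex.I • matDeriv M (Complex.I * τ)) τ := h1.scomp τ h2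
  have h4 : HasDerivWithinAt (fun τ : ℝ => conjMat (M (Complex.I * (τ : ℂ))))
      (conjMat (Complex.I • matDeriv M (Complex.I * τ))) Set.univ τ :=
    hasDerivWithinAt_conjMat h3.hasDerivWithinAt
  have h5 : (fun τ : ℝ => conjMat (M (Complex.I * (τ : ℂ))))
      =ᶠ[𝓝 τ] fun τ : ℝ => c • M (Complex.I * (τ : ℂ)) := by
    filter_upwards [(isOpen_lt continuous_abs continuous_const).mem_nhds hτ] with σ hσ
      using hr σ hσ
  have h6 := ((hasDerivWithinAt_univ.1 h4).congr_of_eventuallyEq h5.symm).unique (h3.const_smul c)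
  generalize matDeriv M (Complex.I * τ) = N at h6 ⊢
  rw [conjMat_smul, Complex.conj_I] at h6
  ext j k
  have h7 : -Complex.I * conjMat N j k = c * (Complex.I * N j k) := congrFun (congrFun h6 j) k
  change conjMat N j k = -c * N j k
  linear_combination Complex.I * h7 + (conjMat N j k + c * N j k) * Complex.I_sq

end MatrixCalculus

section Flow

/-! ### The classical flow -/

variable {A B C : ℂ → Matrix (Fin ν) (Fin ν) ℂ} {r : ℝ}
  {G U' V V' : ℂ → Matrix (Fin ν) (Fin ν) ℂ}

/-- On the disc of radius `r` the coefficients are holomorphic with the given symmetries and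
`z ↦ z G(z)`, `z ↦ V(z)` are the fundamental solutions of `q'' = E q' + F q`, with derivatives
`U'` and `V'`, the first one being invertible for `z ≠ 0`. -/
structure Flow (A B C : ℂ → Matrix (Fin ν) (Fin ν) ℂ) (r : ℝ)
    (G U' V V' : ℂ → Matrix (Fin ν) (Fin ν) ℂ) : Prop where
  pos : 0 < r
  diffA : DifferentiableOn ℂ A (Metric.ball 0 r)
  diffB : DifferentiableOn ℂ B (Metric.ball 0 r)
  diffC : DifferentiableOn ℂ C (Metric.ball 0 r)
  symmA : ∀ z ∈ Metric.ball (0 : ℂ) r, (A z).transpose = A z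
  symmC : ∀ z ∈ Metric.ball (0 : ℂ) r, (C z).transpose = C z
  unitA : ∀ z ∈ Metric.ball (0 : ℂ) r, IsUnit (A z)
  unitG : ∀ z ∈ Metric.ball (0 : ℂ) r, IsUnit (G z)
  diffG : DifferentiableOn ℂ G (Metric.ball 0 r)
  G_zero : G 0 = 1
  U'_zero : U' 0 = 1
  V_zero : V 0 = 1
  V'_zero : V' 0 = 0
  hasDerivU : ∀ z ∈ Metric.ball (0 : ℂ) r, HasDerivAt (fun z => z • G z) (U' z) z
  hasDerivU' : ∀ z ∈ Metric.ball (0 : ℂ) r,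
    HasDerivAt U' (coefE A B z * U' z + coefF A B C z * (z • G z)) z
  hasDerivV : ∀ z ∈ Metric.ball (0 : ℂ) r, HasDerivAt V (V' z) z
  hasDerivV' : ∀ z ∈ Metric.ball (0 : ℂ) r,
    HasDerivAt V' (coefE A B z * V' z + coefF A B C z * V z) z
  realA : ∀ τ : ℝ, |τ| < r → conjMat (A (Complex.I * τ)) = A (Complex.I * τ)
  realB : ∀ τ : ℝ, |τ| < r → conjMat (B (Complex.I * τ)) = -B (Complex.I * τ)
  realC : ∀ τ : ℝ, |τ| < r → conjMat (C (Complex.I * τ)) = C (Complex.I * τ)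

theorem differentiableAt_inv {M : ℂ → Matrix (Fin ν) (Fin ν) ℂ} {z : ℂ}
    (hM : DifferentiableAt ℂ M z) (hu : IsUnit (M z)) :
    DifferentiableAt ℂ (fun z => (M z)⁻¹) z := by
  have h1 : (fun z => (M z)⁻¹) = fun z => Ring.inverse (M z) :=
    funext fun z => Matrix.nonsing_inv_eq_ringInverse _
  rw [h1]
  exact ((analyticOnNhd_inverse (𝕜 := ℂ) (M z) hu).differentiableAt).comp z hM

theorem inv_mul_self {M : Matrix (Fin ν) (Fin ν) ℂ} (h : IsUnit M) : M⁻¹ * M = 1 :=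
  Matrix.nonsing_inv_mul _ ((Matrix.isUnit_iff_isUnit_det _).1 h)

theorem mul_inv_self {M : Matrix (Fin ν) (Fin ν) ℂ} (h : IsUnit M) : M * M⁻¹ = 1 :=
  Matrix.mul_nonsing_inv _ ((Matrix.isUnit_iff_isUnit_det _).1 h)

theorem differentiableAt_coefE {z : ℂ} (hA : AnalyticAt ℂ A z) (hB : AnalyticAt ℂ B z)
    (hu : IsUnit (A z)) : DifferentiableAt ℂ (coefE A B) z := by
  have h1 : coefE A B =ᶠ[𝓝 z] fun z =>
      deriv A z * (A z)⁻¹ + (2 : ℂ) • (A z * (transposeCL (B z) - B z)) := by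
    filter_upwards [hA.eventually_analyticAt] with w hw
    rw [coefE, matDeriv_eq hw.differentiableAt, transposeCL_apply]
  refine DifferentiableAt.congr_of_eventuallyEq ?_ h1
  have h2 : DifferentiableAt ℂ (fun z => transposeCL (B z)) z :=
    (transposeCL (ν := ν)).differentiableAt.comp z hB.differentiableAt
  exact ((hA.deriv.differentiableAt.mul (differentiableAt_inv hA.differentiableAt hu))).add
    ((hA.differentiableAt.mul (h2.sub hB.differentiableAt)).const_smul (2 : ℂ))

theorem differentiableAt_coefF {z : ℂ} (hA : AnalyticAt ℂ A z) (hB : AnalyticAt ℂ B z)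
    (hC : AnalyticAt ℂ C z) : DifferentiableAt ℂ (coefF A B C) z := by
  have h1 : coefF A B C =ᶠ[𝓝 z] fun z =>
      (4 : ℂ) • (A z * C z) - (2 : ℂ) • (A z * deriv B z) := by
    filter_upwards [hB.eventually_analyticAt] with w hw
    rw [coefF, matDeriv_eq hw.differentiableAt]
  refine DifferentiableAt.congr_of_eventuallyEq ?_ h1
  exact ((hA.differentiableAt.mul hC.differentiableAt).const_smul (4 : ℂ)).sub
    ((hA.differentiableAt.mul hB.deriv.differentiableAt).const_smul (2 : ℂ))

theorem eventually_ball_of_nhds {p : ℂ → Prop} (h : ∀ᶠ z in 𝓝 (0 : ℂ), p z) :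
    ∃ r > 0, ∀ z ∈ Metric.ball (0 : ℂ) r, p z := Metric.eventually_nhds_iff_ball.1 h

/-- The classical flow exists near `0`. -/
theorem exists_flow (hA : ∀ j k, AnalyticAt ℂ (fun t => A t j k) 0)
    (hB : ∀ j k, AnalyticAt ℂ (fun t => B t j k) 0)
    (hC : ∀ j k, AnalyticAt ℂ (fun t => C t j k) 0)
    (hAsymm : ∀ᶠ t in 𝓝 (0 : ℂ), (A t).IsSymm)
    (hCsymm : ∀ᶠ t in 𝓝 (0 : ℂ), (C t).IsSymm)
    (hA0 : IsUnit (A 0))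
    (hreal : ∀ᶠ τ : ℝ in 𝓝 0, ∀ j k,
      (A (Complex.I * τ) j k).im = 0 ∧
      (Complex.I * B (Complex.I * τ) j k).im = 0 ∧
      (C (Complex.I * τ) j k).im = 0) :
    ∃ r G U' V V', Flow A B C r G U' V V' := by
  have aA := analyticAt_matrix hA
  have aB := analyticAt_matrix hB
  have aC := analyticAt_matrix hC
  have uA : ∀ᶠ z in 𝓝 (0 : ℂ), IsUnit (A z) :=
    aA.continuousAt (Units.isOpen.mem_nhds hA0)
  have aE : AnalyticAt ℂ (coefE A B) 0 := by
    rw [Complex.analyticAt_iff_eventually_differentiableAt]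
    filter_upwards [aA.eventually_analyticAt, aB.eventually_analyticAt, uA] with z h1 h2 h3
      using differentiableAt_coefE h1 h2 h3
  have aF : AnalyticAt ℂ (coefF A B C) 0 := by
    rw [Complex.analyticAt_iff_eventually_differentiableAt]
    filter_upwards [aA.eventually_analyticAt, aB.eventually_analyticAt,
      aC.eventually_analyticAt] with z h1 h2 h3 using differentiableAt_coefF h1 h2 h3
  obtain ⟨r₁, hr₁, U, U', hU0, hU'0, hU⟩ := exists_second_order_solution aE aF 0 1
  obtain ⟨r₂, hr₂, V, V', hV0, hV'0, hV⟩ := exists_second_order_solution aE aF 1 0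
  have dU : DifferentiableOn ℂ U (Metric.ball 0 r₁) := fun z hz =>
    (hU z hz).1.differentiableAt.differentiableWithinAt
  set G := dslope U 0 with hG
  have hUG : (fun z => z • G z) = U := by
    funext z
    have := sub_smul_dslope U 0 z
    simpa [hU0] using this
  have dG : DifferentiableOn ℂ G (Metric.ball 0 r₁) :=
    (Complex.differentiableOn_dslope (Metric.ball_mem_nhds 0 hr₁)).2 dU
  have hG0 : G 0 = 1 := by
    rw [hG, dslope_same, (hU 0 (Metric.mem_ball_self hr₁)).1.deriv, hU'0]
  have uG : ∀ᶠ z in 𝓝 (0 : ℂ), IsUnit (G z) := by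
    have : ContinuousAt G 0 :=
      (dG.differentiableAt (Metric.ball_mem_nhds 0 hr₁)).continuousAt
    exact this (Units.isOpen.mem_nhds (by rw [hG0]; exact isUnit_one))
  have hre : ∀ᶠ z in 𝓝 (0 : ℂ), ∀ j k, (A (Complex.I * (z.im : ℝ)) j k).im = 0 ∧
      (Complex.I * B (Complex.I * (z.im : ℝ)) j k).im = 0 ∧
      (C (Complex.I * (z.im : ℝ)) j k).im = 0 := by
    have : Tendsto Complex.im (𝓝 0) (𝓝 0) := Complex.continuous_im.tendsto 0
    exact this.eventually hreal
  obtain ⟨r₀, hr₀, hall⟩ := eventually_ball_of_nhds (aA.eventually_analyticAt.and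
    (aB.eventually_analyticAt.and (aC.eventually_analyticAt.and (hAsymm.and (hCsymm.and
      (uA.and (uG.and hre)))))))
  have hsub0 : ∀ z ∈ Metric.ball (0 : ℂ) (min r₀ (min r₁ r₂)), z ∈ Metric.ball (0 : ℂ) r₀ :=
    Metric.ball_subset_ball (min_le_left _ _)
  have hsub1 : ∀ z ∈ Metric.ball (0 : ℂ) (min r₀ (min r₁ r₂)), z ∈ Metric.ball (0 : ℂ) r₁ :=
    Metric.ball_subset_ball ((min_le_right _ _).trans (min_le_left _ _))
  have hsub2 : ∀ z ∈ Metric.ball (0 : ℂ) (min r₀ (min r₁ r₂)), z ∈ Metric.ball (0 : ℂ) r₂ :=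
    Metric.ball_subset_ball ((min_le_right _ _).trans (min_le_right _ _))
  have hrl : ∀ τ : ℝ, |τ| < min r₀ (min r₁ r₂) → ∀ j k, (A (Complex.I * τ) j k).im = 0 ∧
      (Complex.I * B (Complex.I * τ) j k).im = 0 ∧ (C (Complex.I * τ) j k).im = 0 := by
    intro τ hτ
    have := (hall (Complex.I * τ) (hsub0 _ (by simpa using hτ))).2.2.2.2.2.2.2
    simpa using this
  exact ⟨min r₀ (min r₁ r₂), G, U', V, V',
    { pos := lt_min hr₀ (lt_min hr₁ hr₂)
      diffA := fun z hz => (hall z (hsub0 z hz)).1.differentiableAt.differentiableWithinAt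
      diffB := fun z hz => (hall z (hsub0 z hz)).2.1.differentiableAt.differentiableWithinAt
      diffC := fun z hz => (hall z (hsub0 z hz)).2.2.1.differentiableAt.differentiableWithinAt
      symmA := fun z hz => (hall z (hsub0 z hz)).2.2.2.1
      symmC := fun z hz => (hall z (hsub0 z hz)).2.2.2.2.1
      unitA := fun z hz => (hall z (hsub0 z hz)).2.2.2.2.2.1
      unitG := fun z hz => (hall z (hsub0 z hz)).2.2.2.2.2.2.1
      diffG := dG.mono hsub1
      G_zero := hG0
      U'_zero := hU'0
      V_zero := hV0
      V'_zero := hV'0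
      hasDerivU := fun z hz => hUG ▸ (hU z (hsub1 z hz)).1
      hasDerivU' := fun z hz => (congrFun hUG z : z • G z = U z) ▸ (hU z (hsub1 z hz)).2
      hasDerivV := fun z hz => (hV z (hsub2 z hz)).1
      hasDerivV' := fun z hz => (hV z (hsub2 z hz)).2
      realA := fun τ hτ => by
        ext j k
        exact Complex.conj_eq_iff_im.2 (hrl τ hτ j k).1
      realB := fun τ hτ => by
        ext j k
        have := (hrl τ hτ j k).2.1
        rw [Complex.I_mul_im] at this
        apply Complex.ext <;> simp [conjMat_apply, this]
      realC := fun τ hτ => by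
        ext j k
        exact Complex.conj_eq_iff_im.2 (hrl τ hτ j k).2.2 }⟩

end Flow

end

end HeatDeformation

namespace HeatDeformation

noncomputable section

open scoped Matrix.Norms.Operator

variable {ν : ℕ} {A B C : ℂ → Matrix (Fin ν) (Fin ν) ℂ} {r : ℝ}
  {G U' V V' : ℂ → Matrix (Fin ν) (Fin ν) ℂ}

theorem mul_mem_ball {t : ℂ} (ht : t ∈ Metric.ball (0 : ℂ) r) {s : ℝ}
    (hs : s ∈ Set.Icc (0 : ℝ) 1) : t * s ∈ Metric.ball (0 : ℂ) r := by
  rw [Metric.mem_ball, dist_zero_right] at ht ⊢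
  rw [norm_mul, Complex.norm_real, Real.norm_of_nonneg hs.1]
  exact (mul_le_of_le_one_right (norm_nonneg _) hs.2).trans_lt ht

theorem hasDerivAt_comp_mul_ofReal {𝔸 : Type*} [NormedAddCommGroup 𝔸] [NormedSpace ℂ 𝔸]
    {M : ℂ → 𝔸} {M' : 𝔸} {t : ℂ} {s : ℝ} (h : HasDerivAt M M' (t * s)) :
    HasDerivAt (fun s : ℝ => M (t * s)) (t • M') s := by
  have h2 : HasDerivAt (fun s : ℝ => t * (s : ℂ)) t s := by
    simpa using (Complex.ofRealCLM.hasDerivAt (x := s)).const_mul t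
  exact h.scomp s h2

namespace Flow

theorem differentiableAt_G (h : Flow A B C r G U' V V') {z : ℂ} (hz : z ∈ Metric.ball (0 : ℂ) r) :
    DifferentiableAt ℂ G z := h.diffG.differentiableAt (Metric.isOpen_ball.mem_nhds hz)

theorem differentiableAt_A (h : Flow A B C r G U' V V') {z : ℂ} (hz : z ∈ Metric.ball (0 : ℂ) r) :
    DifferentiableAt ℂ A z := h.diffA.differentiableAt (Metric.isOpen_ball.mem_nhds hz)

theorem differentiableAt_B (h : Flow A B C r G U' V V') {z : ℂ} (hz : z ∈ Metric.ball (0 : ℂ) r) :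
    DifferentiableAt ℂ B z := h.diffB.differentiableAt (Metric.isOpen_ball.mem_nhds hz)

theorem analyticAt_of_diff {𝔸 : Type*} [NormedAddCommGroup 𝔸] [NormedSpace ℂ 𝔸] [CompleteSpace 𝔸]
    {M : ℂ → 𝔸} (hM : DifferentiableOn ℂ M (Metric.ball 0 r)) {z : ℂ}
    (hz : z ∈ Metric.ball (0 : ℂ) r) : AnalyticAt ℂ M z :=
  hM.analyticAt (Metric.isOpen_ball.mem_nhds hz)

theorem continuousOn_coefE (h : Flow A B C r G U' V V') :
    ContinuousOn (coefE A B) (Metric.ball 0 r) := fun _ hz =>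
  (differentiableAt_coefE (analyticAt_of_diff h.diffA hz) (analyticAt_of_diff h.diffB hz)
    (h.unitA _ hz)).continuousAt.continuousWithinAt

theorem continuousOn_coefF (h : Flow A B C r G U' V V') :
    ContinuousOn (coefF A B C) (Metric.ball 0 r) := fun _ hz =>
  (differentiableAt_coefF (analyticAt_of_diff h.diffA hz) (analyticAt_of_diff h.diffB hz)
    (analyticAt_of_diff h.diffC hz)).continuousAt.continuousWithinAt

theorem exists_coef_bound (h : Flow A B C r G U' V V') {t : ℂ}
    (ht : t ∈ Metric.ball (0 : ℂ) r) : ∃ K : ℝ, ∀ s ∈ Set.Icc (0 : ℝ) 1,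
      ‖t • coefE A B (t * s)‖ ≤ K ∧ ‖t ^ 2 • coefF A B C (t * s)‖ ≤ K := by
  have hc : ContinuousOn (fun s : ℝ => t * (s : ℂ)) (Set.Icc 0 1) := by fun_prop
  have hm : Set.MapsTo (fun s : ℝ => t * (s : ℂ)) (Set.Icc 0 1) (Metric.ball 0 r) :=
    fun s hs => mul_mem_ball ht hs
  obtain ⟨K₁, h1⟩ := isCompact_Icc.exists_bound_of_continuousOn
    ((h.continuousOn_coefE.comp hc hm).const_smul t)
  obtain ⟨K₂, h2⟩ := isCompact_Icc.exists_bound_of_continuousOn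
    ((h.continuousOn_coefF.comp hc hm).const_smul (t ^ 2))
  exact ⟨max K₁ K₂, fun s hs => ⟨(h1 s hs).trans (le_max_left _ _),
    (h2 s hs).trans (le_max_right _ _)⟩⟩

theorem hasDerivAt_scaledU (h : Flow A B C r G U' V V') {t : ℂ}
    (ht : t ∈ Metric.ball (0 : ℂ) r) {s : ℝ} (hs : s ∈ Set.Icc (0 : ℝ) 1) :
    HasDerivAt (fun s : ℝ => (s : ℂ) • G (t * s)) (U' (t * s)) s := by
  rcases eq_or_ne t 0 with rfl | ht0
  · have h1 : HasDerivAt (fun s : ℝ => (s : ℂ) • G 0) ((1 : ℂ) • G 0) s :=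
      (Complex.ofRealCLM.hasDerivAt (x := s)).smul_const (G 0)
    simpa [h.G_zero, h.U'_zero] using h1
  · have h1 := (hasDerivAt_comp_mul_ofReal (h.hasDerivU _ (mul_mem_ball ht hs))).const_smul t⁻¹
    rw [smul_smul, inv_mul_cancel₀ ht0, one_smul] at h1
    refine h1.congr_of_eventuallyEq (Eventually.of_forall fun s => ?_)
    simp only [smul_smul, Pi.smul_apply]
    rw [← mul_assoc, inv_mul_cancel₀ ht0, one_mul]

theorem hasDerivAt_scaledU' (h : Flow A B C r G U' V V') {t : ℂ}
    (ht : t ∈ Metric.ball (0 : ℂ) r) {s : ℝ} (hs : s ∈ Set.Icc (0 : ℝ) 1) :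
    HasDerivAt (fun s : ℝ => U' (t * s)) ((t • coefE A B (t * s)) * U' (t * s)
      + (t ^ 2 • coefF A B C (t * s)) * ((s : ℂ) • G (t * s))) s := by
  have h1 := hasDerivAt_comp_mul_ofReal (h.hasDerivU' _ (mul_mem_ball ht hs))
  refine h1.congr_deriv ?_
  rw [smul_add, smul_mul_assoc, mul_smul_comm, smul_mul_assoc, mul_smul_comm, smul_smul, smul_smul]
  congr 2
  ring

theorem hasDerivAt_scaledV (h : Flow A B C r G U' V V') {t : ℂ}
    (ht : t ∈ Metric.ball (0 : ℂ) r) {s : ℝ} (hs : s ∈ Set.Icc (0 : ℝ) 1) :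
    HasDerivAt (fun s : ℝ => V (t * s)) (t • V' (t * s)) s :=
  hasDerivAt_comp_mul_ofReal (h.hasDerivV _ (mul_mem_ball ht hs))

theorem hasDerivAt_scaledV' (h : Flow A B C r G U' V V') {t : ℂ}
    (ht : t ∈ Metric.ball (0 : ℂ) r) {s : ℝ} (hs : s ∈ Set.Icc (0 : ℝ) 1) :
    HasDerivAt (fun s : ℝ => t • V' (t * s)) ((t • coefE A B (t * s)) * (t • V' (t * s))
      + (t ^ 2 • coefF A B C (t * s)) * V (t * s)) s := by
  have h1 := (hasDerivAt_comp_mul_ofReal (h.hasDerivV' _ (mul_mem_ball ht hs))).const_smul t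
  refine h1.congr_deriv ?_
  rw [smul_add, smul_mul_assoc, mul_smul_comm, smul_mul_assoc, smul_add, smul_smul, smul_smul,
    pow_two]

end Flow

/-- The solution of the rescaled equation with boundary values `q₀` and `q₁`. -/
def bvpSol (G V : ℂ → Matrix (Fin ν) (Fin ν) ℂ) (t : ℂ) (q₀ q₁ : Matrix (Fin ν) (Fin ν) ℂ)
    (s : ℝ) : Matrix (Fin ν) (Fin ν) ℂ :=
  (s : ℂ) • G (t * s) * ((G t)⁻¹ * (q₁ - V t * q₀)) + V (t * s) * q₀

/-- The derivative of `bvpSol`. -/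
def bvpDeriv (G U' V V' : ℂ → Matrix (Fin ν) (Fin ν) ℂ) (t : ℂ)
    (q₀ q₁ : Matrix (Fin ν) (Fin ν) ℂ) (s : ℝ) : Matrix (Fin ν) (Fin ν) ℂ :=
  U' (t * s) * ((G t)⁻¹ * (q₁ - V t * q₀)) + t • V' (t * s) * q₀

namespace Flow

theorem hasDerivAt_bvpSol (h : Flow A B C r G U' V V') {t : ℂ}
    (ht : t ∈ Metric.ball (0 : ℂ) r) (q₀ q₁ : Matrix (Fin ν) (Fin ν) ℂ) {s : ℝ}
    (hs : s ∈ Set.Icc (0 : ℝ) 1) :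
    HasDerivAt (bvpSol G V t q₀ q₁) (bvpDeriv G U' V V' t q₀ q₁ s) s :=
  ((h.hasDerivAt_scaledU ht hs).mul_const _).add ((h.hasDerivAt_scaledV ht hs).mul_const _)

theorem isBVPSol_bvpSol (h : Flow A B C r G U' V V') {t : ℂ}
    (ht : t ∈ Metric.ball (0 : ℂ) r) (q₀ q₁ : Matrix (Fin ν) (Fin ν) ℂ) :
    IsBVPSol A B C t q₀ q₁ (bvpSol G V t q₀ q₁) := by
  refine ⟨?_, ?_, bvpDeriv G U' V V' t q₀ q₁, fun s hs => ?_⟩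
  · simp [bvpSol, h.V_zero]
  · simp only [bvpSol, Complex.ofReal_one, one_smul, mul_one]
    rw [← mul_assoc, mul_inv_self (h.unitG t ht), one_mul, sub_add_cancel]
  · have h1 : HasDerivWithinAt (bvpSol G V t q₀ q₁) (bvpDeriv G U' V V' t q₀ q₁ s)
        (Set.Icc 0 1) s := (h.hasDerivAt_bvpSol ht q₀ q₁ hs).hasDerivWithinAt
    have h2 : HasDerivWithinAt (bvpDeriv G U' V V' t q₀ q₁)
        (t • (coefE A B (t * s) * bvpDeriv G U' V V' t q₀ q₁ s)
          + t ^ 2 • (coefF A B C (t * s) * bvpSol G V t q₀ q₁ s)) (Set.Icc 0 1) s := by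
      have := (((h.hasDerivAt_scaledU' ht hs).mul_const ((G t)⁻¹ * (q₁ - V t * q₀))).add
        ((h.hasDerivAt_scaledV' ht hs).mul_const q₀)).hasDerivWithinAt (s := Set.Icc 0 1)
      refine this.congr_deriv ?_
      simp only [bvpDeriv, bvpSol, ← smul_mul_assoc]
      noncomm_ring
    exact fun j k => ⟨hasDerivWithinAt_matrix.1 h1 j k, hasDerivWithinAt_matrix.1 h2 j k⟩

theorem eq_of_isBVPSol (h : Flow A B C r G U' V V') {t : ℂ}
    (ht : t ∈ Metric.ball (0 : ℂ) r) {q₀ q₁ : Matrix (Fin ν) (Fin ν) ℂ}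
    {q : ℝ → Matrix (Fin ν) (Fin ν) ℂ} (hq : IsBVPSol A B C t q₀ q₁ q) :
    Set.EqOn q (bvpSol G V t q₀ q₁) (Set.Icc 0 1) := by
  obtain ⟨hq0, hq1, p, hp⟩ := hq
  obtain ⟨K, hK⟩ := h.exists_coef_bound ht
  have key : ∀ s ∈ Set.Icc (0 : ℝ) 1, q s = (s : ℂ) • G (t * s) * p 0 + V (t * s) * q₀ := by
    intro s hs
    have := eq_zero_of_second_order (fun s hs => (hK s hs).1) (fun s hs => (hK s hs).2)
      (q := fun s => q s - ((s : ℂ) • G (t * s) * p 0 + V (t * s) * q₀))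
      (p := fun s => p s - (U' (t * s) * p 0 + t • V' (t * s) * q₀))
      (fun s hs => (hasDerivWithinAt_matrix.2 fun j k => (hp s hs j k).1).sub
        (((h.hasDerivAt_scaledU ht hs).mul_const _).add
          ((h.hasDerivAt_scaledV ht hs).mul_const _)).hasDerivWithinAt)
      (fun s hs => by
        have h1 : HasDerivWithinAt p (t • (coefE A B (t * s) * p s)
            + t ^ 2 • (coefF A B C (t * s) * q s)) (Set.Icc 0 1) s :=
          hasDerivWithinAt_matrix.2 fun j k => (hp s hs j k).2
        have h2 := h1.sub (((h.hasDerivAt_scaledU' ht hs).mul_const (p 0)).add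
          ((h.hasDerivAt_scaledV' ht hs).mul_const q₀)).hasDerivWithinAt
        refine h2.congr_deriv ?_
        simp only [← smul_mul_assoc]
        noncomm_ring)
      (by simp [hq0, h.V_zero]) (by simp [h.U'_zero, h.V'_zero]) s hs
    exact sub_eq_zero.1 this.1
  have h1 := key 1 (by simp)
  simp only [Complex.ofReal_one, one_smul, mul_one] at h1
  have h2 : p 0 = (G t)⁻¹ * (q₁ - V t * q₀) := by
    rw [← hq1, h1, add_sub_cancel_right, ← mul_assoc, inv_mul_self (h.unitG t ht), one_mul]
  intro s hs
  rw [key s hs, h2, bvpSol]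

theorem bvpUniquelySolvable (h : Flow A B C r G U' V V') {t : ℂ}
    (ht : t ∈ Metric.ball (0 : ℂ) r) (q₀ q₁ : Matrix (Fin ν) (Fin ν) ℂ) :
    BVPUniquelySolvable A B C t q₀ q₁ :=
  ⟨_, h.isBVPSol_bvpSol ht q₀ q₁, fun _ hq => h.eq_of_isBVPSol ht hq⟩

theorem qFlat_eq (h : Flow A B C r G U' V V') {t : ℂ} (ht : t ∈ Metric.ball (0 : ℂ) r) {s : ℝ}
    (hs : s ∈ Set.Icc (0 : ℝ) 1) : qFlat A B C t s = (s : ℂ) • (G (t * s) * (G t)⁻¹) := by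
  have := h.eq_of_isBVPSol ht (Classical.epsilon_spec (p := IsBVPSol A B C t 0 1)
    ⟨_, h.isBVPSol_bvpSol ht 0 1⟩) hs
  rw [qFlat, this, bvpSol]
  simp

theorem qSharp_eq (h : Flow A B C r G U' V V') {t : ℂ} (ht : t ∈ Metric.ball (0 : ℂ) r) {s : ℝ}
    (hs : s ∈ Set.Icc (0 : ℝ) 1) :
    qSharp A B C t s = V (t * s) - (s : ℂ) • (G (t * s) * (G t)⁻¹ * V t) := by
  have := h.eq_of_isBVPSol ht (Classical.epsilon_spec (p := IsBVPSol A B C t 1 0)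
    ⟨_, h.isBVPSol_bvpSol ht 1 0⟩) hs
  rw [qSharp, this, bvpSol]
  simp [mul_assoc]
  abel

theorem conj_coef (h : Flow A B C r G U' V V') {τ : ℝ} (hτ : |τ| < r) {s : ℝ}
    (hs : s ∈ Set.Icc (0 : ℝ) 1) :
    conjMat ((Complex.I * τ) • coefE A B (Complex.I * τ * s))
        = (Complex.I * τ) • coefE A B (Complex.I * τ * s) ∧
      conjMat ((Complex.I * τ) ^ 2 • coefF A B C (Complex.I * τ * s))
        = (Complex.I * τ) ^ 2 • coefF A B C (Complex.I * τ * s) := by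
  have hτs : |τ * s| < r := by
    rw [abs_mul, abs_of_nonneg hs.1]
    exact (mul_le_of_le_one_right (abs_nonneg _) hs.2).trans_lt hτ
  have e : Complex.I * τ * s = Complex.I * ((τ * s : ℝ) : ℂ) := by push_cast; ring
  have hmem : Complex.I * ((τ * s : ℝ) : ℂ) ∈ Metric.ball (0 : ℂ) r := by simpa using hτs
  have dA : conjMat (matDeriv A (Complex.I * ((τ * s : ℝ) : ℂ)))
      = -matDeriv A (Complex.I * ((τ * s : ℝ) : ℂ)) := by
    have := conjMat_matDeriv (c := 1) h.diffA (fun σ hσ => by rw [one_smul, h.realA σ hσ]) hτs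
    rwa [neg_smul, one_smul] at this
  have dB : conjMat (matDeriv B (Complex.I * ((τ * s : ℝ) : ℂ)))
      = matDeriv B (Complex.I * ((τ * s : ℝ) : ℂ)) := by
    have := conjMat_matDeriv (c := -1) h.diffB
      (fun σ hσ => by rw [neg_smul, one_smul, h.realB σ hσ]) hτs
    rwa [neg_neg, one_smul] at this
  have cE : conjMat (coefE A B (Complex.I * ((τ * s : ℝ) : ℂ)))
      = -coefE A B (Complex.I * ((τ * s : ℝ) : ℂ)) := by
    rw [coefE, map_add, map_mul, conjMat_smul, map_mul, map_sub, conjMat_transpose,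
      conjMat_inv (h.unitA _ hmem), dA, h.realA _ hτs, h.realB _ hτs, Complex.conj_ofNat,
      Matrix.transpose_neg]
    simp only [neg_mul, mul_sub, mul_neg, smul_sub, smul_neg]
    abel
  have cF : conjMat (coefF A B C (Complex.I * ((τ * s : ℝ) : ℂ)))
      = coefF A B C (Complex.I * ((τ * s : ℝ) : ℂ)) := by
    rw [coefF, map_sub, conjMat_smul, conjMat_smul, map_mul, map_mul, dB, h.realA _ hτs,
      h.realC _ hτs, Complex.conj_ofNat, Complex.conj_ofNat]
  rw [e, conjMat_smul, conjMat_smul, cE, cF]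
  refine ⟨?_, ?_⟩
  · simp
  · simp

theorem conj_scaled (h : Flow A B C r G U' V V') {τ : ℝ} (hτ : |τ| < r)
    {q p : ℝ → Matrix (Fin ν) (Fin ν) ℂ}
    (hq : ∀ s ∈ Set.Icc (0 : ℝ) 1, HasDerivAt q (p s) s)
    (hp : ∀ s ∈ Set.Icc (0 : ℝ) 1, HasDerivAt p
      (((Complex.I * τ) • coefE A B (Complex.I * τ * s)) * p s
        + ((Complex.I * τ) ^ 2 • coefF A B C (Complex.I * τ * s)) * q s) s)
    (hq0 : conjMat (q 0) = q 0) (hp0 : conjMat (p 0) = p 0) :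
    ∀ s ∈ Set.Icc (0 : ℝ) 1, conjMat (q s) = q s := by
  intro s hs
  obtain ⟨K, hK⟩ := h.exists_coef_bound (t := Complex.I * τ) (by simpa using hτ)
  have := eq_zero_of_second_order (fun s hs => (hK s hs).1) (fun s hs => (hK s hs).2)
    (q := fun s => conjMat (q s) - q s) (p := fun s => conjMat (p s) - p s)
    (fun s hs => (hasDerivWithinAt_conjMat (hq s hs).hasDerivWithinAt).sub
      (hq s hs).hasDerivWithinAt)
    (fun s hs => by
      refine ((hasDerivWithinAt_conjMat (hp s hs).hasDerivWithinAt).sub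
        (hp s hs).hasDerivWithinAt).congr_deriv ?_
      rw [map_add, map_mul, map_mul, (h.conj_coef hτ hs).1, (h.conj_coef hτ hs).2]
      noncomm_ring)
    (by simp [hq0]) (by simp [hp0]) s hs
  exact sub_eq_zero.1 this.1

theorem conj_G (h : Flow A B C r G U' V V') {τ : ℝ} (hτ : |τ| < r) :
    conjMat (G (Complex.I * τ)) = G (Complex.I * τ) := by
  have ht : Complex.I * τ ∈ Metric.ball (0 : ℂ) r := by simpa using hτ
  have := h.conj_scaled hτ (fun s hs => h.hasDerivAt_scaledU ht hs)
    (fun s hs => h.hasDerivAt_scaledU' ht hs) (by simp) (by simp [h.U'_zero]) 1 (by simp)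
  simpa using this

theorem conj_V (h : Flow A B C r G U' V V') {τ : ℝ} (hτ : |τ| < r) :
    conjMat (V (Complex.I * τ)) = V (Complex.I * τ) := by
  have ht : Complex.I * τ ∈ Metric.ball (0 : ℂ) r := by simpa using hτ
  have := h.conj_scaled hτ (fun s hs => h.hasDerivAt_scaledV ht hs)
    (fun s hs => h.hasDerivAt_scaledV' ht hs) (by simp [h.V_zero]) (by simp [h.V'_zero]) 1
    (by simp)
  simpa using this

end Flow

end

end HeatDeformation

namespace HeatDeformation

noncomputable section

variable {ν n : ℕ}

section Average

/-! ### Weighted averages of point masses -/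

theorem intervalIntegrable_of_bounded {F : Type*} [NormedAddCommGroup F]
    {f : ℝ → F} {a b K : ℝ} (hf : AEStronglyMeasurable f (volume.restrict (Set.uIoc a b)))
    (hK : ∀ τ ∈ Set.uIoc a b, ‖f τ‖ ≤ K) : IntervalIntegrable f volume a b := by
  rw [intervalIntegrable_iff]
  have : IsFiniteMeasure (volume.restrict (Set.uIoc a b)) := ⟨by simp [Set.uIoc]⟩
  exact Integrable.of_bound hf K
    ((ae_restrict_iff' measurableSet_uIoc).2 (Eventually.of_forall hK))

/-- `(1/τ) ∑_{s_j ≤ τ} s_j x_j`. -/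
def avg (s : Fin n → ℝ) (x : Fin n → ℂ) (τ : ℝ) : ℂ :=
  ∑ j, if s j ≤ τ then ((s j / τ : ℝ) : ℂ) * x j else 0

theorem norm_avg_le {s : Fin n → ℝ} (hs : ∀ j, 0 ≤ s j) (x : Fin n → ℂ) {τ : ℝ} (hτ : 0 < τ) :
    ‖avg s x τ‖ ≤ ∑ j, ‖x j‖ := by
  refine (norm_sum_le _ _).trans (Finset.sum_le_sum fun j _ => ?_)
  split_ifs with h
  · rw [norm_mul, Complex.norm_real, Real.norm_of_nonneg (div_nonneg (hs j) hτ.le)]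
    exact mul_le_of_le_one_left (norm_nonneg _) ((div_le_one hτ).2 h)
  · simp

theorem measurable_avg (s : Fin n → ℝ) (x : Fin n → ℂ) : Measurable (avg s x) := by
  unfold avg
  refine Finset.measurable_fun_sum _ fun j _ => ?_
  refine Measurable.ite measurableSet_Ici ?_ measurable_const
  fun_prop

theorem avg_ofReal (s : Fin n → ℝ) (x : Fin n → ℝ) (τ : ℝ) :
    avg s (fun j => (x j : ℂ)) τ = ((∑ j, if s j ≤ τ then s j / τ * x j else 0 : ℝ) : ℂ) := by
  rw [avg, Complex.ofReal_sum]
  refine Finset.sum_congr rfl fun j _ => ?_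
  split_ifs <;> simp

theorem intervalIntegrable_avg {s : Fin n → ℝ} (hs : ∀ j, 0 < s j) (x : Fin n → ℂ) {a b : ℝ}
    (ha : 0 ≤ a) (hb : 0 ≤ b) : IntervalIntegrable (avg s x) volume a b :=
  intervalIntegrable_of_bounded (measurable_avg s x).aestronglyMeasurable fun _ hτ =>
    norm_avg_le (fun j => (hs j).le) x ((le_min ha hb).trans_lt hτ.1)

/-- Averages of point masses modulated by a `C^1` function are controlled by the unmodulated
averages. -/
theorem norm_avg_mul_le {s : Fin n → ℝ} (hs : ∀ j, 0 < s j) {g g' : ℝ → ℂ} {K : ℝ}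
    (hg : ∀ σ ∈ Set.Icc (0 : ℝ) 1, HasDerivAt g (g' σ) σ)
    (hg' : ContinuousOn g' (Set.Icc 0 1))
    (hK : ∀ σ ∈ Set.Icc (0 : ℝ) 1, ‖g σ‖ ≤ K) (hK' : ∀ σ ∈ Set.Icc (0 : ℝ) 1, ‖g' σ‖ ≤ K)
    (x : Fin n → ℂ) {τ : ℝ} (hτ : τ ∈ Set.Ioc (0 : ℝ) 1) :
    ‖avg s (fun j => g (s j) * x j) τ‖
      ≤ K * (‖avg s x τ‖ + ∫ σ in (0 : ℝ)..1, ‖avg s x σ‖) := by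
  have hK0 : 0 ≤ K := (norm_nonneg _).trans (hK 0 (by simp))
  have hsub : Set.Icc (0 : ℝ) τ ⊆ Set.Icc 0 1 := Set.Icc_subset_Icc_right hτ.2
  have hgm : AEStronglyMeasurable g' (volume.restrict (Set.uIoc 0 τ)) := by
    rw [Set.uIoc_of_le hτ.1.le]
    exact (hg'.mono (Set.Ioc_subset_Icc_self.trans hsub)).aestronglyMeasurable measurableSet_Ioc
  have hterm : ∀ j, (if s j ≤ τ then ((s j / τ : ℝ) : ℂ) * (g (s j) * x j) else 0)
      = g τ * (if s j ≤ τ then ((s j / τ : ℝ) : ℂ) * x j else 0)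
        - (τ : ℂ)⁻¹ * ∫ σ in (0 : ℝ)..τ,
          g' σ * (σ * (if s j ≤ σ then ((s j / σ : ℝ) : ℂ) * x j else 0)) := by
    intro j
    have h1 : (∫ σ in (0 : ℝ)..τ,
          g' σ * (σ * (if s j ≤ σ then ((s j / σ : ℝ) : ℂ) * x j else 0)))
        = ∫ σ in (0 : ℝ)..τ, (Set.Ici (s j)).indicator (fun σ => g' σ * (s j * x j)) σ := by
      refine intervalIntegral.integral_congr_ae (Eventually.of_forall fun σ hσ => ?_)
      rw [Set.uIoc_of_le hτ.1.le] at hσ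
      have hσ0 : (σ : ℂ) ≠ 0 := by exact_mod_cast hσ.1.ne'
      by_cases h : s j ≤ σ
      · rw [if_pos h, Set.indicator_of_mem (Set.mem_Ici.2 h)]
        push_cast
        field_simp
      · rw [if_neg h, Set.indicator_of_notMem (by simpa using h)]
        simp
    rw [h1, intervalIntegral.integral_of_le hτ.1.le, setIntegral_indicator measurableSet_Ici]
    have hτ0 : (τ : ℂ) ≠ 0 := by exact_mod_cast hτ.1.ne'
    split_ifs with h
    · have h2 : Set.Ioc 0 τ ∩ Set.Ici (s j) = Set.Icc (s j) τ := by
        ext σ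
        simp only [Set.mem_inter_iff, Set.mem_Ioc, Set.mem_Ici, Set.mem_Icc]
        exact ⟨fun h => ⟨h.2, h.1.2⟩, fun h => ⟨⟨(hs j).trans_le h.1, h.2⟩, h.1⟩⟩
      rw [h2, integral_Icc_eq_integral_Ioc, ← intervalIntegral.integral_of_le h,
        intervalIntegral.integral_mul_const]
      have hsub' : Set.uIcc (s j) τ ⊆ Set.Icc 0 1 := by
        rw [Set.uIcc_of_le h]; exact Set.Icc_subset_Icc (hs j).le hτ.2
      rw [intervalIntegral.integral_eq_sub_of_hasDerivAt (fun σ hσ => hg σ (hsub' hσ))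
        (hg'.mono hsub').intervalIntegrable]
      push_cast
      field_simp
      ring
    · have h2 : Set.Ioc 0 τ ∩ Set.Ici (s j) = ∅ := by
        ext σ
        simp only [Set.mem_inter_iff, Set.mem_Ioc, Set.mem_Ici, Set.mem_empty_iff_false,
          iff_false, not_and, not_le]
        exact fun h' => h'.2.trans_lt (not_le.1 h)
      rw [h2]
      simp
  have hint : ∀ j, IntervalIntegrable (fun σ : ℝ =>
      g' σ * (σ * (if s j ≤ σ then ((s j / σ : ℝ) : ℂ) * x j else 0))) volume 0 τ := by
    intro j
    refine intervalIntegrable_of_bounded (K := K * (1 * ‖x j‖)) (hgm.mul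
      (Measurable.aestronglyMeasurable (Complex.measurable_ofReal.mul ?_))) fun σ hσ => ?_
    · refine Measurable.ite measurableSet_Ici ?_ measurable_const
      fun_prop
    · rw [Set.uIoc_of_le hτ.1.le] at hσ
      have hσ1 : σ ∈ Set.Icc (0 : ℝ) 1 := ⟨hσ.1.le, hσ.2.trans hτ.2⟩
      rw [norm_mul, norm_mul]
      refine mul_le_mul (hK' σ hσ1) (mul_le_mul ?_ ?_ (norm_nonneg _) zero_le_one)
        (by positivity) hK0
      · rw [Complex.norm_real, Real.norm_of_nonneg hσ1.1]; exact hσ1.2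
      · split_ifs with h
        · rw [norm_mul, Complex.norm_real, Real.norm_of_nonneg (div_nonneg (hs j).le hσ.1.le)]
          exact mul_le_of_le_one_left (norm_nonneg _) ((div_le_one hσ.1).2 h)
        · simp
  have hsum : avg s (fun j => g (s j) * x j) τ
      = g τ * avg s x τ - (τ : ℂ)⁻¹ * ∫ σ in (0 : ℝ)..τ, g' σ * (σ * avg s x σ) := by
    unfold avg
    simp only [Finset.mul_sum]
    rw [intervalIntegral.integral_finsetSum fun j _ => hint j, Finset.mul_sum,
      ← Finset.sum_sub_distrib]
    exact Finset.sum_congr rfl fun j _ => hterm j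
  have hmono : (∫ σ in (0 : ℝ)..τ, ‖avg s x σ‖) ≤ ∫ σ in (0 : ℝ)..1, ‖avg s x σ‖ :=
    intervalIntegral.integral_mono_interval le_rfl hτ.1.le hτ.2
      (Eventually.of_forall fun _ => norm_nonneg _)
      (intervalIntegrable_avg hs x le_rfl zero_le_one).norm
  have hI : ‖∫ σ in (0 : ℝ)..τ, g' σ * (σ * avg s x σ)‖
      ≤ τ * (K * ∫ σ in (0 : ℝ)..τ, ‖avg s x σ‖) := by
    rw [← intervalIntegral.integral_const_mul, ← intervalIntegral.integral_const_mul]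
    refine intervalIntegral.norm_integral_le_of_norm_le hτ.1.le
      (Eventually.of_forall fun σ hσ => ?_)
      (((intervalIntegrable_avg hs x le_rfl hτ.1.le).norm.const_mul _).const_mul _)
    have hσ1 : σ ∈ Set.Icc (0 : ℝ) 1 := ⟨hσ.1.le, hσ.2.trans hτ.2⟩
    rw [norm_mul, norm_mul, Complex.norm_real, Real.norm_of_nonneg hσ.1.le]
    calc ‖g' σ‖ * (σ * ‖avg s x σ‖) ≤ K * (τ * ‖avg s x σ‖) :=
          mul_le_mul (hK' σ hσ1) (mul_le_mul_of_nonneg_right hσ.2 (norm_nonneg _))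
            (mul_nonneg hσ.1.le (norm_nonneg _)) hK0
      _ = τ * (K * ‖avg s x σ‖) := by ring
  rw [hsum]
  refine (norm_sub_le _ _).trans ?_
  rw [norm_mul, norm_mul, mul_add, norm_inv, Complex.norm_real, Real.norm_of_nonneg hτ.1.le]
  refine add_le_add (mul_le_mul_of_nonneg_right (hK τ ⟨hτ.1.le, hτ.2⟩) (norm_nonneg _)) ?_
  rw [inv_mul_le_iff₀ hτ.1]
  exact hI.trans (mul_le_mul_of_nonneg_left (mul_le_mul_of_nonneg_left hmono hK0) hτ.1.le)

theorem sq_integral_le {u : ℝ → ℝ} (hu : IntervalIntegrable u volume 0 1)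
    (hu2 : IntervalIntegrable (fun τ => u τ ^ 2) volume 0 1) :
    (∫ τ in (0 : ℝ)..1, u τ) ^ 2 ≤ ∫ τ in (0 : ℝ)..1, u τ ^ 2 := by
  set J := ∫ τ in (0 : ℝ)..1, u τ with hJ
  have h1 : 0 ≤ ∫ τ in (0 : ℝ)..1, (u τ - J) ^ 2 :=
    intervalIntegral.integral_nonneg zero_le_one fun τ _ => sq_nonneg _
  have h2 : (∫ τ in (0 : ℝ)..1, (u τ - J) ^ 2) = (∫ τ in (0 : ℝ)..1, u τ ^ 2) - J ^ 2 := by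
    have : ∀ τ, (u τ - J) ^ 2 = u τ ^ 2 - (2 * J) * u τ + J ^ 2 := fun τ => by ring
    simp only [this]
    rw [intervalIntegral.integral_add (hu2.sub (hu.const_mul _)) (by simp),
      intervalIntegral.integral_sub hu2 (hu.const_mul _), intervalIntegral.integral_const_mul,
      ← hJ]
    simp
    ring
  linarith

end Average

section Positivity

/-! ### A positivity criterion -/

/-- A holomorphic function that is real on the imaginary axis and positive at `0` satisfies
`Re (t b(t)) ≥ 0` on a closed half-disc whose size depends only on scale-invariant bounds. -/
theorem re_mul_nonneg {b : ℂ → ℂ} {r K a N : ℝ} (hr : 0 < r) (hN : 0 ≤ N) (hK : 0 < K)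
    (hb : DifferentiableOn ℂ b (Metric.ball 0 r)) (hbK : ∀ z ∈ Metric.ball (0 : ℂ) r, ‖b z‖ ≤ K * N)
    (hreal : ∀ τ : ℝ, |τ| < r → (b (Complex.I * τ)).im = 0) (h0 : a * N ≤ (b 0).re)
    {t : ℂ} (ht : t ∈ halfDiscBar (min (r / 2) (a * r / (8 * K)))) : 0 ≤ (t * b t).re := by
  obtain ⟨ht1, ht2⟩ := ht
  have htr : ‖t‖ < r / 2 := ht1.trans_le (min_le_left _ _)
  have hta : ‖t‖ < a * r / (8 * K) := ht1.trans_le (min_le_right _ _)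
  set D := 4 * K * N / r with hD
  have hD0 : 0 ≤ D := by positivity
  have hlip : ∀ z ∈ Metric.ball (0 : ℂ) (r / 2), ∀ w ∈ Metric.ball (0 : ℂ) (r / 2),
      ‖b w - b z‖ ≤ D * ‖w - z‖ := by
    intro z hz w hw
    refine (convex_ball (0 : ℂ) (r / 2)).norm_image_sub_le_of_norm_deriv_le (𝕜 := ℂ)
      (fun y hy => ?_) (fun y hy => ?_) hz hw
    · exact hb.differentiableAt (Metric.isOpen_ball.mem_nhds
        (Metric.ball_subset_ball (by linarith) hy))
    · have hsub : Metric.closedBall y (r / 4) ⊆ Metric.ball 0 r := by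
        intro q hq
        rw [mem_ball_zero_iff] at hy ⊢
        rw [mem_closedBall_iff_norm] at hq
        calc ‖q‖ ≤ ‖q - y‖ + ‖y‖ := by simpa using norm_add_le (q - y) y
          _ < r := by linarith
      have := Complex.norm_deriv_le_of_forall_mem_sphere_norm_le (c := y) (R := r / 4) (C := K * N)
        (by positivity) (DifferentiableOn.diffContOnCl (by
          rw [closure_ball y (by positivity)]; exact hb.mono hsub))
        (fun q hq => hbK q (hsub (Metric.sphere_subset_closedBall hq)))
      refine this.trans (le_of_eq ?_)
      rw [hD]; field_simp
  have h0m : (0 : ℂ) ∈ Metric.ball (0 : ℂ) (r / 2) := Metric.mem_ball_self (by linarith)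
  have him : ‖Complex.I * (t.im : ℂ)‖ ≤ ‖t‖ := by
    simpa using Complex.abs_im_le_norm t
  have hIm : Complex.I * (t.im : ℂ) ∈ Metric.ball (0 : ℂ) (r / 2) := by
    rw [mem_ball_zero_iff]; exact him.trans_lt htr
  have htm : t ∈ Metric.ball (0 : ℂ) (r / 2) := by rwa [mem_ball_zero_iff]
  have h1 := hlip _ h0m _ hIm
  have h2 := hlip _ hIm _ htm
  rw [sub_zero] at h1
  have e : t - Complex.I * (t.im : ℂ) = (t.re : ℂ) := by
    apply Complex.ext <;> simp
  rw [e, Complex.norm_real, Real.norm_of_nonneg ht2] at h2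
  have hrl : (b (Complex.I * (t.im : ℂ))).im = 0 := hreal _ (by
    rw [mem_ball_zero_iff] at hIm; simp at hIm; linarith)
  have h3 : a * N - D * ‖t‖ ≤ (b (Complex.I * (t.im : ℂ))).re := by
    have h4 := (Complex.abs_re_le_norm (b (Complex.I * (t.im : ℂ)) - b 0)).trans h1
    rw [Complex.sub_re] at h4
    have := (abs_le.1 h4).1
    have h5 : D * ‖Complex.I * (t.im : ℂ)‖ ≤ D * ‖t‖ := mul_le_mul_of_nonneg_left him hD0
    linarith
  have h4 : (t * b t).re = t.re * (b (Complex.I * (t.im : ℂ))).re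
      + (t * (b t - b (Complex.I * (t.im : ℂ)))).re := by
    rw [mul_sub, Complex.sub_re, Complex.mul_re t (b (Complex.I * _)), hrl]; ring
  have h5 : -(‖t‖ * (D * t.re)) ≤ (t * (b t - b (Complex.I * (t.im : ℂ)))).re := by
    have := (Complex.abs_re_le_norm (t * (b t - b (Complex.I * (t.im : ℂ))))).trans
      ((norm_mul_le _ _).trans (mul_le_mul_of_nonneg_left h2 (norm_nonneg t)))
    exact (abs_le.1 this).1
  have h6 : 2 * (D * ‖t‖) ≤ a * N := by
    have : ‖t‖ * (8 * K) ≤ a * r := ((lt_div_iff₀ (by positivity)).1 hta).le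
    rw [hD]
    have e2 : 2 * (4 * K * N / r * ‖t‖) = N * (‖t‖ * (8 * K)) / r := by ring
    rw [e2, div_le_iff₀ hr]
    nlinarith
  have h7 := mul_le_mul_of_nonneg_left h3 ht2
  rw [h4]
  nlinarith

end Positivity

end

end HeatDeformation

namespace HeatDeformation

noncomputable section

variable {ν n : ℕ}

section HolMat

/-! ### Bounded holomorphic matrix-valued functions -/

/-- A globally measurable matrix-valued function that is holomorphic and entrywise bounded on the
disc of radius `r`, and real on the imaginary axis. -/
structure HolMat (r K : ℝ) (M : ℂ → Matrix (Fin ν) (Fin ν) ℂ) : Prop where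
  diff : ∀ j k, DifferentiableOn ℂ (fun z => M z j k) (Metric.ball 0 r)
  bound : ∀ z ∈ Metric.ball (0 : ℂ) r, ∀ j k, ‖M z j k‖ ≤ K
  meas : ∀ j k, Measurable fun z => M z j k
  real : ∀ τ : ℝ, |τ| < r → conjMat (M (Complex.I * τ)) = M (Complex.I * τ)

theorem exists_holMat {r r₀ : ℝ} (hr : r < r₀) {M : ℂ → Matrix (Fin ν) (Fin ν) ℂ}
    (hM : ∀ j k, DifferentiableOn ℂ (fun z => M z j k) (Metric.ball 0 r₀))
    (hreal : ∀ τ : ℝ, |τ| < r₀ → conjMat (M (Complex.I * τ)) = M (Complex.I * τ)) :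
    ∃ K₀, ∀ K, K₀ ≤ K → HolMat r K ((Metric.ball 0 r).indicator M) := by
  have hb : ∀ j k, ∃ K, ∀ z ∈ Metric.closedBall (0 : ℂ) r, ‖M z j k‖ ≤ K := fun j k =>
    (isCompact_closedBall (0 : ℂ) r).exists_bound_of_continuousOn
      ((hM j k).continuousOn.mono (Metric.closedBall_subset_ball hr))
  choose K hK using hb
  refine ⟨∑ j, ∑ k, |K j k|, fun K' hK' => ⟨fun j k => ?_, fun z hz j k => ?_, fun j k => ?_,
    fun τ hτ => ?_⟩⟩
  · refine ((hM j k).mono (Metric.ball_subset_ball hr.le)).congr fun z hz => ?_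
    rw [Set.indicator_of_mem hz]
  · rw [Set.indicator_of_mem hz]
    refine (hK j k z (Metric.ball_subset_closedBall hz)).trans ((le_abs_self _).trans ?_)
    refine le_trans ?_ hK'
    calc |K j k| ≤ ∑ k, |K j k| :=
          Finset.single_le_sum (f := fun k => |K j k|) (fun k _ => abs_nonneg _)
            (Finset.mem_univ k)
      _ ≤ _ := Finset.single_le_sum (f := fun j => ∑ k, |K j k|)
            (fun j _ => Finset.sum_nonneg fun k _ => abs_nonneg _) (Finset.mem_univ j)
  · have h1 : (fun z => (Metric.ball (0 : ℂ) r).indicator M z j k)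
        = (Metric.ball (0 : ℂ) r).indicator (fun z => M z j k) := by
      funext z
      by_cases hz : z ∈ Metric.ball (0 : ℂ) r
      · rw [Set.indicator_of_mem hz, Set.indicator_of_mem hz]
      · rw [Set.indicator_of_notMem hz, Set.indicator_of_notMem hz]; rfl
    classical
    rw [h1, ← Set.piecewise_eq_indicator]
    refine ContinuousOn.measurable_piecewise ?_ continuousOn_const Metric.isOpen_ball.measurableSet
    exact (hM j k).continuousOn.mono (Metric.ball_subset_ball hr.le)
  · have hz : Complex.I * τ ∈ Metric.ball (0 : ℂ) r := by simpa using hτ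
    rw [Set.indicator_of_mem hz, hreal τ (hτ.trans hr)]

namespace HolMat

variable {r K : ℝ} {M : ℂ → Matrix (Fin ν) (Fin ν) ℂ}

theorem conj_apply (h : HolMat r K M) {τ : ℝ} (hτ : |τ| < r) (j k : Fin ν) :
    (starRingEnd ℂ) (M (Complex.I * τ) j k) = M (Complex.I * τ) j k :=
  congrFun (congrFun (h.real τ hτ) j) k

theorem norm_deriv_le (h : HolMat r K M) {z : ℂ} (hz : z ∈ Metric.ball (0 : ℂ) (r / 2))
    (j k : Fin ν) : ‖deriv (fun z => M z j k) z‖ ≤ K / (r / 4) := by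
  rw [mem_ball_zero_iff] at hz
  have hr : 0 < r := by linarith [norm_nonneg z]
  have hsub : Metric.closedBall z (r / 4) ⊆ Metric.ball 0 r := by
    intro q hq
    rw [mem_ball_zero_iff]
    rw [mem_closedBall_iff_norm] at hq
    calc ‖q‖ ≤ ‖q - z‖ + ‖z‖ := by simpa using norm_add_le (q - z) z
      _ < r := by linarith
  exact Complex.norm_deriv_le_of_forall_mem_sphere_norm_le (by positivity)
    (DifferentiableOn.diffContOnCl (by
      rw [closure_ball z (by positivity)]; exact (h.diff j k).mono hsub))
    (fun q hq => h.bound q (hsub (Metric.sphere_subset_closedBall hq)) j k)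

end HolMat

theorem mul_ofReal_mem_ball {r : ℝ} {t : ℂ} (ht : t ∈ Metric.ball (0 : ℂ) r) {s : ℝ}
    (hs : s ∈ Set.Icc (0 : ℝ) 1) : t * s ∈ Metric.ball (0 : ℂ) r := by
  rw [mem_ball_zero_iff] at ht ⊢
  rw [norm_mul, Complex.norm_real, Real.norm_of_nonneg hs.1]
  exact (mul_le_of_le_one_right (norm_nonneg _) hs.2).trans_lt ht

end HolMat

section PhaseQ

/-! ### The quadratic phase -/

variable (G W : ℂ → Matrix (Fin ν) (Fin ν) ℂ)

/-- `(1/τ) ∑_{s_j ≤ τ} s_j ᵗG(t s_j) ξ_j`. -/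
def waveVec (t : ℂ) (s : Fin n → ℝ) (ξ : Fin n → EuclideanSpace ℝ (Fin ν)) (τ : ℝ) : Fin ν → ℂ :=
  fun i => ∑ k, avg s (fun j => G (t * s j) k i * (ξ j k : ℂ)) τ

/-- The density of the quadratic phase. -/
def phaseDens (t : ℂ) (s : Fin n → ℝ) (ξ : Fin n → EuclideanSpace ℝ (Fin ν)) (τ : ℝ) : ℂ :=
  ∑ i, ∑ l, waveVec G t s ξ τ i * (W (t * τ) i l * waveVec G t s ξ τ l)

/-- The quadratic phase. -/
def phaseQ (t : ℂ) (s : Fin n → ℝ) (ξ : Fin n → EuclideanSpace ℝ (Fin ν)) : ℂ :=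
  ∫ τ in (0 : ℝ)..1, phaseDens G W t s ξ τ

variable {G W} {r K : ℝ}

theorem norm_coord_le (ξ : EuclideanSpace ℝ (Fin ν)) (k : Fin ν) : ‖((ξ k : ℝ) : ℂ)‖ ≤ ‖ξ‖ := by
  rw [Complex.norm_real]
  exact PiLp.norm_apply_le ξ k

theorem norm_waveVec_le (hG : HolMat r K G) (hK : 0 ≤ K) {t : ℂ}
    (ht : t ∈ Metric.ball (0 : ℂ) r) {s : Fin n → ℝ} (hs : ∀ j, s j ∈ Set.Icc (0 : ℝ) 1)
    (ξ : Fin n → EuclideanSpace ℝ (Fin ν)) {τ : ℝ} (hτ : 0 < τ) (i : Fin ν) :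
    ‖waveVec G t s ξ τ i‖ ≤ ν * K * ∑ j, ‖ξ j‖ := by
  have h1 : ∀ k : Fin ν, ‖avg s (fun j => G (t * s j) k i * (ξ j k : ℂ)) τ‖ ≤ K * ∑ j, ‖ξ j‖ := by
    intro k
    refine (norm_avg_le (fun j => (hs j).1) _ hτ).trans ?_
    rw [Finset.mul_sum]
    refine Finset.sum_le_sum fun j _ => ?_
    rw [norm_mul]
    exact mul_le_mul (hG.bound _ (mul_ofReal_mem_ball ht (hs j)) k i) (norm_coord_le _ _)
      (norm_nonneg _) hK
  refine (norm_sum_le _ _).trans ((Finset.sum_le_sum fun k _ => h1 k).trans (le_of_eq ?_))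
  simp [mul_assoc]

theorem norm_sum_sum_le {w : Fin ν → ℂ} {Y : ℝ} {M : Matrix (Fin ν) (Fin ν) ℂ} (hK : 0 ≤ K)
    (hM : ∀ j k, ‖M j k‖ ≤ K) (hw : ∀ i, ‖w i‖ ≤ Y) :
    ‖∑ i, ∑ l, w i * (M i l * w l)‖ ≤ ν ^ 2 * K * Y ^ 2 := by
  have h1 : ∀ i l : Fin ν, ‖w i * (M i l * w l)‖ ≤ K * Y ^ 2 := by
    intro i l
    have hY : 0 ≤ Y := (norm_nonneg _).trans (hw i)
    rw [norm_mul, norm_mul]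
    calc ‖w i‖ * (‖M i l‖ * ‖w l‖) ≤ Y * (K * Y) :=
          mul_le_mul (hw i) (mul_le_mul (hM i l) (hw l) (norm_nonneg _) hK) (by positivity) hY
      _ = K * Y ^ 2 := by ring
  refine (norm_sum_le _ _).trans ((Finset.sum_le_sum fun i _ => (norm_sum_le _ _).trans
    (Finset.sum_le_sum fun l _ => h1 i l)).trans (le_of_eq ?_))
  simp
  ring

theorem norm_phaseDens_le (hG : HolMat r K G) (hW : HolMat r K W) (hK : 0 ≤ K) {t : ℂ}
    (ht : t ∈ Metric.ball (0 : ℂ) r) {s : Fin n → ℝ} (hs : ∀ j, s j ∈ Set.Icc (0 : ℝ) 1)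
    (ξ : Fin n → EuclideanSpace ℝ (Fin ν)) {τ : ℝ} (hτ : τ ∈ Set.Ioc (0 : ℝ) 1) :
    ‖phaseDens G W t s ξ τ‖ ≤ ν ^ 2 * K * (ν * K * ∑ j, ‖ξ j‖) ^ 2 :=
  norm_sum_sum_le hK (hW.bound _ (mul_ofReal_mem_ball ht ⟨hτ.1.le, hτ.2⟩))
    (norm_waveVec_le hG hK ht hs ξ hτ.1)

theorem norm_phaseQ_le (hG : HolMat r K G) (hW : HolMat r K W) (hK : 0 ≤ K) {t : ℂ}
    (ht : t ∈ Metric.ball (0 : ℂ) r) {s : Fin n → ℝ} (hs : ∀ j, s j ∈ Set.Icc (0 : ℝ) 1)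
    (ξ : Fin n → EuclideanSpace ℝ (Fin ν)) :
    ‖phaseQ G W t s ξ‖ ≤ ν ^ 2 * K * (ν * K * ∑ j, ‖ξ j‖) ^ 2 := by
  have := intervalIntegral.norm_integral_le_of_norm_le_const (a := 0) (b := 1)
    (f := phaseDens G W t s ξ) (C := ν ^ 2 * K * (ν * K * ∑ j, ‖ξ j‖) ^ 2)
    (fun τ hτ => norm_phaseDens_le hG hW hK ht hs ξ (by rwa [Set.uIoc_of_le zero_le_one] at hτ))
  simpa [phaseQ] using this

theorem measurable_waveVec (hG : ∀ j k, Measurable fun z => G z j k) {α : Type*}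
    [MeasurableSpace α] {t : α → ℂ} {s : α → Fin n → ℝ}
    {ξ : α → Fin n → EuclideanSpace ℝ (Fin ν)} {τ : α → ℝ} (ht : Measurable t) (hs : Measurable s)
    (hξ : Measurable ξ) (hτ : Measurable τ) (i : Fin ν) :
    Measurable fun a => waveVec G (t a) (s a) (ξ a) (τ a) i := by
  unfold waveVec avg
  refine Finset.measurable_fun_sum _ fun k _ => Finset.measurable_fun_sum _ fun j _ => ?_
  have hsj : Measurable fun a => s a j := (measurable_pi_apply j).comp hs
  have hξj : Measurable fun a => ξ a j k :=
    ((EuclideanSpace.proj (𝕜 := ℝ) k).continuous.measurable.comp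
      (measurable_pi_apply (X := fun _ : Fin n => EuclideanSpace ℝ (Fin ν)) j)).comp hξ
  refine Measurable.ite (measurableSet_le hsj hτ) ?_ measurable_const
  exact (Complex.measurable_ofReal.comp (hsj.div hτ)).mul
    (((hG k i).comp (ht.mul (Complex.measurable_ofReal.comp hsj))).mul
      (Complex.measurable_ofReal.comp hξj))

theorem measurable_phaseDens (hG : ∀ j k, Measurable fun z => G z j k)
    (hW : ∀ j k, Measurable fun z => W z j k) {α : Type*}
    [MeasurableSpace α] {t : α → ℂ} {s : α → Fin n → ℝ}
    {ξ : α → Fin n → EuclideanSpace ℝ (Fin ν)} {τ : α → ℝ} (ht : Measurable t) (hs : Measurable s)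
    (hξ : Measurable ξ) (hτ : Measurable τ) :
    Measurable fun a => phaseDens G W (t a) (s a) (ξ a) (τ a) := by
  unfold phaseDens
  refine Finset.measurable_fun_sum _ fun i _ => Finset.measurable_fun_sum _ fun l _ => ?_
  exact (measurable_waveVec hG ht hs hξ hτ i).mul
    (((hW i l).comp (ht.mul (Complex.measurable_ofReal.comp hτ))).mul
      (measurable_waveVec hG ht hs hξ hτ l))

theorem measurable_phaseQ (hG : ∀ j k, Measurable fun z => G z j k)
    (hW : ∀ j k, Measurable fun z => W z j k) (t : ℂ) :
    Measurable fun p : (Fin n → ℝ) × (Fin n → EuclideanSpace ℝ (Fin ν)) =>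
      phaseQ G W t p.1 p.2 := by
  have h1 : StronglyMeasurable (Function.uncurry
      fun (p : (Fin n → ℝ) × (Fin n → EuclideanSpace ℝ (Fin ν))) (τ : ℝ) =>
        phaseDens G W t p.1 p.2 τ) :=
    (measurable_phaseDens (α := ((Fin n → ℝ) × (Fin n → EuclideanSpace ℝ (Fin ν))) × ℝ)
      hG hW (measurable_const (a := t)) (measurable_fst.comp measurable_fst)
      (measurable_snd.comp measurable_fst) measurable_snd).stronglyMeasurable
  have h2 := h1.integral_prod_right (ν := volume.restrict (Set.Ioc (0 : ℝ) 1))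
  simp only [phaseQ, intervalIntegral.integral_of_le (zero_le_one' ℝ)]
  exact h2.measurable

theorem differentiableOn_integral_unit {F : ℂ → ℝ → ℂ} {K : ℝ}
    (hF : ∀ τ ∈ Set.Ioc (0 : ℝ) 1, DifferentiableOn ℂ (fun t => F t τ) (Metric.ball 0 r))
    (hK : ∀ τ ∈ Set.Ioc (0 : ℝ) 1, ∀ t ∈ Metric.ball (0 : ℂ) r, ‖F t τ‖ ≤ K)
    (hm : ∀ t, Measurable (F t)) :
    DifferentiableOn ℂ (fun t => ∫ τ in (0 : ℝ)..1, F t τ) (Metric.ball 0 r) := by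
  intro t₀ ht₀
  obtain ⟨ε, hε, hsub⟩ := Metric.isOpen_iff.1 Metric.isOpen_ball t₀ ht₀
  have hsub2 : ∀ x ∈ Metric.ball t₀ (ε / 2), Metric.closedBall x (ε / 4) ⊆ Metric.ball 0 r := by
    intro x hx y hy
    refine hsub ?_
    rw [Metric.mem_ball] at hx ⊢
    rw [Metric.mem_closedBall] at hy
    linarith [dist_triangle y x t₀]
  have hder : ∀ τ ∈ Set.Ioc (0 : ℝ) 1, ∀ x ∈ Metric.ball t₀ (ε / 2),
      HasDerivAt (fun t => F t τ) (deriv (fun t => F t τ) x) x := fun τ hτ x hx =>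
    ((hF τ hτ).differentiableAt (Metric.isOpen_ball.mem_nhds
      (hsub2 x hx (Metric.mem_closedBall_self (by positivity))))).hasDerivAt
  have hbd : ∀ τ ∈ Set.Ioc (0 : ℝ) 1, ∀ x ∈ Metric.ball t₀ (ε / 2),
      ‖deriv (fun t => F t τ) x‖ ≤ K / (ε / 4) := fun τ hτ x hx =>
    Complex.norm_deriv_le_of_forall_mem_sphere_norm_le (by positivity)
      (DifferentiableOn.diffContOnCl (by
        rw [closure_ball x (by positivity)]; exact (hF τ hτ).mono (hsub2 x hx)))
      (fun q hq => hK τ hτ q (hsub2 x hx (Metric.sphere_subset_closedBall hq)))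
  have hint : IntervalIntegrable (F t₀) volume 0 1 :=
    intervalIntegrable_of_bounded (hm t₀).aestronglyMeasurable fun τ hτ => hK τ
      (by rwa [Set.uIoc_of_le zero_le_one] at hτ) t₀ ht₀
  have hdm : AEStronglyMeasurable (fun τ => deriv (fun t => F t τ) t₀)
      (volume.restrict (Set.uIoc (0 : ℝ) 1)) := by
    have := aestronglyMeasurable_fderiv (X := ℂ) (F := ℂ)
      (m := volume.restrict (Set.uIoc (0 : ℝ) 1)) (Metric.isOpen_ball (x := t₀) (ε := ε / 2))
      (J := F) (fun p _ => (hm p).aestronglyMeasurable)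
      ((ae_restrict_iff' measurableSet_uIoc).2 (Eventually.of_forall fun τ hτ x hx =>
        (hder τ (by rwa [Set.uIoc_of_le zero_le_one] at hτ) x hx).differentiableAt
          |>.differentiableWithinAt)) (Metric.mem_ball_self (by positivity : 0 < ε / 2))
    exact (ContinuousLinearMap.apply ℂ ℂ (1 : ℂ)).continuous.comp_aestronglyMeasurable this
  have := (intervalIntegral.hasDerivAt_integral_of_dominated_loc_of_deriv_le
    (F := F) (F' := fun t τ => deriv (fun t => F t τ) t) (x₀ := t₀)
    (bound := fun _ => K / (ε / 4)) (Metric.ball_mem_nhds t₀ (by positivity : 0 < ε / 2))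
    (Eventually.of_forall fun t => (hm t).aestronglyMeasurable) hint hdm
    (Eventually.of_forall fun τ hτ x hx =>
      hbd τ (by rwa [Set.uIoc_of_le zero_le_one] at hτ) x hx) (by simp)
    (Eventually.of_forall fun τ hτ x hx =>
      hder τ (by rwa [Set.uIoc_of_le zero_le_one] at hτ) x hx)).2
  exact this.differentiableAt.differentiableWithinAt

theorem HolMat.differentiableOn_comp_mul (hG : HolMat r K G) {s : ℝ}
    (hs : s ∈ Set.Icc (0 : ℝ) 1) (j k : Fin ν) :
    DifferentiableOn ℂ (fun t => G (t * s) j k) (Metric.ball 0 r) :=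
  (hG.diff j k).comp (differentiableOn_id.mul_const _) fun _ ht => mul_ofReal_mem_ball ht hs

theorem differentiableOn_waveVec (hG : HolMat r K G) {s : Fin n → ℝ}
    (hs : ∀ j, s j ∈ Set.Icc (0 : ℝ) 1) (ξ : Fin n → EuclideanSpace ℝ (Fin ν)) (τ : ℝ)
    (i : Fin ν) : DifferentiableOn ℂ (fun t => waveVec G t s ξ τ i) (Metric.ball 0 r) := by
  unfold waveVec avg
  refine DifferentiableOn.fun_sum fun k _ => DifferentiableOn.fun_sum fun j _ => ?_
  split_ifs
  · exact ((hG.differentiableOn_comp_mul (hs j) k i).mul_const _).const_mul _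
  · exact differentiableOn_const _

theorem differentiableOn_phaseDens (hG : HolMat r K G) (hW : HolMat r K W) {s : Fin n → ℝ}
    (hs : ∀ j, s j ∈ Set.Icc (0 : ℝ) 1) (ξ : Fin n → EuclideanSpace ℝ (Fin ν)) {τ : ℝ}
    (hτ : τ ∈ Set.Icc (0 : ℝ) 1) :
    DifferentiableOn ℂ (fun t => phaseDens G W t s ξ τ) (Metric.ball 0 r) := by
  unfold phaseDens
  exact DifferentiableOn.fun_sum fun i _ => DifferentiableOn.fun_sum fun l _ =>
    (differentiableOn_waveVec hG hs ξ τ i).mul ((hW.differentiableOn_comp_mul hτ i l).mul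
      (differentiableOn_waveVec hG hs ξ τ l))

theorem differentiableOn_phaseQ (hG : HolMat r K G) (hW : HolMat r K W) (hK : 0 ≤ K)
    {s : Fin n → ℝ} (hs : ∀ j, s j ∈ Set.Icc (0 : ℝ) 1)
    (ξ : Fin n → EuclideanSpace ℝ (Fin ν)) :
    DifferentiableOn ℂ (fun t => phaseQ G W t s ξ) (Metric.ball 0 r) :=
  differentiableOn_integral_unit
    (fun _ hτ => differentiableOn_phaseDens hG hW hs ξ ⟨hτ.1.le, hτ.2⟩)
    (fun _ hτ _ ht => norm_phaseDens_le hG hW hK ht hs ξ hτ)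
    (fun _ => measurable_phaseDens hG.meas hW.meas measurable_const measurable_const
      measurable_const measurable_id)

theorem conj_waveVec (hG : HolMat r K G) {τ : ℝ} (hτ : |τ| < r) {s : Fin n → ℝ}
    (hs : ∀ j, s j ∈ Set.Icc (0 : ℝ) 1) (ξ : Fin n → EuclideanSpace ℝ (Fin ν)) (σ : ℝ)
    (i : Fin ν) : (starRingEnd ℂ) (waveVec G (Complex.I * τ) s ξ σ i)
      = waveVec G (Complex.I * τ) s ξ σ i := by
  unfold waveVec avg
  simp only [map_sum]
  refine Finset.sum_congr rfl fun k _ => Finset.sum_congr rfl fun j _ => ?_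
  split_ifs
  · have h1 : |τ * s j| < r := by
      rw [abs_mul, abs_of_nonneg (hs j).1]
      exact (mul_le_of_le_one_right (abs_nonneg _) (hs j).2).trans_lt hτ
    have h2 := hG.conj_apply h1 k i
    rw [Complex.ofReal_mul, ← mul_assoc] at h2
    rw [map_mul, map_mul, h2, Complex.conj_ofReal, Complex.conj_ofReal]
  · simp

theorem im_phaseQ (hG : HolMat r K G) (hW : HolMat r K W) {τ : ℝ} (hτ : |τ| < r) {s : Fin n → ℝ}
    (hs : ∀ j, s j ∈ Set.Icc (0 : ℝ) 1) (ξ : Fin n → EuclideanSpace ℝ (Fin ν)) :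
    (phaseQ G W (Complex.I * τ) s ξ).im = 0 := by
  rw [← Complex.conj_eq_iff_im, phaseQ, intervalIntegral.integral_of_le zero_le_one,
    ← integral_conj]
  refine setIntegral_congr_fun measurableSet_Ioc fun σ hσ => ?_
  unfold phaseDens
  simp only [map_sum]
  refine Finset.sum_congr rfl fun i _ => Finset.sum_congr rfl fun l _ => ?_
  have h1 : |τ * σ| < r := by
    rw [abs_mul, abs_of_nonneg hσ.1.le]
    exact (mul_le_of_le_one_right (abs_nonneg _) hσ.2).trans_lt hτ
  have h2 := hW.conj_apply h1 i l
  rw [Complex.ofReal_mul, ← mul_assoc] at h2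
  rw [map_mul, map_mul, h2, conj_waveVec hG hτ hs, conj_waveVec hG hτ hs]

end PhaseQ

end

end HeatDeformation

namespace HeatDeformation

noncomputable section

variable {ν n : ℕ} {G W : ℂ → Matrix (Fin ν) (Fin ν) ℂ} {r K : ℝ}

section PhasePositivity

/-! ### Positivity of the quadratic phase -/

theorem intervalIntegrable_fun_sum {F ι : Type*} [NormedAddCommGroup F] {S : Finset ι}
    {f : ι → ℝ → F} {a b : ℝ} (h : ∀ i ∈ S, IntervalIntegrable (f i) volume a b) :
    IntervalIntegrable (fun τ => ∑ i ∈ S, f i τ) volume a b := by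
  have := IntervalIntegrable.sum S h
  rwa [Finset.sum_fn] at this

/-- The squared `L²` norm of the averages of the point masses. -/
def massSq (s : Fin n → ℝ) (ξ : Fin n → EuclideanSpace ℝ (Fin ν)) : ℝ :=
  ∑ k, ∫ τ in (0 : ℝ)..1, ‖avg s (fun j => (ξ j k : ℂ)) τ‖ ^ 2

theorem massSq_nonneg (s : Fin n → ℝ) (ξ : Fin n → EuclideanSpace ℝ (Fin ν)) :
    0 ≤ massSq s ξ :=
  Finset.sum_nonneg fun _ _ => intervalIntegral.integral_nonneg zero_le_one fun _ _ => sq_nonneg _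

theorem intervalIntegrable_avg_sq {s : Fin n → ℝ} (hs : ∀ j, 0 < s j) (x : Fin n → ℂ) :
    IntervalIntegrable (fun τ => ‖avg s x τ‖ ^ 2) volume 0 1 := by
  refine intervalIntegrable_of_bounded (K := (∑ j, ‖x j‖) ^ 2)
    ((measurable_avg s x).norm.pow_const 2).aestronglyMeasurable fun τ hτ => ?_
  rw [Set.uIoc_of_le zero_le_one] at hτ
  rw [norm_pow, norm_norm]
  exact pow_le_pow_left₀ (norm_nonneg _) (norm_avg_le (fun j => (hs j).le) x hτ.1) 2

theorem norm_waveVec_le_avg (hG : HolMat r K G) {t : ℂ} (ht : t ∈ Metric.ball (0 : ℂ) (r / 2))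
    {s : Fin n → ℝ} (hs : ∀ j, s j ∈ Set.Ioc (0 : ℝ) 1)
    (ξ : Fin n → EuclideanSpace ℝ (Fin ν)) {τ : ℝ} (hτ : τ ∈ Set.Ioc (0 : ℝ) 1) (i : Fin ν) :
    ‖waveVec G t s ξ τ i‖ ≤ 2 * K * ∑ k, (‖avg s (fun j => (ξ j k : ℂ)) τ‖
      + ∫ σ in (0 : ℝ)..1, ‖avg s (fun j => (ξ j k : ℂ)) σ‖) := by
  have hr : 0 < r := by
    rw [mem_ball_zero_iff] at ht; linarith [norm_nonneg t]
  have hsub : Metric.ball (0 : ℂ) (r / 2) ⊆ Metric.ball 0 r :=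
    Metric.ball_subset_ball (by linarith)
  have hK : 0 ≤ K := (norm_nonneg _).trans (hG.bound 0 (Metric.mem_ball_self hr) i i)
  rw [Finset.mul_sum]
  refine (norm_sum_le _ _).trans (Finset.sum_le_sum fun k _ => ?_)
  have hd : ∀ z ∈ Metric.ball (0 : ℂ) r, DifferentiableAt ℂ (fun z => G z k i) z := fun z hz =>
    (hG.diff k i).differentiableAt (Metric.isOpen_ball.mem_nhds hz)
  have hcd : ContinuousOn (deriv fun z => G z k i) (Metric.ball 0 r) :=
    ((hG.diff k i).contDiffOn (n := 1) Metric.isOpen_ball).continuousOn_deriv_of_isOpen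
      Metric.isOpen_ball le_rfl
  refine norm_avg_mul_le (g := fun σ => G (t * σ) k i)
    (g' := fun σ => t * deriv (fun z => G z k i) (t * σ)) (fun j => (hs j).1) (fun σ hσ => ?_)
    ?_ (fun σ hσ => ?_) (fun σ hσ => ?_) _ hτ
  · have h1 : HasDerivAt (fun σ : ℝ => t * (σ : ℂ)) t σ := by
      simpa using (Complex.ofRealCLM.hasDerivAt (x := σ)).const_mul t
    exact ((hd _ (hsub (mul_ofReal_mem_ball ht hσ))).hasDerivAt.scomp σ h1)
  · refine continuousOn_const.mul (hcd.comp (by fun_prop) fun σ hσ =>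
      hsub (mul_ofReal_mem_ball ht hσ))
  · exact (hG.bound _ (hsub (mul_ofReal_mem_ball ht hσ)) k i).trans (by linarith)
  · rw [norm_mul]
    have h1 := hG.norm_deriv_le (mul_ofReal_mem_ball ht hσ) k i
    rw [mem_ball_zero_iff] at ht
    calc ‖t‖ * ‖deriv (fun z => G z k i) (t * σ)‖ ≤ (r / 2) * (K / (r / 4)) :=
          mul_le_mul ht.le h1 (norm_nonneg _) (by positivity)
      _ = 2 * K := by field_simp; ring

theorem norm_phaseQ_le_massSq (hG : HolMat r K G) (hW : HolMat r K W) (hK : 0 ≤ K) {t : ℂ}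
    (ht : t ∈ Metric.ball (0 : ℂ) (r / 2)) {s : Fin n → ℝ} (hs : ∀ j, s j ∈ Set.Ioc (0 : ℝ) 1)
    (ξ : Fin n → EuclideanSpace ℝ (Fin ν)) :
    ‖phaseQ G W t s ξ‖ ≤ (16 * ν ^ 3 * K ^ 3 + 1) * massSq s ξ := by
  set u : Fin ν → ℝ → ℝ := fun k τ => ‖avg s (fun j => (ξ j k : ℂ)) τ‖ with hu
  set J : Fin ν → ℝ := fun k => ∫ σ in (0 : ℝ)..1, u k σ with hJ
  have hs0 : ∀ j, 0 < s j := fun j => (hs j).1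
  have hr : 0 < r := by
    rw [mem_ball_zero_iff] at ht; linarith [norm_nonneg t]
  have hsub : Metric.ball (0 : ℂ) (r / 2) ⊆ Metric.ball 0 r :=
    Metric.ball_subset_ball (by linarith)
  have h1 : ∀ τ ∈ Set.Ioc (0 : ℝ) 1, ‖phaseDens G W t s ξ τ‖
      ≤ 8 * ν ^ 3 * K ^ 3 * ∑ k, (u k τ ^ 2 + J k ^ 2) := by
    intro τ hτ
    refine (norm_sum_sum_le hK (hW.bound _ (hsub (mul_ofReal_mem_ball ht ⟨hτ.1.le, hτ.2⟩)))
      (norm_waveVec_le_avg hG ht hs ξ hτ)).trans ?_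
    have h2 : (∑ k, (u k τ + J k)) ^ 2 ≤ ν * ∑ k, 2 * (u k τ ^ 2 + J k ^ 2) := by
      refine (sq_sum_le_card_mul_sum_sq (s := Finset.univ)).trans ?_
      rw [Finset.card_univ, Fintype.card_fin]
      refine mul_le_mul_of_nonneg_left (Finset.sum_le_sum fun k _ => ?_) (Nat.cast_nonneg _)
      nlinarith [sq_nonneg (u k τ - J k)]
    rw [← Finset.mul_sum] at h2
    calc (ν : ℝ) ^ 2 * K * (2 * K * ∑ k, (u k τ + J k)) ^ 2
        = 4 * ν ^ 2 * K ^ 3 * (∑ k, (u k τ + J k)) ^ 2 := by ring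
      _ ≤ 4 * ν ^ 2 * K ^ 3 * (ν * (2 * ∑ k, (u k τ ^ 2 + J k ^ 2))) :=
          mul_le_mul_of_nonneg_left h2 (by positivity)
      _ = _ := by ring
  have hint : IntervalIntegrable (fun τ => 8 * ν ^ 3 * K ^ 3 * ∑ k, (u k τ ^ 2 + J k ^ 2))
      volume 0 1 := by
    refine IntervalIntegrable.const_mul (intervalIntegrable_fun_sum fun k _ => ?_) _
    exact (intervalIntegrable_avg_sq hs0 _).add (by simp)
  have h3 := intervalIntegral.norm_integral_le_of_norm_le zero_le_one
    (Eventually.of_forall h1) hint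
  rw [phaseQ]
  refine h3.trans ?_
  rw [intervalIntegral.integral_const_mul, intervalIntegral.integral_finsetSum
    fun k _ => (intervalIntegrable_avg_sq hs0 _).add (by simp)]
  have h4 : ∀ k, (∫ τ in (0 : ℝ)..1, (u k τ ^ 2 + J k ^ 2))
      ≤ 2 * ∫ τ in (0 : ℝ)..1, u k τ ^ 2 := by
    intro k
    rw [intervalIntegral.integral_add (intervalIntegrable_avg_sq hs0 _) (by simp)]
    have := sq_integral_le (intervalIntegrable_avg hs0 (fun j => (ξ j k : ℂ)) le_rfl
      zero_le_one).norm (intervalIntegrable_avg_sq hs0 _)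
    simp only [intervalIntegral.integral_const, sub_zero, one_smul]
    have h5 : J k ^ 2 ≤ ∫ τ in (0 : ℝ)..1, u k τ ^ 2 := this
    linarith
  calc 8 * ν ^ 3 * K ^ 3 * ∑ k, ∫ τ in (0 : ℝ)..1, (u k τ ^ 2 + J k ^ 2)
      ≤ 8 * ν ^ 3 * K ^ 3 * ∑ k, 2 * ∫ τ in (0 : ℝ)..1, u k τ ^ 2 :=
        mul_le_mul_of_nonneg_left (Finset.sum_le_sum fun k _ => h4 k) (by positivity)
    _ = 16 * ν ^ 3 * K ^ 3 * massSq s ξ := by rw [← Finset.mul_sum, massSq]; ring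
    _ ≤ _ := by nlinarith [massSq_nonneg s ξ]

theorem massSq_le_re_phaseQ (hG0 : G 0 = 1) {a : ℝ}
    (ha : ∀ x : Fin ν → ℝ, a * ∑ k, x k ^ 2 ≤ (∑ i, ∑ l, (x i : ℂ) * (W 0 i l * (x l : ℂ))).re)
    {s : Fin n → ℝ} (hs : ∀ j, s j ∈ Set.Ioc (0 : ℝ) 1)
    (ξ : Fin n → EuclideanSpace ℝ (Fin ν)) : a * massSq s ξ ≤ (phaseQ G W 0 s ξ).re := by
  have hs0 : ∀ j, 0 < s j := fun j => (hs j).1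
  have hw : ∀ τ i, waveVec G 0 s ξ τ i = avg s (fun j => (ξ j i : ℂ)) τ := by
    intro τ i
    unfold waveVec
    rw [Finset.sum_eq_single i]
    · simp [hG0]
    · intro k _ hk
      simp [hG0, Matrix.one_apply_ne hk, avg]
    · simp
  have hdens : ∀ τ, phaseDens G W 0 s ξ τ = ∑ i, ∑ l, avg s (fun j => (ξ j i : ℂ)) τ
      * (W 0 i l * avg s (fun j => (ξ j l : ℂ)) τ) := by
    intro τ
    unfold phaseDens
    simp only [hw, zero_mul]
  have hle : ∀ τ, a * ∑ k, ‖avg s (fun j => (ξ j k : ℂ)) τ‖ ^ 2 ≤ (phaseDens G W 0 s ξ τ).re := by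
    intro τ
    have := ha fun k => ∑ j, if s j ≤ τ then s j / τ * ξ j k else 0
    simp only [← avg_ofReal] at this
    rw [hdens]
    refine le_trans (le_of_eq ?_) this
    congr 1
    refine Finset.sum_congr rfl fun k _ => ?_
    rw [avg_ofReal, Complex.norm_real, Real.norm_eq_abs, sq_abs]
  have hint : IntervalIntegrable (phaseDens G W 0 s ξ) volume 0 1 := by
    have : phaseDens G W 0 s ξ = fun τ => ∑ i, ∑ l, W 0 i l *
        (avg s (fun j => (ξ j i : ℂ)) τ * avg s (fun j => (ξ j l : ℂ)) τ) := by
      funext τ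
      rw [hdens]
      exact Finset.sum_congr rfl fun i _ => Finset.sum_congr rfl fun l _ => by ring
    rw [this]
    refine intervalIntegrable_fun_sum fun i _ => intervalIntegrable_fun_sum fun l _ => ?_
    refine IntervalIntegrable.const_mul ?_ _
    refine intervalIntegrable_of_bounded (K := (∑ j, ‖(ξ j i : ℂ)‖) * ∑ j, ‖(ξ j l : ℂ)‖)
      ((measurable_avg _ _).mul (measurable_avg _ _)).aestronglyMeasurable fun τ hτ => ?_
    rw [Set.uIoc_of_le zero_le_one] at hτ
    rw [norm_mul]
    exact mul_le_mul (norm_avg_le (fun j => (hs0 j).le) _ hτ.1)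
      (norm_avg_le (fun j => (hs0 j).le) _ hτ.1) (norm_nonneg _)
      (Finset.sum_nonneg fun _ _ => norm_nonneg _)
  have hre : (phaseQ G W 0 s ξ).re = ∫ τ in (0 : ℝ)..1, (phaseDens G W 0 s ξ τ).re :=
    (Complex.reCLM.intervalIntegral_comp_comm hint).symm
  rw [hre, massSq, ← intervalIntegral.integral_finsetSum
    fun k _ => intervalIntegrable_avg_sq hs0 _, ← intervalIntegral.integral_const_mul]
  exact intervalIntegral.integral_mono_on zero_le_one
    ((intervalIntegrable_fun_sum fun k _ => intervalIntegrable_avg_sq hs0 _).const_mul _)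
    ((intervalIntegrable_iff_integrableOn_Ioc_of_le zero_le_one).2
      (Complex.reCLM.integrable_comp hint.1)) (fun τ _ => hle τ)

end PhasePositivity

end

end HeatDeformation

namespace HeatDeformation

noncomputable section

variable {ν n : ℕ} {A B C : ℂ → Matrix (Fin ν) (Fin ν) ℂ} {G W V H U' V' : ℂ → Matrix (Fin ν) (Fin ν) ℂ}
  {r K : ℝ}

section Phase

/-! ### The data entering the deformation series -/

theorem exists_coercive {A₀ : Matrix (Fin ν) (Fin ν) ℝ} (h : A₀.PosDef) :
    ∃ a > 0, ∀ x : Fin ν → ℝ, a * ∑ k, x k ^ 2 ≤ ∑ i, ∑ l, x i * (A₀ i l * x l) := by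
  set q : EuclideanSpace ℝ (Fin ν) → ℝ := fun x => ∑ i, ∑ l, x i * (A₀ i l * x l) with hq
  have hqc : Continuous q := by fun_prop
  have hpos : ∀ x : EuclideanSpace ℝ (Fin ν), x ≠ 0 → 0 < q x := by
    intro x hx
    have := h.dotProduct_mulVec_pos (x := x.ofLp) (by simpa using hx)
    simpa [dotProduct, Matrix.mulVec, Finset.mul_sum, q] using this
  have hhom : ∀ (c : ℝ) (x : EuclideanSpace ℝ (Fin ν)), q (c • x) = c ^ 2 * q x := by
    intro c x
    simp only [q, PiLp.smul_apply, smul_eq_mul, Finset.mul_sum]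
    exact Finset.sum_congr rfl fun i _ => Finset.sum_congr rfl fun l _ => by ring
  have hmin : ∃ a > 0, ∀ x ∈ Metric.sphere (0 : EuclideanSpace ℝ (Fin ν)) 1, a ≤ q x := by
    rcases (Metric.sphere (0 : EuclideanSpace ℝ (Fin ν)) 1).eq_empty_or_nonempty with he | hne
    · exact ⟨1, one_pos, by simp [he]⟩
    · obtain ⟨x₀, hx₀, hmin⟩ := (isCompact_sphere (0 : EuclideanSpace ℝ (Fin ν)) 1).exists_isMinOn
        hne hqc.continuousOn
      exact ⟨q x₀, hpos x₀ (by rintro rfl; simp at hx₀), fun x hx => hmin hx⟩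
  obtain ⟨a, ha, hmin⟩ := hmin
  refine ⟨a, ha, fun x => ?_⟩
  set y : EuclideanSpace ℝ (Fin ν) := WithLp.toLp 2 x with hy
  have hn : ∑ k, x k ^ 2 = ‖y‖ ^ 2 := by
    rw [EuclideanSpace.norm_sq_eq]; simp [hy]
  change _ ≤ q y
  rw [hn]
  rcases eq_or_ne y 0 with h0 | h0
  · simp [h0, q]
  · have h1 := hmin (‖y‖⁻¹ • y) (by
      rw [mem_sphere_zero_iff_norm, norm_smul, norm_inv, norm_norm,
        inv_mul_cancel₀ (norm_ne_zero_iff.2 h0)])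
    rw [hhom, inv_pow, ← div_eq_inv_mul, le_div_iff₀ (by positivity)] at h1
    exact h1

/-- On the disc of radius `r`, the boundary value problems are solved by bounded holomorphic
matrix-valued functions with the listed properties: `G`, `V` are as in `Flow`, `H = G⁻¹` and
`W = G⁻¹ A ᵗG⁻¹`. -/
structure Phase (A B C : ℂ → Matrix (Fin ν) (Fin ν) ℂ) (r K : ℝ)
    (G W V H : ℂ → Matrix (Fin ν) (Fin ν) ℂ) : Prop where
  pos : 0 < r
  nonneg : 0 ≤ K
  holG : HolMat r K G
  holW : HolMat r K W
  holV : HolMat r K V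
  holH : HolMat r K H
  G_zero : G 0 = 1
  mul_GH : ∀ z ∈ Metric.ball (0 : ℂ) r, G z * H z = 1
  W_eq : ∀ z ∈ Metric.ball (0 : ℂ) r, W z = H z * A z * (H z).transpose
  qFlat_eq : ∀ t ∈ Metric.ball (0 : ℂ) r, ∀ s ∈ Set.Icc (0 : ℝ) 1,
    qFlat A B C t s = (s : ℂ) • (G (t * s) * H t)
  qSharp_eq : ∀ t ∈ Metric.ball (0 : ℂ) r, ∀ s ∈ Set.Icc (0 : ℝ) 1,
    qSharp A B C t s = V (t * s) - (s : ℂ) • (G (t * s) * H t * V t)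
  solvable : ∀ t ∈ Metric.ball (0 : ℂ) r, ∀ q₀ q₁, BVPUniquelySolvable A B C t q₀ q₁
  coercive : ∃ a > 0, ∀ x : Fin ν → ℝ,
    a * ∑ k, x k ^ 2 ≤ (∑ i, ∑ l, (x i : ℂ) * (W 0 i l * (x l : ℂ))).re

open scoped Matrix.Norms.Operator in
theorem differentiableOn_entry {M : ℂ → Matrix (Fin ν) (Fin ν) ℂ}
    (h : DifferentiableOn ℂ M (Metric.ball 0 r)) (j k : Fin ν) :
    DifferentiableOn ℂ (fun z => M z j k) (Metric.ball 0 r) := fun z hz =>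
  ((entryCL j k).differentiableAt.comp_differentiableWithinAt z (h z hz))

open scoped Matrix.Norms.Operator in
theorem Flow.exists_phase (h : Flow A B C r G U' V V')
    (hA0 : ∃ A₀ : Matrix (Fin ν) (Fin ν) ℝ, A₀.PosDef ∧ A 0 = A₀.map Complex.ofReal) :
    ∃ r' K G' W' V₁ H', 0 < r' ∧ r' < r ∧ (∀ z ∈ Metric.ball (0 : ℂ) r', G' z = G z) ∧
      (∀ z ∈ Metric.ball (0 : ℂ) r', V₁ z = V z) ∧ Phase A B C r' K G' W' V₁ H' := by
  have hr := h.pos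
  set r' := r / 2 with hr'
  have hlt : r' < r := by rw [hr']; linarith
  have hpos : 0 < r' := by positivity
  have hdet : ∀ z ∈ Metric.ball (0 : ℂ) r, IsUnit (G z) := h.unitG
  have dH : DifferentiableOn ℂ (fun z => (G z)⁻¹) (Metric.ball 0 r) := fun z hz =>
    (differentiableAt_inv (h.diffG.differentiableAt (Metric.isOpen_ball.mem_nhds hz))
      (hdet z hz)).differentiableWithinAt
  have dHt : DifferentiableOn ℂ (fun z => ((G z)⁻¹).transpose) (Metric.ball 0 r) := fun z hz =>
    (transposeCL (ν := ν)).differentiableAt.comp_differentiableWithinAt z (dH z hz)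
  have dW : DifferentiableOn ℂ (fun z => (G z)⁻¹ * A z * ((G z)⁻¹).transpose)
      (Metric.ball 0 r) := (dH.mul h.diffA).mul dHt
  have dV : DifferentiableOn ℂ V (Metric.ball 0 r) := fun z hz =>
    (h.hasDerivV z hz).differentiableAt.differentiableWithinAt
  have rH : ∀ τ : ℝ, |τ| < r → conjMat (G (Complex.I * τ))⁻¹ = (G (Complex.I * τ))⁻¹ := by
    intro τ hτ
    rw [conjMat_inv (hdet _ (by simpa using hτ)), h.conj_G hτ]
  obtain ⟨K₁, h₁⟩ := exists_holMat hlt (differentiableOn_entry h.diffG) fun τ hτ => h.conj_G hτ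
  obtain ⟨K₂, h₂⟩ := exists_holMat (M := fun z => (G z)⁻¹ * A z * ((G z)⁻¹).transpose) hlt
    (differentiableOn_entry dW) fun τ hτ => by
      rw [map_mul, map_mul, conjMat_transpose, rH τ hτ, h.realA τ hτ]
  obtain ⟨K₃, h₃⟩ := exists_holMat hlt (differentiableOn_entry dV) fun τ hτ => h.conj_V hτ
  obtain ⟨K₄, h₄⟩ := exists_holMat hlt (differentiableOn_entry dH) rH
  set K := |K₁| + |K₂| + |K₃| + |K₄| with hK
  have hK₁ : K₁ ≤ K := by
    rw [hK]; linarith [le_abs_self K₁, abs_nonneg K₂, abs_nonneg K₃, abs_nonneg K₄]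
  have hK₂ : K₂ ≤ K := by
    rw [hK]; linarith [le_abs_self K₂, abs_nonneg K₁, abs_nonneg K₃, abs_nonneg K₄]
  have hK₃ : K₃ ≤ K := by
    rw [hK]; linarith [le_abs_self K₃, abs_nonneg K₂, abs_nonneg K₁, abs_nonneg K₄]
  have hK₄ : K₄ ≤ K := by
    rw [hK]; linarith [le_abs_self K₄, abs_nonneg K₂, abs_nonneg K₃, abs_nonneg K₁]
  have h0 : (0 : ℂ) ∈ Metric.ball (0 : ℂ) r' := Metric.mem_ball_self hpos
  have hsub : Metric.ball (0 : ℂ) r' ⊆ Metric.ball 0 r := Metric.ball_subset_ball hlt.le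
  refine ⟨r', K, _, _, _, _, hpos, hlt, fun z hz => Set.indicator_of_mem hz _,
    fun z hz => Set.indicator_of_mem hz _,
    { pos := hpos
      nonneg := by positivity
      holG := h₁ K hK₁
      holW := h₂ K hK₂
      holV := h₃ K hK₃
      holH := h₄ K hK₄
      G_zero := by rw [Set.indicator_of_mem h0, h.G_zero]
      mul_GH := fun z hz => by
        rw [Set.indicator_of_mem hz, Set.indicator_of_mem hz, mul_inv_self (hdet z (hsub hz))]
      W_eq := fun z hz => by rw [Set.indicator_of_mem hz, Set.indicator_of_mem hz]
      qFlat_eq := fun t ht s hs => by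
        rw [Set.indicator_of_mem ht, Set.indicator_of_mem (mul_ofReal_mem_ball ht hs),
          h.qFlat_eq (hsub ht) hs]
      qSharp_eq := fun t ht s hs => by
        rw [Set.indicator_of_mem ht, Set.indicator_of_mem ht,
          Set.indicator_of_mem (mul_ofReal_mem_ball ht hs),
          Set.indicator_of_mem (mul_ofReal_mem_ball ht hs), h.qSharp_eq (hsub ht) hs]
      solvable := fun t ht => h.bvpUniquelySolvable (hsub ht)
      coercive := ?_ }⟩
  obtain ⟨A₀, hA₀, hA⟩ := hA0
  obtain ⟨a, ha, hle⟩ := exists_coercive hA₀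
  refine ⟨a, ha, fun x => (hle x).trans (le_of_eq ?_)⟩
  rw [Set.indicator_of_mem h0, h.G_zero, hA]
  simp

namespace Phase

theorem mul_HG (h : Phase A B C r K G W V H) {z : ℂ} (hz : z ∈ Metric.ball (0 : ℂ) r) :
    H z * G z = 1 := mul_eq_one_comm.1 (h.mul_GH z hz)

theorem exists_re_nonneg (h : Phase A B C r K G W V H) :
    ∃ T > 0, T < r ∧ ∀ (n : ℕ) (s : Fin n → ℝ) (_ : ∀ j, s j ∈ Set.Ioc (0 : ℝ) 1)
      (ξ : Fin n → EuclideanSpace ℝ (Fin ν)), ∀ t ∈ halfDiscBar T,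
      0 ≤ (t * phaseQ G W t s ξ).re := by
  obtain ⟨a, ha, hco⟩ := h.coercive
  have hr := h.pos
  have hK := h.nonneg
  refine ⟨min (r / 2 / 2) (a * (r / 2) / (8 * (16 * ν ^ 3 * K ^ 3 + 1))),
    lt_min (by positivity) (by positivity), (min_le_left _ _).trans_lt (by linarith),
    fun n s hs ξ t ht => ?_⟩
  have hsub : Metric.ball (0 : ℂ) (r / 2) ⊆ Metric.ball 0 r :=
    Metric.ball_subset_ball (by linarith)
  have hs' : ∀ j, s j ∈ Set.Icc (0 : ℝ) 1 := fun j => Set.Ioc_subset_Icc_self (hs j)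
  exact re_mul_nonneg (b := fun t => phaseQ G W t s ξ) (N := massSq s ξ) (by positivity)
    (massSq_nonneg s ξ) (by positivity) ((differentiableOn_phaseQ h.holG h.holW hK hs' ξ).mono hsub)
    (fun z hz => norm_phaseQ_le_massSq h.holG h.holW hK hz hs ξ)
    (fun τ hτ => im_phaseQ h.holG h.holW (hτ.trans (by linarith)) hs' ξ)
    (massSq_le_re_phaseQ h.G_zero hco hs ξ) ht

theorem kernel_eq (h : Phase A B C r K G W V H) {t : ℂ} (ht : t ∈ Metric.ball (0 : ℂ) r)
    {s s' τ : ℝ} (hs : 0 ≤ s) (hs' : 0 ≤ s') (hsτ : s ≤ τ) (hsτ' : s' ≤ τ) (hτ : 0 < τ)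
    (hτ1 : τ ≤ 1) :
    qFlat A B C (t * τ) (s / τ) * A (t * τ) * (qFlat A B C (t * τ) (s' / τ)).transpose
      = ((s / τ : ℝ) : ℂ) • ((s' / τ : ℝ) : ℂ) • (G (t * s) * W (t * τ) * (G (t * s')).transpose) := by
  have hm : t * τ ∈ Metric.ball (0 : ℂ) r := mul_ofReal_mem_ball ht ⟨hτ.le, hτ1⟩
  have hτ0 : (τ : ℂ) ≠ 0 := by exact_mod_cast hτ.ne'
  have e : ∀ s : ℝ, t * τ * ((s / τ : ℝ) : ℂ) = t * s := fun s => by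
    push_cast; field_simp
  rw [h.qFlat_eq _ hm _ ⟨div_nonneg hs hτ.le, (div_le_one hτ).2 hsτ⟩,
    h.qFlat_eq _ hm _ ⟨div_nonneg hs' hτ.le, (div_le_one hτ).2 hsτ'⟩, e, e, h.W_eq _ hm]
  simp only [Matrix.transpose_smul, Matrix.transpose_mul, smul_mul_assoc, mul_smul_comm, mul_assoc]
  exact smul_comm _ _ _

theorem waveVec_eq (t : ℂ) (s : Fin n → ℝ) (ξ : Fin n → EuclideanSpace ℝ (Fin ν)) (τ : ℝ) :
    waveVec G t s ξ τ = ∑ j, (if s j ≤ τ then ((s j / τ : ℝ) : ℂ) else 0) •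
      (G (t * s j)).transpose.mulVec (toC (ξ j)) := by
  funext i
  unfold waveVec avg
  rw [Finset.sum_comm, Finset.sum_apply]
  refine Finset.sum_congr rfl fun j _ => ?_
  rw [Pi.smul_apply, smul_eq_mul, Matrix.mulVec, dotProduct, Finset.mul_sum]
  refine Finset.sum_congr rfl fun k _ => ?_
  split_ifs <;> simp [toC]

theorem phaseDens_eq_dotProduct (t : ℂ) (s : Fin n → ℝ) (ξ : Fin n → EuclideanSpace ℝ (Fin ν))
    (τ : ℝ) : phaseDens G W t s ξ τ
      = waveVec G t s ξ τ ⬝ᵥ (W (t * τ)).mulVec (waveVec G t s ξ τ) := by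
  simp only [phaseDens, dotProduct, Matrix.mulVec, Finset.mul_sum]

/-- The contribution of a pair of point masses to the density of the phase. -/
def _root_.HeatDeformation.pairDens (W : ℂ → Matrix (Fin ν) (Fin ν) ℂ) (t : ℂ) (s s' : ℝ)
    (u v : Fin ν → ℂ) (τ : ℝ) : ℂ :=
  if s ≤ τ ∧ s' ≤ τ then
    ((s / τ : ℝ) : ℂ) * (((s' / τ : ℝ) : ℂ) * (u ⬝ᵥ (W (t * τ)).mulVec v)) else 0

theorem phaseDens_eq (t : ℂ) (s : Fin n → ℝ) (ξ : Fin n → EuclideanSpace ℝ (Fin ν)) (τ : ℝ) :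
    phaseDens G W t s ξ τ = ∑ j, ∑ k, pairDens W t (s j) (s k)
      ((G (t * s j)).transpose.mulVec (toC (ξ j))) ((G (t * s k)).transpose.mulVec (toC (ξ k)))
      τ := by
  rw [phaseDens_eq_dotProduct, waveVec_eq]
  simp only [Matrix.mulVec_sum, Matrix.mulVec_smul, sum_dotProduct, dotProduct_sum,
    smul_dotProduct, dotProduct_smul, smul_eq_mul, Finset.mul_sum]
  rw [Finset.sum_comm]
  refine Finset.sum_congr rfl fun j _ => Finset.sum_congr rfl fun k _ => ?_
  unfold pairDens
  by_cases h1 : s j ≤ τ <;> by_cases h2 : s k ≤ τ <;> simp [h1, h2, mul_left_comm]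

theorem intervalIntegrable_pairDens (h : Phase A B C r K G W V H) {t : ℂ}
    (ht : t ∈ Metric.ball (0 : ℂ) r) {s s' : ℝ} (hs : s ∈ Set.Ioc (0 : ℝ) 1)
    (hs' : s' ∈ Set.Ioc (0 : ℝ) 1) (u v : Fin ν → ℂ) :
    IntervalIntegrable (pairDens W t s s' u v) volume 0 1 := by
  have hm : Measurable (pairDens W t s s' u v) := by
    unfold pairDens
    refine Measurable.ite (measurableSet_Ici.inter measurableSet_Ici) ?_ measurable_const
    refine Measurable.mul (by fun_prop) (Measurable.mul (by fun_prop) ?_)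
    unfold dotProduct Matrix.mulVec dotProduct
    refine Finset.measurable_fun_sum _ fun i _ => Measurable.const_mul
      (Finset.measurable_fun_sum _ fun l _ => Measurable.mul_const
        ((h.holW.meas i l).comp ?_) _) _
    fun_prop
  refine intervalIntegrable_of_bounded (K := ∑ i, ‖u i‖ * ∑ l, K * ‖v l‖) hm.aestronglyMeasurable
    fun τ hτ => ?_
  rw [Set.uIoc_of_le zero_le_one] at hτ
  have hW : ‖u ⬝ᵥ (W (t * τ)).mulVec v‖ ≤ ∑ i, ‖u i‖ * ∑ l, K * ‖v l‖ := by
    refine (norm_sum_le _ _).trans (Finset.sum_le_sum fun i _ => ?_)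
    rw [norm_mul]
    refine mul_le_mul_of_nonneg_left ?_ (norm_nonneg _)
    rw [Matrix.mulVec, dotProduct]
    refine (norm_sum_le _ _).trans (Finset.sum_le_sum fun l _ => ?_)
    rw [norm_mul]
    exact mul_le_mul_of_nonneg_right
      (h.holW.bound _ (mul_ofReal_mem_ball ht ⟨hτ.1.le, hτ.2⟩) i l) (norm_nonneg _)
  have hdiv : ∀ s : ℝ, 0 < s → s ≤ τ → ‖((s / τ : ℝ) : ℂ)‖ ≤ 1 := fun s h0 h1 => by
    rw [Complex.norm_real, Real.norm_of_nonneg (div_nonneg h0.le hτ.1.le)]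
    exact (div_le_one hτ.1).2 h1
  unfold pairDens
  split_ifs with h1
  · rw [norm_mul, norm_mul]
    exact (mul_le_of_le_one_left (by positivity) (hdiv s hs.1 h1.1)).trans
      ((mul_le_of_le_one_left (by positivity) (hdiv s' hs'.1 h1.2)).trans hW)
  · rw [norm_zero]
    exact (norm_nonneg (u ⬝ᵥ (W (t * τ)).mulVec v)).trans hW

theorem continuousOn_scaled {M : ℂ → Matrix (Fin ν) (Fin ν) ℂ} (hM : HolMat r K M) {t : ℂ}
    (ht : t ∈ Metric.ball (0 : ℂ) r) (j k : Fin ν) :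
    ContinuousOn (fun τ : ℝ => M (t * τ) j k) (Set.Icc 0 1) :=
  (hM.diff j k).continuousOn.comp (by fun_prop) fun _ hτ => mul_ofReal_mem_ball ht hτ

theorem dotProduct_propK (h : Phase A B C r K G W V H) {t : ℂ} (ht : t ∈ Metric.ball (0 : ℂ) r)
    {s s' : ℝ} (hs : s ∈ Set.Ioc (0 : ℝ) 1) (hs' : s' ∈ Set.Ioc (0 : ℝ) 1) (x y : Fin ν → ℂ) :
    x ⬝ᵥ (propK A B C t s s').mulVec y = ∫ τ in (0 : ℝ)..1, pairDens W t s s'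
      ((G (t * s)).transpose.mulVec x) ((G (t * s')).transpose.mulVec y) τ := by
  have hm0 : 0 < max s s' := lt_max_of_lt_left hs.1
  have hm1 : max s s' ≤ 1 := max_le hs.2 hs'.2
  set M : ℝ → Matrix (Fin ν) (Fin ν) ℂ := fun τ => ((s / τ : ℝ) : ℂ) • ((s' / τ : ℝ) : ℂ) •
        (G (t * s) * W (t * τ) * (G (t * s')).transpose) with hM
  have hMc : ∀ a b, IntervalIntegrable (fun τ => M τ a b) volume (max s s') 1 := by
    intro a b
    refine ContinuousOn.intervalIntegrable ?_
    rw [Set.uIcc_of_le hm1]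
    have hsub : Set.Icc (max s s') 1 ⊆ Set.Icc 0 1 := Set.Icc_subset_Icc_left hm0.le
    have h1 : ∀ σ : ℝ, ContinuousOn (fun τ : ℝ => ((σ / τ : ℝ) : ℂ))
        (Set.Icc (max s s') 1) := fun σ =>
      Complex.continuous_ofReal.comp_continuousOn
        (continuousOn_const.div continuousOn_id fun τ hτ => (hm0.trans_le hτ.1).ne')
    simp only [hM, Matrix.smul_apply, smul_eq_mul, Matrix.mul_apply]
    exact (h1 s).mul ((h1 s').mul (continuousOn_finsetSum _ fun l _ => ContinuousOn.mul
      (continuousOn_finsetSum _ fun i _ => continuousOn_const.mul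
        ((continuousOn_scaled h.holW ht i l).mono hsub)) continuousOn_const))
  have h1 : ∀ a b, propK A B C t s s' a b = ∫ τ in (max s s')..1, M τ a b := by
    intro a b
    rw [propK, Matrix.of_apply]
    refine intervalIntegral.integral_congr fun τ hτ => ?_
    rw [Set.uIcc_of_le hm1] at hτ
    have hτ0 : 0 < τ := hm0.trans_le hτ.1
    exact congrFun (congrFun (h.kernel_eq ht hs.1.le hs'.1.le ((le_max_left _ _).trans hτ.1)
      ((le_max_right _ _).trans hτ.1) hτ0 hτ.2) a) b
  have h2 : x ⬝ᵥ (propK A B C t s s').mulVec y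
      = ∫ τ in (max s s')..1, x ⬝ᵥ (M τ).mulVec y := by
    simp only [dotProduct, Matrix.mulVec, h1, Finset.mul_sum]
    rw [intervalIntegral.integral_finsetSum fun a _ => intervalIntegrable_fun_sum fun b _ =>
      ((hMc a b).mul_const _).const_mul _]
    refine Finset.sum_congr rfl fun a _ => ?_
    rw [intervalIntegral.integral_finsetSum fun b _ => ((hMc a b).mul_const _).const_mul _]
    refine Finset.sum_congr rfl fun b _ => ?_
    rw [intervalIntegral.integral_const_mul, intervalIntegral.integral_mul_const]
  rw [h2, intervalIntegral.integral_of_le hm1, intervalIntegral.integral_of_le zero_le_one,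
    ← integral_Icc_eq_integral_Ioc]
  have h3 : Set.Ioc (0 : ℝ) 1 ∩ Set.Ici (max s s') = Set.Icc (max s s') 1 := by
    ext τ
    simp only [Set.mem_inter_iff, Set.mem_Ioc, Set.mem_Ici, Set.mem_Icc]
    exact ⟨fun h => ⟨h.2, h.1.2⟩, fun h => ⟨⟨hm0.trans_le h.1, h.2⟩, h.1⟩⟩
  rw [← h3, ← setIntegral_indicator measurableSet_Ici]
  refine setIntegral_congr_fun measurableSet_Ioc fun τ _ => ?_
  unfold pairDens
  by_cases h4 : max s s' ≤ τ
  · rw [Set.indicator_of_mem (Set.mem_Ici.2 h4)]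
    refine Eq.trans ?_ (if_pos (max_le_iff.1 h4)).symm
    simp only [hM, Matrix.smul_mulVec, dotProduct_smul, smul_eq_mul, ← Matrix.mulVec_mulVec]
    rw [Matrix.dotProduct_mulVec x, Matrix.mulVec_transpose, Matrix.mulVec_transpose]
  · rw [Set.indicator_of_notMem (by simpa using h4)]
    exact (if_neg fun h5 => h4 (max_le_iff.2 h5)).symm

theorem quadForm_propK (h : Phase A B C r K G W V H) {t : ℂ} (ht : t ∈ Metric.ball (0 : ℂ) r)
    {s : Fin n → ℝ} (hs : ∀ j, s j ∈ Set.Ioc (0 : ℝ) 1)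
    (ξ : Fin n → EuclideanSpace ℝ (Fin ν)) :
    quadForm (fun j k => t • propK A B C t (s j) (s k)) ξ = t * phaseQ G W t s ξ := by
  unfold quadForm phaseQ
  simp only [Matrix.smul_mulVec, dotProduct_smul, smul_eq_mul, ← Finset.mul_sum,
    h.dotProduct_propK ht (hs _) (hs _), phaseDens_eq]
  congr 1
  rw [intervalIntegral.integral_finsetSum fun j _ => intervalIntegrable_fun_sum fun k _ =>
    h.intervalIntegrable_pairDens ht (hs j) (hs k) _ _]
  refine Finset.sum_congr rfl fun j _ => ?_
  rw [intervalIntegral.integral_finsetSum fun k _ =>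
    h.intervalIntegrable_pairDens ht (hs j) (hs k) _ _]

end Phase

end Phase

end

end HeatDeformation

namespace HeatDeformation

noncomputable section

set_option linter.unusedSectionVars false

variable {ν n : ℕ} {𝓜 : Type*} [NormedRing 𝓜] [NormedAlgebra ℂ 𝓜] [NormOneClass 𝓜]
  [FiniteDimensional ℂ 𝓜] [MeasurableSpace 𝓜] [BorelSpace 𝓜]

section Potential

/-! ### The potential as the Fourier transform of a finite measure -/

/-- The potential `c` is, for `|t| < T`, the Fourier transform of `g(t,·) m`, where `m` is a finite
measure with exponential moments and `g` is bounded by `1`, jointly measurable, and holomorphic in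
`t`. -/
structure FourierPotential (T : ℝ) (c : ℂ → (Fin ν → ℂ) → 𝓜)
    (m : Measure (EuclideanSpace ℝ (Fin ν))) (g : ℂ → EuclideanSpace ℝ (Fin ν) → 𝓜) : Prop where
  moments : ∀ R : ℝ, Integrable (fun ξ => Real.exp (R * ‖ξ‖)) m
  meas : Measurable (Function.uncurry g)
  bound : ∀ t ξ, ‖g t ξ‖ ≤ 1
  diff : ∀ ξ, DifferentiableOn ℂ (fun t => g t ξ) (Metric.ball 0 T)
  eq : ∀ t ∈ Metric.ball (0 : ℂ) T, ∀ x,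
    c t x = ∫ ξ, Complex.exp (Complex.I * cdot x ξ) • g t ξ ∂m

theorem FourierPotential.isFiniteMeasure {T : ℝ} {c : ℂ → (Fin ν → ℂ) → 𝓜}
    {m : Measure (EuclideanSpace ℝ (Fin ν))} {g : ℂ → EuclideanSpace ℝ (Fin ν) → 𝓜}
    (h : FourierPotential T c m g) : IsFiniteMeasure m := by
  have := h.moments 0
  simp only [zero_mul, Real.exp_zero] at this
  exact (integrable_const_iff_isFiniteMeasure one_ne_zero).1 this

theorem exists_fourierPotential {Tb : ℝ} (hTb : 0 < Tb)
    {f : ℂ → EuclideanSpace ℝ (Fin ν) → 𝓜}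
    (hfmeas : Measurable
      fun p : Metric.ball (0 : ℂ) Tb × EuclideanSpace ℝ (Fin ν) => f p.1 p.2)
    (hfan : ∀ ξ, AnalyticOnNhd ℂ (fun t => f t ξ) (Metric.ball 0 Tb))
    {μ : Measure (EuclideanSpace ℝ (Fin ν))}
    (hμ : ∀ R : ℝ, 0 < R →
      ∫⁻ ξ, ENNReal.ofReal (Real.exp (R * ‖ξ‖)) * ⨆ t ∈ Metric.ball (0 : ℂ) Tb, ‖f t ξ‖ₑ ∂μ < ⊤) :
    ∃ m g, FourierPotential Tb (potential μ f) m g := by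
  classical
  set N : EuclideanSpace ℝ (Fin ν) → ENNReal :=
    fun ξ => ⨆ t ∈ Metric.ball (0 : ℂ) Tb, ‖f t ξ‖ₑ with hN
  have : Nonempty (Metric.ball (0 : ℂ) Tb) := ⟨⟨0, Metric.mem_ball_self hTb⟩⟩
  have hN' : N = fun ξ => ⨆ k, ‖f (TopologicalSpace.denseSeq (Metric.ball (0 : ℂ) Tb) k) ξ‖ₑ := by
    funext ξ
    refine le_antisymm (iSup₂_le fun t ht => ?_) (iSup_le fun k => ?_)
    · have hc : Continuous fun t : Metric.ball (0 : ℂ) Tb => ‖f t ξ‖ₑ :=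
        continuous_enorm.comp ((hfan ξ).continuousOn.domRestrict)
      have := (isClosed_Iic (a := ⨆ k, ‖f (TopologicalSpace.denseSeq
        (Metric.ball (0 : ℂ) Tb) k) ξ‖ₑ)).preimage hc
      have h2 := this.closure_subset_iff (s := Set.range (TopologicalSpace.denseSeq
        (Metric.ball (0 : ℂ) Tb))) |>.2 (by
          rintro _ ⟨k, rfl⟩
          exact le_iSup (fun k => ‖f (TopologicalSpace.denseSeq
            (Metric.ball (0 : ℂ) Tb) k) ξ‖ₑ) k)
      rw [(TopologicalSpace.denseRange_denseSeq _).closure_range] at h2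
      exact h2 (Set.mem_univ ⟨t, ht⟩)
    · exact le_iSup₂ (f := fun t (_ : t ∈ Metric.ball (0 : ℂ) Tb) => ‖f t ξ‖ₑ) _
        (TopologicalSpace.denseSeq (Metric.ball (0 : ℂ) Tb) k).2
  have hNm : Measurable N := by
    rw [hN']
    exact Measurable.iSup fun k => (hfmeas.comp (measurable_const.prodMk measurable_id)).enorm
  have hmom : ∀ R : ℝ, 0 < R →
      ∫⁻ ξ, ENNReal.ofReal (Real.exp (R * ‖ξ‖)) ∂(μ.withDensity N) < ⊤ := by
    intro R hR
    rw [lintegral_withDensity_eq_lintegral_mul μ hNm (by fun_prop)]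
    simpa only [Pi.mul_apply, mul_comm] using hμ R hR
  have hNfin : ∀ᵐ ξ ∂μ, N ξ < ⊤ := by
    have h1 := hμ 1 one_pos
    refine ae_lt_top hNm (ne_of_lt (lt_of_le_of_lt (lintegral_mono fun ξ => ?_) h1))
    refine le_mul_of_one_le_left zero_le ?_
    rw [ENNReal.one_le_ofReal]
    exact Real.one_le_exp (by positivity)
  have hle : ∀ t ∈ Metric.ball (0 : ℂ) Tb, ∀ ξ, N ξ < ⊤ → ‖f t ξ‖ ≤ (N ξ).toReal := by
    intro t ht ξ hξ
    have h1 : ‖f t ξ‖ₑ ≤ N ξ := le_iSup₂ (f := fun t (_ : t ∈ Metric.ball (0 : ℂ) Tb) =>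
      ‖f t ξ‖ₑ) t ht
    rw [← toReal_enorm]
    exact ENNReal.toReal_mono hξ.ne h1
  set F : ℂ × EuclideanSpace ℝ (Fin ν) → 𝓜 := fun p =>
    if p.1 ∈ Metric.ball (0 : ℂ) Tb then f p.1 p.2 else 0 with hF
  have hFm : Measurable F := by
    have hS : MeasurableSet {p : ℂ × EuclideanSpace ℝ (Fin ν) | p.1 ∈ Metric.ball (0 : ℂ) Tb} :=
      measurable_fst Metric.isOpen_ball.measurableSet
    have h1 : Measurable fun p : {p : ℂ × EuclideanSpace ℝ (Fin ν) |
        p.1 ∈ Metric.ball (0 : ℂ) Tb} => f p.1.1 p.1.2 :=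
      hfmeas.comp (f := fun p : {p : ℂ × EuclideanSpace ℝ (Fin ν) |
        p.1 ∈ Metric.ball (0 : ℂ) Tb} => ((⟨p.1.1, p.2⟩ : Metric.ball (0 : ℂ) Tb), p.1.2))
        (((measurable_fst.comp measurable_subtype_coe).subtype_mk).prodMk
          (measurable_snd.comp measurable_subtype_coe))
    exact h1.dite (g := fun _ => 0) measurable_const hS
  have hgm : Measurable fun p : ℂ × EuclideanSpace ℝ (Fin ν) => ((N p.2).toReal : ℂ)⁻¹ • F p :=
    ((Complex.measurable_ofReal.comp (hNm.comp measurable_snd).ennreal_toReal).inv).smul hFm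
  refine ⟨μ.withDensity N, fun t ξ => ((N ξ).toReal : ℂ)⁻¹ • F (t, ξ), ?_, hgm, ?_, ?_, ?_⟩
  · intro R
    have h1 : Integrable (fun ξ => Real.exp ((|R| + 1) * ‖ξ‖)) (μ.withDensity N) := by
      refine ⟨by fun_prop, ?_⟩
      rw [hasFiniteIntegral_iff_ofReal (Eventually.of_forall fun _ => (Real.exp_pos _).le)]
      exact hmom _ (by positivity)
    refine h1.mono' (by fun_prop) (Eventually.of_forall fun ξ => ?_)
    rw [Real.norm_eq_abs, Real.abs_exp, Real.exp_le_exp]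
    exact mul_le_mul_of_nonneg_right (by linarith [le_abs_self R]) (norm_nonneg _)
  · intro t ξ
    simp only [hF]
    split_ifs with ht
    · rcases eq_or_ne (N ξ) ⊤ with h | h
      · simp [h]
      · rw [norm_smul, norm_inv, Complex.norm_real, Real.norm_of_nonneg ENNReal.toReal_nonneg]
        exact inv_mul_le_one_of_le₀ (hle t ht ξ h.lt_top) ENNReal.toReal_nonneg
    · simp
  · intro ξ
    refine DifferentiableOn.fun_const_smul ?_ _
    refine (hfan ξ).differentiableOn.congr fun t ht => ?_
    simp only [hF]
    rw [if_pos ht]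
  · intro t ht x
    rw [potential, integral_withDensity_eq_integral_toReal_smul hNm hNfin]
    refine integral_congr_ae ?_
    filter_upwards [hNfin] with ξ hξ
    simp only [hF]
    rw [if_pos ht, smul_comm]
    congr 1
    rcases eq_or_ne (N ξ).toReal 0 with h | h
    · have : f t ξ = 0 := norm_le_zero_iff.1 ((hle t ht ξ hξ).trans h.le)
      simp [this]
    · rw [← Complex.coe_smul, smul_smul, mul_inv_cancel₀ (by exact_mod_cast h), one_smul]

end Potential

section Peel

/-! ### Splitting off the last coordinate -/

variable {α : Type} [MeasurableSpace α]

theorem measurePreserving_snoc (ρ : Measure α) [SigmaFinite ρ] (n : ℕ) :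
    MeasurePreserving (fun p : α × (Fin n → α) => (Fin.snoc p.2 p.1 : Fin (n + 1) → α))
      (ρ.prod (Measure.pi fun _ => ρ)) (Measure.pi fun _ => ρ) := by
  have h := (measurePreserving_piFinSuccAbove (fun _ : Fin (n + 1) => ρ) (Fin.last n)).symm
  convert h using 1
  funext p
  exact (Fin.insertNth_last' p.1 p.2).symm

theorem measurableEmbedding_snoc (n : ℕ) :
    MeasurableEmbedding (fun p : α × (Fin n → α) => (Fin.snoc p.2 p.1 : Fin (n + 1) → α)) := by
  convert (MeasurableEquiv.piFinSuccAbove (fun _ : Fin (n + 1) => α)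
    (Fin.last n)).symm.measurableEmbedding using 1
  funext p
  exact (Fin.insertNth_last' p.1 p.2).symm

end Peel

section OrderedProduct

/-! ### Products of Fourier transforms -/

theorem prod_reverse_ofFn_succ {R : Type*} [Monoid R] (h : Fin (n + 1) → R) :
    (List.ofFn h).reverse.prod
      = h (Fin.last n) * (List.ofFn fun j : Fin n => h j.castSucc).reverse.prod := by
  rw [List.ofFn_succ', List.concat_eq_append, List.reverse_append]
  simp

theorem measurable_prod_reverse_ofFn {α : Type*} [MeasurableSpace α] {h : Fin n → α → 𝓜}
    (hh : ∀ j, Measurable (h j)) : Measurable fun a => (List.ofFn fun j => h j a).reverse.prod := by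
  have : ProperSpace 𝓜 := FiniteDimensional.proper ℂ 𝓜
  induction n with
  | zero => simp
  | succ n ih =>
    simp only [prod_reverse_ofFn_succ]
    exact (hh _).mul (ih fun j => hh _)

theorem norm_prod_reverse_ofFn_le {h : Fin n → 𝓜} {b : Fin n → ℝ} (hb : ∀ j, ‖h j‖ ≤ b j) :
    ‖(List.ofFn h).reverse.prod‖ ≤ ∏ j, b j := by
  induction n with
  | zero => simp
  | succ n ih =>
    rw [prod_reverse_ofFn_succ, Fin.prod_univ_castSucc, mul_comm]
    exact (norm_mul_le _ _).trans (mul_le_mul (hb _) (ih fun j => hb _) (norm_nonneg _)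
      ((norm_nonneg _).trans (hb _)))

theorem integral_prod_reverse_ofFn {α : Type} [MeasurableSpace α] (m : Measure α) [SigmaFinite m]
    {h : Fin n → α → 𝓜} (hh : ∀ j, Integrable (h j) m) :
    Integrable (fun ξ : Fin n → α => (List.ofFn fun j => h j (ξ j)).reverse.prod)
        (Measure.pi fun _ => m) ∧
      ∫ ξ, (List.ofFn fun j => h j (ξ j)).reverse.prod ∂(Measure.pi fun _ : Fin n => m)
        = (List.ofFn fun j => ∫ ξ, h j ξ ∂m).reverse.prod := by
  have : CompleteSpace 𝓜 := FiniteDimensional.complete ℂ 𝓜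
  induction n with
  | zero =>
    rw [Measure.pi_of_empty fun _ : Fin 0 => m]
    simp
  | succ n ih =>
    obtain ⟨i1, i2⟩ := ih fun j => hh j.castSucc
    have hmp := measurePreserving_snoc m n
    have hme := measurableEmbedding_snoc (α := α) n
    constructor
    · rw [← hmp.integrable_comp_emb hme]
      simp only [Function.comp_def, prod_reverse_ofFn_succ, Fin.snoc_last, Fin.snoc_castSucc]
      exact (hh _).mul_prod i1
    · rw [← hmp.integral_comp hme]
      simp only [prod_reverse_ofFn_succ, Fin.snoc_last, Fin.snoc_castSucc]
      rw [← i2]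
      exact integral_prod_bilin (ContinuousLinearMap.mul ℂ 𝓜) (hh _) i1

end OrderedProduct

end

end HeatDeformation

namespace HeatDeformation

noncomputable section

variable {ν n : ℕ}

section Simplex

/-! ### Integration over time-ordered configurations -/

/-- The configurations `(s_j, ξ_j)_j` with `0 < s_1 < ⋯ < s_n < b`. -/
def orderedSet (ν n : ℕ) (b : ℝ) : Set (Fin n → ℝ × EuclideanSpace ℝ (Fin ν)) :=
  {w | StrictMono (fun j => (w j).1) ∧ ∀ j, (w j).1 ∈ Set.Ioo 0 b}

/-- The measure `ds_1 ⋯ ds_n dm(ξ_1) ⋯ dm(ξ_n)`. -/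
def pointMeasure (m : Measure (EuclideanSpace ℝ (Fin ν))) (n : ℕ) :
    Measure (Fin n → ℝ × EuclideanSpace ℝ (Fin ν)) :=
  Measure.pi fun _ => (volume : Measure ℝ).prod m

instance (m : Measure (EuclideanSpace ℝ (Fin ν))) [SigmaFinite m] (n : ℕ) :
    SigmaFinite (pointMeasure m n) := by
  unfold pointMeasure; infer_instance

theorem measurableSet_orderedSet (b : ℝ) : MeasurableSet (orderedSet ν n b) := by
  have h1 : orderedSet ν n b = (⋂ i, ⋂ j, {w | i < j → (w i).1 < (w j).1}) ∩
      ⋂ j, {w | (w j).1 ∈ Set.Ioo 0 b} := by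
    ext w
    simp [orderedSet, StrictMono]
  rw [h1]
  have hm : ∀ j : Fin n, Measurable fun w : Fin n → ℝ × EuclideanSpace ℝ (Fin ν) => (w j).1 :=
    fun j => measurable_fst.comp (measurable_pi_apply j)
  refine (MeasurableSet.iInter fun i => MeasurableSet.iInter fun j => ?_).inter
    (MeasurableSet.iInter fun j => hm j measurableSet_Ioo)
  by_cases h : i < j
  · simpa [h] using measurableSet_lt (hm i) (hm j)
  · simp [h]

theorem snoc_mem_orderedSet {b : ℝ} {w : Fin n → ℝ × EuclideanSpace ℝ (Fin ν)}
    {q : ℝ × EuclideanSpace ℝ (Fin ν)} :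
    (Fin.snoc w q : Fin (n + 1) → ℝ × EuclideanSpace ℝ (Fin ν)) ∈ orderedSet ν (n + 1) b ↔
      q.1 ∈ Set.Ioo 0 b ∧ w ∈ orderedSet ν n q.1 := by
  constructor
  · rintro ⟨h1, h2⟩
    have hl := h2 (Fin.last n)
    simp only [Fin.snoc_last] at hl
    refine ⟨hl, fun i j hij => ?_, fun j => ⟨?_, ?_⟩⟩
    · have := h1 (Fin.castSucc_lt_castSucc_iff.2 hij)
      simpa only [Fin.snoc_castSucc] using this
    · have := (h2 j.castSucc).1
      simpa only [Fin.snoc_castSucc] using this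
    · have := h1 (Fin.castSucc_lt_last j)
      simpa only [Fin.snoc_castSucc, Fin.snoc_last] using this
  · rintro ⟨h1, h2, h3⟩
    refine ⟨fun i j hij => ?_, fun j => ?_⟩
    · induction j using Fin.lastCases with
      | last =>
        induction i using Fin.lastCases with
        | last => exact absurd hij (lt_irrefl _)
        | cast i => simpa only [Fin.snoc_castSucc, Fin.snoc_last] using (h3 i).2
      | cast j =>
        induction i using Fin.lastCases with
        | last => exact absurd (hij.trans (Fin.castSucc_lt_last j)) (lt_irrefl _)
        | cast i =>
          simpa only [Fin.snoc_castSucc] using h2 (Fin.castSucc_lt_castSucc_iff.1 hij)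
    · induction j using Fin.lastCases with
      | last => simpa only [Fin.snoc_last] using h1
      | cast j =>
        rw [Fin.snoc_castSucc]
        exact ⟨(h3 j).1, (h3 j).2.trans h1.2⟩

theorem orderedSet_mono {b b' : ℝ} (h : b ≤ b') : orderedSet ν n b ⊆ orderedSet ν n b' :=
  fun _ hw => ⟨hw.1, fun j => ⟨(hw.2 j).1, (hw.2 j).2.trans_le h⟩⟩

variable (m : Measure (EuclideanSpace ℝ (Fin ν))) [SigmaFinite m]

theorem measurePreserving_snoc_points (n : ℕ) :
    MeasurePreserving (fun p : (ℝ × EuclideanSpace ℝ (Fin ν)) ×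
        (Fin n → ℝ × EuclideanSpace ℝ (Fin ν)) =>
          (Fin.snoc p.2 p.1 : Fin (n + 1) → ℝ × EuclideanSpace ℝ (Fin ν)))
      (((volume : Measure ℝ).prod m).prod (pointMeasure m n)) (pointMeasure m (n + 1)) :=
  measurePreserving_snoc _ n

/-- Splitting off the last time and frequency, for non-negative functions. -/
theorem lintegral_orderedSet_succ {b : ℝ}
    {f : (Fin (n + 1) → ℝ × EuclideanSpace ℝ (Fin ν)) → ENNReal} (hf : Measurable f) :
    ∫⁻ w in orderedSet ν (n + 1) b, f w ∂pointMeasure m (n + 1)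
      = ∫⁻ r in Set.Ioo 0 b, ∫⁻ η, ∫⁻ w in orderedSet ν n r, f (Fin.snoc w (r, η))
          ∂pointMeasure m n ∂m := by
  have hsm := (measurableEmbedding_snoc (α := ℝ × EuclideanSpace ℝ (Fin ν)) n)
  have hg : Measurable ((orderedSet ν (n + 1) b).indicator f) :=
    hf.indicator (measurableSet_orderedSet b)
  have hg' : Measurable fun p : (ℝ × EuclideanSpace ℝ (Fin ν)) ×
      (Fin n → ℝ × EuclideanSpace ℝ (Fin ν)) =>
        (orderedSet ν (n + 1) b).indicator f (Fin.snoc p.2 p.1) := hg.comp hsm.measurable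
  rw [← lintegral_indicator (measurableSet_orderedSet b),
    ← (measurePreserving_snoc_points m n).lintegral_comp_emb hsm,
    lintegral_prod _ hg'.aemeasurable,
    lintegral_prod _ hg'.lintegral_prod_right'.aemeasurable,
    ← lintegral_indicator measurableSet_Ioo]
  refine lintegral_congr fun r => ?_
  by_cases hr : r ∈ Set.Ioo 0 b
  · rw [Set.indicator_of_mem hr]
    refine lintegral_congr fun η => ?_
    rw [← lintegral_indicator (measurableSet_orderedSet r)]
    refine lintegral_congr fun w => ?_
    by_cases hw : w ∈ orderedSet ν n r
    · rw [Set.indicator_of_mem hw, Set.indicator_of_mem (snoc_mem_orderedSet.2 ⟨hr, hw⟩)]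
    · rw [Set.indicator_of_notMem hw,
        Set.indicator_of_notMem fun h => hw (snoc_mem_orderedSet.1 h).2]
  · rw [Set.indicator_of_notMem hr]
    refine (lintegral_congr fun η => lintegral_congr fun w => Set.indicator_of_notMem
      (fun h => hr (snoc_mem_orderedSet.1 h).1) _).trans ?_
    simp

theorem lintegral_orderedSet_prod {φ : EuclideanSpace ℝ (Fin ν) → ENNReal} (hφ : Measurable φ)
    (n : ℕ) : ∀ {b : ℝ}, 0 ≤ b →
    ∫⁻ w in orderedSet ν n b, ∏ j, φ (w j).2 ∂pointMeasure m n
      = ENNReal.ofReal (b ^ n / n.factorial) * (∫⁻ ξ, φ ξ ∂m) ^ n := by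
  induction n with
  | zero =>
    intro b _
    have : orderedSet ν 0 b = Set.univ := by
      ext w; simp [orderedSet, Subsingleton.strictMono]
    rw [this, pointMeasure, Measure.pi_of_empty fun _ : Fin 0 => (volume : Measure ℝ).prod m]
    simp
  | succ n ih =>
    intro b hb
    have hm : Measurable fun w : Fin (n + 1) → ℝ × EuclideanSpace ℝ (Fin ν) => ∏ j, φ (w j).2 :=
      Finset.measurable_fun_prod _ fun j _ => hφ.comp (measurable_snd.comp (measurable_pi_apply j))
    rw [lintegral_orderedSet_succ m hm]
    simp only [Fin.prod_univ_castSucc, Fin.snoc_castSucc, Fin.snoc_last]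
    have h1 : ∀ r ∈ Set.Ioo (0 : ℝ) b, (∫⁻ η, ∫⁻ w in orderedSet ν n r,
        (∏ j, φ (w j).2) * φ η ∂pointMeasure m n ∂m)
        = ENNReal.ofReal (r ^ n / n.factorial) * (∫⁻ ξ, φ ξ ∂m) ^ (n + 1) := by
      intro r hr
      have h2 : Measurable fun w : Fin n → ℝ × EuclideanSpace ℝ (Fin ν) => ∏ j, φ (w j).2 :=
        Finset.measurable_fun_prod _ fun j _ =>
          hφ.comp (measurable_snd.comp (measurable_pi_apply j))
      simp only [lintegral_mul_const _ h2, ih hr.1.le]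
      rw [lintegral_const_mul _ hφ, pow_succ, mul_assoc]
    rw [setLIntegral_congr_fun measurableSet_Ioo h1, lintegral_mul_const _ (by fun_prop)]
    congr 1
    rw [← ofReal_integral_eq_lintegral_ofReal]
    · rw [← integral_Ioc_eq_integral_Ioo, ← intervalIntegral.integral_of_le hb,
        intervalIntegral.integral_div, integral_pow]
      congr 1
      rw [Nat.factorial_succ]
      push_cast
      rw [zero_pow (Nat.succ_ne_zero n)]
      field_simp
      ring
    · exact ((by fun_prop : Continuous fun r : ℝ => r ^ n / n.factorial).integrableOn_Icc
        (a := 0) (b := b)).mono_set Set.Ioo_subset_Icc_self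
    · exact (ae_restrict_iff' measurableSet_Ioo).2 (Eventually.of_forall fun r hr =>
        div_nonneg (pow_nonneg hr.1.le n) (by positivity))

/-- The exponential weights are integrable over the time-ordered configurations, with the expected
factorial gain. -/
theorem integrable_orderedSet_exp {m : Measure (EuclideanSpace ℝ (Fin ν))} [SigmaFinite m]
    (hm : ∀ R : ℝ, Integrable (fun ξ => Real.exp (R * ‖ξ‖)) m) (R : ℝ) (n : ℕ) {b : ℝ}
    (hb : 0 ≤ b) :
    Integrable (fun w : Fin n → ℝ × EuclideanSpace ℝ (Fin ν) => Real.exp (R * ∑ j, ‖(w j).2‖))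
        ((pointMeasure m n).restrict (orderedSet ν n b)) ∧
      ∫ w in orderedSet ν n b, Real.exp (R * ∑ j, ‖(w j).2‖) ∂pointMeasure m n
        = b ^ n / n.factorial * (∫ ξ, Real.exp (R * ‖ξ‖) ∂m) ^ n := by
  have h1 : ∫⁻ w in orderedSet ν n b, ENNReal.ofReal (Real.exp (R * ∑ j, ‖(w j).2‖))
      ∂pointMeasure m n
      = ENNReal.ofReal (b ^ n / n.factorial * (∫ ξ, Real.exp (R * ‖ξ‖) ∂m) ^ n) := by
    have h2 := lintegral_orderedSet_prod m
      (φ := fun ξ => ENNReal.ofReal (Real.exp (R * ‖ξ‖))) (by fun_prop) n hb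
    rw [← ofReal_integral_eq_lintegral_ofReal (hm R)
      (Eventually.of_forall fun _ => (Real.exp_pos _).le),
      ← ENNReal.ofReal_pow (integral_nonneg fun _ => (Real.exp_pos _).le),
      ← ENNReal.ofReal_mul (by positivity)] at h2
    rw [← h2]
    refine lintegral_congr fun w => ?_
    rw [← ENNReal.ofReal_prod_of_nonneg fun j _ => (Real.exp_pos _).le, ← Real.exp_sum,
      Finset.mul_sum]
  have hme : Measurable fun w : Fin n → ℝ × EuclideanSpace ℝ (Fin ν) =>
      Real.exp (R * ∑ j, ‖(w j).2‖) := by fun_prop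
  have hint : Integrable (fun w : Fin n → ℝ × EuclideanSpace ℝ (Fin ν) =>
      Real.exp (R * ∑ j, ‖(w j).2‖)) ((pointMeasure m n).restrict (orderedSet ν n b)) := by
    refine ⟨hme.aestronglyMeasurable, ?_⟩
    rw [hasFiniteIntegral_iff_ofReal (Eventually.of_forall fun _ => (Real.exp_pos _).le), h1]
    exact ENNReal.ofReal_lt_top
  refine ⟨hint, ?_⟩
  rw [integral_eq_lintegral_of_nonneg_ae (Eventually.of_forall fun _ => (Real.exp_pos _).le)
    hme.aestronglyMeasurable, h1, ENNReal.toReal_ofReal]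
  have : 0 ≤ ∫ ξ, Real.exp (R * ‖ξ‖) ∂m := integral_nonneg fun _ => (Real.exp_pos _).le
  positivity

end Simplex

end

end HeatDeformation

namespace HeatDeformation

noncomputable section

set_option linter.unusedSectionVars false

variable {ν n : ℕ} {𝓜 : Type*} [NormedRing 𝓜] [NormedAlgebra ℂ 𝓜] [NormOneClass 𝓜]
  [FiniteDimensional ℂ 𝓜] [MeasurableSpace 𝓜] [BorelSpace 𝓜]

section Kernel

/-! ### The integrands of the deformation series -/

/-- The classical path from `y` to `x`, expressed with the fundamental solutions. -/
def cPath (G V H : ℂ → Matrix (Fin ν) (Fin ν) ℂ) (t : ℂ) (x y : Fin ν → ℂ) (s : ℝ) : Fin ν → ℂ :=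
  (s : ℂ) • (G (t * s)).mulVec ((H t).mulVec (x - (V t).mulVec y)) + (V (t * s)).mulVec y

/-- The linear phase `∑_j q(s_j) · ξ_j` along the classical path. -/
def linPhase (G V H : ℂ → Matrix (Fin ν) (Fin ν) ℂ) (p : ℂ × (Fin ν → ℂ) × (Fin ν → ℂ))
    (w : Fin n → ℝ × EuclideanSpace ℝ (Fin ν)) : ℂ :=
  ∑ j, cdot (cPath G V H p.1 p.2.1 p.2.2 (w j).1) (w j).2

/-- The ordered product `g(s_n t, ξ_n) ⋯ g(s_1 t, ξ_1)`. -/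
def gProd (g : ℂ → EuclideanSpace ℝ (Fin ν) → 𝓜) (t : ℂ)
    (w : Fin n → ℝ × EuclideanSpace ℝ (Fin ν)) : 𝓜 :=
  (List.ofFn fun j => g ((w j).1 * t) (w j).2).reverse.prod

/-- The quadratic phase as a function of a configuration. -/
def quadPhase (G W : ℂ → Matrix (Fin ν) (Fin ν) ℂ) (t : ℂ)
    (w : Fin n → ℝ × EuclideanSpace ℝ (Fin ν)) : ℂ :=
  phaseQ G W t (fun j => (w j).1) fun j => (w j).2

/-- The integrand of the `n`-th term of the deformation series, without the power of `t`. -/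
def kernCore (G W V H : ℂ → Matrix (Fin ν) (Fin ν) ℂ) (g : ℂ → EuclideanSpace ℝ (Fin ν) → 𝓜)
    (n : ℕ) (p : ℂ × (Fin ν → ℂ) × (Fin ν → ℂ)) (w : Fin n → ℝ × EuclideanSpace ℝ (Fin ν)) : 𝓜 :=
  Complex.exp (-(p.1 * quadPhase G W p.1 w) + Complex.I * linPhase G V H p w) • gProd g p.1 w

/-- The integrand of the `n`-th term of the deformation series. -/
def kern (G W V H : ℂ → Matrix (Fin ν) (Fin ν) ℂ) (g : ℂ → EuclideanSpace ℝ (Fin ν) → 𝓜) (n : ℕ)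
    (p : ℂ × (Fin ν → ℂ) × (Fin ν → ℂ)) (w : Fin n → ℝ × EuclideanSpace ℝ (Fin ν)) : 𝓜 :=
  p.1 ^ n • kernCore G W V H g n p w

variable {A B C G W V H : ℂ → Matrix (Fin ν) (Fin ν) ℂ} {r K : ℝ}

theorem norm_mulVec_le {M : Matrix (Fin ν) (Fin ν) ℂ} {K : ℝ} (hK : 0 ≤ K)
    (hM : ∀ j k, ‖M j k‖ ≤ K) (v : Fin ν → ℂ) : ‖M.mulVec v‖ ≤ ν * K * ‖v‖ := by
  rw [pi_norm_le_iff_of_nonneg (by positivity)]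
  intro i
  rw [Matrix.mulVec, dotProduct]
  refine (norm_sum_le _ _).trans ((Finset.sum_le_sum fun k _ => (norm_mul_le _ _).trans
    (mul_le_mul (hM i k) (norm_le_pi_norm v k) (norm_nonneg _) hK)).trans (le_of_eq ?_))
  simp [mul_assoc]

theorem norm_cdot_le (v : Fin ν → ℂ) (ξ : EuclideanSpace ℝ (Fin ν)) :
    ‖cdot v ξ‖ ≤ ν * ‖v‖ * ‖ξ‖ := by
  rw [cdot, dotProduct]
  refine (norm_sum_le _ _).trans ((Finset.sum_le_sum fun k _ => (norm_mul_le _ _).trans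
    (mul_le_mul (norm_le_pi_norm v k) (norm_coord_le ξ k) (norm_nonneg _)
      (norm_nonneg _))).trans (le_of_eq ?_))
  simp [mul_assoc]

/-- Lipschitz bound for a bounded holomorphic function, inside a smaller disc. -/
theorem norm_sub_le_of_bounded {b : ℂ → ℂ} {r ρ M : ℝ} (hρ : ρ < r)
    (hb : DifferentiableOn ℂ b (Metric.ball 0 r)) (hM : ∀ z ∈ Metric.ball (0 : ℂ) r, ‖b z‖ ≤ M)
    {z w : ℂ} (hz : z ∈ Metric.ball (0 : ℂ) ρ) (hw : w ∈ Metric.ball (0 : ℂ) ρ) :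
    ‖b w - b z‖ ≤ M / ((r - ρ) / 2) * ‖w - z‖ := by
  refine (convex_ball (0 : ℂ) ρ).norm_image_sub_le_of_norm_deriv_le (𝕜 := ℂ)
    (fun y hy => hb.differentiableAt (Metric.isOpen_ball.mem_nhds
      (Metric.ball_subset_ball hρ.le hy))) (fun y hy => ?_) hz hw
  have hsub : Metric.closedBall y ((r - ρ) / 2) ⊆ Metric.ball 0 r := by
    intro q hq
    rw [mem_ball_zero_iff] at hy ⊢
    rw [mem_closedBall_iff_norm] at hq
    calc ‖q‖ ≤ ‖q - y‖ + ‖y‖ := by simpa using norm_add_le (q - y) y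
      _ < r := by linarith
  have hpos : 0 < (r - ρ) / 2 := by linarith
  exact Complex.norm_deriv_le_of_forall_mem_sphere_norm_le hpos
    (DifferentiableOn.diffContOnCl (by rw [closure_ball y hpos.ne']; exact hb.mono hsub))
    (fun q hq => hM q (hsub (Metric.sphere_subset_closedBall hq)))

/-- The constant bounding the classical paths. -/
def pathBound (ν : ℕ) (K : ℝ) : ℝ := ν * K * (ν * K * (1 + ν * K)) + ν * K

theorem pathBound_nonneg (hK : 0 ≤ K) : 0 ≤ pathBound ν K := by
  unfold pathBound; positivity

namespace Phase

theorem norm_cPath_le (h : Phase A B C r K G W V H) {t : ℂ} (ht : t ∈ Metric.ball (0 : ℂ) r)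
    (z : (Fin ν → ℂ) × (Fin ν → ℂ)) {s : ℝ} (hs : s ∈ Set.Icc (0 : ℝ) 1) :
    ‖cPath G V H t z.1 z.2 s‖ ≤ pathBound ν K * ‖z‖ := by
  have hK := h.nonneg
  have hts := mul_ofReal_mem_ball ht hs
  have h1 : ‖z.1‖ ≤ ‖z‖ := norm_fst_le z
  have h2 : ‖z.2‖ ≤ ‖z‖ := norm_snd_le z
  have h3 : ‖z.1 - (V t).mulVec z.2‖ ≤ (1 + ν * K) * ‖z‖ := by
    refine (norm_sub_le _ _).trans ?_
    have := (norm_mulVec_le hK (h.holV.bound t ht) z.2).trans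
      (mul_le_mul_of_nonneg_left h2 (by positivity))
    linarith
  have h4 : ‖(G (t * s)).mulVec ((H t).mulVec (z.1 - (V t).mulVec z.2))‖
      ≤ ν * K * (ν * K * ((1 + ν * K) * ‖z‖)) :=
    (norm_mulVec_le hK (h.holG.bound _ hts) _).trans (mul_le_mul_of_nonneg_left
      ((norm_mulVec_le hK (h.holH.bound _ ht) _).trans
        (mul_le_mul_of_nonneg_left h3 (by positivity))) (by positivity))
  have h5 : ‖(V (t * s)).mulVec z.2‖ ≤ ν * K * ‖z‖ :=
    (norm_mulVec_le hK (h.holV.bound _ hts) _).trans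
      (mul_le_mul_of_nonneg_left h2 (by positivity))
  have h6 : ‖(s : ℂ)‖ ≤ 1 := by
    rw [Complex.norm_real, Real.norm_of_nonneg hs.1]; exact hs.2
  unfold cPath pathBound
  refine (norm_add_le _ _).trans ?_
  rw [norm_smul]
  have := mul_le_of_le_one_left (norm_nonneg
    ((G (t * s)).mulVec ((H t).mulVec (z.1 - (V t).mulVec z.2)))) h6
  linarith

theorem norm_linPhase_le (h : Phase A B C r K G W V H) {t : ℂ} (ht : t ∈ Metric.ball (0 : ℂ) r)
    (z : (Fin ν → ℂ) × (Fin ν → ℂ)) {w : Fin n → ℝ × EuclideanSpace ℝ (Fin ν)}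
    (hw : w ∈ orderedSet ν n 1) :
    ‖linPhase G V H (t, z) w‖ ≤ ν * pathBound ν K * ‖z‖ * ∑ j, ‖(w j).2‖ := by
  rw [linPhase, Finset.mul_sum]
  refine (norm_sum_le _ _).trans (Finset.sum_le_sum fun j _ => ?_)
  refine (norm_cdot_le _ _).trans (mul_le_mul_of_nonneg_right ?_ (norm_nonneg _))
  rw [mul_assoc]
  exact mul_le_mul_of_nonneg_left (h.norm_cPath_le ht z ⟨(hw.2 j).1.le, (hw.2 j).2.le⟩)
    (Nat.cast_nonneg _)

theorem _root_.HeatDeformation.HolMat.contDiffOn_comp {M : ℂ → Matrix (Fin ν) (Fin ν) ℂ}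
    (hM : HolMat r K M) {s : ℝ} (hs : s ∈ Set.Icc (0 : ℝ) 1) (i a : Fin ν) :
    ContDiffOn ℂ ∞ (fun p : ℂ × (Fin ν → ℂ) × (Fin ν → ℂ) => M (p.1 * s) i a)
      (Metric.ball 0 r ×ˢ Set.univ) :=
  ((hM.differentiableOn_comp_mul hs i a).contDiffOn Metric.isOpen_ball).comp
    contDiff_fst.contDiffOn fun _ hp => hp.1

theorem contDiffOn_cPath (h : Phase A B C r K G W V H) {s : ℝ} (hs : s ∈ Set.Icc (0 : ℝ) 1)
    (i : Fin ν) :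
    ContDiffOn ℂ ∞ (fun p : ℂ × (Fin ν → ℂ) × (Fin ν → ℂ) => cPath G V H p.1 p.2.1 p.2.2 s i)
      (Metric.ball 0 r ×ˢ Set.univ) := by
  have h1 : (1 : ℝ) ∈ Set.Icc (0 : ℝ) 1 := by simp
  have hx : ∀ a, ContDiffOn ℂ ∞ (fun p : ℂ × (Fin ν → ℂ) × (Fin ν → ℂ) => p.2.1 a)
      (Metric.ball 0 r ×ˢ Set.univ) := fun a => ContDiff.contDiffOn (by fun_prop)
  have hy : ∀ a, ContDiffOn ℂ ∞ (fun p : ℂ × (Fin ν → ℂ) × (Fin ν → ℂ) => p.2.2 a)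
      (Metric.ball 0 r ×ˢ Set.univ) := fun a => ContDiff.contDiffOn (by fun_prop)
  have hH := fun a b => by simpa using h.holH.contDiffOn_comp h1 a b
  have hV := fun a b => by simpa using h.holV.contDiffOn_comp h1 a b
  simp only [cPath, Pi.add_apply, Pi.smul_apply, Matrix.mulVec, dotProduct, smul_eq_mul,
    Pi.sub_apply]
  refine (contDiffOn_const.mul (ContDiffOn.sum fun a _ => (h.holG.contDiffOn_comp hs i a).mul
    (ContDiffOn.sum fun b _ => (hH a b).mul ((hx b).sub
      (ContDiffOn.sum fun c _ => (hV b c).mul (hy c)))))).add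
    (ContDiffOn.sum fun a _ => (h.holV.contDiffOn_comp hs i a).mul (hy a))

theorem contDiffOn_linPhase (h : Phase A B C r K G W V H)
    {w : Fin n → ℝ × EuclideanSpace ℝ (Fin ν)} (hw : w ∈ orderedSet ν n 1) :
    ContDiffOn ℂ ∞ (fun p => linPhase G V H p w) (Metric.ball 0 r ×ˢ Set.univ) := by
  unfold linPhase cdot dotProduct
  exact ContDiffOn.sum fun j _ => ContDiffOn.sum fun i _ =>
    (h.contDiffOn_cPath ⟨(hw.2 j).1.le, (hw.2 j).2.le⟩ i).mul contDiffOn_const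

theorem differentiableOn_quadPhase (h : Phase A B C r K G W V H)
    {w : Fin n → ℝ × EuclideanSpace ℝ (Fin ν)} (hw : w ∈ orderedSet ν n 1) :
    DifferentiableOn ℂ (fun t => quadPhase G W t w) (Metric.ball 0 r) :=
  differentiableOn_phaseQ h.holG h.holW h.nonneg (fun j => ⟨(hw.2 j).1.le, (hw.2 j).2.le⟩) _

theorem contDiffOn_quadPhase (h : Phase A B C r K G W V H)
    {w : Fin n → ℝ × EuclideanSpace ℝ (Fin ν)} (hw : w ∈ orderedSet ν n 1) :
    ContDiffOn ℂ ∞ (fun p : ℂ × (Fin ν → ℂ) × (Fin ν → ℂ) => quadPhase G W p.1 w)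
      (Metric.ball 0 r ×ˢ Set.univ) :=
  ((h.differentiableOn_quadPhase hw).contDiffOn Metric.isOpen_ball).comp
    contDiff_fst.contDiffOn fun _ hp => hp.1

end Phase

theorem FourierPotential.contDiffOn_gProd {T : ℝ} {c : ℂ → (Fin ν → ℂ) → 𝓜}
    {m : Measure (EuclideanSpace ℝ (Fin ν))} {g : ℂ → EuclideanSpace ℝ (Fin ν) → 𝓜}
    (hc : FourierPotential T c m g) {w : Fin n → ℝ × EuclideanSpace ℝ (Fin ν)}
    (hw : w ∈ orderedSet ν n 1) :
    ContDiffOn ℂ ∞ (fun t => gProd g t w) (Metric.ball 0 T) := by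
  have : CompleteSpace 𝓜 := FiniteDimensional.complete ℂ 𝓜
  have h1 : ∀ j, ContDiffOn ℂ ∞ (fun t => g ((w j).1 * t) (w j).2) (Metric.ball 0 T) := by
    intro j
    refine DifferentiableOn.contDiffOn ?_ Metric.isOpen_ball
    refine (hc.diff (w j).2).comp (differentiableOn_id.const_mul _) fun t ht => ?_
    rw [mul_comm]
    exact mul_ofReal_mem_ball ht ⟨(hw.2 j).1.le, (hw.2 j).2.le⟩
  clear hw
  unfold gProd
  induction n with
  | zero => simpa using contDiffOn_const
  | succ n ih =>
    simp only [prod_reverse_ofFn_succ]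
    exact (h1 _).mul (ih (w := fun j => w j.castSucc) fun j => h1 j.castSucc)

theorem FourierPotential.norm_gProd_le {T : ℝ} {c : ℂ → (Fin ν → ℂ) → 𝓜}
    {m : Measure (EuclideanSpace ℝ (Fin ν))} {g : ℂ → EuclideanSpace ℝ (Fin ν) → 𝓜}
    (hc : FourierPotential T c m g) (t : ℂ) (w : Fin n → ℝ × EuclideanSpace ℝ (Fin ν)) :
    ‖gProd g t w‖ ≤ 1 := by
  simpa [gProd] using norm_prod_reverse_ofFn_le (h := fun j => g ((w j).1 * t) (w j).2) (b := fun _ => 1)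
    fun j => hc.bound _ _

theorem measurable_gProd {g : ℂ → EuclideanSpace ℝ (Fin ν) → 𝓜}
    (hg : Measurable (Function.uncurry g)) (t : ℂ) :
    Measurable fun w : Fin n → ℝ × EuclideanSpace ℝ (Fin ν) => gProd g t w := by
  unfold gProd
  refine measurable_prod_reverse_ofFn fun j => hg.comp (Measurable.prodMk ?_ ?_)
  · fun_prop
  · fun_prop

theorem measurable_cdot {α : Type*} [MeasurableSpace α] {v : α → Fin ν → ℂ}
    {ξ : α → EuclideanSpace ℝ (Fin ν)} (hv : ∀ i, Measurable fun a => v a i)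
    (hξ : Measurable ξ) : Measurable fun a => cdot (v a) (ξ a) := by
  unfold cdot dotProduct toC
  refine Finset.measurable_fun_sum _ fun i _ => (hv i).mul (Complex.measurable_ofReal.comp ?_)
  exact (EuclideanSpace.proj (𝕜 := ℝ) i).continuous.measurable.comp hξ

namespace Phase

theorem measurable_cPath (h : Phase A B C r K G W V H) (t : ℂ) (x y : Fin ν → ℂ) (i : Fin ν) :
    Measurable fun s : ℝ => cPath G V H t x y s i := by
  simp only [cPath, Pi.add_apply, Pi.smul_apply, Matrix.mulVec, dotProduct, smul_eq_mul,
    Pi.sub_apply]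
  have hG : ∀ a b, Measurable fun s : ℝ => G (t * s) a b := fun a b =>
    (h.holG.meas a b).comp (by fun_prop)
  have hV : ∀ a b, Measurable fun s : ℝ => V (t * s) a b := fun a b =>
    (h.holV.meas a b).comp (by fun_prop)
  exact (Complex.measurable_ofReal.mul (Finset.measurable_fun_sum _ fun a _ =>
    (hG i a).mul_const _)).add (Finset.measurable_fun_sum _ fun a _ => (hV i a).mul_const _)

theorem measurable_kernCore (h : Phase A B C r K G W V H) {g : ℂ → EuclideanSpace ℝ (Fin ν) → 𝓜}
    (hg : Measurable (Function.uncurry g)) (p : ℂ × (Fin ν → ℂ) × (Fin ν → ℂ)) :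
    Measurable (kernCore G W V H g n p) := by
  have : ProperSpace 𝓜 := FiniteDimensional.proper ℂ 𝓜
  have h1 : Measurable fun w : Fin n → ℝ × EuclideanSpace ℝ (Fin ν) => linPhase G V H p w := by
    unfold linPhase
    refine Finset.measurable_fun_sum _ fun j _ => measurable_cdot (fun i => ?_) (by fun_prop)
    exact (h.measurable_cPath p.1 p.2.1 p.2.2 i).comp
      (measurable_fst.comp (measurable_pi_apply j))
  have h2 : Measurable fun w : Fin n → ℝ × EuclideanSpace ℝ (Fin ν) => quadPhase G W p.1 w :=
    (measurable_phaseQ h.holG.meas h.holW.meas p.1).comp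
      (f := fun w : Fin n → ℝ × EuclideanSpace ℝ (Fin ν) =>
        ((fun j => (w j).1 : Fin n → ℝ), fun j => (w j).2)) (by fun_prop)
  unfold kernCore
  exact ((h2.const_mul _).neg.add (h1.const_mul _)).cexp.smul (measurable_gProd hg p.1)

theorem measurable_kern (h : Phase A B C r K G W V H) {g : ℂ → EuclideanSpace ℝ (Fin ν) → 𝓜}
    (hg : Measurable (Function.uncurry g)) (p : ℂ × (Fin ν → ℂ) × (Fin ν → ℂ)) :
    Measurable (kern G W V H g n p) := by
  have : ProperSpace 𝓜 := FiniteDimensional.proper ℂ 𝓜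
  exact (h.measurable_kernCore hg p).const_smul _

/-- The size of a configuration. -/
def _root_.HeatDeformation.wt (w : Fin n → ℝ × EuclideanSpace ℝ (Fin ν)) : ℝ :=
  1 + ∑ j, ‖(w j).2‖

theorem _root_.HeatDeformation.one_le_wt (w : Fin n → ℝ × EuclideanSpace ℝ (Fin ν)) : 1 ≤ wt w :=
  le_add_of_nonneg_right (Finset.sum_nonneg fun _ _ => norm_nonneg _)

theorem norm_mul_quadPhase_le (h : Phase A B C r K G W V H)
    {w : Fin n → ℝ × EuclideanSpace ℝ (Fin ν)} (hw : w ∈ orderedSet ν n 1) {t : ℂ}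
    (ht : t ∈ Metric.ball (0 : ℂ) r) :
    ‖t * quadPhase G W t w‖ ≤ r * (ν ^ 2 * K * (ν * K) ^ 2) * wt w ^ 2 := by
  have hK := h.nonneg
  have hr := h.pos
  have h1 := norm_phaseQ_le h.holG h.holW hK ht (s := fun j => (w j).1)
    (fun j => ⟨(hw.2 j).1.le, (hw.2 j).2.le⟩) fun j => (w j).2
  rw [mul_pow (ν * K : ℝ)] at h1
  have h2 : (∑ j, ‖(w j).2‖) ^ 2 ≤ wt w ^ 2 :=
    pow_le_pow_left₀ (Finset.sum_nonneg fun _ _ => norm_nonneg _)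
      (le_add_of_nonneg_left zero_le_one) 2
  rw [mem_ball_zero_iff] at ht
  rw [norm_mul, mul_assoc]
  refine mul_le_mul ht.le (h1.trans ?_) (norm_nonneg _) hr.le
  rw [← mul_assoc]
  exact mul_le_mul_of_nonneg_left h2 (by positivity)

/-- The bound for the real part of the quadratic phase close to the closed half-disc. -/
def _root_.HeatDeformation.quadBound (ν : ℕ) (r K T : ℝ) : ℝ :=
  r * (ν ^ 2 * K * (ν * K) ^ 2) / ((r - T) / 2)

theorem norm_kern_le (h : Phase A B C r K G W V H) {Tb : ℝ} {c : ℂ → (Fin ν → ℂ) → 𝓜}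
    {m : Measure (EuclideanSpace ℝ (Fin ν))} {g : ℂ → EuclideanSpace ℝ (Fin ν) → 𝓜}
    (hc : FourierPotential Tb c m g) {T : ℝ} (hTr : T < r) (hT1 : T ≤ 1)
    {w : Fin n → ℝ × EuclideanSpace ℝ (Fin ν)} (hw : w ∈ orderedSet ν n 1) {t t' : ℂ}
    (ht : t ∈ Metric.ball (0 : ℂ) T) (hre : 0 ≤ (t * quadPhase G W t w).re)
    (ht' : t' ∈ Metric.ball (0 : ℂ) T) (htt' : ‖t' - t‖ ≤ 1 / wt w ^ 2)
    (z : (Fin ν → ℂ) × (Fin ν → ℂ)) :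
    ‖kern G W V H g n (t', z) w‖
      ≤ Real.exp (quadBound ν r K T + (Complex.I * linPhase G V H (t', z) w).re) := by
  have hwt := one_le_wt w
  have h1 := norm_sub_le_of_bounded (b := fun t => t * quadPhase G W t w) hTr
    (differentiableOn_id.mul (h.differentiableOn_quadPhase hw))
    (fun t ht => h.norm_mul_quadPhase_le hw ht) ht ht'
  have h2 : -(t' * quadPhase G W t' w).re ≤ quadBound ν r K T := by
    have h3 := (Complex.abs_re_le_norm _).trans h1
    rw [Complex.sub_re] at h3
    have h4 := (abs_le.1 h3).1
    have h5 : r * (ν ^ 2 * K * (ν * K) ^ 2) * wt w ^ 2 / ((r - T) / 2) * ‖t' - t‖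
        ≤ quadBound ν r K T := by
      have hnn : 0 ≤ r * (ν ^ 2 * K * (ν * K) ^ 2) * wt w ^ 2 / ((r - T) / 2) := by
        have := h.pos; have := h.nonneg
        have : 0 < r - T := by linarith
        positivity
      refine (mul_le_mul_of_nonneg_left htt' hnn).trans (le_of_eq ?_)
      unfold quadBound
      field_simp
    linarith
  have h6 : ‖t'‖ ^ n ≤ 1 := by
    rw [mem_ball_zero_iff] at ht'
    exact pow_le_one₀ (norm_nonneg _) (ht'.le.trans hT1)
  unfold kern kernCore
  rw [norm_smul, norm_smul, norm_pow, Complex.norm_exp]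
  have h7 : (-(t' * quadPhase G W t' w) + Complex.I * linPhase G V H (t', z) w).re
      ≤ quadBound ν r K T + (Complex.I * linPhase G V H (t', z) w).re := by
    rw [Complex.add_re, Complex.neg_re]; linarith
  calc ‖t'‖ ^ n * (Real.exp _ * ‖gProd g t' w‖) ≤ 1 * (Real.exp (quadBound ν r K T
        + (Complex.I * linPhase G V H (t', z) w).re) * 1) :=
        mul_le_mul h6 (mul_le_mul (Real.exp_le_exp.2 h7) (hc.norm_gProd_le _ _) (norm_nonneg _)
          (Real.exp_pos _).le) (by positivity) zero_le_one
    _ = _ := by ring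

theorem contDiffOn_kern (h : Phase A B C r K G W V H) {Tb : ℝ} {c : ℂ → (Fin ν → ℂ) → 𝓜}
    {m : Measure (EuclideanSpace ℝ (Fin ν))} {g : ℂ → EuclideanSpace ℝ (Fin ν) → 𝓜}
    (hc : FourierPotential Tb c m g) {T : ℝ} (hTr : T ≤ r) (hTb : T ≤ Tb)
    {w : Fin n → ℝ × EuclideanSpace ℝ (Fin ν)} (hw : w ∈ orderedSet ν n 1) :
    ContDiffOn ℂ ∞ (fun p => kern G W V H g n p w) (Metric.ball 0 T ×ˢ Set.univ) := by
  have hsub : Metric.ball (0 : ℂ) T ×ˢ (Set.univ : Set ((Fin ν → ℂ) × (Fin ν → ℂ)))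
      ⊆ Metric.ball 0 r ×ˢ Set.univ :=
    Set.prod_mono (Metric.ball_subset_ball hTr) le_rfl
  have h1 : ContDiffOn ℂ ∞ (fun p : ℂ × (Fin ν → ℂ) × (Fin ν → ℂ) => gProd g p.1 w)
      (Metric.ball 0 T ×ˢ Set.univ) :=
    (hc.contDiffOn_gProd hw).comp contDiff_fst.contDiffOn
      fun _ hp => Metric.ball_subset_ball hTb hp.1
  unfold kern kernCore
  exact (contDiff_fst.pow n).contDiffOn.smul
    ((((contDiff_fst.contDiffOn.mul ((h.contDiffOn_quadPhase hw).mono hsub)).neg.add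
      (contDiffOn_const.mul ((h.contDiffOn_linPhase hw).mono hsub))).cexp).smul h1)

end Phase

end Kernel

end

end HeatDeformation

namespace HeatDeformation

noncomputable section

set_option linter.unusedSectionVars false

variable {ν n : ℕ} {𝓜 : Type*} [NormedRing 𝓜] [NormedAlgebra ℂ 𝓜] [NormOneClass 𝓜]
  [FiniteDimensional ℂ 𝓜] [MeasurableSpace 𝓜] [BorelSpace 𝓜]
  {A B C G W V H : ℂ → Matrix (Fin ν) (Fin ν) ℂ} {r K Tb T : ℝ}
  {c : ℂ → (Fin ν → ℂ) → 𝓜} {m : Measure (EuclideanSpace ℝ (Fin ν))}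
  {g : ℂ → EuclideanSpace ℝ (Fin ν) → 𝓜}

section Family

/-! ### The deformation series as a smooth family -/

/-- The hypotheses under which the deformation series is studied: the phase has non-negative real
part on the closed half-disc of radius `T`. -/
structure Deformation (A B C : ℂ → Matrix (Fin ν) (Fin ν) ℂ) (c : ℂ → (Fin ν → ℂ) → 𝓜)
    (r K Tb T : ℝ) (G W V H : ℂ → Matrix (Fin ν) (Fin ν) ℂ)
    (m : Measure (EuclideanSpace ℝ (Fin ν))) (g : ℂ → EuclideanSpace ℝ (Fin ν) → 𝓜) : Prop where
  phase : Phase A B C r K G W V H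
  pot : FourierPotential Tb c m g
  pos : 0 < T
  lt : T < r
  le_one : T ≤ 1
  le_Tb : T ≤ Tb
  re_nonneg : ∀ (n : ℕ) (s : Fin n → ℝ) (_ : ∀ j, s j ∈ Set.Ioc (0 : ℝ) 1)
    (ξ : Fin n → EuclideanSpace ℝ (Fin ν)), ∀ t ∈ halfDiscBar T, 0 ≤ (t * phaseQ G W t s ξ).re

theorem Phase.exists_deformation (h : Phase A B C r K G W V H)
    (hc : FourierPotential Tb c m g) (hTb : 0 < Tb) {T₀ : ℝ} (hT₀ : 0 < T₀) :
    ∃ T, T ≤ T₀ ∧ Deformation A B C c r K Tb T G W V H m g := by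
  obtain ⟨T₁, h1, h2, h3⟩ := h.exists_re_nonneg
  refine ⟨min (min T₁ T₀) (min 1 Tb), (min_le_left _ _).trans (min_le_right _ _),
    h, hc, lt_min (lt_min h1 hT₀) (lt_min one_pos hTb),
    ((min_le_left _ _).trans (min_le_left _ _)).trans_lt h2,
    (min_le_right _ _).trans (min_le_left _ _), (min_le_right _ _).trans (min_le_right _ _),
    fun n s hs ξ t ht => h3 n s hs ξ t ⟨ht.1.trans_le ?_, ht.2⟩⟩
  exact (min_le_left _ _).trans (min_le_left _ _)

/-- The measures of the deformation series. -/
def seriesMeasure (m : Measure (EuclideanSpace ℝ (Fin ν))) (n : ℕ) :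
    Measure (Fin n → ℝ × EuclideanSpace ℝ (Fin ν)) :=
  (pointMeasure m n).restrict (orderedSet ν n 1)

theorem ae_seriesMeasure {p : (Fin n → ℝ × EuclideanSpace ℝ (Fin ν)) → Prop}
    (h : ∀ w ∈ orderedSet ν n 1, p w) : ∀ᵐ w ∂seriesMeasure m n, p w :=
  (ae_restrict_iff' (measurableSet_orderedSet 1)).2 (Eventually.of_forall h)

theorem wt_pow_le (w : Fin n → ℝ × EuclideanSpace ℝ (Fin ν)) (k : ℕ) :
    wt w ^ k ≤ k.factorial * Real.exp 1 * Real.exp (∑ j, ‖(w j).2‖) := by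
  have h0 : 0 ≤ wt w := zero_le_one.trans (one_le_wt w)
  have := Real.pow_div_factorial_le_exp (wt w) h0 k
  rw [div_le_iff₀ (by positivity)] at this
  rw [mul_assoc, ← Real.exp_add, mul_comm]
  exact this

theorem summable_exp_weight [SigmaFinite m]
    (hm : ∀ R : ℝ, Integrable (fun ξ => Real.exp (R * ‖ξ‖)) m) (D R : ℝ) :
    (∀ n, Integrable (fun w : Fin n → ℝ × EuclideanSpace ℝ (Fin ν) =>
        D * Real.exp (R * ∑ j, ‖(w j).2‖)) (seriesMeasure m n)) ∧
      Summable fun n => ∫ w, D * Real.exp (R * ∑ j, ‖(w j).2‖) ∂seriesMeasure m n := by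
  refine ⟨fun n => (integrable_orderedSet_exp hm R n zero_le_one).1.const_mul D, ?_⟩
  simp only [integral_const_mul]
  refine Summable.mul_left D ?_
  refine (Real.summable_pow_div_factorial (∫ ξ, Real.exp (R * ‖ξ‖) ∂m)).congr fun n => ?_
  rw [seriesMeasure, (integrable_orderedSet_exp hm R n zero_le_one).2]
  rw [one_pow]
  ring

namespace Deformation

variable (h : Deformation A B C c r K Tb T G W V H m g)
include h

theorem isFiniteMeasure : IsFiniteMeasure m := h.pot.isFiniteMeasure

theorem half_lt : T / 2 < T := by linarith [h.pos]

theorem mem_ball_of_half {t : ℂ} (ht : t ∈ halfDiscBar (T / 2)) : t ∈ Metric.ball (0 : ℂ) T := by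
  rw [mem_ball_zero_iff]; exact ht.1.trans h.half_lt

theorem re_quadPhase_nonneg {w : Fin n → ℝ × EuclideanSpace ℝ (Fin ν)}
    (hw : w ∈ orderedSet ν n 1) {t : ℂ} (ht : t ∈ halfDiscBar (T / 2)) :
    0 ≤ (t * quadPhase G W t w).re :=
  h.re_nonneg n _ (fun j => ⟨(hw.2 j).1, (hw.2 j).2.le⟩) _ t ⟨ht.1.trans h.half_lt, ht.2⟩

theorem ball_subset {p : ℂ × (Fin ν → ℂ) × (Fin ν → ℂ)} (hp : p.1 ∈ halfDiscBar (T / 2))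
    {ρ : ℝ} (hρ : ρ ≤ T / 2) :
    Metric.ball p ρ ⊆ Metric.ball 0 T ×ˢ Set.univ := by
  intro q hq
  refine ⟨?_, trivial⟩
  rw [mem_ball_zero_iff]
  rw [mem_ball_iff_norm] at hq
  have h1 : ‖q.1 - p.1‖ ≤ ‖q - p‖ := norm_fst_le (q - p)
  have h2 : ‖q.1‖ ≤ ‖q.1 - p.1‖ + ‖p.1‖ := by simpa using norm_add_le (q.1 - p.1) p.1
  linarith [hp.1]

theorem norm_kern_le_of_ball {w : Fin n → ℝ × EuclideanSpace ℝ (Fin ν)}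
    (hw : w ∈ orderedSet ν n 1) {p q : ℂ × (Fin ν → ℂ) × (Fin ν → ℂ)}
    (hp : p.1 ∈ halfDiscBar (T / 2)) (hq : q ∈ Metric.ball p (T / 2 / wt w ^ 2)) {R : ℝ}
    (hR : ‖q.2‖ ≤ R) :
    ‖kern G W V H g n q w‖
      ≤ Real.exp (quadBound ν r K T) * Real.exp (ν * pathBound ν K * R * ∑ j, ‖(w j).2‖) := by
  have hwt := one_le_wt w
  have hT := h.pos
  have hwt2 : (1 : ℝ) ≤ wt w ^ 2 := one_le_pow₀ hwt
  have hq0 := h.ball_subset hp (div_le_self (by positivity) hwt2) hq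
  have hq1 : ‖q.1 - p.1‖ ≤ 1 / wt w ^ 2 := by
    rw [mem_ball_iff_norm] at hq
    refine ((norm_fst_le (q - p)).trans hq.le).trans ?_
    gcongr
    linarith [h.le_one]
  refine (h.phase.norm_kern_le h.pot h.lt h.le_one hw (h.mem_ball_of_half hp)
    (h.re_quadPhase_nonneg hw hp) hq0.1 hq1 q.2).trans ?_
  rw [← Real.exp_add, Real.exp_le_exp]
  have h1 : (Complex.I * linPhase G V H (q.1, q.2) w).re
      ≤ ν * pathBound ν K * ‖q.2‖ * ∑ j, ‖(w j).2‖ := by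
    refine (Complex.re_le_norm _).trans ?_
    rw [norm_mul, Complex.norm_I, one_mul]
    exact h.phase.norm_linPhase_le (Metric.ball_subset_ball h.lt.le hq0.1) q.2 hw
  have h2 : ν * pathBound ν K * ‖q.2‖ * ∑ j, ‖(w j).2‖
      ≤ ν * pathBound ν K * R * ∑ j, ‖(w j).2‖ := by
    have := pathBound_nonneg (ν := ν) h.phase.nonneg
    gcongr
  linarith

theorem smoothFamily :
    SmoothFamily (seriesMeasure m) (Metric.ball 0 T ×ˢ Set.univ)
      (halfDiscBar (T / 2) ×ˢ Set.univ) (kern G W V H g) where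
  isOpen := Metric.isOpen_ball.prod isOpen_univ
  subset := Set.prod_mono (fun _ ht => h.mem_ball_of_half ht) le_rfl
  convex := Convex.prod convex_halfDiscBar convex_univ
  meas n p _ := by
    have : ProperSpace 𝓜 := FiniteDimensional.proper ℂ 𝓜
    exact (h.phase.measurable_kern h.pot.meas p).aestronglyMeasurable
  smooth n := ae_seriesMeasure fun w hw => h.phase.contDiffOn_kern h.pot h.lt.le h.le_Tb hw
  bound k p₀ hp₀ := by
    have := h.isFiniteMeasure
    have : CompleteSpace 𝓜 := FiniteDimensional.complete ℂ 𝓜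
    have hT := h.pos
    set R := ‖p₀‖ + 2 with hR
    set D := Real.exp (quadBound ν r K T) * ((k + 1) / (T / 2)) ^ k
      * ((2 * k).factorial * Real.exp 1) with hD
    obtain ⟨h1, h2⟩ := summable_exp_weight h.pot.moments D (ν * pathBound ν K * R + 1)
    refine ⟨1, one_pos, fun n w => D * Real.exp ((ν * pathBound ν K * R + 1) * ∑ j, ‖(w j).2‖),
      h1, h2, fun n => ae_seriesMeasure fun w hw p hp => ?_⟩
    have hwt := one_le_wt w
    have hwt2 : (1 : ℝ) ≤ wt w ^ 2 := one_le_pow₀ hwt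
    have hle : T / 2 / wt w ^ 2 ≤ T / 2 := div_le_self (by positivity) hwt2
    have h3 := norm_iteratedFDeriv_le_of_ball (Metric.isOpen_ball.prod isOpen_univ)
      (h.phase.contDiffOn_kern h.pot h.lt.le h.le_Tb hw) (p := p) (R := T / 2 / wt w ^ 2)
      (M := Real.exp (quadBound ν r K T) * Real.exp (ν * pathBound ν K * R * ∑ j, ‖(w j).2‖))
      (by positivity) (by positivity) (h.ball_subset hp.1.1 hle) (fun q hq => by
        refine h.norm_kern_le_of_ball hw hp.1.1 hq ?_
        have hq' := hq
        rw [mem_ball_iff_norm] at hq'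
        have hp' := hp.2
        rw [mem_ball_iff_norm] at hp'
        have e1 : ‖q‖ ≤ ‖q - p‖ + ‖p - p₀‖ + ‖p₀‖ := by
          calc ‖q‖ = ‖(q - p) + (p - p₀) + p₀‖ := by congr 1; abel
            _ ≤ _ := norm_add₃_le
        have := norm_snd_le q
        rw [hR]
        linarith [h.le_one]) k
    refine h3.trans ?_
    have h4 : ((k + 1) / (T / 2 / wt w ^ 2)) ^ k
        = ((k + 1) / (T / 2)) ^ k * wt w ^ (2 * k) := by
      rw [pow_mul, ← mul_pow]
      congr 1
      field_simp
    change _ ≤ D * Real.exp ((ν * pathBound ν K * R + 1) * ∑ j, ‖(w j).2‖)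
    rw [h4, add_mul, one_mul, Real.exp_add, hD]
    have h5 := wt_pow_le w (2 * k)
    calc _ = Real.exp (quadBound ν r K T) * ((k + 1) / (T / 2)) ^ k *
          Real.exp (ν * pathBound ν K * R * ∑ j, ‖(w j).2‖) * wt w ^ (2 * k) := by ring
      _ ≤ Real.exp (quadBound ν r K T) * ((k + 1) / (T / 2)) ^ k *
          Real.exp (ν * pathBound ν K * R * ∑ j, ‖(w j).2‖) *
          ((2 * k).factorial * Real.exp 1 * Real.exp (∑ j, ‖(w j).2‖)) :=
          mul_le_mul_of_nonneg_left h5 (by positivity)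
      _ = _ := by ring

end Deformation

end Family

end

end HeatDeformation

namespace HeatDeformation

noncomputable section

set_option linter.unusedSectionVars false

variable {ν n : ℕ} {𝓜 : Type*} [NormedRing 𝓜] [NormedAlgebra ℂ 𝓜] [NormOneClass 𝓜]
  [FiniteDimensional ℂ 𝓜] [MeasurableSpace 𝓜] [BorelSpace 𝓜]
  {A B C G W V H : ℂ → Matrix (Fin ν) (Fin ν) ℂ} {r K Tb T : ℝ}
  {c : ℂ → (Fin ν → ℂ) → 𝓜} {m : Measure (EuclideanSpace ℝ (Fin ν))}
  {g : ℂ → EuclideanSpace ℝ (Fin ν) → 𝓜}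

section Series

/-! ### Identification of the deformation series -/

theorem prod_reverse_ofFn_smul (e : Fin n → ℂ) (h : Fin n → 𝓜) :
    (List.ofFn fun j => e j • h j).reverse.prod = (∏ j, e j) • (List.ofFn h).reverse.prod := by
  induction n with
  | zero => simp
  | succ n ih =>
    rw [prod_reverse_ofFn_succ, prod_reverse_ofFn_succ, ih, Fin.prod_univ_castSucc, smul_mul_smul_comm,
      mul_comm]

theorem integrable_pi_exp [SigmaFinite m]
    (hm : ∀ R : ℝ, Integrable (fun ξ => Real.exp (R * ‖ξ‖)) m) (R : ℝ) :
    Integrable (fun ξ : Fin n → EuclideanSpace ℝ (Fin ν) => Real.exp (R * ∑ j, ‖ξ j‖))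
      (Measure.pi fun _ => m) := by
  have := Integrable.fintype_prod (𝕜 := ℝ) (f := fun (_ : Fin n) ξ => Real.exp (R * ‖ξ‖))
    (μ := fun _ => m) fun _ => hm R
  refine this.congr (Eventually.of_forall fun ξ => ?_)
  simp only [← Real.exp_sum, Finset.mul_sum]

theorem norm_pi_le_sum (ξ : Fin n → EuclideanSpace ℝ (Fin ν)) : ‖ξ‖ ≤ ∑ j, ‖ξ j‖ := by
  rw [pi_norm_le_iff_of_nonneg (Finset.sum_nonneg fun _ _ => norm_nonneg _)]
  exact fun j => Finset.single_le_sum (f := fun j => ‖ξ j‖) (fun _ _ => norm_nonneg _)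
    (Finset.mem_univ j)

theorem hasExpMoments_of_bounded [SigmaFinite m]
    (hm : ∀ R : ℝ, Integrable (fun ξ => Real.exp (R * ‖ξ‖)) m)
    {q : (Fin n → EuclideanSpace ℝ (Fin ν)) → 𝓜} (hq : Measurable q) (hb : ∀ ξ, ‖q ξ‖ ≤ 1) :
    HasExpMoments (Measure.pi fun _ => m) q := by
  have : ProperSpace 𝓜 := FiniteDimensional.proper ℂ 𝓜
  intro R
  refine (integrable_pi_exp hm |R|).mono' ?_ (Eventually.of_forall fun ξ => ?_)
  · exact (Measurable.smul (by fun_prop) hq).aestronglyMeasurable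
  · rw [norm_smul, Complex.norm_real, Real.norm_eq_abs, Real.abs_exp]
    refine (mul_le_of_le_one_right (Real.exp_pos _).le (hb ξ)).trans (Real.exp_le_exp.2 ?_)
    exact mul_le_mul (le_abs_self R) (norm_pi_le_sum ξ) (norm_nonneg _) (abs_nonneg R)

theorem FourierPotential.orderedProd_eq (hc : FourierPotential Tb c m g) {t : ℂ}
    (ht : t ∈ Metric.ball (0 : ℂ) Tb) {s : Fin n → ℝ} (hs : ∀ j, s j ∈ Set.Icc (0 : ℝ) 1) :
    orderedProd c t s = fourierMeasure (Measure.pi fun _ => m)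
      fun ξ => gProd g t fun j => (s j, ξ j) := by
  have := hc.isFiniteMeasure
  have : ProperSpace 𝓜 := FiniteDimensional.proper ℂ 𝓜
  funext z
  have hint : ∀ j, Integrable (fun ξ => Complex.exp (Complex.I * cdot (z j) ξ) •
      g (s j * t) ξ) m := by
    intro j
    have m1 : Measurable fun ξ : EuclideanSpace ℝ (Fin ν) => cdot (z j) ξ := by
      unfold cdot toC dotProduct; fun_prop
    have m2 : Measurable fun ξ => g (s j * t) ξ :=
      hc.meas.comp (f := fun ξ => ((s j * t : ℂ), ξ)) (by fun_prop)
    refine (hc.moments (ν * ‖z j‖)).mono' ?_ (Eventually.of_forall fun ξ => ?_)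
    · exact (Measurable.smul (m1.const_mul _).cexp m2).aestronglyMeasurable
    · rw [norm_smul, Complex.norm_exp]
      refine (mul_le_of_le_one_right (Real.exp_pos _).le (hc.bound _ _)).trans
        (Real.exp_le_exp.2 ((Complex.re_le_norm _).trans ?_))
      rw [norm_mul, Complex.norm_I, one_mul]
      exact norm_cdot_le _ _
  have h1 := (integral_prod_reverse_ofFn m hint).2
  have h2 : ∀ j, ∫ ξ, Complex.exp (Complex.I * cdot (z j) ξ) • g (s j * t) ξ ∂m
      = c (s j * t) (z j) := fun j => by
    rw [hc.eq]
    rw [mul_comm]; exact mul_ofReal_mem_ball ht (hs j)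
  simp only [h2] at h1
  rw [orderedProd, ← h1, fourierMeasure]
  refine integral_congr_ae (Eventually.of_forall fun ξ => ?_)
  simp only [prod_reverse_ofFn_smul, ← Complex.exp_sum, Finset.mul_sum, gProd]

theorem Phase.qNat_eq (h : Phase A B C r K G W V H) {t : ℂ} (ht : t ∈ Metric.ball (0 : ℂ) r)
    (x y : Fin ν → ℂ) {s : ℝ} (hs : s ∈ Set.Icc (0 : ℝ) 1) :
    qNat A B C t x y s = cPath G V H t x y s := by
  rw [qNat, h.qFlat_eq t ht s hs, h.qSharp_eq t ht s hs, cPath]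
  simp only [Matrix.smul_mulVec, Matrix.sub_mulVec, ← Matrix.mulVec_mulVec, Matrix.mulVec_sub,
    smul_sub]
  abel

/-- The correspondence between configurations and pairs of times and frequencies. -/
theorem measurePreserving_points [SigmaFinite m] (n : ℕ) :
    MeasurePreserving (MeasurableEquiv.arrowProdEquivProdArrow ℝ (EuclideanSpace ℝ (Fin ν)) (Fin n))
      (pointMeasure m n) ((volume : Measure (Fin n → ℝ)).prod (Measure.pi fun _ => m)) :=
  measurePreserving_arrowProdEquivProdArrow ℝ (EuclideanSpace ℝ (Fin ν)) (Fin n)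
    (fun _ => volume) fun _ => m

theorem preimage_openSimplex (n : ℕ) :
    (MeasurableEquiv.arrowProdEquivProdArrow ℝ (EuclideanSpace ℝ (Fin ν)) (Fin n)) ⁻¹'
      (openSimplex n ×ˢ Set.univ) = orderedSet ν n 1 := by
  ext w
  simp only [Set.mem_preimage, Set.mem_prod, Set.mem_univ, and_true]
  exact Iff.rfl

theorem integral_orderedSet_eq [SigmaFinite m]
    {q : (Fin n → ℝ × EuclideanSpace ℝ (Fin ν)) → 𝓜}
    (hq : Integrable q (seriesMeasure m n)) :
    IntegrableOn (fun s => ∫ ξ : Fin n → EuclideanSpace ℝ (Fin ν), q (fun j => (s j, ξ j))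
        ∂Measure.pi fun _ => m) (openSimplex n) ∧
      ∫ w, q w ∂seriesMeasure m n = ∫ s in openSimplex n, ∫ ξ, q (fun j => (s j, ξ j))
        ∂Measure.pi fun _ => m := by
  have hmp := measurePreserving_points (m := m) n
  set e := MeasurableEquiv.arrowProdEquivProdArrow ℝ (EuclideanSpace ℝ (Fin ν)) (Fin n) with he
  set q' : (Fin n → ℝ) × (Fin n → EuclideanSpace ℝ (Fin ν)) → 𝓜 :=
    fun z => q fun j => (z.1 j, z.2 j) with hq'
  have hqe : q = q' ∘ e := rfl
  have h1 : IntegrableOn q' (openSimplex n ×ˢ Set.univ)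
      ((volume : Measure (Fin n → ℝ)).prod (Measure.pi fun _ => m)) := by
    rw [← hmp.integrableOn_comp_preimage e.measurableEmbedding, preimage_openSimplex]
    exact hq
  refine ⟨?_, ?_⟩
  · have h2 := h1
    rw [IntegrableOn, ← Measure.prod_restrict, Measure.restrict_univ] at h2
    exact h2.integral_prod_left
  · rw [seriesMeasure, ← preimage_openSimplex]
    refine (hmp.setIntegral_preimage_emb e.measurableEmbedding q' _).trans ?_
    rw [setIntegral_prod _ h1]
    simp only [Measure.restrict_univ, hq']

namespace Deformation

variable (h : Deformation A B C c r K Tb T G W V H m g)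
include h

theorem mem_ball_r {t : ℂ} (ht : t ∈ halfDiscBar (T / 2)) : t ∈ Metric.ball (0 : ℂ) r :=
  Metric.ball_subset_ball h.lt.le (h.mem_ball_of_half ht)

theorem mem_ball_Tb {t : ℂ} (ht : t ∈ halfDiscBar (T / 2)) : t ∈ Metric.ball (0 : ℂ) Tb :=
  Metric.ball_subset_ball h.le_Tb (h.mem_ball_of_half ht)

theorem norm_kernCore_le {t : ℂ} (ht : t ∈ halfDiscBar (T / 2))
    (z : (Fin ν → ℂ) × (Fin ν → ℂ)) {w : Fin n → ℝ × EuclideanSpace ℝ (Fin ν)}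
    (hw : w ∈ orderedSet ν n 1) :
    ‖kernCore G W V H g n (t, z) w‖ ≤ Real.exp (ν * pathBound ν K * ‖z‖ * ∑ j, ‖(w j).2‖) := by
  rw [kernCore, norm_smul, Complex.norm_exp]
  refine (mul_le_of_le_one_right (Real.exp_pos _).le (h.pot.norm_gProd_le _ _)).trans
    (Real.exp_le_exp.2 ?_)
  rw [Complex.add_re, Complex.neg_re]
  have h1 := h.re_quadPhase_nonneg hw ht
  have h2 : (Complex.I * linPhase G V H (t, z) w).re
      ≤ ν * pathBound ν K * ‖z‖ * ∑ j, ‖(w j).2‖ := by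
    refine (Complex.re_le_norm _).trans ?_
    rw [norm_mul, Complex.norm_I, one_mul]
    exact h.phase.norm_linPhase_le (h.mem_ball_r ht) z hw
  change -(t * quadPhase G W t w).re + _ ≤ _
  linarith

theorem integrable_kernCore {t : ℂ} (ht : t ∈ halfDiscBar (T / 2))
    (z : (Fin ν → ℂ) × (Fin ν → ℂ)) (n : ℕ) :
    Integrable (kernCore G W V H g n (t, z)) (seriesMeasure m n) := by
  have := h.isFiniteMeasure
  have : ProperSpace 𝓜 := FiniteDimensional.proper ℂ 𝓜
  exact (integrable_orderedSet_exp h.pot.moments (ν * pathBound ν K * ‖z‖) n zero_le_one).1.mono'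
    (h.phase.measurable_kernCore h.pot.meas _).aestronglyMeasurable
    (ae_seriesMeasure fun w hw => h.norm_kernCore_le ht z hw)

theorem isExpQuad {t : ℂ} (ht : t ∈ halfDiscBar (T / 2)) {s : Fin n → ℝ}
    (hs : s ∈ openSimplex n) :
    IsExpQuad (fun j k => t • propK A B C t (s j) (s k)) (orderedProd c t s)
      (fourierMeasure (Measure.pi fun _ => m) fun ξ =>
        Complex.exp (-(t * phaseQ G W t s ξ)) • gProd g t fun j => (s j, ξ j)) := by
  have := h.isFiniteMeasure
  have : ProperSpace 𝓜 := FiniteDimensional.proper ℂ 𝓜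
  have hs' : ∀ j, s j ∈ Set.Ioc (0 : ℝ) 1 := fun j => ⟨(hs.2 j).1, (hs.2 j).2.le⟩
  have hq : ∀ ξ, quadForm (fun j k => t • propK A B C t (s j) (s k)) ξ = t * phaseQ G W t s ξ :=
    h.phase.quadForm_propK (h.mem_ball_r ht) hs'
  have hgm : Measurable fun ξ : Fin n → EuclideanSpace ℝ (Fin ν) =>
      gProd g t fun j => (s j, ξ j) :=
    (measurable_gProd h.pot.meas t).comp (by fun_prop)
  refine ⟨Measure.pi fun _ => m, fun ξ => gProd g t fun j => (s j, ξ j), inferInstance,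
    hasExpMoments_of_bounded h.pot.moments hgm fun ξ => h.pot.norm_gProd_le _ _, ?_,
    h.pot.orderedProd_eq (h.mem_ball_Tb ht) fun j => Set.Ioc_subset_Icc_self (hs' j), ?_⟩
  · simp only [hq]
    refine hasExpMoments_of_bounded h.pot.moments (Measurable.smul ?_ hgm) fun ξ => ?_
    · refine (Measurable.const_mul ?_ t).neg.cexp
      exact (measurable_phaseQ h.phase.holG.meas h.phase.holW.meas t).comp
        (f := fun ξ => (s, ξ)) (by fun_prop)
    · rw [norm_smul, Complex.norm_exp, Complex.neg_re]
      refine (mul_le_of_le_one_right (Real.exp_pos _).le (h.pot.norm_gProd_le _ _)).trans ?_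
      rw [Real.exp_le_one_iff, neg_nonpos]
      exact h.re_nonneg n s hs' ξ t ⟨ht.1.trans h.half_lt, ht.2⟩
  · simp only [hq]

theorem vIntegrand_eq {t : ℂ} (ht : t ∈ halfDiscBar (T / 2)) (x y : Fin ν → ℂ) {s : Fin n → ℝ}
    (hs : s ∈ openSimplex n) :
    vIntegrand A B C c n t x y s
      = ∫ ξ, kernCore G W V H g n (t, x, y) (fun j => (s j, ξ j)) ∂Measure.pi fun _ => m := by
  rw [vIntegrand, expQuad_eq (h.isExpQuad ht hs), fourierMeasure]
  refine integral_congr_ae (Eventually.of_forall fun ξ => ?_)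
  have h1 : ∀ j, qNat A B C t x y (s j) = cPath G V H t x y (s j) := fun j =>
    h.phase.qNat_eq (h.mem_ball_r ht) x y ⟨(hs.2 j).1.le, (hs.2 j).2.le⟩
  simp only [h1, kernCore, smul_smul, ← Complex.exp_add, linPhase, quadPhase]
  rw [add_comm]

theorem measurableSet_openSimplex' : MeasurableSet (openSimplex n) := by
  have h1 : openSimplex n = (⋂ i, ⋂ j, {w | i < j → w i < w j}) ∩
      ⋂ j, {w | w j ∈ Set.Ioo (0 : ℝ) 1} := by
    ext w
    simp [openSimplex, StrictMono]
  rw [h1]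
  refine (MeasurableSet.iInter fun i => MeasurableSet.iInter fun j => ?_).inter
    (MeasurableSet.iInter fun j => measurable_pi_apply j measurableSet_Ioo)
  by_cases h : i < j
  · simpa [h] using measurableSet_lt (measurable_pi_apply (X := fun _ : Fin n => ℝ) i)
      (measurable_pi_apply j)
  · simp [h]

theorem integrableOn_vIntegrand {t : ℂ} (ht : t ∈ halfDiscBar (T / 2)) (x y : Fin ν → ℂ) (n : ℕ) :
    IntegrableOn (vIntegrand A B C c n t x y) (openSimplex n) := by
  have := h.isFiniteMeasure
  refine (integral_orderedSet_eq (h.integrable_kernCore ht (x, y) n)).1.congr_fun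
    (fun s hs => (h.vIntegrand_eq ht x y hs).symm) h.measurableSet_openSimplex'

theorem vTerm_eq {t : ℂ} (ht : t ∈ halfDiscBar (T / 2)) (x y : Fin ν → ℂ) (n : ℕ) :
    vTerm A B C c n t x y = ∫ w, kern G W V H g n (t, x, y) w ∂seriesMeasure m n := by
  have := h.isFiniteMeasure
  unfold kern
  rw [integral_smul, vTerm, (integral_orderedSet_eq (h.integrable_kernCore ht (x, y) n)).2]
  congr 1
  exact setIntegral_congr_fun h.measurableSet_openSimplex' fun s hs => h.vIntegrand_eq ht x y hs

theorem integral_kern_zero (p : ℂ × (Fin ν → ℂ) × (Fin ν → ℂ)) :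
    ∫ w, kern G W V H g 0 p w ∂seriesMeasure m 0 = 1 := by
  have := h.isFiniteMeasure
  have : CompleteSpace 𝓜 := FiniteDimensional.complete ℂ 𝓜
  have h1 : ∀ w, kern G W V H g 0 p w = 1 := by
    intro w
    simp [kern, kernCore, quadPhase, phaseQ, phaseDens, waveVec, avg, linPhase, gProd]
  have h2 : orderedSet ν 0 1 = Set.univ := by
    ext w; simp [orderedSet, Subsingleton.strictMono]
  simp only [h1]
  rw [seriesMeasure, h2, pointMeasure, Measure.pi_of_empty fun _ : Fin 0 =>
    (volume : Measure ℝ).prod m]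
  simp

/-- The deformation series as a series of integrals over configurations. -/
theorem pConj_eq {t : ℂ} (ht : t ∈ halfDiscBar (T / 2)) (x y : Fin ν → ℂ) :
    pConj A B C c t x y = ∑' n, ∫ w, kern G W V H g n (t, x, y) w ∂seriesMeasure m n := by
  have hs := (h.smoothFamily.summable_norm (p := (t, x, y)) ⟨ht, trivial⟩).of_norm
  rw [hs.tsum_eq_zero_add, h.integral_kern_zero, pConj]
  simp only [h.vTerm_eq ht]

theorem seriesWellDefined {t : ℂ} (ht : t ∈ halfDiscBar (T / 2)) (x y : Fin ν → ℂ) :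
    SeriesWellDefined A B C c t x y := by
  refine ⟨h.phase.solvable t (h.mem_ball_r ht) _ _, h.phase.solvable t (h.mem_ball_r ht) _ _,
    fun n _ => ⟨fun s hs => ⟨_, h.isExpQuad ht hs⟩, h.integrableOn_vIntegrand ht x y n⟩, ?_⟩
  simp only [h.vTerm_eq ht]
  exact (summable_nat_add_iff 1).2 (h.smoothFamily.summable_norm (p := (t, x, y)) ⟨ht, trivial⟩)

theorem contDiffOn_pConj :
    ContDiffOn ℂ ∞ (fun p : ℂ × (Fin ν → ℂ) × (Fin ν → ℂ) => pConj A B C c p.1 p.2.1 p.2.2)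
      (halfDiscBar (T / 2) ×ˢ Set.univ) := by
  have : CompleteSpace 𝓜 := FiniteDimensional.complete ℂ 𝓜
  exact h.smoothFamily.contDiffOn.congr fun p hp => h.pConj_eq hp.1 _ _

theorem analyticOnNhd_pConj :
    AnalyticOnNhd ℂ
      (fun p : ℂ × (Fin ν → ℂ) × (Fin ν → ℂ) => pConj A B C c p.1 p.2.1 p.2.2)
      (halfDisc (T / 2) ×ˢ Set.univ) := by
  have : CompleteSpace 𝓜 := FiniteDimensional.complete ℂ 𝓜
  exact analyticOnNhd_of_contDiffOn (isOpen_halfDisc.prod isOpen_univ)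
    (h.contDiffOn_pConj.mono (Set.prod_mono halfDisc_subset_halfDiscBar le_rfl))

theorem smoothEntireValued_pConj :
    SmoothEntireValued (halfDiscBar (T / 2))
      (fun (t : ℂ) (p : (Fin ν → ℂ) × (Fin ν → ℂ)) => pConj A B C c t p.1 p.2) := by
  have : CompleteSpace 𝓜 := FiniteDimensional.complete ℂ 𝓜
  exact smoothEntireValued_of_contDiffOn convex_halfDiscBar
    (uniqueDiffOn_halfDiscBar (half_pos h.pos)) h.contDiffOn_pConj

end Deformation

end Series

end

end HeatDeformation

namespace HeatDeformation

noncomputable section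

set_option linter.unusedSectionVars false

section TimeJet

/-! ### Bounds on the imaginary axis -/

theorem SmoothFamily.clm_tsum {X : Type} [NormedAddCommGroup X] [NormedSpace ℂ X]
    {Ω : ℕ → Type} [∀ n, MeasurableSpace (Ω n)] {F G : Type*} [NormedAddCommGroup F]
    [NormedSpace ℂ F] [CompleteSpace F] [NormedAddCommGroup G] [NormedSpace ℂ G] [CompleteSpace G]
    {P : ∀ n, Measure (Ω n)} {O D : Set X} {I : ∀ n, X → Ω n → F}
    (h : SmoothFamily P O D I) (L : F →L[ℂ] G) {p : X} (hp : p ∈ D) :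
    L (∑' n, ∫ w, I n p w ∂P n) = ∑' n, ∫ w, L (I n p w) ∂P n := by
  rw [L.map_tsum (h.summable_norm hp).of_norm]
  exact tsum_congr fun n => (L.integral_comp_comm (h.integrable hp n)).symm

variable {Z : Type} [NormedAddCommGroup Z] [NormedSpace ℂ Z] [FiniteDimensional ℂ Z]
  {F : Type*} [NormedAddCommGroup F] [NormedSpace ℂ F]

/-- The derivative in the time direction of a function on the product. -/
def jetDeriv (f : ℂ × Z → F) (p : ℂ × Z) : F := fderiv ℂ f p (1, 0)

theorem contDiffOn_iterate_jetDeriv {f : ℂ × Z → F} {O : Set (ℂ × Z)} (hO : IsOpen O)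
    (hf : ContDiffOn ℂ ∞ f O) (a : ℕ) : ContDiffOn ℂ ∞ (jetDeriv^[a] f) O := by
  induction a with
  | zero => exact hf
  | succ a ih =>
    rw [Function.iterate_succ_apply']
    exact (ih.fderiv_of_isOpen hO (by simp)).clm_apply contDiffOn_const

theorem iterate_jetDeriv_eq {f : ℂ × Z → F} {B : Set ℂ} (hB : IsOpen B)
    (hf : ContDiffOn ℂ ∞ f (B ×ˢ Set.univ)) (z : Z) (a : ℕ) {t : ℂ} (ht : t ∈ B) :
    jetDeriv^[a] f (t, z) = iteratedDeriv a (fun t => f (t, z)) t := by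
  induction a generalizing t with
  | zero => simp
  | succ a ih =>
    rw [Function.iterate_succ_apply', iteratedDeriv_succ]
    have h1 : iteratedDeriv a (fun t => f (t, z)) =ᶠ[𝓝 t] fun t => jetDeriv^[a] f (t, z) := by
      filter_upwards [hB.mem_nhds ht] with s hs using (ih hs).symm
    rw [h1.deriv_eq]
    have h2 := (((contDiffOn_iterate_jetDeriv (hB.prod isOpen_univ) hf a).differentiableOn
      (by simp)).differentiableAt ((hB.prod isOpen_univ).mem_nhds
        (⟨ht, trivial⟩ : (t, z) ∈ B ×ˢ Set.univ))).hasFDerivAt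
    exact (h2.comp_hasDerivAt t ((hasDerivAt_id t).prodMk (hasDerivAt_const t z))).deriv.symm

variable {Ω : ℕ → Type} [∀ n, MeasurableSpace (Ω n)] {P : ∀ n, Measure (Ω n)} {O : Set (ℂ × Z)}
  {D : Set ℂ} {I : ∀ n, ℂ × Z → Ω n → F}

theorem SmoothFamily.iterate_jetDeriv (h : SmoothFamily P O (D ×ˢ Set.univ) I) (a : ℕ) :
    SmoothFamily P O (D ×ˢ Set.univ) fun n p w => jetDeriv^[a] (fun p => I n p w) p := by
  induction a with
  | zero => exact h
  | succ a ih =>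
    simp only [Function.iterate_succ_apply']
    exact ih.fderiv.clm_comp (ContinuousLinearMap.apply ℂ F ((1, 0) : ℂ × Z))

theorem SmoothFamily.iterate_timeDeriv [CompleteSpace F] (hD : UniqueDiffOn ℂ D)
    (h : SmoothFamily P O (D ×ˢ Set.univ) I) (a : ℕ) {t : ℂ} (ht : t ∈ D) (z : Z) :
    (timeDeriv D)^[a] (fun t z => ∑' n, ∫ w, I n (t, z) w ∂P n) t z
      = ∑' n, ∫ w, jetDeriv^[a] (fun p => I n p w) (t, z) ∂P n := by
  induction a generalizing t z with
  | zero => rfl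
  | succ a ih =>
    have hp : (t, z) ∈ D ×ˢ (Set.univ : Set Z) := ⟨ht, trivial⟩
    simp only [Function.iterate_succ_apply']
    have h1 : ∀ p ∈ D ×ˢ (Set.univ : Set Z),
        (timeDeriv D)^[a] (fun t z => ∑' n, ∫ w, I n (t, z) w ∂P n) p.1 p.2
          = ∑' n, ∫ w, jetDeriv^[a] (fun p => I n p w) p ∂P n := fun p hp => ih hp.1 p.2
    rw [timeDeriv, fderivWithin_congr h1 (h1 _ hp),
      ((h.iterate_jetDeriv a).hasFDerivWithinAt hp).fderivWithin
        ((hD.prod uniqueDiffOn_univ) _ hp)]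
    exact (h.iterate_jetDeriv a).fderiv.clm_tsum
      (ContinuousLinearMap.apply ℂ F ((1, 0) : ℂ × Z)) hp

end TimeJet

variable {ν n : ℕ} {𝓜 : Type*} [NormedRing 𝓜] [NormedAlgebra ℂ 𝓜] [NormOneClass 𝓜]
  [FiniteDimensional ℂ 𝓜] [MeasurableSpace 𝓜] [BorelSpace 𝓜]
  {A B C G W V H : ℂ → Matrix (Fin ν) (Fin ν) ℂ} {r K Tb T : ℝ}
  {c : ℂ → (Fin ν → ℂ) → 𝓜} {m : Measure (EuclideanSpace ℝ (Fin ν))}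
  {g : ℂ → EuclideanSpace ℝ (Fin ν) → 𝓜}

section ImaginaryAxis

theorem cPath_add (t : ℂ) (x y x' y' : Fin ν → ℂ) (s : ℝ) :
    cPath G V H t (x + x') (y + y') s = cPath G V H t x y s + cPath G V H t x' y' s := by
  have : x + x' - (V t).mulVec (y + y') = (x - (V t).mulVec y) + (x' - (V t).mulVec y') := by
    rw [Matrix.mulVec_add]; abel
  rw [cPath, this]
  simp only [cPath, Matrix.mulVec_add, smul_add]
  abel

theorem linPhase_add (t : ℂ) (z z' : (Fin ν → ℂ) × (Fin ν → ℂ))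
    (w : Fin n → ℝ × EuclideanSpace ℝ (Fin ν)) :
    linPhase G V H (t, z + z') w = linPhase G V H (t, z) w + linPhase G V H (t, z') w := by
  simp only [linPhase, ← Finset.sum_add_distrib, Prod.fst_add, Prod.snd_add, cPath_add, cdot,
    add_dotProduct]

theorem Phase.im_linPhase (h : Phase A B C r K G W V H) {τ : ℝ} (hτ : |τ| < r)
    (x y : EuclideanSpace ℝ (Fin ν)) {w : Fin n → ℝ × EuclideanSpace ℝ (Fin ν)}
    (hw : w ∈ orderedSet ν n 1) :
    (linPhase G V H (Complex.I * τ, toC x, toC y) w).im = 0 := by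
  rw [← Complex.conj_eq_iff_im]
  have hG : ∀ j i k, (starRingEnd ℂ) (G (Complex.I * τ * (w j).1) i k)
      = G (Complex.I * τ * (w j).1) i k := fun j i k => by
    have h1 : |τ * (w j).1| < r := by
      rw [abs_mul, abs_of_nonneg (hw.2 j).1.le]
      exact (mul_le_of_le_one_right (abs_nonneg _) (hw.2 j).2.le).trans_lt hτ
    simpa [mul_assoc] using h.holG.conj_apply h1 i k
  have hV : ∀ j i k, (starRingEnd ℂ) (V (Complex.I * τ * (w j).1) i k)
      = V (Complex.I * τ * (w j).1) i k := fun j i k => by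
    have h1 : |τ * (w j).1| < r := by
      rw [abs_mul, abs_of_nonneg (hw.2 j).1.le]
      exact (mul_le_of_le_one_right (abs_nonneg _) (hw.2 j).2.le).trans_lt hτ
    simpa [mul_assoc] using h.holV.conj_apply h1 i k
  simp only [linPhase, cdot, dotProduct, cPath, Matrix.mulVec, Pi.add_apply, Pi.smul_apply,
    Pi.sub_apply, smul_eq_mul, toC, map_sum, map_mul, map_add, map_sub, Complex.conj_ofReal, hG,
    hV, h.holV.conj_apply hτ, h.holH.conj_apply hτ]

namespace Deformation

variable (h : Deformation A B C c r K Tb T G W V H m g)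
include h

/-- The Lipschitz constant of the linear phase in time. -/
theorem re_linPhase_le {τ : ℝ} (hτ : τ ∈ Set.Ioo (-(T / 2)) (T / 2))
    (x : EuclideanSpace ℝ (Fin ν) × EuclideanSpace ℝ (Fin ν))
    {z : (Fin ν → ℂ) × (Fin ν → ℂ)} (hz : z ∈ Metric.ball (toCL₂ ν x) 1)
    {w : Fin n → ℝ × EuclideanSpace ℝ (Fin ν)} (hw : w ∈ orderedSet ν n 1) {t : ℂ}
    (ht : ‖t - Complex.I * τ‖ ≤ T / 4 / (wt w ^ 2 * (1 + ‖x‖))) :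
    (Complex.I * linPhase G V H (t, z) w).re
      ≤ ν * pathBound ν K / ((r - T) / 2) + ν * pathBound ν K * ∑ j, ‖(w j).2‖ := by
  have hT := h.pos
  have hb := pathBound_nonneg (ν := ν) h.phase.nonneg
  have hrT : 0 < (r - T) / 2 := by linarith [h.lt]
  have hwt := one_le_wt w
  have hsw : ∑ j, ‖(w j).2‖ ≤ wt w ^ 2 := by
    have h1 : ∑ j, ‖(w j).2‖ ≤ wt w := le_add_of_nonneg_left zero_le_one
    exact h1.trans (le_self_pow₀ hwt two_ne_zero)
  have hs0 : 0 ≤ ∑ j, ‖(w j).2‖ := Finset.sum_nonneg fun _ _ => norm_nonneg _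
  have hden : 1 ≤ wt w ^ 2 * (1 + ‖x‖) := by
    nlinarith [one_le_pow₀ hwt (n := 2), norm_nonneg x]
  have ht0 : Complex.I * τ ∈ halfDiscBar (T / 2) := I_mul_mem_halfDiscBar hτ
  have htT : t ∈ Metric.ball (0 : ℂ) T := by
    rw [mem_ball_zero_iff]
    have h1 : ‖t‖ ≤ ‖t - Complex.I * τ‖ + ‖Complex.I * τ‖ := by
      simpa using norm_add_le (t - Complex.I * τ) (Complex.I * τ)
    have h2 := ht.trans (div_le_self (by positivity) hden)
    linarith [ht0.1]
  have htr := Metric.ball_subset_ball h.lt.le htT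
  set X := toCL₂ ν x with hX
  have e1 : linPhase G V H (t, z) w = linPhase G V H (Complex.I * τ, X) w
      + (linPhase G V H (t, X) w - linPhase G V H (Complex.I * τ, X) w)
      + linPhase G V H (t, z - X) w := by
    have : z = X + (z - X) := by abel
    conv_lhs => rw [this, linPhase_add]
    ring
  have e2 : (Complex.I * linPhase G V H (Complex.I * τ, X) w).re = 0 := by
    have hτr : |τ| < r := by
      rw [abs_lt]; constructor <;> linarith [hτ.1, hτ.2, h.lt]
    rw [Complex.I_mul_re]
    have := h.phase.im_linPhase hτr x.1 x.2 hw
    rw [hX]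
    change -(linPhase G V H (Complex.I * τ, toC x.1, toC x.2) w).im = 0
    rw [this, neg_zero]
  have e3 : ‖linPhase G V H (t, z - X) w‖ ≤ ν * pathBound ν K * ∑ j, ‖(w j).2‖ := by
    refine (h.phase.norm_linPhase_le htr _ hw).trans ?_
    have h1 : ‖z - X‖ ≤ 1 := (mem_ball_iff_norm.1 hz).le
    exact mul_le_mul_of_nonneg_right (mul_le_of_le_one_right (by positivity) h1) hs0
  have e4 : ‖linPhase G V H (t, X) w - linPhase G V H (Complex.I * τ, X) w‖
      ≤ ν * pathBound ν K / ((r - T) / 2) := by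
    refine (norm_sub_le_of_bounded (b := fun t => linPhase G V H (t, X) w) h.lt
      (M := ν * pathBound ν K * ‖X‖ * ∑ j, ‖(w j).2‖) ?_
      (fun s hs => h.phase.norm_linPhase_le hs X hw) (h.mem_ball_of_half ht0) htT).trans ?_
    · exact ((h.phase.contDiffOn_linPhase hw).differentiableOn (by simp)).comp
        (f := fun t : ℂ => (t, X)) (by fun_prop) fun s hs => ⟨hs, trivial⟩
    · have h1 : ‖X‖ ≤ ‖x‖ := norm_toCL₂_apply_le x
      have h2 : ‖X‖ * (∑ j, ‖(w j).2‖) * ‖t - Complex.I * τ‖ ≤ 1 := by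
        calc ‖X‖ * (∑ j, ‖(w j).2‖) * ‖t - Complex.I * τ‖
            ≤ (1 + ‖x‖) * wt w ^ 2 * (T / 4 / (wt w ^ 2 * (1 + ‖x‖))) := by
              gcongr
              linarith
          _ = T / 4 := by field_simp
          _ ≤ 1 := by linarith [h.le_one]
      calc _ = ν * pathBound ν K / ((r - T) / 2)
            * (‖X‖ * (∑ j, ‖(w j).2‖) * ‖t - Complex.I * τ‖) := by ring
        _ ≤ _ := mul_le_of_le_one_right (by positivity) h2
  rw [e1, mul_add, mul_add, Complex.add_re, Complex.add_re, e2]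
  have e5 := Complex.re_le_norm (Complex.I * linPhase G V H (t, z - X) w)
  have e6 := Complex.re_le_norm
    (Complex.I * (linPhase G V H (t, X) w - linPhase G V H (Complex.I * τ, X) w))
  rw [norm_mul, Complex.norm_I, one_mul] at e5 e6
  linarith

theorem norm_iteratedDeriv_kern_le (a : ℕ) {τ : ℝ} (hτ : τ ∈ Set.Ioo (-(T / 2)) (T / 2))
    (x : EuclideanSpace ℝ (Fin ν) × EuclideanSpace ℝ (Fin ν))
    {z : (Fin ν → ℂ) × (Fin ν → ℂ)} (hz : z ∈ Metric.ball (toCL₂ ν x) 1)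
    {w : Fin n → ℝ × EuclideanSpace ℝ (Fin ν)} (hw : w ∈ orderedSet ν n 1) :
    ‖iteratedDeriv a (fun t => kern G W V H g n (t, z) w) (Complex.I * τ)‖
      ≤ (1 + ‖x‖) ^ a * (a.factorial * (4 / T) ^ a * ((2 * a).factorial * Real.exp 1)
          * Real.exp (quadBound ν r K T + ν * pathBound ν K / ((r - T) / 2))
          * Real.exp ((ν * pathBound ν K + 1) * ∑ j, ‖(w j).2‖)) := by
  have : CompleteSpace 𝓜 := FiniteDimensional.complete ℂ 𝓜
  have hT := h.pos
  have hwt := one_le_wt w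
  have hwt2 : (1 : ℝ) ≤ wt w ^ 2 := one_le_pow₀ hwt
  have hden : wt w ^ 2 ≤ wt w ^ 2 * (1 + ‖x‖) :=
    le_mul_of_one_le_right (by positivity) (by linarith [norm_nonneg x])
  have ht0 : Complex.I * τ ∈ halfDiscBar (T / 2) := I_mul_mem_halfDiscBar hτ
  set ρ := T / 4 / (wt w ^ 2 * (1 + ‖x‖)) with hρ
  have hρ0 : 0 < ρ := by positivity
  have hρT : ρ ≤ T / 4 := div_le_self (by positivity) (hwt2.trans hden)
  have hsub : Metric.closedBall (Complex.I * τ) ρ ⊆ Metric.ball 0 T := by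
    intro t ht
    rw [mem_ball_zero_iff]
    rw [mem_closedBall_iff_norm] at ht
    have h1 : ‖t‖ ≤ ‖t - Complex.I * τ‖ + ‖Complex.I * τ‖ := by
      simpa using norm_add_le (t - Complex.I * τ) (Complex.I * τ)
    linarith [ht0.1]
  have hd : DifferentiableOn ℂ (fun t => kern G W V H g n (t, z) w) (Metric.ball 0 T) :=
    ((h.phase.contDiffOn_kern h.pot h.lt.le h.le_Tb hw).differentiableOn (by simp)).comp
      (f := fun t : ℂ => (t, z)) (by fun_prop) fun s hs => ⟨hs, trivial⟩
  have hC := Complex.norm_iteratedDeriv_le_of_forall_mem_sphere_norm_le a hρ0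
    (DifferentiableOn.diffContOnCl (by
      rw [closure_ball _ hρ0.ne']; exact hd.mono hsub))
    (C := Real.exp (quadBound ν r K T + (ν * pathBound ν K / ((r - T) / 2)
      + ν * pathBound ν K * ∑ j, ‖(w j).2‖))) (fun t ht => by
      have ht' := mem_sphere_iff_norm.1 ht
      refine (h.phase.norm_kern_le h.pot h.lt h.le_one hw (h.mem_ball_of_half ht0)
        (h.re_quadPhase_nonneg hw ht0) (hsub (Metric.sphere_subset_closedBall ht)) ?_ z).trans ?_
      · rw [ht', hρ]
        gcongr
        linarith [h.le_one]
      · rw [Real.exp_le_exp]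
        gcongr
        exact h.re_linPhase_le hτ x hz hw ht'.le)
  refine hC.trans ?_
  have e1 : (a.factorial : ℝ) * Real.exp (quadBound ν r K T + (ν * pathBound ν K / ((r - T) / 2)
      + ν * pathBound ν K * ∑ j, ‖(w j).2‖)) / ρ ^ a
      = (1 + ‖x‖) ^ a * (a.factorial * (4 / T) ^ a
        * Real.exp (quadBound ν r K T + ν * pathBound ν K / ((r - T) / 2))
        * Real.exp (ν * pathBound ν K * ∑ j, ‖(w j).2‖) * wt w ^ (2 * a)) := by
    rw [← add_assoc, Real.exp_add, hρ, div_pow, div_pow, div_pow, mul_pow, ← pow_mul]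
    field_simp
  rw [e1, add_mul, one_mul, Real.exp_add (ν * pathBound ν K * ∑ j, ‖(w j).2‖)]
  have h5 := wt_pow_le w (2 * a)
  refine mul_le_mul_of_nonneg_left ?_ (by positivity)
  calc _ ≤ a.factorial * (4 / T) ^ a
        * Real.exp (quadBound ν r K T + ν * pathBound ν K / ((r - T) / 2))
        * Real.exp (ν * pathBound ν K * ∑ j, ‖(w j).2‖)
        * ((2 * a).factorial * Real.exp 1 * Real.exp (∑ j, ‖(w j).2‖)) :=
        mul_le_mul_of_nonneg_left h5 (by positivity)
    _ = _ := by ring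

theorem cInftyB1_pConj :
    CInftyB1 (T / 2)
      (fun (t : ℂ) (p : EuclideanSpace ℝ (Fin ν) × EuclideanSpace ℝ (Fin ν)) =>
        pConj A B C c t (toC p.1) (toC p.2)) := by
  have : CompleteSpace 𝓜 := FiniteDimensional.complete ℂ 𝓜
  have := h.isFiniteMeasure
  have hT2 := half_pos h.pos
  refine cInftyB1_of_bound (H := fun t z => pConj A B C c t z.1 z.2) hT2 h.contDiffOn_pConj
    fun a => ?_
  set D := a.factorial * (4 / T) ^ a * ((2 * a).factorial * Real.exp 1)
    * Real.exp (quadBound ν r K T + ν * pathBound ν K / ((r - T) / 2)) with hD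
  obtain ⟨h1, h2⟩ := summable_exp_weight h.pot.moments D (ν * pathBound ν K + 1)
  have hD0 : 0 ≤ D := by have := h.pos; positivity
  refine ⟨∑' n, ∫ w, D * Real.exp ((ν * pathBound ν K + 1) * ∑ j, ‖(w j).2‖) ∂seriesMeasure m n,
    tsum_nonneg fun n => integral_nonneg fun w => mul_nonneg hD0 (Real.exp_pos _).le,
    fun τ hτ x z hz => ?_⟩
  have ht0 : Complex.I * τ ∈ halfDiscBar (T / 2) := I_mul_mem_halfDiscBar hτ
  have e0 := iteratedDeriv_imaginary_axis hT2 z a (H := fun t z => ∑' n, ∫ w,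
    kern G W V H g n (t, z) w ∂seriesMeasure m n) h.smoothFamily.contDiffOn hτ
  have e1 : iteratedDeriv a (fun τ' : ℝ => pConj A B C c (Complex.I * τ') z.1 z.2) τ
      = iteratedDeriv a (fun τ' : ℝ => ∑' n, ∫ w,
        kern G W V H g n (Complex.I * τ', z) w ∂seriesMeasure m n) τ := by
    refine Filter.EventuallyEq.iteratedDeriv_eq a ?_
    filter_upwards [isOpen_Ioo.mem_nhds hτ] with τ' hτ'
    exact h.pConj_eq (I_mul_mem_halfDiscBar hτ') z.1 z.2
  rw [e1, e0, h.smoothFamily.iterate_timeDeriv (uniqueDiffOn_halfDiscBar hT2) a ht0 z, norm_smul,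
    norm_pow, Complex.norm_I, one_pow, one_mul, mul_comm (tsum _), ← tsum_mul_left]
  refine tsum_of_norm_bounded (h2.mul_left ((1 + ‖x‖) ^ a)).hasSum fun n => ?_
  rw [← integral_const_mul]
  refine norm_integral_le_of_norm_le ((h1 n).const_mul _) (ae_seriesMeasure fun w hw => ?_)
  rw [iterate_jetDeriv_eq Metric.isOpen_ball
    (h.phase.contDiffOn_kern h.pot h.lt.le h.le_Tb hw) z a (h.mem_ball_of_half ht0)]
  exact h.norm_iteratedDeriv_kern_le a hτ x hz hw

end Deformation

end ImaginaryAxis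

end

end HeatDeformation

namespace HeatDeformation

noncomputable section

set_option linter.unusedSectionVars false

variable {ν n : ℕ} {𝓜 : Type*} [NormedRing 𝓜] [NormedAlgebra ℂ 𝓜] [NormOneClass 𝓜]
  [FiniteDimensional ℂ 𝓜] [MeasurableSpace 𝓜] [BorelSpace 𝓜]
  {A B C G W V H : ℂ → Matrix (Fin ν) (Fin ν) ℂ} {r K Tb T : ℝ}
  {c : ℂ → (Fin ν → ℂ) → 𝓜} {m : Measure (EuclideanSpace ℝ (Fin ν))}
  {g : ℂ → EuclideanSpace ℝ (Fin ν) → 𝓜}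

section Scaling

/-! ### Scaling of the times -/

/-- Multiplication of all times by `a`. -/
def scalePoints (a : ℝ) (w : Fin n → ℝ × EuclideanSpace ℝ (Fin ν)) :
    Fin n → ℝ × EuclideanSpace ℝ (Fin ν) := fun j => (a * (w j).1, (w j).2)

/-- `scalePoints` as an equivalence. -/
def scaleEquiv (ν n : ℕ) {a : ℝ} (ha : a ≠ 0) : (Fin n → ℝ × EuclideanSpace ℝ (Fin ν)) ≃ᵐ
    (Fin n → ℝ × EuclideanSpace ℝ (Fin ν)) :=
  ((MeasurableEquiv.arrowProdEquivProdArrow ℝ (EuclideanSpace ℝ (Fin ν)) (Fin n)).trans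
    (MeasurableEquiv.prodCongr (MeasurableEquiv.smul₀ a ha) (MeasurableEquiv.refl _))).trans
    (MeasurableEquiv.arrowProdEquivProdArrow ℝ (EuclideanSpace ℝ (Fin ν)) (Fin n)).symm

theorem coe_scaleEquiv {a : ℝ} (ha : a ≠ 0) : ⇑(scaleEquiv ν n ha) = scalePoints a := rfl

theorem measurePreserving_scaleEquiv [SigmaFinite m] {a : ℝ} (ha : 0 < a) :
    MeasurePreserving (scaleEquiv ν n ha.ne') (pointMeasure m n)
      (ENNReal.ofReal (a ^ n)⁻¹ • pointMeasure m n) := by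
  have h1 : MeasurePreserving (fun s : Fin n → ℝ => a • s) volume
      (ENNReal.ofReal (a ^ n)⁻¹ • (volume : Measure (Fin n → ℝ))) := by
    refine ⟨measurable_const_smul a, ?_⟩
    rw [Measure.map_addHaar_smul _ ha.ne', Module.finrank_fintype_fun_eq_card, Fintype.card_fin,
      abs_of_nonneg (by positivity)]
  have h2 := h1.prod (MeasurePreserving.id (Measure.pi fun _ : Fin n => m))
  rw [Measure.prod_smul_left] at h2
  have h3 := (measurePreserving_points (m := m) n).symm
  exact ((h3.smul_measure (ENNReal.ofReal (a ^ n)⁻¹)).comp h2).comp (measurePreserving_points n)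

theorem preimage_scaleEquiv {a : ℝ} (ha : 0 < a) :
    scaleEquiv ν n ha.ne' ⁻¹' orderedSet ν n a = orderedSet ν n 1 := by
  rw [coe_scaleEquiv]
  ext w
  simp only [Set.mem_preimage, orderedSet, scalePoints, Set.mem_ofPred_eq, StrictMono, Set.mem_Ioo,
    mul_lt_mul_iff_right₀ ha, mul_pos_iff_of_pos_left ha, mul_lt_iff_lt_one_right ha]

theorem integral_scalePoints [SigmaFinite m] {a : ℝ} (ha : 0 < a)
    (q : (Fin n → ℝ × EuclideanSpace ℝ (Fin ν)) → 𝓜) :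
    ∫ w, q (scalePoints a w) ∂seriesMeasure m n
      = ((a : ℂ) ^ n)⁻¹ • ∫ w in orderedSet ν n a, q w ∂pointMeasure m n := by
  rw [seriesMeasure, ← preimage_scaleEquiv ha]
  refine ((measurePreserving_scaleEquiv ha).setIntegral_preimage_emb
    (scaleEquiv ν n ha.ne').measurableEmbedding q _).trans ?_
  rw [Measure.restrict_smul, integral_smul_measure, ENNReal.toReal_ofReal (by positivity)]
  rw [← Complex.ofReal_pow, ← Complex.ofReal_inv, Complex.coe_smul]

/-- The integral of the density of the phase up to the time `a`. -/
def cumPhase (G W : ℂ → Matrix (Fin ν) (Fin ν) ℂ) (t : ℂ)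
    (w : Fin n → ℝ × EuclideanSpace ℝ (Fin ν)) (a : ℝ) : ℂ :=
  ∫ τ in (0 : ℝ)..a, phaseDens G W t (fun j => (w j).1) (fun j => (w j).2) τ

/-- The phase `∑_j X(s_j) · ξ_j` along a path `X`. -/
def pathPhase (X : ℝ → Fin ν → ℂ) (w : Fin n → ℝ × EuclideanSpace ℝ (Fin ν)) : ℂ :=
  ∑ j, cdot (X (w j).1) (w j).2

/-- The integrand of the series on the time interval `[0, a]`, along the path `X`. -/
def kernAt (G W : ℂ → Matrix (Fin ν) (Fin ν) ℂ) (X : ℝ → Fin ν → ℂ)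
    (g : ℂ → EuclideanSpace ℝ (Fin ν) → 𝓜) (t : ℂ) (a : ℝ)
    (w : Fin n → ℝ × EuclideanSpace ℝ (Fin ν)) : 𝓜 :=
  Complex.exp (-(t * cumPhase G W t w a) + Complex.I * pathPhase X w) • gProd g t w

theorem phaseDens_scale {a : ℝ} (ha : 0 < a) (t : ℂ) (s : Fin n → ℝ)
    (ξ : Fin n → EuclideanSpace ℝ (Fin ν)) (τ : ℝ) :
    phaseDens G W (a * t) s ξ τ = phaseDens G W t (fun j => a * s j) ξ (a * τ) := by
  have h1 : ∀ σ : ℝ, (a : ℂ) * t * σ = t * ((a * σ : ℝ) : ℂ) := fun σ => by push_cast; ring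
  have h2 : ∀ j, a * s j / (a * τ) = s j / τ := fun j => mul_div_mul_left _ _ ha.ne'
  simp only [phaseDens, waveVec, avg, h1, h2, mul_le_mul_iff_right₀ ha]

theorem mul_quadPhase_scale {a : ℝ} (ha : 0 < a) (t : ℂ)
    (w : Fin n → ℝ × EuclideanSpace ℝ (Fin ν)) :
    (a : ℂ) * t * quadPhase G W (a * t) w = t * cumPhase G W t (scalePoints a w) a := by
  have h1 := intervalIntegral.smul_integral_comp_mul_left (a := 0) (b := 1)
    (phaseDens G W t (fun j => a * (w j).1) fun j => (w j).2) a
  rw [mul_zero, mul_one] at h1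
  unfold quadPhase phaseQ cumPhase scalePoints
  simp only [phaseDens_scale ha]
  rw [← h1, Complex.real_smul]
  ring

theorem gProd_scale (a : ℝ) (t : ℂ) (w : Fin n → ℝ × EuclideanSpace ℝ (Fin ν)) :
    gProd g (a * t) w = gProd g t (scalePoints a w) := by
  unfold gProd scalePoints
  congr 3
  funext j
  congr 1
  push_cast
  ring

theorem Phase.cPath_cPath (h : Phase A B C r K G W V H) {t : ℂ} (ht : t ∈ Metric.ball (0 : ℂ) r)
    {a : ℝ} (ha : a ∈ Set.Icc (0 : ℝ) 1) (x y : Fin ν → ℂ) (s : ℝ) :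
    cPath G V H (a * t) (cPath G V H t x y a) y s = cPath G V H t x y (a * s) := by
  have hm := mul_ofReal_mem_ball ht ha
  have h1 : ∀ σ : ℝ, (a : ℂ) * t * σ = t * ((a * σ : ℝ) : ℂ) := fun σ => by push_cast; ring
  simp only [cPath, h1]
  rw [mul_comm (a : ℂ) t, add_sub_cancel_right, Matrix.mulVec_smul, Matrix.mulVec_mulVec,
    h.mul_HG hm, Matrix.one_mulVec, Matrix.mulVec_smul, smul_smul]
  push_cast
  rw [mul_comm (s : ℂ)]

theorem Phase.kernCore_scale (h : Phase A B C r K G W V H) {t : ℂ}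
    (ht : t ∈ Metric.ball (0 : ℂ) r) {a : ℝ} (ha : a ∈ Set.Ioc (0 : ℝ) 1) (x y : Fin ν → ℂ)
    (w : Fin n → ℝ × EuclideanSpace ℝ (Fin ν)) :
    kernCore G W V H g n (a * t, cPath G V H t x y a, y) w
      = kernAt G W (cPath G V H t x y) g t a (scalePoints a w) := by
  have h1 : linPhase G V H (a * t, cPath G V H t x y a, y) w
      = pathPhase (cPath G V H t x y) (scalePoints a w) := by
    simp only [linPhase, pathPhase, scalePoints, h.cPath_cPath ht (Set.Ioc_subset_Icc_self ha)]
  rw [kernCore, kernAt, h1, gProd_scale]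
  simp only [mul_quadPhase_scale ha.1]

theorem Phase.integral_kern_scale [SigmaFinite m] (h : Phase A B C r K G W V H) {t : ℂ}
    (ht : t ∈ Metric.ball (0 : ℂ) r) {a : ℝ} (ha : a ∈ Set.Ioc (0 : ℝ) 1) (x y : Fin ν → ℂ)
    (q : (Fin n → ℝ × EuclideanSpace ℝ (Fin ν)) → ℂ) :
    ∫ w, q (scalePoints a w) • kern G W V H g n (a * t, cPath G V H t x y a, y) w
        ∂seriesMeasure m n
      = t ^ n • ∫ w in orderedSet ν n a, q w • kernAt G W (cPath G V H t x y) g t a w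
        ∂pointMeasure m n := by
  have ha0 : (a : ℂ) ≠ 0 := by exact_mod_cast ha.1.ne'
  unfold kern
  simp only [h.kernCore_scale ht ha, smul_comm (q _)]
  rw [integral_smul, integral_scalePoints ha.1 fun w => q w • kernAt G W (cPath G V H t x y) g t a w,
    smul_smul]
  congr 1
  simp only [mul_pow]
  field_simp

namespace Deformation

variable (h : Deformation A B C c r K Tb T G W V H m g)
include h

theorem re_cumPhase_nonneg {t : ℂ} (ht : t ∈ halfDiscBar (T / 2)) {a : ℝ}
    (ha : a ∈ Set.Ioc (0 : ℝ) 1) {w : Fin n → ℝ × EuclideanSpace ℝ (Fin ν)}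
    (hw : ∀ j, (w j).1 ∈ Set.Ioc 0 a) : 0 ≤ (t * cumPhase G W t w a).re := by
  have h1 : w = scalePoints a (scalePoints a⁻¹ w) := by
    funext j
    simp only [scalePoints, ← mul_assoc, mul_inv_cancel₀ ha.1.ne', one_mul]
  rw [h1, ← mul_quadPhase_scale ha.1]
  have h2 := smul_mem_halfDiscBar ht ha.1.le ha.2
  refine h.re_nonneg n _ (fun j => ⟨?_, ?_⟩) _ _ ⟨h2.1.trans h.half_lt, h2.2⟩
  · exact mul_pos (inv_pos.2 ha.1) (hw j).1
  · change a⁻¹ * _ ≤ 1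
    rw [inv_mul_le_iff₀ ha.1, mul_one]
    exact (hw j).2

theorem norm_kernAt_le {t : ℂ} (ht : t ∈ halfDiscBar (T / 2)) {a : ℝ}
    (ha : a ∈ Set.Ioc (0 : ℝ) 1) (x y : Fin ν → ℂ) {w : Fin n → ℝ × EuclideanSpace ℝ (Fin ν)}
    (hw : ∀ j, (w j).1 ∈ Set.Ioc 0 a) :
    ‖kernAt G W (cPath G V H t x y) g t a w‖
      ≤ Real.exp (ν * pathBound ν K * ‖(x, y)‖ * ∑ j, ‖(w j).2‖) := by
  rw [kernAt, norm_smul, Complex.norm_exp]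
  refine (mul_le_of_le_one_right (Real.exp_pos _).le (h.pot.norm_gProd_le _ _)).trans
    (Real.exp_le_exp.2 ?_)
  rw [Complex.add_re, Complex.neg_re]
  have h1 := h.re_cumPhase_nonneg ht ha hw
  have h2 : (Complex.I * pathPhase (cPath G V H t x y) w).re
      ≤ ν * pathBound ν K * ‖(x, y)‖ * ∑ j, ‖(w j).2‖ := by
    refine (Complex.re_le_norm _).trans ?_
    rw [norm_mul, Complex.norm_I, one_mul, pathPhase, Finset.mul_sum]
    refine (norm_sum_le _ _).trans (Finset.sum_le_sum fun j _ => (norm_cdot_le _ _).trans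
      (mul_le_mul_of_nonneg_right ?_ (norm_nonneg _)))
    rw [mul_assoc]
    exact mul_le_mul_of_nonneg_left (h.phase.norm_cPath_le (h.mem_ball_r ht) (x, y)
      ⟨(hw j).1.le, (hw j).2.trans ha.2⟩) (Nat.cast_nonneg _)
  linarith

end Deformation

end Scaling

end

end HeatDeformation

namespace HeatDeformation

noncomputable section

set_option linter.unusedSectionVars false

section DirDeriv

/-! ### Spatial derivatives of the deformation series -/

variable {X : Type} [NormedAddCommGroup X] [NormedSpace ℂ X] {F : Type*} [NormedAddCommGroup F]
  [NormedSpace ℂ F]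

/-- The derivative in the direction `e`. -/
def dirDeriv (e : X) (f : X → F) (p : X) : F := fderiv ℂ f p e

theorem dirDeriv_of_exp {e p : X} {f : X → F} (hf : DifferentiableAt ℂ f p) {κ : ℂ}
    (h : ∀ ε : ℂ, f (p + ε • e) = Complex.exp (ε * κ) • f p) : dirDeriv e f p = κ • f p := by
  have h1 : HasDerivAt (fun ε : ℂ => p + ε • e) e 0 := by
    simpa using ((hasDerivAt_id (0 : ℂ)).smul_const e).const_add p
  have hf' : HasFDerivAt f (fderiv ℂ f p) (p + (0 : ℂ) • e) := by simpa using hf.hasFDerivAt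
  have h2 := hf'.comp_hasDerivAt (0 : ℂ) h1
  have h3 : HasDerivAt (fun ε : ℂ => Complex.exp (ε * κ) • f p) (κ • f p) 0 := by
    have := (((hasDerivAt_id (0 : ℂ)).mul_const κ).cexp).smul_const (f p)
    simpa using this
  refine h2.unique (h3.congr_of_eventuallyEq (Eventually.of_forall fun ε => ?_))
  exact h ε

end DirDeriv

variable {ν n : ℕ} {𝓜 : Type*} [NormedRing 𝓜] [NormedAlgebra ℂ 𝓜] [NormOneClass 𝓜]
  [FiniteDimensional ℂ 𝓜] [MeasurableSpace 𝓜] [BorelSpace 𝓜]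
  {A B C G W V H : ℂ → Matrix (Fin ν) (Fin ν) ℂ} {r K Tb T : ℝ}
  {c : ℂ → (Fin ν → ℂ) → 𝓜} {m : Measure (EuclideanSpace ℝ (Fin ν))}
  {g : ℂ → EuclideanSpace ℝ (Fin ν) → 𝓜}

section Spatial

/-- The direction `v` in the variable `x`. -/
def xDir (v : Fin ν → ℂ) : ℂ × (Fin ν → ℂ) × (Fin ν → ℂ) := (0, v, 0)

theorem kern_add_xDir (p : ℂ × (Fin ν → ℂ) × (Fin ν → ℂ)) (v : Fin ν → ℂ) (ε : ℂ)
    (w : Fin n → ℝ × EuclideanSpace ℝ (Fin ν)) :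
    kern G W V H g n (p + ε • xDir v) w
      = Complex.exp (ε * (Complex.I * linPhase G V H (p.1, v, 0) w)) • kern G W V H g n p w := by
  have h1 : (p + ε • xDir v).1 = p.1 := by simp [xDir]
  have h2 : linPhase G V H (p + ε • xDir v) w
      = linPhase G V H p w + ε * linPhase G V H (p.1, v, 0) w := by
    have e1 : p + ε • xDir v = (p.1, p.2 + (ε • v, 0)) := by
      simp [xDir, Prod.ext_iff]
    rw [e1, linPhase_add]
    congr 1
    simp only [linPhase, Finset.mul_sum, cPath, Matrix.mulVec_zero, sub_zero, add_zero,
      Matrix.mulVec_smul, cdot, smul_dotProduct, smul_eq_mul]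
    exact Finset.sum_congr rfl fun j _ => mul_left_comm _ _ _
  have h3 : -(p.1 * quadPhase G W p.1 w) + Complex.I * (linPhase G V H p w
      + ε * linPhase G V H (p.1, v, 0) w) = ε * (Complex.I * linPhase G V H (p.1, v, 0) w)
      + (-(p.1 * quadPhase G W p.1 w) + Complex.I * linPhase G V H p w) := by ring
  rw [kern, kern, kernCore, kernCore, h1, h2, h3, Complex.exp_add, ← smul_smul, smul_comm (p.1 ^ n)]

namespace Deformation

variable (h : Deformation A B C c r K Tb T G W V H m g)
include h

theorem dirDeriv_kern {w : Fin n → ℝ × EuclideanSpace ℝ (Fin ν)} (hw : w ∈ orderedSet ν n 1)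
    {p : ℂ × (Fin ν → ℂ) × (Fin ν → ℂ)} (hp : p.1 ∈ Metric.ball (0 : ℂ) T) (v : Fin ν → ℂ) :
    dirDeriv (xDir v) (fun p => kern G W V H g n p w) p
      = (Complex.I * linPhase G V H (p.1, v, 0) w) • kern G W V H g n p w := by
  refine dirDeriv_of_exp ?_ fun ε => kern_add_xDir p v ε w
  exact ((h.phase.contDiffOn_kern h.pot h.lt.le h.le_Tb hw).differentiableOn
    (by simp)).differentiableAt ((Metric.isOpen_ball.prod isOpen_univ).mem_nhds ⟨hp, trivial⟩)

theorem dirDeriv_dirDeriv_kern {w : Fin n → ℝ × EuclideanSpace ℝ (Fin ν)}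
    (hw : w ∈ orderedSet ν n 1) {p : ℂ × (Fin ν → ℂ) × (Fin ν → ℂ)}
    (hp : p.1 ∈ Metric.ball (0 : ℂ) T) (u v : Fin ν → ℂ) :
    dirDeriv (xDir u) (fun p => dirDeriv (xDir v) (fun p => kern G W V H g n p w) p) p
      = -(linPhase G V H (p.1, u, 0) w * linPhase G V H (p.1, v, 0) w) •
        kern G W V H g n p w := by
  have hO : IsOpen (Metric.ball (0 : ℂ) T ×ˢ (Set.univ : Set ((Fin ν → ℂ) × (Fin ν → ℂ)))) :=
    Metric.isOpen_ball.prod isOpen_univ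
  have hd : ContDiffOn ℂ ∞ (fun p => dirDeriv (xDir v) (fun p => kern G W V H g n p w) p)
      (Metric.ball 0 T ×ˢ Set.univ) :=
    ((h.phase.contDiffOn_kern h.pot h.lt.le h.le_Tb hw).fderiv_of_isOpen hO
      (by simp)).clm_apply contDiffOn_const
  rw [dirDeriv_of_exp (κ := Complex.I * linPhase G V H (p.1, u, 0) w), h.dirDeriv_kern hw hp,
    smul_smul]
  · congr 1
    linear_combination linPhase G V H (p.1, u, 0) w * linPhase G V H (p.1, v, 0) w *
      Complex.I_mul_I
  · exact (hd.differentiableOn (by simp)).differentiableAt (hO.mem_nhds ⟨hp, trivial⟩)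
  · intro ε
    have h1 : (p + ε • xDir u).1 = p.1 := by simp [xDir]
    rw [h.dirDeriv_kern hw (by rwa [h1]), h.dirDeriv_kern hw hp, h1, kern_add_xDir]
    exact smul_comm _ _ _

theorem sum_linPhase {t : ℂ} (ht : t ∈ Metric.ball (0 : ℂ) r)
    {w : Fin n → ℝ × EuclideanSpace ℝ (Fin ν)} (hw : w ∈ orderedSet ν n 1) :
    ∑ j, ∑ k, A t j k * (linPhase G V H (t, Pi.single j 1, 0) w
        * linPhase G V H (t, Pi.single k 1, 0) w)
      = phaseDens G W t (fun j => (w j).1) (fun j => (w j).2) 1 := by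
  set v := waveVec G t (fun j => (w j).1) (fun j => (w j).2) 1 with hv
  have h1 : ∀ x : Fin ν → ℂ, linPhase G V H (t, x, 0) w = v ⬝ᵥ (H t).mulVec x := by
    intro x
    rw [hv, Phase.waveVec_eq, linPhase, sum_dotProduct]
    refine Finset.sum_congr rfl fun j _ => ?_
    rw [if_pos (hw.2 j).2.le, div_one, smul_dotProduct, cdot, cPath]
    simp only [Matrix.mulVec_zero, sub_zero, add_zero, smul_dotProduct]
    rw [Matrix.mulVec_transpose, ← Matrix.dotProduct_mulVec, dotProduct_comm]
  have h2 : ∀ k, linPhase G V H (t, Pi.single k 1, 0) w = ((H t).transpose.mulVec v) k := by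
    intro k
    rw [h1, Matrix.mulVec_transpose, Matrix.dotProduct_mulVec, dotProduct_single_one]
  rw [Phase.phaseDens_eq_dotProduct, Complex.ofReal_one, mul_one, h.phase.W_eq t ht]
  have h3 : v ⬝ᵥ (H t * A t * (H t).transpose).mulVec v
      = ((H t).transpose.mulVec v) ⬝ᵥ (A t).mulVec ((H t).transpose.mulVec v) := by
    rw [← Matrix.mulVec_mulVec, ← Matrix.mulVec_mulVec, Matrix.dotProduct_mulVec,
      Matrix.mulVec_transpose]
  simp only [h2]
  rw [h3]
  simp only [dotProduct, Matrix.mulVec, Finset.mul_sum]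
  exact Finset.sum_congr rfl fun j _ => Finset.sum_congr rfl fun k _ => by ring_nf

theorem smoothFamily_dirDeriv (u v : ℂ × (Fin ν → ℂ) × (Fin ν → ℂ)) :
    SmoothFamily (seriesMeasure m) (Metric.ball 0 T ×ˢ Set.univ)
      (halfDiscBar (T / 2) ×ˢ Set.univ)
      (fun n p w => dirDeriv u (fun p => dirDeriv v (fun p => kern G W V H g n p w) p) p) :=
  (h.smoothFamily.fderiv.clm_comp (ContinuousLinearMap.apply ℂ 𝓜 v)).fderiv.clm_comp
    (ContinuousLinearMap.apply ℂ 𝓜 u)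

theorem sum_integral_dirDeriv {t : ℂ} (ht : t ∈ halfDiscBar (T / 2))
    (z : (Fin ν → ℂ) × (Fin ν → ℂ)) (n : ℕ) :
    ∑ j, ∑ k, A t j k • ∫ w, dirDeriv (xDir (Pi.single j 1))
        (fun p => dirDeriv (xDir (Pi.single k 1)) (fun p => kern G W V H g n p w) p) (t, z)
        ∂seriesMeasure m n
      = ∫ w, -phaseDens G W t (fun j => (w j).1) (fun j => (w j).2) 1 • kern G W V H g n (t, z) w
        ∂seriesMeasure m n := by
  have hp : (t, z) ∈ halfDiscBar (T / 2) ×ˢ (Set.univ : Set ((Fin ν → ℂ) × (Fin ν → ℂ))) :=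
    ⟨ht, trivial⟩
  have hi : ∀ j k, Integrable (fun w => A t j k • dirDeriv (xDir (Pi.single j 1))
      (fun p => dirDeriv (xDir (Pi.single k 1)) (fun p => kern G W V H g n p w) p) (t, z))
      (seriesMeasure m n) := fun j k =>
    ((h.smoothFamily_dirDeriv (xDir (Pi.single j 1)) (xDir (Pi.single k 1))).integrable hp n).smul
      (A t j k)
  simp only [← integral_smul]
  rw [Finset.sum_congr rfl fun j _ => (integral_finsetSum _ fun k _ => hi j k).symm,
    ← integral_finsetSum _ fun j _ => integrable_finsetSum _ fun k _ => hi j k]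
  refine integral_congr_ae (ae_seriesMeasure fun w hw => ?_)
  have e := fun u v => h.dirDeriv_dirDeriv_kern hw (p := (t, z)) (h.mem_ball_of_half ht) u v
  simp only [e, smul_smul, ← Finset.sum_smul, ← h.sum_linPhase (h.mem_ball_r ht) hw, mul_neg,
    Finset.sum_neg_distrib]

end Deformation

theorem _root_.HeatDeformation.SmoothFamily.pd_eq {F : Type*} [NormedAddCommGroup F]
    [NormedSpace ℂ F] [CompleteSpace F] {Ω : ℕ → Type} [∀ n, MeasurableSpace (Ω n)]
    {P : ∀ n, Measure (Ω n)} {O : Set (ℂ × (Fin ν → ℂ) × (Fin ν → ℂ))} {D : Set ℂ}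
    {I : ∀ n, ℂ × (Fin ν → ℂ) × (Fin ν → ℂ) → Ω n → F}
    (h : SmoothFamily P O (D ×ˢ Set.univ) I) {t : ℂ} (ht : t ∈ D) (x y : Fin ν → ℂ) (k : Fin ν) :
    pd k (fun x => ∑' n, ∫ w, I n (t, x, y) w ∂P n) x
      = ∑' n, ∫ w, dirDeriv (xDir (Pi.single k 1)) (fun p => I n p w) (t, x, y) ∂P n := by
  have hp : (t, x, y) ∈ D ×ˢ (Set.univ : Set ((Fin ν → ℂ) × (Fin ν → ℂ))) := ⟨ht, trivial⟩
  have h2 : HasFDerivWithinAt (fun x : Fin ν → ℂ => (t, x, y))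
      ((0 : (Fin ν → ℂ) →L[ℂ] ℂ).prod ((ContinuousLinearMap.id ℂ (Fin ν → ℂ)).prod 0))
      Set.univ x :=
    (hasFDerivWithinAt_const t x _).prodMk
      ((hasFDerivWithinAt_id x _).prodMk (hasFDerivWithinAt_const y x _))
  have h3 := ((h.hasFDerivWithinAt hp).comp x h2 (show Set.MapsTo (fun x : Fin ν → ℂ => (t, x, y)) Set.univ (D ×ˢ Set.univ) from
    fun x' _ => ⟨ht, trivial⟩)).hasFDerivAt
    Filter.univ_mem
  rw [pd, show (fun x => ∑' n, ∫ w, I n (t, x, y) w ∂P n)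
    = (fun p => ∑' n, ∫ w, I n p w ∂P n) ∘ fun x => (t, x, y) from rfl, h3.fderiv]
  exact h.fderiv.clm_tsum (ContinuousLinearMap.apply ℂ F (xDir (Pi.single k 1))) hp

theorem Deformation.sum_pd_pConj (h : Deformation A B C c r K Tb T G W V H m g) {t : ℂ}
    (ht : t ∈ halfDiscBar (T / 2)) (x y : Fin ν → ℂ) :
    ∑ j, ∑ k, A t j k • pd j (pd k fun x => pConj A B C c t x y) x
      = ∑' n, ∫ w, -phaseDens G W t (fun j => (w j).1) (fun j => (w j).2) 1 •
          kern G W V H g n (t, x, y) w ∂seriesMeasure m n := by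
  have : CompleteSpace 𝓜 := FiniteDimensional.complete ℂ 𝓜
  have hp : (t, x, y) ∈ halfDiscBar (T / 2) ×ˢ (Set.univ : Set ((Fin ν → ℂ) × (Fin ν → ℂ))) :=
    ⟨ht, trivial⟩
  have h1 : (fun x => pConj A B C c t x y)
      = fun x => ∑' n, ∫ w, kern G W V H g n (t, x, y) w ∂seriesMeasure m n :=
    funext fun x => h.pConj_eq ht x y
  have h2 : ∀ k, pd k (fun x => pConj A B C c t x y)
      = fun x => ∑' n, ∫ w, dirDeriv (xDir (Pi.single k 1)) (fun p => kern G W V H g n p w)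
        (t, x, y) ∂seriesMeasure m n := fun k => by
    rw [h1]
    exact funext fun x => h.smoothFamily.pd_eq ht x y k
  have h3 : ∀ j k, pd j (pd k fun x => pConj A B C c t x y) x
      = ∑' n, ∫ w, dirDeriv (xDir (Pi.single j 1)) (fun p => dirDeriv (xDir (Pi.single k 1))
        (fun p => kern G W V H g n p w) p) (t, x, y) ∂seriesMeasure m n := fun j k => by
    rw [h2]
    exact (h.smoothFamily.fderiv.clm_comp
      (ContinuousLinearMap.apply ℂ 𝓜 (xDir (Pi.single k 1)))).pd_eq ht x y j
  have hs : ∀ j k, Summable fun n => A t j k • ∫ w, dirDeriv (xDir (Pi.single j 1))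
      (fun p => dirDeriv (xDir (Pi.single k 1)) (fun p => kern G W V H g n p w) p) (t, x, y)
      ∂seriesMeasure m n := fun j k =>
    ((h.smoothFamily_dirDeriv _ _).summable_norm hp).of_norm.const_smul _
  simp only [h3, ← h.sum_integral_dirDeriv ht]
  rw [Summable.tsum_finsetSum fun j _ => summable_sum fun k _ => hs j k]
  refine Finset.sum_congr rfl fun j _ => ?_
  rw [Summable.tsum_finsetSum fun k _ => hs j k]
  refine Finset.sum_congr rfl fun k _ => ?_
  exact (((h.smoothFamily_dirDeriv _ _).summable_norm hp).of_norm.tsum_const_smul _).symm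

end Spatial

end

end HeatDeformation

namespace HeatDeformation

noncomputable section

set_option linter.unusedSectionVars false

variable {ν n : ℕ} {𝓜 : Type*} [NormedRing 𝓜] [NormedAlgebra ℂ 𝓜] [NormOneClass 𝓜]
  [FiniteDimensional ℂ 𝓜] [MeasurableSpace 𝓜] [BorelSpace 𝓜]
  {A B C G W V H : ℂ → Matrix (Fin ν) (Fin ν) ℂ} {r K Tb T : ℝ}
  {c : ℂ → (Fin ν → ℂ) → 𝓜} {m : Measure (EuclideanSpace ℝ (Fin ν))}
  {g : ℂ → EuclideanSpace ℝ (Fin ν) → 𝓜}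

section Duhamel

/-! ### The integral equation -/

theorem norm_phaseDens_le_wt (h : Phase A B C r K G W V H) {t : ℂ}
    (ht : t ∈ Metric.ball (0 : ℂ) r) {w : Fin n → ℝ × EuclideanSpace ℝ (Fin ν)}
    (hw : w ∈ orderedSet ν n 1) {τ : ℝ} (hτ : τ ∈ Set.Ioc (0 : ℝ) 1) :
    ‖phaseDens G W t (fun j => (w j).1) (fun j => (w j).2) τ‖
      ≤ ν ^ 2 * K * (ν * K) ^ 2 * wt w ^ 2 := by
  have hK := h.nonneg
  have h1 := norm_phaseDens_le h.holG h.holW hK ht (s := fun j => (w j).1)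
    (fun j => ⟨(hw.2 j).1.le, (hw.2 j).2.le⟩) (fun j => (w j).2) hτ
  rw [mul_pow (ν * K : ℝ), ← mul_assoc] at h1
  refine h1.trans (mul_le_mul_of_nonneg_left ?_ (by positivity))
  exact pow_le_pow_left₀ (Finset.sum_nonneg fun _ _ => norm_nonneg _)
    (le_add_of_nonneg_left zero_le_one) 2

theorem measurable_phaseDens_point (h : Phase A B C r K G W V H) (t : ℂ) :
    Measurable fun p : ℝ × (Fin n → ℝ × EuclideanSpace ℝ (Fin ν)) =>
      phaseDens G W t (fun j => (p.2 j).1) (fun j => (p.2 j).2) p.1 :=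
  measurable_phaseDens h.holG.meas h.holW.meas measurable_const (by fun_prop) (by fun_prop)
    measurable_fst

theorem measurable_cumPhase (h : Phase A B C r K G W V H) (t : ℂ) :
    Measurable fun p : ℝ × (Fin n → ℝ × EuclideanSpace ℝ (Fin ν)) => cumPhase G W t p.2 p.1 := by
  have e : ∀ p : ℝ × (Fin n → ℝ × EuclideanSpace ℝ (Fin ν)), cumPhase G W t p.2 p.1
      = (p.1 : ℂ) * ∫ σ in Set.Ioc (0 : ℝ) 1,
        phaseDens G W t (fun j => (p.2 j).1) (fun j => (p.2 j).2) (p.1 * σ) := by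
    intro p
    have h1 := intervalIntegral.smul_integral_comp_mul_left (a := 0) (b := 1)
      (phaseDens G W t (fun j => (p.2 j).1) fun j => (p.2 j).2) p.1
    rw [mul_zero, mul_one] at h1
    rw [cumPhase, ← h1, Complex.real_smul, intervalIntegral.integral_of_le zero_le_one]
  simp only [e]
  refine (Complex.measurable_ofReal.comp measurable_fst).mul ?_
  have h1 : StronglyMeasurable (Function.uncurry
      fun (p : ℝ × (Fin n → ℝ × EuclideanSpace ℝ (Fin ν))) (σ : ℝ) =>
        phaseDens G W t (fun j => (p.2 j).1) (fun j => (p.2 j).2) (p.1 * σ)) :=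
    ((measurable_phaseDens_point h t).comp
      (f := fun q : (ℝ × (Fin n → ℝ × EuclideanSpace ℝ (Fin ν))) × ℝ => (q.1.1 * q.2, q.1.2))
      (by fun_prop)).stronglyMeasurable
  exact (h1.integral_prod_right (ν := volume.restrict (Set.Ioc (0 : ℝ) 1))).measurable

theorem measurable_kernAt (h : Phase A B C r K G W V H) (hg : Measurable (Function.uncurry g))
    (t : ℂ) (x y : Fin ν → ℂ) :
    Measurable fun p : ℝ × (Fin n → ℝ × EuclideanSpace ℝ (Fin ν)) =>
      kernAt G W (cPath G V H t x y) g t p.1 p.2 := by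
  have : ProperSpace 𝓜 := FiniteDimensional.proper ℂ 𝓜
  have h1 : Measurable fun w : Fin n → ℝ × EuclideanSpace ℝ (Fin ν) =>
      pathPhase (cPath G V H t x y) w := by
    unfold pathPhase
    refine Finset.measurable_fun_sum _ fun j _ => measurable_cdot (fun i => ?_) (by fun_prop)
    exact (h.measurable_cPath t x y i).comp (measurable_fst.comp (measurable_pi_apply j))
  unfold kernAt
  exact (((measurable_cumPhase h t).const_mul _).neg.add
    ((h1.comp measurable_snd).const_mul _)).cexp.smul ((measurable_gProd hg t).comp measurable_snd)

theorem continuousAt_phaseDens (h : Phase A B C r K G W V H) {t : ℂ}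
    (ht : t ∈ Metric.ball (0 : ℂ) r) {w : Fin n → ℝ × EuclideanSpace ℝ (Fin ν)} {τ : ℝ}
    (hτ : τ ∈ Set.Ioo (0 : ℝ) 1) (hw : ∀ j, (w j).1 < τ) :
    ContinuousAt (fun τ => phaseDens G W t (fun j => (w j).1) (fun j => (w j).2) τ) τ := by
  have hW : ∀ i l, ContinuousAt (fun τ : ℝ => W (t * τ) i l) τ := fun i l =>
    (Phase.continuousOn_scaled h.holW ht i l).continuousAt (Icc_mem_nhds hτ.1 hτ.2)
  have hwv : ∀ i, ContinuousAt
      (fun τ => waveVec G t (fun j => (w j).1) (fun j => (w j).2) τ i) τ := by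
    intro i
    unfold waveVec avg
    refine tendsto_finsetSum _ fun k _ => tendsto_finsetSum _ fun j _ => ?_
    have h1 : ContinuousAt (fun τ : ℝ => (((w j).1 / τ : ℝ) : ℂ)
        * (G (t * (w j).1) k i * (((w j).2 k : ℝ) : ℂ))) τ := by
      refine ContinuousAt.mul ?_ continuousAt_const
      exact Complex.continuous_ofReal.continuousAt.comp
        (continuousAt_const.div continuousAt_id hτ.1.ne')
    refine h1.congr ?_
    filter_upwards [lt_mem_nhds (hw j)] with σ hσ
    rw [if_pos hσ.le]
  unfold phaseDens
  exact tendsto_finsetSum _ fun i _ => tendsto_finsetSum _ fun l _ =>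
    (hwv i).mul ((hW i l).mul (hwv l))

theorem integrableOn_phaseDens (h : Phase A B C r K G W V H) {t : ℂ}
    (ht : t ∈ Metric.ball (0 : ℂ) r) {w : Fin n → ℝ × EuclideanSpace ℝ (Fin ν)}
    (hw : w ∈ orderedSet ν n 1) :
    IntegrableOn (fun τ => phaseDens G W t (fun j => (w j).1) (fun j => (w j).2) τ)
      (Set.Ioc 0 1) := by
  refine Measure.integrableOn_of_bounded (M := ν ^ 2 * K * (ν * K) ^ 2 * wt w ^ 2) (by simp)
    ((measurable_phaseDens_point h t).comp
      (f := fun τ : ℝ => (τ, w)) (by fun_prop)).aestronglyMeasurable ?_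
  exact (ae_restrict_iff' measurableSet_Ioc).2 (Eventually.of_forall fun τ hτ =>
    norm_phaseDens_le_wt h ht hw hτ)

/-- The fundamental theorem of calculus for the integrand after the last time. -/
theorem integral_phaseDens_smul_kernAt (h : Phase A B C r K G W V H) {t : ℂ}
    (ht : t ∈ Metric.ball (0 : ℂ) r) (X : ℝ → Fin ν → ℂ)
    {w : Fin n → ℝ × EuclideanSpace ℝ (Fin ν)} (hw : w ∈ orderedSet ν n 1) {a b : ℝ} (ha : 0 ≤ a)
    (hwa : ∀ j, (w j).1 ≤ a) (hab : a ≤ b) (hb : b ≤ 1) :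
    ∫ τ in a..b, (-(t * phaseDens G W t (fun j => (w j).1) (fun j => (w j).2) τ)) •
        kernAt G W X g t τ w = kernAt G W X g t b w - kernAt G W X g t a w := by
  have : CompleteSpace 𝓜 := FiniteDimensional.complete ℂ 𝓜
  have hi := integrableOn_phaseDens h ht hw
  have hii : ∀ τ ∈ Set.Icc (0 : ℝ) 1, IntervalIntegrable
      (fun τ => phaseDens G W t (fun j => (w j).1) (fun j => (w j).2) τ) volume 0 τ :=
    fun τ hτ => (intervalIntegrable_iff_integrableOn_Ioc_of_le hτ.1).2
      (hi.mono_set (Set.Ioc_subset_Ioc_right hτ.2))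
  have hc : ContinuousOn (cumPhase G W t w) (Set.Icc a b) := by
    have := intervalIntegral.continuousOn_primitive_interval (μ := volume) (a := 0) (b := 1)
      (f := fun τ => phaseDens G W t (fun j => (w j).1) (fun j => (w j).2) τ) (by
        rw [Set.uIcc_of_le zero_le_one]
        exact (integrableOn_Icc_iff_integrableOn_Ioc (by simp)).2 hi)
    rw [Set.uIcc_of_le zero_le_one] at this
    exact this.mono (Set.Icc_subset_Icc ha hb)
  have hd : ∀ τ ∈ Set.Ioo a b, HasDerivAt (cumPhase G W t w)
      (phaseDens G W t (fun j => (w j).1) (fun j => (w j).2) τ) τ := fun τ hτ =>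
    intervalIntegral.integral_hasDerivAt_right
      (hii τ ⟨ha.trans hτ.1.le, hτ.2.le.trans hb⟩)
      (((measurable_phaseDens_point h t).comp
        (f := fun τ : ℝ => (τ, w)) (by fun_prop)).stronglyMeasurable.stronglyMeasurableAtFilter)
      (continuousAt_phaseDens h ht ⟨ha.trans_lt hτ.1, hτ.2.trans_le hb⟩
        fun j => (hwa j).trans_lt hτ.1)
  have hkc : ContinuousOn (fun τ => kernAt G W X g t τ w) (Set.Icc a b) := by
    unfold kernAt
    exact (((continuousOn_const.mul hc).neg.add continuousOn_const).cexp).smul continuousOn_const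
  refine intervalIntegral.integral_eq_sub_of_hasDeriv_right_of_le hab hkc
    (fun τ hτ => ?_) ?_
  · have h1 := ((((hd τ hτ).const_mul t).neg.add_const
      (Complex.I * pathPhase X w)).cexp).smul_const (gProd g t w)
    refine HasDerivAt.hasDerivWithinAt (h1.congr_deriv ?_)
    rw [kernAt, smul_smul, mul_comm]
    rfl
  · rw [intervalIntegrable_iff_integrableOn_Ioc_of_le hab]
    obtain ⟨M, hM⟩ := isCompact_Icc.exists_bound_of_continuousOn hkc
    have h2 : IntegrableOn (fun τ => -(t * phaseDens G W t (fun j => (w j).1)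
        (fun j => (w j).2) τ)) (Set.Ioc a b) :=
      ((hi.mono_set (Set.Ioc_subset_Ioc ha hb)).const_mul t).neg
    refine Integrable.smul_bdd h2 M ?_ ?_
    · exact (hkc.mono Set.Ioc_subset_Icc_self).aestronglyMeasurable measurableSet_Ioc
    · exact (ae_restrict_iff' measurableSet_Ioc).2 (Eventually.of_forall fun τ hτ =>
        hM τ (Set.Ioc_subset_Icc_self hτ))

theorem cumPhase_snoc (t : ℂ) {s : ℝ} (hs : 0 ≤ s) (ξ : EuclideanSpace ℝ (Fin ν))
    (w : Fin n → ℝ × EuclideanSpace ℝ (Fin ν)) :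
    cumPhase G W t (Fin.snoc w (s, ξ) : Fin (n + 1) → ℝ × EuclideanSpace ℝ (Fin ν)) s
      = cumPhase G W t w s := by
  unfold cumPhase
  rw [intervalIntegral.integral_of_le hs, intervalIntegral.integral_of_le hs,
    integral_Ioc_eq_integral_Ioo, integral_Ioc_eq_integral_Ioo]
  refine setIntegral_congr_fun measurableSet_Ioo fun τ hτ => ?_
  have h1 : ∀ i, waveVec G t (fun j => ((Fin.snoc w (s, ξ) : Fin (n + 1) → _) j).1)
      (fun j => ((Fin.snoc w (s, ξ) : Fin (n + 1) → ℝ × EuclideanSpace ℝ (Fin ν)) j).2) τ i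
      = waveVec G t (fun j => (w j).1) (fun j => (w j).2) τ i := fun i => by
    unfold waveVec avg
    simp only [Fin.sum_univ_castSucc, Fin.snoc_castSucc, Fin.snoc_last, if_neg (not_le.2 hτ.2),
      add_zero]
  simp only [phaseDens, h1]

theorem kernAt_snoc (X : ℝ → Fin ν → ℂ) (t : ℂ) {s : ℝ} (hs : 0 ≤ s)
    (ξ : EuclideanSpace ℝ (Fin ν)) (w : Fin n → ℝ × EuclideanSpace ℝ (Fin ν)) :
    kernAt G W X g t s (Fin.snoc w (s, ξ) : Fin (n + 1) → ℝ × EuclideanSpace ℝ (Fin ν))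
      = (Complex.exp (Complex.I * cdot (X s) ξ) • g (s * t) ξ) * kernAt G W X g t s w := by
  rw [kernAt, kernAt, cumPhase_snoc t hs, gProd, prod_reverse_ofFn_succ, smul_mul_smul_comm,
    ← Complex.exp_add]
  simp only [pathPhase, Fin.sum_univ_castSucc, Fin.snoc_castSucc, Fin.snoc_last, gProd]
  congr 2
  ring

/-- Splitting off the last time and frequency. -/
theorem integral_orderedSet_succ [SigmaFinite m] {b : ℝ}
    {q : (Fin (n + 1) → ℝ × EuclideanSpace ℝ (Fin ν)) → 𝓜}
    (hq : IntegrableOn q (orderedSet ν (n + 1) b) (pointMeasure m (n + 1))) :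
    ∫ w in orderedSet ν (n + 1) b, q w ∂pointMeasure m (n + 1)
      = ∫ s in Set.Ioo 0 b, ∫ z : EuclideanSpace ℝ (Fin ν) × (Fin n → ℝ × EuclideanSpace ℝ (Fin ν)),
          q (Fin.snoc z.2 (s, z.1)) ∂(m.prod ((pointMeasure m n).restrict (orderedSet ν n s))) := by
  have hsm := (measurableEmbedding_snoc (α := ℝ × EuclideanSpace ℝ (Fin ν)) n)
  have hmp := measurePreserving_snoc_points m n
  have hi : Integrable ((orderedSet ν (n + 1) b).indicator q) (pointMeasure m (n + 1)) :=
    hq.integrable_indicator (measurableSet_orderedSet b)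
  have hi' := (hmp.integrable_comp_emb hsm).2 hi
  have ha := (measurePreserving_prodAssoc (volume : Measure ℝ) m (pointMeasure m n)).symm
  have hi'' := (ha.integrable_comp_emb (MeasurableEquiv.prodAssoc.symm.measurableEmbedding)).2 hi'
  rw [← integral_indicator (measurableSet_orderedSet b), ← hmp.integral_comp hsm,
    ← ha.integral_comp MeasurableEquiv.prodAssoc.symm.measurableEmbedding]
  refine (integral_prod _ hi'').trans ?_
  rw [← integral_indicator measurableSet_Ioo]
  refine integral_congr_ae (Eventually.of_forall fun s => ?_)
  have hms : MeasurableSet ((Set.univ : Set (EuclideanSpace ℝ (Fin ν))) ×ˢ orderedSet ν n s) :=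
    MeasurableSet.univ.prod (measurableSet_orderedSet s)
  by_cases hs : s ∈ Set.Ioo 0 b
  · have e1 : m.prod ((pointMeasure m n).restrict (orderedSet ν n s))
        = (m.prod (pointMeasure m n)).restrict (Set.univ ×ˢ orderedSet ν n s) := by
      rw [← Measure.prod_restrict, Measure.restrict_univ]
    simp only [Set.indicator_of_mem hs]
    rw [e1, ← integral_indicator hms]
    refine integral_congr_ae (Eventually.of_forall fun z => ?_)
    change (orderedSet ν (n + 1) b).indicator q (Fin.snoc z.2 (s, z.1)) = _
    by_cases hz : z.2 ∈ orderedSet ν n s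
    · rw [Set.indicator_of_mem (snoc_mem_orderedSet.2 ⟨hs, hz⟩),
        Set.indicator_of_mem (show z ∈ Set.univ ×ˢ orderedSet ν n s from ⟨trivial, hz⟩)]
    · rw [Set.indicator_of_notMem fun h => hz (snoc_mem_orderedSet.1 h).2,
        Set.indicator_of_notMem fun h => hz h.2]
  · rw [Set.indicator_of_notMem hs]
    refine (integral_congr_ae (Eventually.of_forall fun z => ?_)).trans (integral_zero _ _)
    exact Set.indicator_of_notMem (fun h => hs (snoc_mem_orderedSet.1 h).1) _

end Duhamel

end

end HeatDeformation

namespace HeatDeformation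

noncomputable section

set_option linter.unusedSectionVars false

variable {ν n : ℕ} {𝓜 : Type*} [NormedRing 𝓜] [NormedAlgebra ℂ 𝓜] [NormOneClass 𝓜]
  [FiniteDimensional ℂ 𝓜] [MeasurableSpace 𝓜] [BorelSpace 𝓜]
  {A B C G W V H : ℂ → Matrix (Fin ν) (Fin ν) ℂ} {r K Tb T : ℝ}
  {c : ℂ → (Fin ν → ℂ) → 𝓜} {m : Measure (EuclideanSpace ℝ (Fin ν))}
  {g : ℂ → EuclideanSpace ℝ (Fin ν) → 𝓜}

section Potential

theorem FourierPotential.measurable_exp_smul (hc : FourierPotential Tb c m g) (t : ℂ)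
    (x : Fin ν → ℂ) : Measurable fun ξ => Complex.exp (Complex.I * cdot x ξ) • g t ξ := by
  have : ProperSpace 𝓜 := FiniteDimensional.proper ℂ 𝓜
  have m1 : Measurable fun ξ : EuclideanSpace ℝ (Fin ν) => cdot x ξ := by
    unfold cdot toC dotProduct; fun_prop
  have m2 : Measurable fun ξ => g t ξ := hc.meas.comp (f := fun ξ => (t, ξ)) (by fun_prop)
  exact Measurable.smul (m1.const_mul _).cexp m2

theorem FourierPotential.norm_exp_smul_le (hc : FourierPotential Tb c m g) (t : ℂ)
    {x : Fin ν → ℂ} {M : ℝ} (hx : ‖x‖ ≤ M) (ξ : EuclideanSpace ℝ (Fin ν)) :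
    ‖Complex.exp (Complex.I * cdot x ξ) • g t ξ‖ ≤ Real.exp (ν * M * ‖ξ‖) := by
  rw [norm_smul, Complex.norm_exp]
  refine (mul_le_of_le_one_right (Real.exp_pos _).le (hc.bound _ _)).trans
    (Real.exp_le_exp.2 ((Complex.re_le_norm _).trans ?_))
  rw [norm_mul, Complex.norm_I, one_mul]
  refine (norm_cdot_le _ _).trans ?_
  gcongr

theorem FourierPotential.integrable_exp_smul (hc : FourierPotential Tb c m g) (t : ℂ)
    (x : Fin ν → ℂ) : Integrable (fun ξ => Complex.exp (Complex.I * cdot x ξ) • g t ξ) m := by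
  have : ProperSpace 𝓜 := FiniteDimensional.proper ℂ 𝓜
  exact (hc.moments (ν * ‖x‖)).mono' (hc.measurable_exp_smul t x).aestronglyMeasurable
    (Eventually.of_forall fun ξ => hc.norm_exp_smul_le t le_rfl ξ)

theorem FourierPotential.continuousOn_curve (hc : FourierPotential Tb c m g) {τ : ℝ → ℂ}
    {X : ℝ → Fin ν → ℂ} {S : Set ℝ} (hS : IsCompact S) (hτ : ContinuousOn τ S)
    (hτS : ∀ s ∈ S, τ s ∈ Metric.ball (0 : ℂ) Tb) (hX : ContinuousOn X S) :
    ContinuousOn (fun s => c (τ s) (X s)) S := by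
  have : ProperSpace 𝓜 := FiniteDimensional.proper ℂ 𝓜
  obtain ⟨M, hM⟩ := hS.exists_bound_of_continuousOn hX
  have h1 : ContinuousOn (fun s => ∫ ξ, Complex.exp (Complex.I * cdot (X s) ξ) • g (τ s) ξ ∂m) S := by
    refine continuousOn_of_dominated (bound := fun ξ => Real.exp (ν * M * ‖ξ‖))
      (fun s _ => (hc.measurable_exp_smul _ _).aestronglyMeasurable)
      (fun s hs => Eventually.of_forall fun ξ => hc.norm_exp_smul_le _ (hM s hs) ξ)
      (hc.moments _) (Eventually.of_forall fun ξ => ?_)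
    refine ContinuousOn.smul ?_ ((hc.diff ξ).continuousOn.comp hτ hτS)
    have h2 : ContinuousOn (fun s => cdot (X s) ξ) S := by
      unfold cdot dotProduct
      exact continuousOn_finsetSum _ fun i _ =>
        ((continuous_apply i).comp_continuousOn hX).mul continuousOn_const
    exact (continuousOn_const.mul h2).cexp
  exact h1.congr fun s hs => hc.eq _ (hτS s hs) _

end Potential

section Duhamel

theorem Phase.continuousOn_cPath (h : Phase A B C r K G W V H) {t : ℂ}
    (ht : t ∈ Metric.ball (0 : ℂ) r) (x y : Fin ν → ℂ) :
    ContinuousOn (cPath G V H t x y) (Set.Icc 0 1) := by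
  refine continuousOn_pi.2 fun i => ?_
  simp only [cPath, Pi.add_apply, Pi.smul_apply, Matrix.mulVec, dotProduct, smul_eq_mul]
  exact (Complex.continuous_ofReal.continuousOn.mul (continuousOn_finsetSum _ fun a _ =>
    (Phase.continuousOn_scaled h.holG ht i a).mul continuousOn_const)).add
    (continuousOn_finsetSum _ fun a _ =>
      (Phase.continuousOn_scaled h.holV ht i a).mul continuousOn_const)

namespace Deformation

variable (h : Deformation A B C c r K Tb T G W V H m g)
include h

theorem integrableOn_kernAt {t : ℂ} (ht : t ∈ halfDiscBar (T / 2)) (x y : Fin ν → ℂ) {a : ℝ}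
    (ha : a ∈ Set.Ioc (0 : ℝ) 1) {σ : (Fin n → ℝ × EuclideanSpace ℝ (Fin ν)) → ℝ}
    (hσ : Measurable σ) (hσa : ∀ w ∈ orderedSet ν n a, σ w ∈ Set.Ioc 0 a ∧ ∀ j, (w j).1 ≤ σ w) :
    IntegrableOn (fun w => kernAt G W (cPath G V H t x y) g t (σ w) w) (orderedSet ν n a)
      (pointMeasure m n) := by
  have : ProperSpace 𝓜 := FiniteDimensional.proper ℂ 𝓜
  have := h.isFiniteMeasure
  refine (integrable_orderedSet_exp h.pot.moments (ν * pathBound ν K * ‖(x, y)‖) n ha.1.le).1.mono'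
    ((measurable_kernAt h.phase h.pot.meas t x y).comp
      (hσ.prodMk measurable_id)).aestronglyMeasurable ?_
  refine (ae_restrict_iff' (measurableSet_orderedSet a)).2 (Eventually.of_forall fun w hw => ?_)
  obtain ⟨h1, h2⟩ := hσa w hw
  exact h.norm_kernAt_le ht ⟨h1.1, h1.2.trans ha.2⟩ x y fun j => ⟨(hw.2 j).1, h2 j⟩

/-- Integrating first over the last time. -/
theorem integral_last_time {t : ℂ} (ht : t ∈ halfDiscBar (T / 2)) (x y : Fin ν → ℂ) {a : ℝ}
    (ha : a ∈ Set.Ioc (0 : ℝ) 1) (n : ℕ) :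
    ∫ w in orderedSet ν (n + 1) a, kernAt G W (cPath G V H t x y) g t (w (Fin.last n)).1 w
        ∂pointMeasure m (n + 1)
      = ∫ s in (0 : ℝ)..a, c (s * t) (cPath G V H t x y s) *
          ∫ w in orderedSet ν n s, kernAt G W (cPath G V H t x y) g t s w ∂pointMeasure m n := by
  have : CompleteSpace 𝓜 := FiniteDimensional.complete ℂ 𝓜
  have := h.isFiniteMeasure
  rw [integral_orderedSet_succ (h.integrableOn_kernAt ht x y ha (by fun_prop) fun w hw =>
    ⟨⟨(hw.2 _).1, (hw.2 _).2.le⟩, fun j => hw.1.monotone (Fin.le_last j)⟩),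
    intervalIntegral.integral_of_le ha.1.le, integral_Ioc_eq_integral_Ioo]
  refine setIntegral_congr_fun measurableSet_Ioo fun s hs => ?_
  have hs1 : s ∈ Set.Ioc (0 : ℝ) 1 := ⟨hs.1, hs.2.le.trans ha.2⟩
  have hst : (s : ℂ) * t ∈ Metric.ball (0 : ℂ) Tb :=
    h.mem_ball_Tb (smul_mem_halfDiscBar ht hs1.1.le hs1.2)
  simp only [Fin.snoc_last, kernAt_snoc _ _ hs.1.le]
  rw [h.pot.eq _ hst]
  exact integral_prod_bilin (ContinuousLinearMap.mul ℂ 𝓜) (h.pot.integrable_exp_smul _ _)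
    (h.integrableOn_kernAt ht x y hs1 measurable_const fun w hw =>
      ⟨⟨hs.1, le_rfl⟩, fun j => (hw.2 j).2.le⟩)

theorem norm_phaseDens_smul_kernAt_le {t : ℂ} (ht : t ∈ halfDiscBar (T / 2)) (x y : Fin ν → ℂ)
    {s : ℝ} (hs : s ∈ Set.Ioc (0 : ℝ) 1) {w : Fin n → ℝ × EuclideanSpace ℝ (Fin ν)}
    (hw : w ∈ orderedSet ν n s) :
    ‖(-(t * phaseDens G W t (fun j => (w j).1) (fun j => (w j).2) s)) •
        kernAt G W (cPath G V H t x y) g t s w‖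
      ≤ ν ^ 2 * K * (ν * K) ^ 2 * (Nat.factorial 2 * Real.exp 1) *
        Real.exp ((ν * pathBound ν K * ‖(x, y)‖ + 1) * ∑ j, ‖(w j).2‖) := by
  have hK := h.phase.nonneg
  have h1 := norm_phaseDens_le_wt h.phase (h.mem_ball_r ht) (orderedSet_mono hs.2 hw) hs
  have h2 := h.norm_kernAt_le ht hs x y (w := w) fun j => ⟨(hw.2 j).1, (hw.2 j).2.le⟩
  have h3 : ‖t‖ ≤ 1 := by linarith [ht.1, h.le_one, h.pos]
  have h4 := wt_pow_le w 2
  rw [norm_smul, norm_neg, norm_mul, add_mul, one_mul, Real.exp_add]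
  calc ‖t‖ * _ * _ ≤ 1 * (ν ^ 2 * K * (ν * K) ^ 2 * wt w ^ 2) *
        Real.exp (ν * pathBound ν K * ‖(x, y)‖ * ∑ j, ‖(w j).2‖) := by gcongr
    _ ≤ 1 * (ν ^ 2 * K * (ν * K) ^ 2 *
        ((Nat.factorial 2) * Real.exp 1 * Real.exp (∑ j, ‖(w j).2‖))) *
        Real.exp (ν * pathBound ν K * ‖(x, y)‖ * ∑ j, ‖(w j).2‖) := by gcongr
    _ = _ := by ring

theorem integral_phaseDens_orderedSet {t : ℂ} (ht : t ∈ halfDiscBar (T / 2)) (x y : Fin ν → ℂ)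
    {a : ℝ} (ha : a ∈ Set.Ioc (0 : ℝ) 1) (n : ℕ) :
    ∫ s in (0 : ℝ)..a, ∫ w in orderedSet ν (n + 1) s,
        (-(t * phaseDens G W t (fun j => (w j).1) (fun j => (w j).2) s)) •
          kernAt G W (cPath G V H t x y) g t s w ∂pointMeasure m (n + 1)
      = ∫ w in orderedSet ν (n + 1) a, (kernAt G W (cPath G V H t x y) g t a w
          - kernAt G W (cPath G V H t x y) g t (w (Fin.last n)).1 w) ∂pointMeasure m (n + 1) := by
  have : ProperSpace 𝓜 := FiniteDimensional.proper ℂ 𝓜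
  have := h.isFiniteMeasure
  set X := cPath G V H t x y with hX
  set F : ℝ × (Fin (n + 1) → ℝ × EuclideanSpace ℝ (Fin ν)) → 𝓜 := fun p =>
    (-(t * phaseDens G W t (fun j => (p.2 j).1) (fun j => (p.2 j).2) p.1)) •
      kernAt G W X g t p.1 p.2 with hF
  set E : Set (ℝ × (Fin (n + 1) → ℝ × EuclideanSpace ℝ (Fin ν))) :=
    {p | p.2 ∈ orderedSet ν (n + 1) p.1} with hE
  have hEm : MeasurableSet E := by
    have h1 : E = (⋂ i, ⋂ j, {p | i < j → (p.2 i).1 < (p.2 j).1}) ∩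
        ⋂ j, ({p | 0 < (p.2 j).1} ∩ {p | (p.2 j).1 < p.1}) := by
      ext p
      simp [hE, orderedSet, StrictMono]
    rw [h1]
    refine (MeasurableSet.iInter fun i => MeasurableSet.iInter fun j => ?_).inter
      (MeasurableSet.iInter fun j => (measurableSet_lt (by fun_prop) (by fun_prop)).inter
        (measurableSet_lt (by fun_prop) (by fun_prop)))
    by_cases h : i < j
    · simpa [h] using measurableSet_lt (f := fun p : ℝ × (Fin (n + 1) → ℝ × EuclideanSpace ℝ (Fin ν))
        => (p.2 i).1) (g := fun p => (p.2 j).1) (by fun_prop) (by fun_prop)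
    · simp [h]
  have hFm : Measurable F :=
    ((measurable_phaseDens_point h.phase t).const_mul t).neg.smul
      (measurable_kernAt h.phase h.pot.meas t x y)
  set D := ν ^ 2 * K * (ν * K) ^ 2 * (Nat.factorial 2 * Real.exp 1) with hD
  set R := ν * pathBound ν K * ‖(x, y)‖ + 1 with hR
  have hD0 : 0 ≤ D := by have := h.phase.nonneg; positivity
  have hbi : Integrable (fun p : ℝ × (Fin (n + 1) → ℝ × EuclideanSpace ℝ (Fin ν)) =>
      (orderedSet ν (n + 1) 1).indicator (fun w => D * Real.exp (R * ∑ j, ‖(w j).2‖)) p.2)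
      ((volume.restrict (Set.Ioc 0 a)).prod (pointMeasure m (n + 1))) := by
    refine Integrable.comp_snd (μ := volume.restrict (Set.Ioc 0 a)) ?_
    exact IntegrableOn.integrable_indicator
      ((integrable_orderedSet_exp h.pot.moments R (n + 1) zero_le_one).1.const_mul D)
      (measurableSet_orderedSet 1)
  have hfi : Integrable (Function.uncurry fun s w => E.indicator F (s, w))
      ((volume.restrict (Set.Ioc 0 a)).prod (pointMeasure m (n + 1))) := by
    refine hbi.mono' (hFm.indicator hEm).aestronglyMeasurable ?_
    have hae : ∀ᵐ p ∂((volume.restrict (Set.Ioc 0 a)).prod (pointMeasure m (n + 1))),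
        p.1 ∈ Set.Ioc 0 a := by
      refine Measure.quasiMeasurePreserving_fst.ae ?_
      exact (ae_restrict_iff' measurableSet_Ioc).2 (Eventually.of_forall fun _ h => h)
    filter_upwards [hae] with p hp
    change ‖E.indicator F p‖ ≤ _
    have hp1 : p.1 ∈ Set.Ioc (0 : ℝ) 1 := ⟨hp.1, hp.2.trans ha.2⟩
    by_cases hpE : p ∈ E
    · rw [Set.indicator_of_mem hpE, Set.indicator_of_mem (orderedSet_mono hp1.2 hpE)]
      exact h.norm_phaseDens_smul_kernAt_le ht x y hp1 hpE
    · rw [Set.indicator_of_notMem hpE, norm_zero]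
      exact Set.indicator_nonneg (fun w _ => mul_nonneg hD0 (Real.exp_pos _).le) _
  have hl : ∀ s, ∫ w in orderedSet ν (n + 1) s, F (s, w) ∂pointMeasure m (n + 1)
      = ∫ w, E.indicator F (s, w) ∂pointMeasure m (n + 1) := fun s => by
    rw [← integral_indicator (measurableSet_orderedSet s)]
    rfl
  have hr : ∀ w, ∫ s in Set.Ioc 0 a, E.indicator F (s, w)
      = (orderedSet ν (n + 1) a).indicator (fun w => kernAt G W X g t a w
          - kernAt G W X g t (w (Fin.last n)).1 w) w := by
    intro w
    by_cases hw : w ∈ orderedSet ν (n + 1) a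
    · have hlast := hw.2 (Fin.last n)
      have hmono : ∀ j, (w j).1 ≤ (w (Fin.last n)).1 := fun j => hw.1.monotone (Fin.le_last j)
      rw [Set.indicator_of_mem hw, ← integral_phaseDens_smul_kernAt h.phase (h.mem_ball_r ht) X
        (orderedSet_mono ha.2 hw) hlast.1.le hmono hlast.2.le ha.2,
        intervalIntegral.integral_of_le hlast.2.le]
      have h1 : Set.Ioc (w (Fin.last n)).1 a = Set.Ioc 0 a ∩ Set.Ioi (w (Fin.last n)).1 := by
        rw [Set.Ioc_inter_Ioi, max_eq_right hlast.1.le]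
      rw [h1, ← setIntegral_indicator measurableSet_Ioi]
      refine integral_congr_ae (Eventually.of_forall fun s => ?_)
      change E.indicator F (s, w) = (Set.Ioi _).indicator (fun s => F (s, w)) s
      by_cases hs : (w (Fin.last n)).1 < s
      · rw [Set.indicator_of_mem (show s ∈ Set.Ioi _ from hs), Set.indicator_of_mem
          (show (s, w) ∈ E from ⟨hw.1, fun j => ⟨(hw.2 j).1, (hmono j).trans_lt hs⟩⟩)]
      · rw [Set.indicator_of_notMem (show s ∉ Set.Ioi _ from hs), Set.indicator_of_notMem
          (show (s, w) ∉ E from fun hsE => hs (hsE.2 _).2)]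
    · rw [Set.indicator_of_notMem hw]
      refine (setIntegral_congr_fun measurableSet_Ioc fun s hs => ?_).trans (integral_zero _ _)
      exact Set.indicator_of_notMem (fun hsE : (s, w) ∈ E => hw (orderedSet_mono hs.2 hsE)) F
  rw [intervalIntegral.integral_of_le ha.1.le]
  calc _ = ∫ s in Set.Ioc 0 a, ∫ w, E.indicator F (s, w) ∂pointMeasure m (n + 1) :=
        integral_congr_ae (Eventually.of_forall fun s => hl s)
    _ = ∫ w, (∫ s in Set.Ioc 0 a, E.indicator F (s, w)) ∂pointMeasure m (n + 1) :=
        integral_integral_swap hfi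
    _ = _ := by
        simp only [hr]
        rw [integral_indicator (measurableSet_orderedSet a)]

theorem integral_kernAt_succ {t : ℂ} (ht : t ∈ halfDiscBar (T / 2)) (x y : Fin ν → ℂ)
    {a : ℝ} (ha : a ∈ Set.Ioc (0 : ℝ) 1) (n : ℕ) :
    ∫ w in orderedSet ν (n + 1) a, kernAt G W (cPath G V H t x y) g t a w ∂pointMeasure m (n + 1)
      = (∫ s in (0 : ℝ)..a, c (s * t) (cPath G V H t x y s) *
          ∫ w in orderedSet ν n s, kernAt G W (cPath G V H t x y) g t s w ∂pointMeasure m n)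
        + ∫ s in (0 : ℝ)..a, ∫ w in orderedSet ν (n + 1) s,
          (-(t * phaseDens G W t (fun j => (w j).1) (fun j => (w j).2) s)) •
            kernAt G W (cPath G V H t x y) g t s w ∂pointMeasure m (n + 1) := by
  rw [← h.integral_last_time ht x y ha, h.integral_phaseDens_orderedSet ht x y ha,
    integral_sub (h.integrableOn_kernAt ht x y ha measurable_const fun w hw =>
      ⟨⟨ha.1, le_rfl⟩, fun j => (hw.2 j).2.le⟩)
    (h.integrableOn_kernAt ht x y ha (by fun_prop) fun w hw =>
      ⟨⟨(hw.2 _).1, (hw.2 _).2.le⟩, fun j => hw.1.monotone (Fin.le_last j)⟩)]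
  abel

end Deformation

end Duhamel

end

end HeatDeformation

namespace HeatDeformation

noncomputable section

set_option linter.unusedSectionVars false

section Single

theorem SmoothFamily.single {X : Type} [NormedAddCommGroup X] [NormedSpace ℂ X]
    {Ω : ℕ → Type} [∀ n, MeasurableSpace (Ω n)] {F : Type*} [NormedAddCommGroup F]
    [NormedSpace ℂ F] {P : ∀ n, Measure (Ω n)} {O D : Set X} {I : ∀ n, X → Ω n → F}
    (h : SmoothFamily P O D I) (n : ℕ) :
    SmoothFamily P O D fun k p w => if k = n then I k p w else 0 where
  isOpen := h.isOpen
  subset := h.subset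
  convex := h.convex
  meas k p hp := by
    by_cases hk : k = n
    · subst hk; simpa using h.meas k p hp
    · simpa [hk] using aestronglyMeasurable_const
  smooth k := by
    by_cases hk : k = n
    · subst hk; simpa using h.smooth k
    · simp only [hk, if_false]
      exact Eventually.of_forall fun _ => contDiffOn_const
  bound k p₀ hp₀ := by
    obtain ⟨ε, hε, b, hb, hs, hI⟩ := h.bound k p₀ hp₀
    refine ⟨ε, hε, b, hb, hs, fun l => ?_⟩
    filter_upwards [hI l] with w hw p hp
    by_cases hk : l = n
    · subst hk
      simpa using hw p hp
    · have h0 := (norm_nonneg _).trans (hw p hp)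
      simp only [hk, if_false]
      have : iteratedFDeriv ℂ k (fun _ : X => (0 : F)) p = 0 := by
        rw [iteratedFDeriv_fun_zero]; rfl
      rwa [this, norm_zero]

theorem SmoothFamily.hasFDerivWithinAt_integral {X : Type} [NormedAddCommGroup X]
    [NormedSpace ℂ X] [FiniteDimensional ℂ X]
    {Ω : ℕ → Type} [∀ n, MeasurableSpace (Ω n)] {F : Type*} [NormedAddCommGroup F]
    [NormedSpace ℂ F] [CompleteSpace F] {P : ∀ n, Measure (Ω n)} {O D : Set X}
    {I : ∀ n, X → Ω n → F} (h : SmoothFamily P O D I) (n : ℕ) {p₀ : X} (hp₀ : p₀ ∈ D) :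
    HasFDerivWithinAt (fun p => ∫ w, I n p w ∂P n)
      (∫ w, _root_.fderiv ℂ (fun p => I n p w) p₀ ∂P n) D p₀ := by
  have h1 := (h.single n).hasFDerivWithinAt hp₀
  have e1 : (fun p => ∑' k, ∫ w, (if k = n then I k p w else 0) ∂P k)
      = fun p => ∫ w, I n p w ∂P n := by
    funext p
    rw [tsum_eq_single n fun k hk => by simp [hk]]
    simp
  have e2 : (∑' k, ∫ w, _root_.fderiv ℂ (fun p => if k = n then I k p w else 0) p₀ ∂P k)
      = ∫ w, _root_.fderiv ℂ (fun p => I n p w) p₀ ∂P n := by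
    rw [tsum_eq_single n fun k hk => by simp [hk]]
    simp
  rwa [e1, e2] at h1

end Single

variable {ν n : ℕ} {𝓜 : Type*} [NormedRing 𝓜] [NormedAlgebra ℂ 𝓜] [NormOneClass 𝓜]
  [FiniteDimensional ℂ 𝓜] [MeasurableSpace 𝓜] [BorelSpace 𝓜]
  {A B C G W V H : ℂ → Matrix (Fin ν) (Fin ν) ℂ} {r K Tb T : ℝ}
  {c : ℂ → (Fin ν → ℂ) → 𝓜} {m : Measure (EuclideanSpace ℝ (Fin ν))}
  {g : ℂ → EuclideanSpace ℝ (Fin ν) → 𝓜}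

section Transport

/-! ### The transport equation for the deformation series -/

theorem Phase.cPath_one (h : Phase A B C r K G W V H) {t : ℂ} (ht : t ∈ Metric.ball (0 : ℂ) r)
    (x y : Fin ν → ℂ) : cPath G V H t x y 1 = x := by
  simp [cPath, h.mul_GH t ht]

theorem Phase.A_eq (h : Phase A B C r K G W V H) {t : ℂ} (ht : t ∈ Metric.ball (0 : ℂ) r) :
    A t = G t * W t * (G t).transpose := by
  rw [h.W_eq t ht, mul_assoc, mul_assoc, mul_assoc, ← Matrix.transpose_mul, h.mul_GH t ht,
    Matrix.transpose_one, mul_one, ← mul_assoc, h.mul_GH t ht, one_mul]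

theorem Phase.differentiableOn_A (h : Phase A B C r K G W V H) (j k : Fin ν) :
    DifferentiableOn ℂ (fun t => A t j k) (Metric.ball 0 r) := by
  have h1 : DifferentiableOn ℂ (fun t => ∑ b, (∑ a, G t j a * W t a b) * G t k b)
      (Metric.ball 0 r) :=
    DifferentiableOn.fun_sum fun b _ => (DifferentiableOn.fun_sum fun a _ =>
      (h.holG.diff j a).mul (h.holW.diff a b)).mul (h.holG.diff k b)
  refine h1.congr fun t ht => ?_
  rw [h.A_eq ht]
  simp [Matrix.mul_apply]

namespace Deformation

variable (h : Deformation A B C c r K Tb T G W V H m g)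
include h

/-- The dilation curve through `(t, x, y)`. -/
theorem continuousOn_dilation {t : ℂ} (ht : t ∈ halfDiscBar (T / 2)) (x y : Fin ν → ℂ) :
    ContinuousOn (fun a : ℝ => ((a : ℂ) * t, cPath G V H t x y a, y)) (Set.Icc 0 1) :=
  ContinuousOn.prodMk (by fun_prop)
    ((h.phase.continuousOn_cPath (h.mem_ball_r ht) x y).prodMk continuousOn_const)

theorem mapsTo_dilation {t : ℂ} (ht : t ∈ halfDiscBar (T / 2)) (x y : Fin ν → ℂ) :
    Set.MapsTo (fun a : ℝ => ((a : ℂ) * t, cPath G V H t x y a, y)) (Set.Icc 0 1)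
      (halfDiscBar (T / 2) ×ˢ Set.univ) :=
  fun _ ha => ⟨smul_mem_halfDiscBar ht ha.1 ha.2, trivial⟩

theorem continuousOn_integral_kern (n : ℕ) :
    ContinuousOn (fun p => ∫ w, kern G W V H g n p w ∂seriesMeasure m n)
      (halfDiscBar (T / 2) ×ˢ Set.univ) := by
  have : CompleteSpace 𝓜 := FiniteDimensional.complete ℂ 𝓜
  exact fun p hp => (h.smoothFamily.hasFDerivWithinAt_integral n hp).continuousWithinAt

theorem continuousOn_integral_phaseDens (n : ℕ) :
    ContinuousOn (fun p : ℂ × (Fin ν → ℂ) × (Fin ν → ℂ) =>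
      ∫ w, -phaseDens G W p.1 (fun j => (w j).1) (fun j => (w j).2) 1 • kern G W V H g n p w
        ∂seriesMeasure m n) (halfDiscBar (T / 2) ×ˢ Set.univ) := by
  have : CompleteSpace 𝓜 := FiniteDimensional.complete ℂ 𝓜
  have h1 : ContinuousOn (fun p : ℂ × (Fin ν → ℂ) × (Fin ν → ℂ) => ∑ j, ∑ k, A p.1 j k •
      ∫ w, dirDeriv (xDir (Pi.single j 1)) (fun p => dirDeriv (xDir (Pi.single k 1))
        (fun p => kern G W V H g n p w) p) p ∂seriesMeasure m n)
      (halfDiscBar (T / 2) ×ˢ Set.univ) := by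
    refine continuousOn_finsetSum _ fun j _ => continuousOn_finsetSum _ fun k _ =>
      ContinuousOn.smul ?_ fun p hp =>
        ((h.smoothFamily_dirDeriv _ _).hasFDerivWithinAt_integral n hp).continuousWithinAt
    exact (h.phase.differentiableOn_A j k).continuousOn.comp continuousOn_fst
      fun p hp => h.mem_ball_r hp.1
  exact h1.congr fun p hp => (h.sum_integral_dirDeriv hp.1 p.2 n).symm

theorem integral_kern_eq_integral {t : ℂ} (ht : t ∈ halfDiscBar (T / 2)) (x y : Fin ν → ℂ)
    {a : ℝ} (ha : a ∈ Set.Ioc (0 : ℝ) 1) (n : ℕ) :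
    ∫ w, kern G W V H g (n + 1) ((a : ℂ) * t, cPath G V H t x y a, y) w ∂seriesMeasure m (n + 1)
      = t • ∫ s in (0 : ℝ)..a, (c (s * t) (cPath G V H t x y s) *
          (∫ w, kern G W V H g n ((s : ℂ) * t, cPath G V H t x y s, y) w ∂seriesMeasure m n)
        + ∫ w, -phaseDens G W (s * t) (fun j => (w j).1) (fun j => (w j).2) 1 •
            kern G W V H g (n + 1) ((s : ℂ) * t, cPath G V H t x y s, y) w
            ∂seriesMeasure m (n + 1)) := by
  have : CompleteSpace 𝓜 := FiniteDimensional.complete ℂ 𝓜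
  have := h.isFiniteMeasure
  have htr := h.mem_ball_r ht
  have hcont := h.continuousOn_dilation ht x y
  have hmaps := h.mapsTo_dilation ht x y
  have hsub : Set.Icc 0 a ⊆ Set.Icc 0 1 := Set.Icc_subset_Icc_right ha.2
  have c1 : ContinuousOn (fun s : ℝ => c (s * t) (cPath G V H t x y s)) (Set.Icc 0 1) :=
    h.pot.continuousOn_curve isCompact_Icc (by fun_prop)
      (fun s hs => h.mem_ball_Tb (smul_mem_halfDiscBar ht hs.1 hs.2))
      (h.phase.continuousOn_cPath htr x y)
  have c2 := c1.mul ((h.continuousOn_integral_kern n).comp hcont hmaps)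
  have c3 := (h.continuousOn_integral_phaseDens (n + 1)).comp hcont hmaps
  have i1 := ((c2.mono hsub).intervalIntegrable_of_Icc ha.1.le (μ := volume))
  have i2 := ((c3.mono hsub).intervalIntegrable_of_Icc ha.1.le (μ := volume))
  have e0 : ∀ (n : ℕ) {s : ℝ}, s ∈ Set.Ioc (0 : ℝ) 1 →
      ∫ w, kern G W V H g n ((s : ℂ) * t, cPath G V H t x y s, y) w ∂seriesMeasure m n
      = t ^ n • ∫ w in orderedSet ν n s, kernAt G W (cPath G V H t x y) g t s w
        ∂pointMeasure m n := fun n s hs => by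
    simpa using h.phase.integral_kern_scale (n := n) (m := m) (g := g) htr hs x y fun _ => 1
  have e1 : ∀ s ∈ Set.Ioc (0 : ℝ) 1,
      ∫ w, -phaseDens G W (s * t) (fun j => (w j).1) (fun j => (w j).2) 1 •
        kern G W V H g (n + 1) ((s : ℂ) * t, cPath G V H t x y s, y) w ∂seriesMeasure m (n + 1)
      = t ^ (n + 1) • ∫ w in orderedSet ν (n + 1) s,
        (-phaseDens G W t (fun j => (w j).1) (fun j => (w j).2) s) •
          kernAt G W (cPath G V H t x y) g t s w ∂pointMeasure m (n + 1) := fun s hs => by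
    rw [← h.phase.integral_kern_scale (n := n + 1) htr hs x y
      fun w => -phaseDens G W t (fun j => (w j).1) (fun j => (w j).2) s]
    refine integral_congr_ae (Eventually.of_forall fun w => ?_)
    simp only [phaseDens_scale hs.1, mul_one, scalePoints]
  have hadd := intervalIntegral.integral_add i1 i2
  simp only [Pi.mul_apply, Function.comp_apply] at hadd
  rw [e0 _ ha, h.integral_kernAt_succ ht x y ha, hadd, smul_add,
    smul_add, ← intervalIntegral.integral_smul, ← intervalIntegral.integral_smul,
    ← intervalIntegral.integral_smul, ← intervalIntegral.integral_smul]
  congr 1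
  · refine intervalIntegral.integral_congr_ae (Eventually.of_forall fun s hs => ?_)
    rw [Set.uIoc_of_le ha.1.le] at hs
    rw [e0 n ⟨hs.1, hs.2.trans ha.2⟩, mul_smul_comm, smul_smul, pow_succ']
  · refine intervalIntegral.integral_congr_ae (Eventually.of_forall fun s hs => ?_)
    rw [Set.uIoc_of_le ha.1.le] at hs
    have e2 : ∀ w : Fin (n + 1) → ℝ × EuclideanSpace ℝ (Fin ν),
        (-(t * phaseDens G W t (fun j => (w j).1) (fun j => (w j).2) s)) •
          kernAt G W (cPath G V H t x y) g t s w
        = t • ((-phaseDens G W t (fun j => (w j).1) (fun j => (w j).2) s) •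
          kernAt G W (cPath G V H t x y) g t s w) := fun w => by
      rw [smul_smul, mul_neg]
    simp only [e2]
    rw [e1 s ⟨hs.1, hs.2.trans ha.2⟩, integral_smul, smul_comm]

theorem integral_fderiv_kern {t : ℂ} (ht : t ∈ halfDiscBar (T / 2)) (x y : Fin ν → ℂ)
    {X₁ : Fin ν → ℂ} (hX : HasDerivWithinAt (cPath G V H t x y) X₁ (Set.Icc 0 1) 1) (n : ℕ) :
    (∫ w, fderiv ℂ (fun p => kern G W V H g (n + 1) p w) (t, x, y) ∂seriesMeasure m (n + 1))
        (t, X₁, 0)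
      = t • (c t x * (∫ w, kern G W V H g n (t, x, y) w ∂seriesMeasure m n)
        + ∫ w, -phaseDens G W t (fun j => (w j).1) (fun j => (w j).2) 1 •
            kern G W V H g (n + 1) (t, x, y) w ∂seriesMeasure m (n + 1)) := by
  have : CompleteSpace 𝓜 := FiniteDimensional.complete ℂ 𝓜
  have htr := h.mem_ball_r ht
  have hcont := h.continuousOn_dilation ht x y
  have hmaps := h.mapsTo_dilation ht x y
  have hone : (1 : ℝ) ∈ Set.Icc (0 : ℝ) 1 := ⟨zero_le_one, le_rfl⟩
  have hγ1 : (((1 : ℝ) : ℂ) * t, cPath G V H t x y 1, y) = (t, x, y) := by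
    rw [Complex.ofReal_one, one_mul, h.phase.cPath_one htr]
  have hγ : HasDerivWithinAt (fun a : ℝ => ((a : ℂ) * t, cPath G V H t x y a, y)) (t, X₁, 0)
      (Set.Icc 0 1) 1 := by
    refine HasDerivWithinAt.prodMk ?_ (hX.prodMk (hasDerivWithinAt_const _ _ _))
    simpa using ((Complex.ofRealCLM.hasDerivAt (x := (1 : ℝ))).mul_const t).hasDerivWithinAt
  have hp : (t, x, y) ∈ halfDiscBar (T / 2) ×ˢ (Set.univ : Set ((Fin ν → ℂ) × (Fin ν → ℂ))) :=
    ⟨ht, trivial⟩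
  have hJ := (h.smoothFamily.hasFDerivWithinAt_integral (n + 1) hp).restrictScalars ℝ
  rw [← hγ1] at hJ
  have hL := hJ.comp_hasDerivWithinAt 1 hγ hmaps
  rw [hγ1] at hL
  have c1 : ContinuousOn (fun s : ℝ => c (s * t) (cPath G V H t x y s)) (Set.Icc 0 1) :=
    h.pot.continuousOn_curve isCompact_Icc (by fun_prop)
      (fun s hs => h.mem_ball_Tb (smul_mem_halfDiscBar ht hs.1 hs.2))
      (h.phase.continuousOn_cPath htr x y)
  have c2 := (c1.mul ((h.continuousOn_integral_kern n).comp hcont hmaps)).add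
    ((h.continuousOn_integral_phaseDens (n + 1)).comp hcont hmaps)
  have : Fact ((1 : ℝ) ∈ Set.Icc (0 : ℝ) 1) := ⟨hone⟩
  have hR := (intervalIntegral.integral_hasDerivWithinAt_right (s := Set.Icc 0 1)
    (t := Set.Icc 0 1) (c2.intervalIntegrable_of_Icc zero_le_one (μ := volume))
    (c2.stronglyMeasurableAtFilter_nhdsWithin measurableSet_Icc 1) (c2 1 hone)).const_smul t
  have hsub : Set.Ioc (0 : ℝ) 1 ⊆ Set.Icc 0 1 := Set.Ioc_subset_Icc_self
  have hmem : (1 : ℝ) ∈ Set.Ioc (0 : ℝ) 1 := ⟨zero_lt_one, le_rfl⟩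
  have hR' := (hR.mono hsub).congr (fun a ha => h.integral_kern_eq_integral ht x y ha n)
    (h.integral_kern_eq_integral ht x y hmem n)
  have key := (uniqueDiffOn_Ioc (0 : ℝ) 1 1 hmem).eq_deriv _ (hL.mono hsub) hR'
  simp only [Function.comp_def, Pi.add_apply, Pi.mul_apply, Complex.ofReal_one, one_mul,
    h.phase.cPath_one htr] at key
  exact key

/-- The transport equation for `p^conj`. -/
theorem fderivWithin_pConj {t : ℂ} (ht : t ∈ halfDiscBar (T / 2)) (x y : Fin ν → ℂ)
    {X₁ : Fin ν → ℂ} (hX : HasDerivWithinAt (cPath G V H t x y) X₁ (Set.Icc 0 1) 1) :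
    fderivWithin ℂ (fun p : ℂ × (Fin ν → ℂ) × (Fin ν → ℂ) => pConj A B C c p.1 p.2.1 p.2.2)
        (halfDiscBar (T / 2) ×ˢ Set.univ) (t, x, y) (t, X₁, 0)
      = t • (c t x * pConj A B C c t x y
        + ∑ j, ∑ k, A t j k • pd j (pd k fun x => pConj A B C c t x y) x) := by
  have : CompleteSpace 𝓜 := FiniteDimensional.complete ℂ 𝓜
  have hp : (t, x, y) ∈ halfDiscBar (T / 2) ×ˢ (Set.univ : Set ((Fin ν → ℂ) × (Fin ν → ℂ))) :=
    ⟨ht, trivial⟩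
  have hu := (uniqueDiffOn_halfDiscBar (half_pos h.pos)).prod
    (uniqueDiffOn_univ (𝕜 := ℂ) (E := (Fin ν → ℂ) × (Fin ν → ℂ))) _ hp
  have h0 : HasFDerivWithinAt
      (fun p : ℂ × (Fin ν → ℂ) × (Fin ν → ℂ) => pConj A B C c p.1 p.2.1 p.2.2) _
      (halfDiscBar (T / 2) ×ˢ Set.univ) (t, x, y) :=
    (h.smoothFamily.hasFDerivWithinAt hp).congr (fun p hp => h.pConj_eq hp.1 p.2.1 p.2.2)
      (h.pConj_eq ht x y)
  have hS := (h.smoothFamily.fderiv.summable_norm hp).of_norm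
  rw [h0.fderivWithin hu]
  have e1 := (ContinuousLinearMap.apply ℂ 𝓜 ((t, X₁, 0) : ℂ × (Fin ν → ℂ) × (Fin ν → ℂ))).map_tsum
    hS
  simp only [ContinuousLinearMap.apply_apply] at e1
  have hS' : Summable fun n => (∫ w, fderiv ℂ (fun p => kern G W V H g n p w) (t, x, y)
      ∂seriesMeasure m n) (t, X₁, 0) :=
    (ContinuousLinearMap.apply ℂ 𝓜 ((t, X₁, 0) : ℂ × (Fin ν → ℂ) × (Fin ν → ℂ))).summable hS
  have z1 : (∫ w, fderiv ℂ (fun p => kern G W V H g 0 p w) (t, x, y) ∂seriesMeasure m 0)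
      (t, X₁, 0) = 0 := by
    have : ∀ w, (fun p => kern G W V H g 0 p w) = fun _ => (1 : 𝓜) := fun w => by
      funext p
      simp [kern, kernCore, quadPhase, phaseQ, phaseDens, waveVec, avg, linPhase, gProd]
    simp [this]
  set D : ℕ → 𝓜 := fun n => ∫ w, -phaseDens G W t (fun j => (w j).1) (fun j => (w j).2) 1 •
    kern G W V H g n (t, x, y) w ∂seriesMeasure m n with hD
  have z2 : D 0 = 0 := by
    simp [hD, phaseDens, waveVec, avg]
  have sJ : Summable fun n => ∫ w, kern G W V H g n (t, x, y) w ∂seriesMeasure m n :=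
    (h.smoothFamily.summable_norm hp).of_norm
  have sD : Summable D := by
    simp only [hD, ← h.sum_integral_dirDeriv ht (x, y)]
    exact summable_sum fun j _ => summable_sum fun k _ =>
      ((h.smoothFamily_dirDeriv _ _).summable_norm hp).of_norm.const_smul _
  refine e1.trans ?_
  rw [hS'.tsum_eq_zero_add, z1, zero_add]
  simp only [h.integral_fderiv_kern ht x y hX]
  have sD' : Summable fun n => D (n + 1) := (summable_nat_add_iff 1).2 sD
  have sJ' : Summable fun n => c t x * ∫ w, kern G W V H g n (t, x, y) w ∂seriesMeasure m n :=
    sJ.mul_left _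
  rw [h.sum_pd_pConj ht, h.pConj_eq ht]
  change _ = t • (_ + ∑' n, D n)
  rw [sD.tsum_eq_zero_add, z2, zero_add, ← sJ.tsum_mul_left, ← sJ'.tsum_add sD']
  exact (sJ'.add sD').tsum_const_smul t

end Deformation

end Transport

end

end HeatDeformation

namespace HeatDeformation

noncomputable section

set_option linter.unusedSectionVars false

open scoped Matrix.Norms.Operator

variable {ν : ℕ} {A B C : ℂ → Matrix (Fin ν) (Fin ν) ℂ} {r : ℝ}
  {G U' V V' : ℂ → Matrix (Fin ν) (Fin ν) ℂ}

section Momentum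

/-! ### Momenta and the Riccati equation -/

/-- Application of matrices to a fixed vector. -/
def mulVecCL (v : Fin ν → ℂ) : Matrix (Fin ν) (Fin ν) ℂ →L[ℂ] (Fin ν → ℂ) :=
  LinearMap.toContinuousLinearMap
    { toFun := fun M => M.mulVec v
      map_add' := fun M N => Matrix.add_mulVec M N v
      map_smul' := fun c M => Matrix.smul_mulVec c M v }

theorem hasDerivAt_mulVec {M : ℂ → Matrix (Fin ν) (Fin ν) ℂ} {M' : Matrix (Fin ν) (Fin ν) ℂ} {z : ℂ}
    (h : HasDerivAt M M' z) (v : Fin ν → ℂ) :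
    HasDerivAt (fun z => (M z).mulVec v) (M'.mulVec v) z :=
  (mulVecCL v).hasFDerivAt.comp_hasDerivAt z h

theorem hasDerivAt_dotProduct {f g : ℂ → Fin ν → ℂ} {f' g' : Fin ν → ℂ} {z : ℂ}
    (hf : HasDerivAt f f' z) (hg : HasDerivAt g g' z) :
    HasDerivAt (fun z => f z ⬝ᵥ g z) (f' ⬝ᵥ g z + f z ⬝ᵥ g') z := by
  have := HasDerivAt.fun_sum (u := Finset.univ) fun i _ =>
    (hasDerivAt_pi.1 hf i).mul (hasDerivAt_pi.1 hg i)
  refine this.congr_deriv ?_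
  simp only [dotProduct, Finset.sum_add_distrib]

theorem hasDerivAt_transpose {M : ℂ → Matrix (Fin ν) (Fin ν) ℂ} {M' : Matrix (Fin ν) (Fin ν) ℂ}
    {z : ℂ} (h : HasDerivAt M M' z) : HasDerivAt (fun z => (M z).transpose) M'.transpose z :=
  (transposeCL (ν := ν)).hasFDerivAt.comp_hasDerivAt z h

theorem hasDerivAt_matrix_inv {M : ℂ → Matrix (Fin ν) (Fin ν) ℂ} {M' : Matrix (Fin ν) (Fin ν) ℂ}
    {z : ℂ} (h : HasDerivAt M M' z) (hu : IsUnit (M z)) :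
    HasDerivAt (fun z => (M z)⁻¹) (-((M z)⁻¹ * M' * (M z)⁻¹)) z := by
  have hd : DifferentiableAt ℂ (fun z => (M z)⁻¹) z := differentiableAt_inv h.differentiableAt hu
  have h1 : HasDerivAt (fun z => (M z)⁻¹) (matDeriv (fun z => (M z)⁻¹) z) z :=
    hasDerivAt_matDeriv hd
  generalize matDeriv (fun z => (M z)⁻¹) z = N at h1
  have h2 : HasDerivAt (fun z => (M z)⁻¹ * M z) (N * M z + (M z)⁻¹ * M') z := h1.mul h
  have h3 : (fun z => (M z)⁻¹ * M z) =ᶠ[𝓝 z] fun _ => 1 := by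
    filter_upwards [h.continuousAt (Units.isOpen.mem_nhds hu)] with w hw
    exact inv_mul_self hw
  have h4 := h2.unique ((hasDerivAt_const z (1 : Matrix (Fin ν) (Fin ν) ℂ)).congr_of_eventuallyEq h3)
  have h5 : N = -((M z)⁻¹ * M' * (M z)⁻¹) := by
    have := congrArg (· * (M z)⁻¹) h4
    simp only [add_mul, zero_mul, mul_assoc, mul_inv_self hu, mul_one] at this
    rw [mul_assoc]
    exact eq_neg_of_add_eq_zero_left this
  rwa [h5] at h1

/-- The momentum `½ A⁻¹ Q' + B Q` of a solution `Q`. -/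
def momentum (A B Q Q' : ℂ → Matrix (Fin ν) (Fin ν) ℂ) (z : ℂ) : Matrix (Fin ν) (Fin ν) ℂ :=
  (1 / 2 : ℂ) • ((A z)⁻¹ * Q' z) + B z * Q z

namespace Flow

variable (h : Flow A B C r G U' V V')
include h

theorem hasDerivAt_momentum {Q Q' : ℂ → Matrix (Fin ν) (Fin ν) ℂ} {z : ℂ}
    (hz : z ∈ Metric.ball (0 : ℂ) r) (hQ : HasDerivAt Q (Q' z) z)
    (hQ' : HasDerivAt Q' (coefE A B z * Q' z + coefF A B C z * Q z) z) :
    HasDerivAt (momentum A B Q Q')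
      ((B z).transpose * Q' z + (2 : ℂ) • (C z * Q z)) z := by
  have hA := hasDerivAt_matDeriv (h.differentiableAt_A hz)
  have hB := hasDerivAt_matDeriv (h.differentiableAt_B hz)
  have h1 := (((hasDerivAt_matrix_inv hA (h.unitA z hz)).mul hQ').const_smul (1 / 2 : ℂ)).add
    (hB.mul hQ)
  refine h1.congr_deriv ?_
  have e : (A z)⁻¹ * A z = 1 := inv_mul_self (h.unitA z hz)
  have e1 : (A z)⁻¹ * (coefE A B z * Q' z + coefF A B C z * Q z)
      = (A z)⁻¹ * matDeriv A z * (A z)⁻¹ * Q' z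
        + (2 : ℂ) • (((A z)⁻¹ * A z) * ((B z).transpose - B z) * Q' z)
        + (4 : ℂ) • (((A z)⁻¹ * A z) * C z * Q z)
        - (2 : ℂ) • (((A z)⁻¹ * A z) * matDeriv B z * Q z) := by
    rw [coefE, coefF]
    simp only [mul_add, add_mul, mul_sub, sub_mul, smul_mul_assoc, mul_smul_comm, mul_assoc,
      smul_sub]
    abel
  rw [e1, e]
  simp only [one_mul, mul_sub, sub_mul, neg_mul, smul_add, smul_sub, smul_neg, smul_smul, mul_assoc]
  norm_num
  abel

theorem hasDerivAt_wronskian {Q₁ Q₁' Q₂ Q₂' : ℂ → Matrix (Fin ν) (Fin ν) ℂ} {z : ℂ}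
    (hz : z ∈ Metric.ball (0 : ℂ) r) (hQ₁ : HasDerivAt Q₁ (Q₁' z) z)
    (hQ₁' : HasDerivAt Q₁' (coefE A B z * Q₁' z + coefF A B C z * Q₁ z) z)
    (hQ₂ : HasDerivAt Q₂ (Q₂' z) z)
    (hQ₂' : HasDerivAt Q₂' (coefE A B z * Q₂' z + coefF A B C z * Q₂ z) z) :
    HasDerivAt (fun z => (Q₁ z).transpose * momentum A B Q₂ Q₂' z
      - (momentum A B Q₁ Q₁' z).transpose * Q₂ z) 0 z := by
  have h1 := ((hasDerivAt_transpose hQ₁).mul (h.hasDerivAt_momentum hz hQ₂ hQ₂')).sub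
    ((hasDerivAt_transpose (h.hasDerivAt_momentum hz hQ₁ hQ₁')).mul hQ₂)
  refine h1.congr_deriv ?_
  have e : ((A z)⁻¹).transpose = (A z)⁻¹ := by rw [Matrix.transpose_nonsing_inv, h.symmA z hz]
  simp only [momentum, Matrix.transpose_add, Matrix.transpose_smul, Matrix.transpose_mul,
    Matrix.transpose_transpose, e, h.symmC z hz]
  simp only [mul_add, add_mul, smul_mul_assoc, mul_smul_comm, mul_assoc]
  abel

theorem wronskian_eq {Q₁ Q₁' Q₂ Q₂' : ℂ → Matrix (Fin ν) (Fin ν) ℂ}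
    (hQ₁ : ∀ z ∈ Metric.ball (0 : ℂ) r, HasDerivAt Q₁ (Q₁' z) z)
    (hQ₁' : ∀ z ∈ Metric.ball (0 : ℂ) r,
      HasDerivAt Q₁' (coefE A B z * Q₁' z + coefF A B C z * Q₁ z) z)
    (hQ₂ : ∀ z ∈ Metric.ball (0 : ℂ) r, HasDerivAt Q₂ (Q₂' z) z)
    (hQ₂' : ∀ z ∈ Metric.ball (0 : ℂ) r,
      HasDerivAt Q₂' (coefE A B z * Q₂' z + coefF A B C z * Q₂ z) z)
    {z : ℂ} (hz : z ∈ Metric.ball (0 : ℂ) r) :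
    (Q₁ z).transpose * momentum A B Q₂ Q₂' z - (momentum A B Q₁ Q₁' z).transpose * Q₂ z
      = (Q₁ 0).transpose * momentum A B Q₂ Q₂' 0 - (momentum A B Q₁ Q₁' 0).transpose * Q₂ 0 := by
  have hd := fun z hz => h.hasDerivAt_wronskian hz (hQ₁ z hz) (hQ₁' z hz) (hQ₂ z hz) (hQ₂' z hz)
  exact (convex_ball (0 : ℂ) r).is_const_of_fderivWithin_eq_zero (𝕜 := ℂ)
    (f := fun z => (Q₁ z).transpose * momentum A B Q₂ Q₂' z
      - (momentum A B Q₁ Q₁' z).transpose * Q₂ z)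
    (fun z hz => (hd z hz).differentiableAt.differentiableWithinAt)
    (fun z hz => ((fderivWithin_of_isOpen Metric.isOpen_ball hz).trans
      (hd z hz).hasFDerivAt.fderiv).trans (ContinuousLinearMap.toSpanSingleton_zero ℂ)) hz (Metric.mem_ball_self h.pos)

end Flow

/-- The inverse of `U(t) = t G(t)`. -/
def flowInv (G : ℂ → Matrix (Fin ν) (Fin ν) ℂ) (t : ℂ) : Matrix (Fin ν) (Fin ν) ℂ :=
  t⁻¹ • (G t)⁻¹

/-- The coefficient of `½ x ⊗ x` in the action. -/
def actR (A B G U' : ℂ → Matrix (Fin ν) (Fin ν) ℂ) (t : ℂ) : Matrix (Fin ν) (Fin ν) ℂ :=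
  momentum A B (fun z => z • G z) U' t * flowInv G t

/-- The coefficient of `-y ⊗ x` in the action. -/
def actJ (A G : ℂ → Matrix (Fin ν) (Fin ν) ℂ) (t : ℂ) : Matrix (Fin ν) (Fin ν) ℂ :=
  (1 / 2 : ℂ) • ((A 0)⁻¹ * flowInv G t)

/-- The coefficient of `½ y ⊗ y` in the action. -/
def actZ (A B G V : ℂ → Matrix (Fin ν) (Fin ν) ℂ) (t : ℂ) : Matrix (Fin ν) (Fin ν) ℂ :=
  actJ A G t * V t - B 0

namespace Flow

variable (h : Flow A B C r G U' V V')
include h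

theorem smul_mul_flowInv {t : ℂ} (ht : t ∈ Metric.ball (0 : ℂ) r) (h0 : t ≠ 0) :
    (t • G t) * flowInv G t = 1 := by
  rw [flowInv, smul_mul_smul_comm, mul_inv_cancel₀ h0, one_smul, mul_inv_self (h.unitG t ht)]

theorem flowInv_mul_smul {t : ℂ} (ht : t ∈ Metric.ball (0 : ℂ) r) (h0 : t ≠ 0) :
    flowInv G t * (t • G t) = 1 := by
  rw [flowInv, smul_mul_smul_comm, inv_mul_cancel₀ h0, one_smul, inv_mul_self (h.unitG t ht)]

theorem hasDerivAt_flowInv {t : ℂ} (ht : t ∈ Metric.ball (0 : ℂ) r) (h0 : t ≠ 0) :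
    HasDerivAt (flowInv G) (-(flowInv G t * U' t * flowInv G t)) t := by
  have e : ∀ t ∈ Metric.ball (0 : ℂ) r, t ≠ 0 → (t • G t)⁻¹ = flowInv G t := fun t ht h0 =>
    Matrix.inv_eq_left_inv (h.flowInv_mul_smul ht h0)
  have h1 := hasDerivAt_matrix_inv (h.hasDerivU t ht) (IsUnit.of_mul_eq_one _
    (h.smul_mul_flowInv ht h0))
  rw [e t ht h0] at h1
  refine h1.congr_of_eventuallyEq ?_
  filter_upwards [Metric.isOpen_ball.mem_nhds ht, isOpen_ne.mem_nhds h0] with s hs hs0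
  exact (e s hs hs0).symm

theorem transpose_inv_zero : ((A 0)⁻¹).transpose = (A 0)⁻¹ := by
  rw [Matrix.transpose_nonsing_inv, h.symmA 0 (Metric.mem_ball_self h.pos)]

theorem actR_symm {t : ℂ} (ht : t ∈ Metric.ball (0 : ℂ) r) (h0 : t ≠ 0) :
    (actR A B G U' t).transpose = actR A B G U' t := by
  have h1 := h.wronskian_eq h.hasDerivU h.hasDerivU' h.hasDerivU h.hasDerivU' ht
  simp only [zero_smul, Matrix.transpose_zero, zero_mul, mul_zero, sub_zero] at h1
  have h2 := congrArg (fun M => (flowInv G t).transpose * M * flowInv G t) (sub_eq_zero.1 h1)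
  have e1 : (flowInv G t).transpose * (t • G t).transpose = 1 := by
    rw [← Matrix.transpose_mul, h.smul_mul_flowInv ht h0, Matrix.transpose_one]
  rw [← mul_assoc, e1, one_mul, mul_assoc, mul_assoc, h.smul_mul_flowInv ht h0, mul_one] at h2
  rw [actR, Matrix.transpose_mul, ← h2]

theorem momentum_V {t : ℂ} (ht : t ∈ Metric.ball (0 : ℂ) r) (h0 : t ≠ 0) :
    momentum A B V V' t = actR A B G U' t * V t - (actJ A G t).transpose := by
  have h1 := h.wronskian_eq h.hasDerivU h.hasDerivU' h.hasDerivV h.hasDerivV' ht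
  have e0 : momentum A B (fun z => z • G z) U' 0 = (1 / 2 : ℂ) • (A 0)⁻¹ := by
    simp [momentum, h.U'_zero]
  rw [e0] at h1
  simp only [zero_smul, Matrix.transpose_zero, zero_mul, zero_sub, h.V_zero, mul_one,
    Matrix.transpose_smul, h.transpose_inv_zero] at h1
  have h2 := congrArg (fun M => (flowInv G t).transpose * M) h1
  have e1 : (flowInv G t).transpose * (t • G t).transpose = 1 := by
    rw [← Matrix.transpose_mul, h.smul_mul_flowInv ht h0, Matrix.transpose_one]
  have e2 : (flowInv G t).transpose * (momentum A B (fun z => z • G z) U' t).transpose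
      = actR A B G U' t := by
    rw [← Matrix.transpose_mul, ← actR, h.actR_symm ht h0]
  simp only [mul_sub] at h2
  rw [Matrix.transpose_smul] at e1
  rw [← mul_assoc, e1, one_mul, ← mul_assoc, e2] at h2
  rw [actJ, Matrix.transpose_smul, Matrix.transpose_mul, h.transpose_inv_zero,
    sub_eq_iff_eq_add.1 h2, mul_neg, mul_smul_comm]
  abel

theorem deriv_mul_flowInv {t : ℂ} (ht : t ∈ Metric.ball (0 : ℂ) r) (h0 : t ≠ 0) :
    U' t * flowInv G t = (2 : ℂ) • (A t * (actR A B G U' t - B t)) := by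
  rw [actR, momentum, add_mul, mul_assoc (B t), h.smul_mul_flowInv ht h0, mul_one,
    add_sub_cancel_right, smul_mul_assoc, mul_smul_comm, smul_smul, mul_assoc, ← mul_assoc (A t),
    mul_inv_self (h.unitA t ht)]
  norm_num

theorem V'_eq {t : ℂ} (ht : t ∈ Metric.ball (0 : ℂ) r) (h0 : t ≠ 0) :
    V' t = (2 : ℂ) • (A t * ((actR A B G U' t - B t) * V t - (actJ A G t).transpose)) := by
  have h1 := h.momentum_V ht h0
  have h2 : V' t = (2 : ℂ) • (A t * (momentum A B V V' t - B t * V t)) := by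
    rw [momentum, add_sub_cancel_right, mul_smul_comm, smul_smul, ← mul_assoc,
      mul_inv_self (h.unitA t ht)]
    norm_num
  rw [h2, h1, sub_mul]
  congr 2
  abel

theorem hasDerivAt_actR {t : ℂ} (ht : t ∈ Metric.ball (0 : ℂ) r) (h0 : t ≠ 0) :
    HasDerivAt (actR A B G U') ((2 : ℂ) • C t - (2 : ℂ) •
      ((actR A B G U' t - B t).transpose * A t * (actR A B G U' t - B t))) t := by
  have h1 := (h.hasDerivAt_momentum ht (h.hasDerivU t ht) (h.hasDerivU' t ht)).mul
    (h.hasDerivAt_flowInv ht h0)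
  refine h1.congr_deriv ?_
  have e1 : ((B t).transpose * U' t + (2 : ℂ) • (C t * t • G t)) * flowInv G t
      = (B t).transpose * (U' t * flowInv G t) + (2 : ℂ) • C t := by
    rw [add_mul, mul_assoc, smul_mul_assoc, mul_assoc (C t), h.smul_mul_flowInv ht h0, mul_one]
  have e2 : momentum A B (fun z => z • G z) U' t * -(flowInv G t * U' t * flowInv G t)
      = -(actR A B G U' t * (U' t * flowInv G t)) := by
    rw [actR, mul_neg]
    simp only [mul_assoc]
  rw [e1, e2, h.deriv_mul_flowInv ht h0, Matrix.transpose_sub, h.actR_symm ht h0]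
  simp only [mul_sub, sub_mul, mul_smul_comm, smul_sub, mul_assoc]
  abel

theorem hasDerivAt_actJ {t : ℂ} (ht : t ∈ Metric.ball (0 : ℂ) r) (h0 : t ≠ 0) :
    HasDerivAt (actJ A G) (-((2 : ℂ) • (actJ A G t * A t * (actR A B G U' t - B t)))) t := by
  have h1 := ((h.hasDerivAt_flowInv ht h0).const_mul ((A 0)⁻¹)).const_smul (1 / 2 : ℂ)
  refine h1.congr_deriv ?_
  rw [mul_assoc, h.deriv_mul_flowInv ht h0, actJ]
  simp only [mul_smul_comm, smul_mul_assoc, mul_neg, smul_neg, smul_smul, mul_assoc]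
  norm_num

theorem hasDerivAt_actZ {t : ℂ} (ht : t ∈ Metric.ball (0 : ℂ) r) (h0 : t ≠ 0) :
    HasDerivAt (actZ A B G V)
      (-((2 : ℂ) • (actJ A G t * A t * (actJ A G t).transpose))) t := by
  have h1 := ((h.hasDerivAt_actJ ht h0).mul (h.hasDerivV t ht)).sub_const (B 0)
  refine h1.congr_deriv ?_
  rw [h.V'_eq ht h0]
  simp only [mul_smul_comm, smul_mul_assoc, neg_mul, mul_sub, sub_mul, smul_sub, mul_assoc]
  abel

end Flow

end Momentum

end

end HeatDeformation

namespace HeatDeformation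

noncomputable section

set_option linter.unusedSectionVars false

open scoped Matrix.Norms.Operator

variable {ν : ℕ} {A B C : ℂ → Matrix (Fin ν) (Fin ν) ℂ} {r : ℝ}
  {G U' V V' : ℂ → Matrix (Fin ν) (Fin ν) ℂ}

section Action

/-! ### The action -/

/-- The action `Φ(x,y,t) / t`. -/
def act (A B G U' V : ℂ → Matrix (Fin ν) (Fin ν) ℂ) (t : ℂ) (x y : Fin ν → ℂ) : ℂ :=
  1 / 2 * (x ⬝ᵥ (actR A B G U' t).mulVec x) - y ⬝ᵥ (actJ A G t).mulVec x
    + 1 / 2 * (y ⬝ᵥ (actZ A B G V t).mulVec y)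

/-- The gauge covariant gradient of the action in the variable `x`. -/
def actGrad (A B G U' : ℂ → Matrix (Fin ν) (Fin ν) ℂ) (t : ℂ) (x y : Fin ν → ℂ) : Fin ν → ℂ :=
  (actR A B G U' t - B t).mulVec x - (actJ A G t).transpose.mulVec y

/-- The vector `η` such that the classical path from `y` to `x` is `z ↦ z G(z) η + V(z) y`. -/
def initVel (G V : ℂ → Matrix (Fin ν) (Fin ν) ℂ) (t : ℂ) (x y : Fin ν → ℂ) : Fin ν → ℂ :=
  (flowInv G t).mulVec (x - (V t).mulVec y)

theorem dotProduct_transpose_mulVec (M : Matrix (Fin ν) (Fin ν) ℂ) (x y : Fin ν → ℂ) :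
    x ⬝ᵥ M.transpose.mulVec y = y ⬝ᵥ M.mulVec x := by
  rw [Matrix.mulVec_transpose, dotProduct_comm, ← Matrix.dotProduct_mulVec]

namespace Flow

variable (h : Flow A B C r G U' V V')
include h

theorem qNat_eq {t : ℂ} (ht : t ∈ Metric.ball (0 : ℂ) r) (h0 : t ≠ 0) (x y : Fin ν → ℂ) {s : ℝ}
    (hs : s ∈ Set.Icc (0 : ℝ) 1) :
    qNat A B C t x y s = ((t * s) • G (t * s)).mulVec (initVel G V t x y)
      + (V (t * s)).mulVec y := by
  rw [qNat, h.qFlat_eq ht hs, h.qSharp_eq ht hs, initVel, flowInv]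
  have e : ∀ v : Fin ν → ℂ, t⁻¹ • (t * s) • v = (s : ℂ) • v := fun v => by
    rw [smul_smul, ← mul_assoc, inv_mul_cancel₀ h0, one_mul]
  simp only [Matrix.smul_mulVec, Matrix.mulVec_smul, e]
  simp only [Matrix.sub_mulVec, Matrix.smul_mulVec, ← Matrix.mulVec_mulVec, Matrix.mulVec_sub,
    smul_sub]
  abel

theorem hasDerivAt_path {z : ℂ} (hz : z ∈ Metric.ball (0 : ℂ) r) (η y : Fin ν → ℂ) :
    HasDerivAt (fun z => (z • G z).mulVec η + (V z).mulVec y)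
      ((U' z).mulVec η + (V' z).mulVec y) z :=
  (hasDerivAt_mulVec (h.hasDerivU z hz) η).add (hasDerivAt_mulVec (h.hasDerivV z hz) y)

theorem hasDerivAt_dotProduct_momentum {z : ℂ} (hz : z ∈ Metric.ball (0 : ℂ) r) (η y : Fin ν → ℂ)
    {q q' : Fin ν → ℂ} (hq : q = (z • G z).mulVec η + (V z).mulVec y)
    (hq' : q' = (U' z).mulVec η + (V' z).mulVec y) :
    HasDerivAt (fun z => 1 / 2 * (((z • G z).mulVec η + (V z).mulVec y) ⬝ᵥ
        ((momentum A B (fun z => z • G z) U' z).mulVec η + (momentum A B V V' z).mulVec y)))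
      (1 / 4 * (q' ⬝ᵥ (A z)⁻¹.mulVec q') + q' ⬝ᵥ (B z).mulVec q + q ⬝ᵥ (C z).mulVec q) z := by
  have h1 := (hasDerivAt_mulVec (h.hasDerivAt_momentum hz (h.hasDerivU z hz)
    (h.hasDerivU' z hz)) η).add (hasDerivAt_mulVec (h.hasDerivAt_momentum hz (h.hasDerivV z hz)
    (h.hasDerivV' z hz)) y)
  refine ((hasDerivAt_dotProduct (h.hasDerivAt_path hz η y) h1).const_mul (1 / 2)).congr_deriv ?_
  have e1 : (momentum A B (fun z => z • G z) U' z).mulVec η + (momentum A B V V' z).mulVec y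
      = (1 / 2 : ℂ) • (A z)⁻¹.mulVec q' + (B z).mulVec q := by
    rw [hq, hq', momentum, momentum]
    simp only [Matrix.add_mulVec, Matrix.smul_mulVec, ← Matrix.mulVec_mulVec, Matrix.mulVec_add,
      smul_add, Matrix.mulVec_smul]
    abel
  have e2 : ((B z).transpose * U' z + (2 : ℂ) • (C z * z • G z)).mulVec η
      + ((B z).transpose * V' z + (2 : ℂ) • (C z * V z)).mulVec y
      = (B z).transpose.mulVec q' + (2 : ℂ) • (C z).mulVec q := by
    rw [hq, hq']
    simp only [Matrix.add_mulVec, Matrix.smul_mulVec, ← Matrix.mulVec_mulVec, Matrix.mulVec_add,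
      smul_add, Matrix.mulVec_smul]
    abel
  simp only [Pi.add_apply]
  rw [e1, e2, ← hq, ← hq']
  simp only [dotProduct_add, dotProduct_smul, dotProduct_transpose_mulVec, smul_eq_mul]
  ring

theorem path_end {t : ℂ} (ht : t ∈ Metric.ball (0 : ℂ) r) (h0 : t ≠ 0) (x y : Fin ν → ℂ) :
    (t • G t).mulVec (initVel G V t x y) + (V t).mulVec y = x := by
  rw [initVel, Matrix.mulVec_mulVec, h.smul_mul_flowInv ht h0, Matrix.one_mulVec, sub_add_cancel]

theorem momentum_end {t : ℂ} (ht : t ∈ Metric.ball (0 : ℂ) r) (h0 : t ≠ 0) (x y : Fin ν → ℂ) :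
    (momentum A B (fun z => z • G z) U' t).mulVec (initVel G V t x y)
      + (momentum A B V V' t).mulVec y
      = (actR A B G U' t).mulVec x - (actJ A G t).transpose.mulVec y := by
  rw [initVel, Matrix.mulVec_mulVec, ← actR, h.momentum_V ht h0, Matrix.mulVec_sub,
    Matrix.sub_mulVec, Matrix.mulVec_mulVec]
  abel

theorem momentum_start (t : ℂ) (x y : Fin ν → ℂ) :
    (momentum A B (fun z => z • G z) U' 0).mulVec (initVel G V t x y)
      + (momentum A B V V' 0).mulVec y
      = (actJ A G t).mulVec x - (actZ A B G V t).mulVec y := by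
  have e0 : momentum A B (fun z => z • G z) U' 0 = (1 / 2 : ℂ) • (A 0)⁻¹ := by
    simp [momentum, h.U'_zero]
  have e1 : momentum A B V V' 0 = B 0 := by simp [momentum, h.V'_zero, h.V_zero]
  rw [e0, e1, initVel, Matrix.mulVec_mulVec, smul_mul_assoc, ← actJ, actZ, Matrix.mulVec_sub,
    Matrix.sub_mulVec, Matrix.mulVec_mulVec]
  abel

theorem reducedAction_eq {t : ℂ} (ht : t ∈ Metric.ball (0 : ℂ) r) (h0 : t ≠ 0)
    (x y : Fin ν → ℂ) : reducedAction A B C x y t = t * act A B G U' V t x y := by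
  set η := initVel G V t x y with hη
  set f : ℂ → ℂ := fun z => 1 / 2 * (((z • G z).mulVec η + (V z).mulVec y) ⬝ᵥ
    ((momentum A B (fun z => z • G z) U' z).mulVec η + (momentum A B V V' z).mulVec y)) with hf
  have df : ∀ z ∈ Metric.ball (0 : ℂ) r, HasDerivAt f _ z := fun z hz =>
    h.hasDerivAt_dotProduct_momentum hz η y rfl rfl
  have dfo : DifferentiableOn ℂ f (Metric.ball 0 r) := fun z hz =>
    (df z hz).differentiableAt.differentiableWithinAt
  have key : Set.EqOn (fun s : ℝ =>
      ((1 / 4 : ℂ) * (deriv (qNat A B C t x y) s ⬝ᵥ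
        (A (t * s))⁻¹.mulVec (deriv (qNat A B C t x y) s))
      + t * (deriv (qNat A B C t x y) s ⬝ᵥ (B (t * s)).mulVec (qNat A B C t x y s))
      + t ^ 2 * (qNat A B C t x y s ⬝ᵥ (C (t * s)).mulVec (qNat A B C t x y s))))
      (fun s : ℝ => t * (t * deriv f (t * s))) (Set.Ioo 0 1) := by
    intro s hs
    have hs' := Set.Ioo_subset_Icc_self hs
    have h1 : HasDerivAt (qNat A B C t x y) (t • ((U' (t * s)).mulVec η + (V' (t * s)).mulVec y))
        s := by
      refine (hasDerivAt_comp_mul_ofReal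
        (h.hasDerivAt_path (mul_mem_ball ht hs') η y)).congr_of_eventuallyEq ?_
      filter_upwards [Ioo_mem_nhds hs.1 hs.2] with σ hσ
      exact h.qNat_eq ht h0 x y (Set.Ioo_subset_Icc_self hσ)
    simp only [h1.deriv, h.qNat_eq ht h0 x y hs', (df _ (mul_mem_ball ht hs')).deriv, ← hη]
    simp only [Matrix.mulVec_smul, smul_dotProduct, dotProduct_smul, smul_eq_mul]
    ring
  rw [reducedAction, intervalIntegral.integral_congr_Ioo_of_le zero_le_one key,
    intervalIntegral.integral_eq_sub_of_hasDerivAt (f := fun s : ℝ => t * f (t * s))]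
  · have e1 := h.path_end ht h0 x y
    have e2 := h.momentum_end ht h0 x y
    have e3 := h.momentum_start t x y
    simp only [hf, Complex.ofReal_one, Complex.ofReal_zero, mul_one, mul_zero]
    rw [hη, e1, e2, e3, zero_smul, Matrix.zero_mulVec, h.V_zero, Matrix.one_mulVec, zero_add, act]
    simp only [dotProduct_sub, dotProduct_transpose_mulVec]
    ring
  · intro s hs
    rw [Set.uIcc_of_le zero_le_one] at hs
    exact (hasDerivAt_comp_mul_ofReal (dfo.differentiableAt
      (Metric.isOpen_ball.mem_nhds (mul_mem_ball ht hs))).hasDerivAt).const_mul t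
  · refine ContinuousOn.intervalIntegrable ?_
    rw [Set.uIcc_of_le zero_le_one]
    have h2 : ContinuousOn (deriv f) (Metric.ball 0 r) :=
      (dfo.deriv Metric.isOpen_ball).continuousOn
    have h3 : ContinuousOn (fun s : ℝ => deriv f (t * s)) (Set.Icc 0 1) :=
      h2.comp (by fun_prop) fun s hs => mul_mem_ball ht hs
    exact continuousOn_const.mul (continuousOn_const.mul h3)

theorem hasDerivAt_act {t : ℂ} (ht : t ∈ Metric.ball (0 : ℂ) r) (h0 : t ≠ 0) (x y : Fin ν → ℂ) :
    HasDerivAt (fun t => act A B G U' V t x y) (x ⬝ᵥ (C t).mulVec x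
      - actGrad A B G U' t x y ⬝ᵥ (A t).mulVec (actGrad A B G U' t x y)) t := by
  have hd : ∀ {M : ℂ → Matrix (Fin ν) (Fin ν) ℂ} {M' : Matrix (Fin ν) (Fin ν) ℂ} (u v : Fin ν → ℂ),
      HasDerivAt M M' t → HasDerivAt (fun t => u ⬝ᵥ (M t).mulVec v) (u ⬝ᵥ M'.mulVec v) t := by
    intro M M' u v hM
    simpa using hasDerivAt_dotProduct (hasDerivAt_const t u) (hasDerivAt_mulVec hM v)
  have h1 := (((hd x x (h.hasDerivAt_actR ht h0)).const_mul (1 / 2)).sub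
    (hd y x (h.hasDerivAt_actJ ht h0))).add ((hd y y (h.hasDerivAt_actZ ht h0)).const_mul (1 / 2))
  refine h1.congr_deriv ?_
  have e : ∀ u v : Fin ν → ℂ, u ⬝ᵥ (A t).mulVec v = v ⬝ᵥ (A t).mulVec u := fun u v => by
    rw [← dotProduct_transpose_mulVec, h.symmA t ht]
  rw [actGrad]
  set D := actR A B G U' t - B t
  set a := D.mulVec x with ha
  set b := (actJ A G t).transpose.mulVec y with hb
  have e1 : x ⬝ᵥ (D.transpose * A t * D).mulVec x = a ⬝ᵥ (A t).mulVec a := by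
    rw [← Matrix.mulVec_mulVec, ← Matrix.mulVec_mulVec, dotProduct_transpose_mulVec, ← ha,
      dotProduct_comm]
  have e2 : ∀ v : Fin ν → ℂ, y ⬝ᵥ (actJ A G t).mulVec v = b ⬝ᵥ v := fun v => by
    rw [← dotProduct_transpose_mulVec, dotProduct_comm]
  have e3 : y ⬝ᵥ (actJ A G t * A t * D).mulVec x = b ⬝ᵥ (A t).mulVec a := by
    rw [← Matrix.mulVec_mulVec, ← Matrix.mulVec_mulVec, e2]
  have e4 : y ⬝ᵥ (actJ A G t * A t * (actJ A G t).transpose).mulVec y = b ⬝ᵥ (A t).mulVec b := by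
    rw [← Matrix.mulVec_mulVec, ← Matrix.mulVec_mulVec, e2]
  simp only [Matrix.sub_mulVec, Matrix.neg_mulVec, Matrix.smul_mulVec, dotProduct_sub,
    dotProduct_neg, dotProduct_smul, smul_eq_mul, e1, e3, e4, Matrix.mulVec_sub, sub_dotProduct,
    e a b]
  ring

theorem hasFDerivAt_act {t : ℂ} (ht : t ∈ Metric.ball (0 : ℂ) r) (h0 : t ≠ 0) (x y : Fin ν → ℂ) :
    ∃ L : (Fin ν → ℂ) →L[ℂ] ℂ, HasFDerivAt (fun x => act A B G U' V t x y) L x ∧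
      ∀ v, L v = v ⬝ᵥ (actGrad A B G U' t x y + (B t).mulVec x) := by
  have hl : ∀ u : Fin ν → ℂ, ∃ L : (Fin ν → ℂ) →L[ℂ] ℂ, ∀ v, L v = u ⬝ᵥ v := fun u =>
    ⟨LinearMap.toContinuousLinearMap
      { toFun := fun v => u ⬝ᵥ v
        map_add' := dotProduct_add u
        map_smul' := fun c v => dotProduct_smul c u v }, fun v => rfl⟩
  have hd : DifferentiableAt ℂ (fun x => act A B G U' V t x y) x := by
    unfold act dotProduct Matrix.mulVec dotProduct
    fun_prop
  refine ⟨_, hd.hasFDerivAt, fun v => ?_⟩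
  have h1 : HasDerivAt (fun ε : ℂ => x + ε • v) v 0 := by
    simpa using ((hasDerivAt_id (0 : ℂ)).smul_const v).const_add x
  have hf' : HasFDerivAt (fun x => act A B G U' V t x y)
      (fderiv ℂ (fun x => act A B G U' V t x y) x) (x + (0 : ℂ) • v) := by
    simpa using hd.hasFDerivAt
  have h2 := hf'.comp_hasDerivAt (0 : ℂ) h1
  set R := actR A B G U' t with hR
  have hs : x ⬝ᵥ R.mulVec v = v ⬝ᵥ R.mulVec x := by
    rw [← dotProduct_transpose_mulVec, hR, h.actR_symm ht h0]
  have h3 : HasDerivAt (fun ε : ℂ => act A B G U' V t x y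
      + ε * (v ⬝ᵥ (actGrad A B G U' t x y + (B t).mulVec x)) + ε ^ 2 * (1 / 2 * (v ⬝ᵥ R.mulVec v)))
      (v ⬝ᵥ (actGrad A B G U' t x y + (B t).mulVec x)) 0 := by
    have := (((hasDerivAt_id (0 : ℂ)).mul_const
      (v ⬝ᵥ (actGrad A B G U' t x y + (B t).mulVec x))).const_add (act A B G U' V t x y)).add
      (((hasDerivAt_id (0 : ℂ)).pow 2).mul_const (1 / 2 * (v ⬝ᵥ R.mulVec v)))
    refine this.congr_deriv ?_
    simp
  refine h2.unique (h3.congr_of_eventuallyEq (Eventually.of_forall fun ε => ?_))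
  have e : actGrad A B G U' t x y + (B t).mulVec x
      = R.mulVec x - (actJ A G t).transpose.mulVec y := by
    rw [actGrad, Matrix.sub_mulVec]
    abel
  rw [e]
  simp only [Function.comp_apply, act, Matrix.mulVec_add, Matrix.mulVec_smul, dotProduct_add,
    add_dotProduct, smul_dotProduct, dotProduct_smul, smul_eq_mul, dotProduct_sub, ← hR, hs,
    dotProduct_transpose_mulVec]
  ring

end Flow

end Action

end

end HeatDeformation

namespace HeatDeformation

noncomputable section

set_option linter.unusedSectionVars false

variable {ν : ℕ} {A B C : ℂ → Matrix (Fin ν) (Fin ν) ℂ} {r : ℝ}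
  {G U' V V' : ℂ → Matrix (Fin ν) (Fin ν) ℂ}

section FreeKernel

/-! ### The unperturbed kernel -/

namespace Flow

variable (h : Flow A B C r G U' V V')
include h

theorem theta_eq {t : ℂ} (ht : t ∈ Metric.ball (0 : ℂ) r) (h0 : t ≠ 0) :
    theta A B C t = (ν : ℂ) / (2 * t) - (A t * (actR A B G U' t - B t)).trace := by
  have h1 : ∀ k, (pd k fun x => reducedAction A B C x 0 t)
      = fun x => t * (actR A B G U' t).mulVec x k := by
    intro k
    funext x
    have e : (fun x => reducedAction A B C x 0 t) = fun x => t * act A B G U' V t x 0 :=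
      funext fun x => h.reducedAction_eq ht h0 x 0
    obtain ⟨L, hL, hv⟩ := h.hasFDerivAt_act ht h0 x 0
    rw [pd, e, (hL.const_mul t).fderiv]
    change t * L (Pi.single k 1) = _
    rw [hv, single_one_dotProduct, actGrad, Matrix.sub_mulVec, Matrix.mulVec_zero, sub_zero,
      sub_add_cancel]
  have h2 : ∀ j k, pd j (fun x => t * (actR A B G U' t).mulVec x k) 0
      = t * actR A B G U' t k j := by
    intro j k
    have : HasFDerivAt (fun x => t * (actR A B G U' t).mulVec x k)
        (t • (ContinuousLinearMap.proj k).comp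
          (Matrix.mulVecLin (actR A B G U' t)).toContinuousLinearMap) 0 :=
      (((ContinuousLinearMap.proj (R := ℂ) (φ := fun _ : Fin ν => ℂ) k).comp
        (Matrix.mulVecLin (actR A B G U' t)).toContinuousLinearMap).hasFDerivAt).const_mul t
    rw [pd, this.fderiv]
    simp
  rw [theta]
  simp only [h1, h2]
  have h3 : ∑ j, ∑ k, A t j k * (t * actR A B G U' t k j) = t * (A t * actR A B G U' t).trace := by
    simp only [Matrix.trace, Matrix.diag_apply, Matrix.mul_apply, Finset.mul_sum]
    exact Finset.sum_congr rfl fun j _ => Finset.sum_congr rfl fun k _ => by ring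
  rw [h3, mul_sub, Matrix.trace_sub, ← mul_assoc, one_div, inv_mul_cancel₀ h0, one_mul]
  ring

open scoped Matrix.Norms.Operator in
theorem theta_eq_trace {t : ℂ} (ht : t ∈ Metric.ball (0 : ℂ) r) (h0 : t ≠ 0) :
    theta A B C t = -(1 / 2 * (matDeriv G t * (G t)⁻¹).trace) := by
  have h1 : HasDerivAt (fun z => z • G z) (t • matDeriv G t + (1 : ℂ) • G t) t :=
    (hasDerivAt_id t).smul (hasDerivAt_matDeriv (h.differentiableAt_G ht))
  have h2 : U' t = t • matDeriv G t + (1 : ℂ) • G t := (h.hasDerivU t ht).unique h1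
  have h3 := h.deriv_mul_flowInv ht h0
  have h4 : U' t * flowInv G t = matDeriv G t * (G t)⁻¹ + t⁻¹ • 1 := by
    rw [h2, add_mul, flowInv, smul_mul_smul_comm, smul_mul_smul_comm, mul_inv_cancel₀ h0,
      mul_inv_self (h.unitG t ht), one_smul, one_mul]
  have h5 := congrArg Matrix.trace (h3.symm.trans h4)
  rw [Matrix.trace_smul, Matrix.trace_add, Matrix.trace_smul, Matrix.trace_one, Fintype.card_fin,
    smul_eq_mul, smul_eq_mul] at h5
  rw [h.theta_eq ht h0]
  have h6 : (ν : ℂ) / (2 * t) = 1 / 2 * (t⁻¹ * ν) := by field_simp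
  rw [h6]
  linear_combination (-1 / 2 : ℂ) * h5

open scoped Matrix.Norms.Operator in
theorem exists_thetaPrimitive : ∃ Θ : ℂ → ℂ, Θ 0 = 0 ∧ ContinuousAt Θ 0 ∧
    ∀ t ∈ Metric.ball (0 : ℂ) r, t ≠ 0 → HasDerivAt Θ (theta A B C t) t ∧
      t * (∫ s in (0 : ℝ)..1, theta A B C (t * s)) = Θ t := by
  have hd : DifferentiableOn ℂ (fun t => -(1 / 2 * (matDeriv G t * (G t)⁻¹).trace))
      (Metric.ball 0 r) := by
    intro z hz
    have h1 : ∀ j k, DifferentiableAt ℂ (fun z => matDeriv G z j k) z := fun j k =>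
      ((differentiableOn_entry h.diffG j k).deriv Metric.isOpen_ball).differentiableAt
        (Metric.isOpen_ball.mem_nhds hz)
    have h2 : ∀ j k, DifferentiableAt ℂ (fun z => (G z)⁻¹ j k) z := fun j k =>
      (entryCL j k).differentiableAt.comp z
        (differentiableAt_inv (h.differentiableAt_G hz) (h.unitG z hz))
    refine (DifferentiableAt.neg (DifferentiableAt.const_mul ?_ _)).differentiableWithinAt
    simp only [Matrix.trace, Matrix.diag_apply, Matrix.mul_apply]
    exact DifferentiableAt.fun_sum fun j _ => DifferentiableAt.fun_sum fun k _ =>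
      (h1 j k).mul (h2 k j)
  obtain ⟨Θ, hΘ0, hΘ⟩ := hd.isExactOn_ball.with_val_at 0 0
  refine ⟨Θ, hΘ0, (hΘ 0 (Metric.mem_ball_self h.pos)).continuousAt, fun t ht h0 => ⟨?_, ?_⟩⟩
  · rw [h.theta_eq_trace ht h0]
    exact hΘ t ht
  · have key : Set.EqOn (fun s : ℝ => theta A B C (t * s))
        (fun s : ℝ => -(1 / 2 * (matDeriv G (t * s) * (G (t * s))⁻¹).trace)) (Set.Ioo 0 1) :=
      fun s hs => h.theta_eq_trace (mul_mem_ball ht (Set.Ioo_subset_Icc_self hs))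
        (mul_ne_zero h0 (by exact_mod_cast hs.1.ne'))
    rw [intervalIntegral.integral_congr_Ioo_of_le zero_le_one key,
      ← intervalIntegral.integral_const_mul,
      intervalIntegral.integral_eq_sub_of_hasDerivAt (f := fun s : ℝ => Θ (t * s))]
    · simp [hΘ0]
    · intro s hs
      rw [Set.uIcc_of_le zero_le_one] at hs
      exact hasDerivAt_comp_mul_ofReal (hΘ _ (mul_mem_ball ht hs))
    · refine ContinuousOn.intervalIntegrable ?_
      rw [Set.uIcc_of_le zero_le_one]
      exact continuousOn_const.mul (hd.continuousOn.comp
        (f := fun s : ℝ => t * (s : ℂ)) (by fun_prop) fun s hs => mul_mem_ball ht hs)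

theorem pZero_eq {Θ : ℂ → ℂ} {t : ℂ} (ht : t ∈ Metric.ball (0 : ℂ) r) (h0 : t ≠ 0)
    (hΘ : t * (∫ s in (0 : ℝ)..1, theta A B C (t * s)) = Θ t) (x y : Fin ν → ℂ) :
    pZero A B C t x y = ((A 0).det ^ (1 / 2 : ℂ))⁻¹ *
      (((4 * (Real.pi : ℂ) * t) ^ (1 / 2 : ℂ)) ^ ν)⁻¹ *
      Complex.exp (Θ t - act A B G U' V t x y) := by
  rw [pZero, hΘ, h.reducedAction_eq ht h0, ← mul_assoc, one_div t, inv_mul_cancel₀ h0, one_mul]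

theorem hasDerivAt_pZero {t : ℂ} (ht : t ∈ Metric.ball (0 : ℂ) r) (h0 : t ≠ 0) (hre : 0 ≤ t.re)
    (x y : Fin ν → ℂ) :
    HasDerivAt (fun t => pZero A B C t x y) (pZero A B C t x y *
      (actGrad A B G U' t x y ⬝ᵥ (A t).mulVec (actGrad A B G U' t x y)
        - (A t * (actR A B G U' t - B t)).trace - x ⬝ᵥ (C t).mulVec x)) t := by
  obtain ⟨Θ, -, -, hΘ⟩ := h.exists_thetaPrimitive
  have hev : (fun t => pZero A B C t x y) =ᶠ[𝓝 t] fun t => ((A 0).det ^ (1 / 2 : ℂ))⁻¹ *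
      (((4 * (Real.pi : ℂ) * t) ^ (1 / 2 : ℂ)) ^ ν)⁻¹ *
      Complex.exp (Θ t - act A B G U' V t x y) := by
    filter_upwards [Metric.isOpen_ball.mem_nhds ht, isOpen_ne.mem_nhds h0] with s hs hs0
    exact h.pZero_eq hs hs0 (hΘ s hs hs0).2 x y
  refine HasDerivAt.congr_of_eventuallyEq ?_ hev
  have hpi : (4 * (Real.pi : ℂ)) ≠ 0 := by
    simp [Real.pi_ne_zero]
  have hslit : 4 * (Real.pi : ℂ) * t ∈ Complex.slitPlane := by
    have e : 4 * (Real.pi : ℂ) * t = ((4 * Real.pi : ℝ) : ℂ) * t := by push_cast; ring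
    rw [e, Complex.mem_slitPlane_iff, Complex.re_ofReal_mul, Complex.im_ofReal_mul]
    rcases hre.lt_or_eq with hlt | heq
    · exact Or.inl (by positivity)
    · refine Or.inr (mul_ne_zero (by positivity) fun him => h0 ?_)
      exact Complex.ext heq.symm him
  have hpow0 : (4 * (Real.pi : ℂ) * t) ^ (1 / 2 : ℂ) ≠ 0 := by
    rw [Complex.cpow_def_of_ne_zero (mul_ne_zero hpi h0)]
    exact Complex.exp_ne_zero _
  have d1 : HasDerivAt (fun t => (4 * (Real.pi : ℂ) * t) ^ (1 / 2 : ℂ))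
      ((4 * (Real.pi : ℂ) * t) ^ (1 / 2 : ℂ) * (1 / (2 * t))) t := by
    refine (((hasDerivAt_id t).const_mul (4 * (Real.pi : ℂ))).cpow_const hslit).congr_deriv ?_
    simp only [id, mul_one]
    rw [Complex.cpow_sub _ _ (mul_ne_zero hpi h0), Complex.cpow_one]
    have : (Real.pi : ℂ) ≠ 0 := by simp [Real.pi_ne_zero]
    field_simp
  have d2 := (d1.pow ν).inv (pow_ne_zero ν hpow0)
  have d3 := (d2.const_mul ((A 0).det ^ (1 / 2 : ℂ))⁻¹).mul
    (((hΘ t ht h0).1.sub (h.hasDerivAt_act ht h0 x y)).cexp)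
  refine d3.congr_deriv ?_
  rw [h.pZero_eq ht h0 (hΘ t ht h0).2 x y, h.theta_eq ht h0]
  have e1 : -(↑ν * ((4 * (Real.pi : ℂ) * t) ^ (1 / 2 : ℂ)) ^ (ν - 1)
      * ((4 * (Real.pi : ℂ) * t) ^ (1 / 2 : ℂ) * (1 / (2 * t))))
      / (((4 * (Real.pi : ℂ) * t) ^ (1 / 2 : ℂ)) ^ ν) ^ 2
      = -(((4 * (Real.pi : ℂ) * t) ^ (1 / 2 : ℂ)) ^ ν)⁻¹ * ((ν : ℂ) / (2 * t)) := by
    generalize (4 * (Real.pi : ℂ) * t) ^ (1 / 2 : ℂ) = a at hpow0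
    rcases ν with _ | n
    · simp
    · simp only [Nat.add_sub_cancel]
      field_simp
      rw [pow_succ]
  simp only [Pi.sub_apply, Pi.inv_apply, Pi.pow_apply]
  rw [e1]
  ring

theorem hasFDerivAt_pZero {t : ℂ} (ht : t ∈ Metric.ball (0 : ℂ) r) (h0 : t ≠ 0)
    (x y : Fin ν → ℂ) :
    ∃ L : (Fin ν → ℂ) →L[ℂ] ℂ, HasFDerivAt (fun x => pZero A B C t x y) L x ∧
      ∀ j, L (Pi.single j 1) = -(pZero A B C t x y *
        (actGrad A B G U' t x y j + (B t).mulVec x j)) := by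
  obtain ⟨Θ, -, -, hΘ⟩ := h.exists_thetaPrimitive
  have e : (fun x => pZero A B C t x y) = fun x => ((A 0).det ^ (1 / 2 : ℂ))⁻¹ *
      (((4 * (Real.pi : ℂ) * t) ^ (1 / 2 : ℂ)) ^ ν)⁻¹ *
      Complex.exp (Θ t - act A B G U' V t x y) :=
    funext fun x => h.pZero_eq ht h0 (hΘ t ht h0).2 x y
  obtain ⟨L, hL, hv⟩ := h.hasFDerivAt_act ht h0 x y
  refine ⟨_, e ▸ ((hL.const_sub (Θ t)).cexp).const_mul _, fun j => ?_⟩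
  rw [h.pZero_eq ht h0 (hΘ t ht h0).2 x y]
  simp only [smul_apply, neg_apply, hv, single_one_dotProduct, smul_eq_mul, Pi.add_apply]
  ring

end Flow

end FreeKernel

section Conjugation

variable {𝓜 : Type*} [NormedAddCommGroup 𝓜] [NormedSpace ℂ 𝓜]

/-- Conjugation of the covariant derivative. -/
theorem covD_smul {e : (Fin ν → ℂ) → ℂ} {L : (Fin ν → ℂ) →L[ℂ] ℂ} {w x : Fin ν → ℂ} {t : ℂ}
    {F : (Fin ν → ℂ) → 𝓜} (he : HasFDerivAt e L x)
    (hL : ∀ j, L (Pi.single j 1) = -(e x * (w j + (B t).mulVec x j)))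
    (hF : DifferentiableAt ℂ F x) (k : Fin ν) :
    covD B t k (fun x => e x • F x) x = e x • (pd k F x - w k • F x) := by
  have h1 : pd k (fun x => e x • F x) x = e x • pd k F x + L (Pi.single k 1) • F x := by
    have h2 : HasFDerivAt (fun x => e x • F x) _ x := he.smul hF.hasFDerivAt
    rw [pd, h2.fderiv]
    rfl
  rw [covD, h1, hL, smul_sub, smul_smul, smul_smul, mul_add, neg_add, add_smul, neg_smul, neg_smul,
    mul_comm ((B t).mulVec x k)]
  abel

/-- Conjugation of the operator `P₀` by a Gaussian. -/
theorem opP0_smul {e : (Fin ν → ℂ) → ℂ} {w : (Fin ν → ℂ) → Fin ν → ℂ} {t : ℂ}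
    {D : Matrix (Fin ν) (Fin ν) ℂ} {b : Fin ν → ℂ} {F : (Fin ν → ℂ) → 𝓜}
    (he : ∀ x, ∃ L : (Fin ν → ℂ) →L[ℂ] ℂ, HasFDerivAt e L x ∧
      ∀ j, L (Pi.single j 1) = -(e x * (w x j + (B t).mulVec x j)))
    (hw : w = fun x => D.mulVec x - b) (hA : (A t).transpose = A t) (hF : ContDiff ℂ 2 F)
    (x : Fin ν → ℂ) :
    opP0 A B C t (fun x => e x • F x) x = e x • (∑ j, ∑ k, A t j k • pd j (pd k F) x
      - (2 : ℂ) • ∑ j, (A t).mulVec (w x) j • pd j F x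
      + (w x ⬝ᵥ (A t).mulVec (w x) - (A t * D).trace - x ⬝ᵥ (C t).mulVec x) • F x) := by
  have hF1 : Differentiable ℂ F := hF.differentiable (by simp)
  have hpd : ∀ k, Differentiable ℂ (pd k F) := fun k =>
    ((hF.fderiv_right (m := 1) (by norm_num)).clm_apply contDiff_const).differentiable (by simp)
  have hwk : ∀ k, HasFDerivAt (fun x => w x k) ((ContinuousLinearMap.proj k).comp
      (Matrix.mulVecLin D).toContinuousLinearMap) x := fun k => by
    rw [hw]
    exact (((ContinuousLinearMap.proj (R := ℂ) (φ := fun _ : Fin ν => ℂ) k).comp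
      (Matrix.mulVecLin D).toContinuousLinearMap).hasFDerivAt (x := x)).sub_const (b k)
  have h1 : ∀ k, covD B t k (fun x => e x • F x)
      = fun x => e x • (pd k F x - w x k • F x) := fun k => funext fun x => by
    obtain ⟨L, hL, hv⟩ := he x
    exact covD_smul hL hv (hF1 x) k
  have h2 : ∀ j k, pd j (fun x => pd k F x - w x k • F x) x
      = pd j (pd k F) x - (w x k • pd j F x + D k j • F x) := by
    intro j k
    have : HasFDerivAt (fun x => pd k F x - w x k • F x) _ x :=
      (hpd k x).hasFDerivAt.sub ((hwk k).smul (hF1 x).hasFDerivAt)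
    rw [pd, this.fderiv]
    change pd j (pd k F) x - (w x k • pd j F x + (D.mulVec (Pi.single j 1) k) • F x) = _
    rw [Matrix.mulVec_single_one]
    rfl
  have h3 : ∀ j k, covD B t j (covD B t k fun x => e x • F x) x
      = e x • (pd j (pd k F) x - (w x k • pd j F x + D k j • F x)
        - w x j • (pd k F x - w x k • F x)) := by
    intro j k
    obtain ⟨L, hL, hv⟩ := he x
    have hd : DifferentiableAt ℂ (fun x => pd k F x - w x k • F x) x :=
      (hpd k x).sub ((hwk k).differentiableAt.smul (hF1 x))
    rw [h1, covD_smul hL hv hd, h2]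
  have s1 : ∑ j, ∑ k, A t j k • w x k • pd j F x = ∑ j, (A t).mulVec (w x) j • pd j F x :=
    Finset.sum_congr rfl fun j _ => by
      simp only [Matrix.mulVec, dotProduct, Finset.sum_smul, smul_smul]
  have s2 : ∑ j, ∑ k, A t j k • w x j • pd k F x = ∑ j, (A t).mulVec (w x) j • pd j F x := by
    rw [Finset.sum_comm, ← s1]
    refine Finset.sum_congr rfl fun j _ => Finset.sum_congr rfl fun k _ => ?_
    rw [← congrFun (congrFun hA j) k, Matrix.transpose_apply]
  have s3 : ∑ j, ∑ k, A t j k • D k j • F x = (A t * D).trace • F x := by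
    simp only [Matrix.trace, Matrix.diag_apply, Matrix.mul_apply, Finset.sum_smul, smul_smul]
  have s4 : ∑ j, ∑ k, A t j k • w x j • w x k • F x = (w x ⬝ᵥ (A t).mulVec (w x)) • F x := by
    simp only [Matrix.mulVec, dotProduct, Finset.sum_smul, smul_smul, Finset.mul_sum]
    exact Finset.sum_congr rfl fun j _ => Finset.sum_congr rfl fun k _ => by
      rw [mul_left_comm]
  rw [opP0]
  simp only [h3, smul_comm (A t _ _) (e x), ← Finset.smul_sum]
  rw [smul_comm (x ⬝ᵥ (C t).mulVec x), ← smul_sub]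
  congr 1
  simp only [smul_sub, smul_add, Finset.sum_sub_distrib, Finset.sum_add_distrib, s1, s2, s3, s4,
    sub_smul, two_smul]
  abel

end Conjugation

end

end HeatDeformation

namespace HeatDeformation

noncomputable section

set_option linter.unusedSectionVars false

variable {ν : ℕ} {𝓜 : Type*} [NormedRing 𝓜] [NormedAlgebra ℂ 𝓜] [NormOneClass 𝓜]
  [FiniteDimensional ℂ 𝓜] [MeasurableSpace 𝓜] [BorelSpace 𝓜]
  {A B C G W V H G₀ U' V₀ V' : ℂ → Matrix (Fin ν) (Fin ν) ℂ} {r K Tb T r₀ : ℝ}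
  {c : ℂ → (Fin ν → ℂ) → 𝓜} {m : Measure (EuclideanSpace ℝ (Fin ν))}
  {g : ℂ → EuclideanSpace ℝ (Fin ν) → 𝓜}

section HeatEquation

/-! ### The heat equation -/

theorem Flow.endVelocity (h : Flow A B C r G U' V V') {t : ℂ}
    (ht : t ∈ Metric.ball (0 : ℂ) r) (h0 : t ≠ 0) (x y : Fin ν → ℂ) :
    (U' t).mulVec (initVel G V t x y) + (V' t).mulVec y
      = (2 : ℂ) • (A t).mulVec (actGrad A B G U' t x y) := by
  rw [initVel, Matrix.mulVec_mulVec, h.deriv_mul_flowInv ht h0, h.V'_eq ht h0, actGrad]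
  simp only [Matrix.smul_mulVec, ← Matrix.mulVec_mulVec, Matrix.sub_mulVec, Matrix.mulVec_sub,
    smul_sub]
  abel

namespace Deformation

variable (h : Deformation A B C c r K Tb T G W V H m g)
include h

theorem hasDerivWithinAt_cPath_one (hf : Flow A B C r₀ G₀ U' V₀ V') (hr : r ≤ r₀) {t : ℂ}
    (ht : t ∈ Metric.ball (0 : ℂ) r) (h0 : t ≠ 0) (x y : Fin ν → ℂ) :
    HasDerivWithinAt (cPath G V H t x y)
      (t • (2 : ℂ) • (A t).mulVec (actGrad A B G₀ U' t x y)) (Set.Icc 0 1) 1 := by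
  have ht' : t ∈ Metric.ball (0 : ℂ) r₀ := Metric.ball_subset_ball hr ht
  have h1 : t * ((1 : ℝ) : ℂ) ∈ Metric.ball (0 : ℂ) r₀ := by simpa using ht'
  have h2 := (hasDerivAt_comp_mul_ofReal (hf.hasDerivAt_path h1 (initVel G₀ V₀ t x y)
    y)).hasDerivWithinAt (s := Set.Icc (0 : ℝ) 1)
  rw [Complex.ofReal_one, mul_one, hf.endVelocity ht' h0] at h2
  refine h2.congr_of_mem (fun s hs => ?_) (by simp)
  rw [← h.phase.qNat_eq ht x y hs, hf.qNat_eq ht' h0 x y hs]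

theorem contDiff_pConj_left {t : ℂ} (ht : t ∈ halfDiscBar (T / 2)) (y : Fin ν → ℂ) :
    ContDiff ℂ ∞ fun x => pConj A B C c t x y :=
  contDiffOn_univ.1 (h.contDiffOn_pConj.comp (f := fun x : Fin ν → ℂ => (t, x, y))
    (by fun_prop) fun _ _ => ⟨ht, trivial⟩)

/-- `p⁰ p^conj` solves the heat equation. -/
theorem hasDerivWithinAt_pZero_smul_pConj (hf : Flow A B C r₀ G₀ U' V₀ V') (hr : r ≤ r₀) {t : ℂ}
    (ht : t ∈ halfDiscBar (T / 2)) (h0 : t ≠ 0) (x y : Fin ν → ℂ) :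
    HasDerivWithinAt (fun t' => pZero A B C t' x y • pConj A B C c t' x y)
      (opP0 A B C t (fun x' => pZero A B C t x' y • pConj A B C c t x' y) x
        + c t x * (pZero A B C t x y • pConj A B C c t x y))
      (halfDiscBar (T / 2)) t := by
  have htr : t ∈ Metric.ball (0 : ℂ) r := h.mem_ball_r ht
  have ht' : t ∈ Metric.ball (0 : ℂ) r₀ := Metric.ball_subset_ball hr htr
  set D := halfDiscBar (T / 2) with hD
  set P : ℂ × (Fin ν → ℂ) × (Fin ν → ℂ) → 𝓜 := fun p => pConj A B C c p.1 p.2.1 p.2.2 with hP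
  set w := actGrad A B G₀ U' t x y with hw
  have hp : (t, x, y) ∈ D ×ˢ (Set.univ : Set ((Fin ν → ℂ) × (Fin ν → ℂ))) := ⟨ht, trivial⟩
  have hL : HasFDerivWithinAt P (fderivWithin ℂ P (D ×ˢ Set.univ) (t, x, y)) (D ×ˢ Set.univ)
      (t, x, y) := (h.contDiffOn_pConj.differentiableOn (by simp) _ hp).hasFDerivWithinAt
  have key := h.fderivWithin_pConj ht x y (h.hasDerivWithinAt_cPath_one hf hr htr h0 x y)
  rw [← hP, ← hD] at key
  set L := fderivWithin ℂ P (D ×ˢ Set.univ) (t, x, y) with hLdef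
  have dt : HasDerivWithinAt (fun t' => pConj A B C c t' x y) (L (1, 0, 0)) D t :=
    hL.comp_hasDerivWithinAt (f := fun s : ℂ => (s, x, y)) t ((hasDerivWithinAt_id t D).prodMk
      (hasDerivWithinAt_const t D (x, y))) fun s hs => Set.mk_mem_prod hs (Set.mem_univ _)
  have dx : HasFDerivAt (fun x => pConj A B C c t x y) (L.comp
      ((0 : (Fin ν → ℂ) →L[ℂ] ℂ).prod ((ContinuousLinearMap.id ℂ (Fin ν → ℂ)).prod 0))) x := by
    rw [← hasFDerivWithinAt_univ]
    exact hL.comp x (f := fun x : Fin ν → ℂ => (t, x, y)) ((hasFDerivWithinAt_const t x _).prodMk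
      ((hasFDerivWithinAt_id x _).prodMk (hasFDerivWithinAt_const y x _)))
      fun _ _ => ⟨ht, trivial⟩
  have hpd : ∀ j, pd j (fun x => pConj A B C c t x y) x = L (0, Pi.single j 1, 0) := fun j => by
    rw [pd, dx.fderiv]
    rfl
  have hsplit : ∀ v : Fin ν → ℂ, L (0, v, 0)
      = ∑ j, v j • pd j (fun x => pConj A B C c t x y) x := fun v => by
    have e : v = ∑ j, v j • (Pi.single j 1 : Fin ν → ℂ) := by
      simpa using (pi_eq_sum_univ' v)
    have e2 : ∀ v, L (0, v, 0) = (L.comp ((0 : (Fin ν → ℂ) →L[ℂ] ℂ).prod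
      ((ContinuousLinearMap.id ℂ (Fin ν → ℂ)).prod 0))) v := fun v => rfl
    conv_lhs => rw [e, e2, map_sum]
    refine Finset.sum_congr rfl fun j _ => ?_
    rw [map_smul, ← e2, hpd]
  have e3 : ((t, t • (2 : ℂ) • (A t).mulVec w, 0) : ℂ × (Fin ν → ℂ) × (Fin ν → ℂ))
      = t • ((1, 0, 0) + (2 : ℂ) • (0, (A t).mulVec w, 0)) := by
    simp
  rw [e3, map_smul, map_add, map_smul, hsplit] at key
  have key' := smul_right_injective 𝓜 h0 key
  have hsec := opP0_smul (A := A) (B := B) (C := C) (w := fun x => actGrad A B G₀ U' t x y)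
    (D := actR A B G₀ U' t - B t)
    (b := (actJ A G₀ t).transpose.mulVec y)
    (fun x => hf.hasFDerivAt_pZero ht' h0 x y) rfl (hf.symmA t ht')
    (contDiff_infty.1 (h.contDiff_pConj_left ht y) 2) x
  refine ((hf.hasDerivAt_pZero ht' h0 ht.2 x y).hasDerivWithinAt.smul dt).congr_deriv ?_
  rw [hsec, eq_sub_of_add_eq key', ← hw, mul_smul_comm, ← smul_smul, ← smul_add, ← smul_add]
  congr 1
  abel

end Deformation

end HeatEquation

end

end HeatDeformation

namespace HeatDeformation

noncomputable section

set_option linter.unusedSectionVars false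

variable {ν : ℕ} {A B C G U' V V' : ℂ → Matrix (Fin ν) (Fin ν) ℂ} {r : ℝ}

section ShortTime

/-! ### The action for short times -/

open scoped Matrix.Norms.Operator

theorem norm_dotProduct_mulVec_le (M : Matrix (Fin ν) (Fin ν) ℂ) (a b : Fin ν → ℂ) :
    ‖a ⬝ᵥ M.mulVec b‖ ≤ ν * ‖M‖ * (‖a‖ * ‖b‖) := by
  have h1 : ∀ i, ‖a i * M.mulVec b i‖ ≤ ‖a‖ * (‖M‖ * ‖b‖) := fun i => by
    rw [norm_mul]
    exact mul_le_mul (norm_le_pi_norm a i) ((norm_le_pi_norm _ i).trans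
      (Matrix.linfty_opNorm_mulVec M b)) (norm_nonneg _) (norm_nonneg _)
  refine (norm_sum_le _ _).trans ((Finset.sum_le_sum fun i _ => h1 i).trans (le_of_eq ?_))
  rw [Finset.sum_const, Finset.card_univ, Fintype.card_fin, nsmul_eq_mul]
  ring

/-- Along `t = τ²`, a differentiable function is constant to first order in `τ`. -/
theorem tendsto_sq_slope {M : ℂ → Matrix (Fin ν) (Fin ν) ℂ} {M' : Matrix (Fin ν) (Fin ν) ℂ}
    (h : HasDerivAt M M' 0) :
    Tendsto (fun τ : ℝ => (τ : ℂ)⁻¹ • (M ((τ : ℂ) ^ 2) - M 0)) (𝓝[>] 0) (𝓝 0) := by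
  have h1 : HasDerivAt (fun z : ℂ => M (z ^ 2)) ((0 : ℂ) • M') 0 := by
    have h2 : HasDerivAt (fun z : ℂ => z ^ 2) 0 0 := by simpa using hasDerivAt_pow 2 (0 : ℂ)
    have h3 : HasDerivAt M M' ((0 : ℂ) ^ 2) := by simpa using h
    exact h3.scomp 0 h2
  rw [zero_smul] at h1
  have h3 := hasDerivAt_iff_tendsto_slope.1 h1
  have h2 : Tendsto (fun τ : ℝ => (τ : ℂ)) (𝓝[>] 0) (𝓝[≠] 0) := by
    refine tendsto_nhdsWithin_iff.2 ⟨?_, ?_⟩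
    · exact (Complex.continuous_ofReal.tendsto' 0 0 (by simp)).mono_left nhdsWithin_le_nhds
    · filter_upwards [self_mem_nhdsWithin] with τ hτ
      exact Complex.ofReal_ne_zero.2 (ne_of_gt hτ)
  refine (h3.comp h2).congr fun τ => ?_
  simp [slope_def_module]

namespace Flow

variable (h : Flow A B C r G U' V V')
include h

theorem act_add {τ : ℂ} (h0 : τ ≠ 0) (ht : τ ^ 2 ∈ Metric.ball (0 : ℂ) r) (d y : Fin ν → ℂ)
    {PU PV Hm v p : Matrix (Fin ν) (Fin ν) ℂ} {P₀ : Matrix (Fin ν) (Fin ν) ℂ}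
    (hPU : PU = momentum A B (fun z => z • G z) U' (τ ^ 2)) (hPV : PV = momentum A B V V' (τ ^ 2))
    (hH : Hm = (G (τ ^ 2))⁻¹) (hv : v = τ⁻¹ • (V (τ ^ 2) - V 0))
    (hP₀ : P₀ = momentum A B (fun z => z • G z) U' 0) (hp : p = τ⁻¹ • (PU - P₀)) :
    act A B G U' V (τ ^ 2) (y + τ • d) y = 1 / 2 * (d ⬝ᵥ (PU * Hm).mulVec d)
      + 1 / 2 * (d ⬝ᵥ (τ • PV - PU * Hm * v).mulVec y)
      + 1 / 2 * (y ⬝ᵥ (p * Hm).mulVec d)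
      + 1 / 2 * (y ⬝ᵥ (PV - momentum A B V V' 0 - p * Hm * v).mulVec y) := by
  set x := y + τ • d with hx
  have ht0 : τ ^ 2 ≠ 0 := pow_ne_zero 2 h0
  have e1 := h.momentum_end ht ht0 x y
  have e2 := h.momentum_start (τ ^ 2) x y
  have e3 : act A B G U' V (τ ^ 2) x y
      = 1 / 2 * (x ⬝ᵥ ((actR A B G U' (τ ^ 2)).mulVec x - (actJ A G (τ ^ 2)).transpose.mulVec y))
        - 1 / 2 * (y ⬝ᵥ ((actJ A G (τ ^ 2)).mulVec x - (actZ A B G V (τ ^ 2)).mulVec y)) := by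
    rw [act]
    simp only [dotProduct_sub, dotProduct_transpose_mulVec]
    ring
  have e4 : initVel G V (τ ^ 2) x y = τ⁻¹ • Hm.mulVec (d - v.mulVec y) := by
    rw [initVel, flowInv, hx, hH, hv, h.V_zero, Matrix.smul_mulVec, Matrix.smul_mulVec,
      Matrix.sub_mulVec, Matrix.one_mulVec, ← Matrix.mulVec_smul, ← Matrix.mulVec_smul]
    congr 1
    ext i
    simp only [Pi.smul_apply, Pi.sub_apply, Pi.add_apply, smul_eq_mul]
    field_simp
    ring
  rw [e3, ← e1, ← e2, e4, ← hPU, ← hPV, ← hP₀]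
  have e5 : P₀ = PU - τ • p := by
    rw [hp, smul_smul, mul_inv_cancel₀ h0, one_smul, sub_sub_cancel]
  set u := d - v.mulVec y with hu
  have e6 : ∀ M : Matrix (Fin ν) (Fin ν) ℂ, (M * Hm).mulVec d - (M * Hm * v).mulVec y
      = M.mulVec (Hm.mulVec u) := fun M => by
    rw [hu, Matrix.mulVec_sub, Matrix.mulVec_sub, Matrix.mulVec_mulVec, Matrix.mulVec_mulVec,
      Matrix.mulVec_mulVec]
  have e7 := congrArg (fun w => d ⬝ᵥ w) (e6 PU)
  have e8 := congrArg (fun w => y ⬝ᵥ w) (e6 p)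
  simp only [dotProduct_sub] at e7 e8
  rw [e5, hx]
  simp only [Matrix.sub_mulVec, Matrix.smul_mulVec, Matrix.mulVec_smul, dotProduct_sub,
    dotProduct_add, add_dotProduct, smul_dotProduct, dotProduct_smul, smul_eq_mul]
  rw [← e7, ← e8]
  field_simp
  ring

/-- The action at time `τ²` between points at distance of order `τ`. -/
theorem exists_act_expansion : ∃ ε : ℝ → ℝ, Tendsto ε (𝓝[>] 0) (𝓝 0) ∧
    ∀ᶠ τ : ℝ in 𝓝[>] 0, ∀ d y : Fin ν → ℂ,
      ‖act A B G U' V ((τ : ℂ) ^ 2) (y + (τ : ℂ) • d) y - 1 / 4 * (d ⬝ᵥ (A 0)⁻¹.mulVec d)‖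
        ≤ ε τ * (‖d‖ + ‖y‖) ^ 2 := by
  have hm := Metric.mem_ball_self (x := (0 : ℂ)) h.pos
  set PU := momentum A B (fun z => z • G z) U' with hPU
  set PV := momentum A B V V' with hPV
  set p : ℝ → Matrix (Fin ν) (Fin ν) ℂ := fun τ => (τ : ℂ)⁻¹ • (PU ((τ : ℂ) ^ 2) - PU 0) with hp
  set v : ℝ → Matrix (Fin ν) (Fin ν) ℂ := fun τ => (τ : ℂ)⁻¹ • (V ((τ : ℂ) ^ 2) - V 0) with hv
  set Hm : ℝ → Matrix (Fin ν) (Fin ν) ℂ := fun τ => (G ((τ : ℂ) ^ 2))⁻¹ with hH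
  have tp : Tendsto p (𝓝[>] 0) (𝓝 0) :=
    tendsto_sq_slope (h.hasDerivAt_momentum hm (h.hasDerivU 0 hm) (h.hasDerivU' 0 hm))
  have tv : Tendsto v (𝓝[>] 0) (𝓝 0) := tendsto_sq_slope (h.hasDerivV 0 hm)
  have tτ : Tendsto (fun τ : ℝ => (τ : ℂ)) (𝓝[>] 0) (𝓝 0) :=
    (Complex.continuous_ofReal.tendsto' 0 0 (by simp)).mono_left nhdsWithin_le_nhds
  have tsq : Tendsto (fun τ : ℝ => (τ : ℂ) ^ 2) (𝓝[>] 0) (𝓝 0) := by simpa using tτ.pow 2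
  have tPU : Tendsto (fun τ : ℝ => PU ((τ : ℂ) ^ 2)) (𝓝[>] 0) (𝓝 (PU 0)) :=
    (h.hasDerivAt_momentum hm (h.hasDerivU 0 hm) (h.hasDerivU' 0 hm)).continuousAt.tendsto.comp tsq
  have tPV : Tendsto (fun τ : ℝ => PV ((τ : ℂ) ^ 2)) (𝓝[>] 0) (𝓝 (PV 0)) :=
    (h.hasDerivAt_momentum hm (h.hasDerivV 0 hm) (h.hasDerivV' 0 hm)).continuousAt.tendsto.comp tsq
  have tH : Tendsto Hm (𝓝[>] 0) (𝓝 1) := by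
    have := (differentiableAt_inv (h.differentiableAt_G hm) (h.unitG 0 hm)).continuousAt.tendsto
    rw [h.G_zero, inv_one] at this
    exact this.comp tsq
  have t1 : Tendsto (fun τ : ℝ => PU ((τ : ℂ) ^ 2) * Hm τ - PU 0) (𝓝[>] 0) (𝓝 0) := by
    simpa using (tPU.mul tH).sub_const (PU 0)
  have t2 : Tendsto (fun τ : ℝ => (τ : ℂ) • PV ((τ : ℂ) ^ 2) - PU ((τ : ℂ) ^ 2) * Hm τ * v τ)
      (𝓝[>] 0) (𝓝 0) := by
    simpa using (tτ.smul tPV).sub ((tPU.mul tH).mul tv)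
  have t3 : Tendsto (fun τ => p τ * Hm τ) (𝓝[>] 0) (𝓝 0) := by simpa using tp.mul tH
  have t4 : Tendsto (fun τ : ℝ => PV ((τ : ℂ) ^ 2) - PV 0 - p τ * Hm τ * v τ) (𝓝[>] 0) (𝓝 0) := by
    simpa using (tPV.sub_const (PV 0)).sub ((tp.mul tH).mul tv)
  have hsum := (((t1.norm.add t2.norm).add t3.norm).add t4.norm).const_mul (ν : ℝ)
  simp only [norm_zero, add_zero, mul_zero] at hsum
  refine ⟨_, hsum, ?_⟩
  filter_upwards [self_mem_nhdsWithin, tsq (Metric.ball_mem_nhds 0 h.pos)] with τ hτ hb d y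
  have h0 : (τ : ℂ) ≠ 0 := by exact_mod_cast (ne_of_gt hτ)
  rw [h.act_add h0 hb d y rfl rfl rfl rfl rfl rfl]
  have e0 : 1 / 4 * (d ⬝ᵥ (A 0)⁻¹.mulVec d) = 1 / 2 * (d ⬝ᵥ (PU 0).mulVec d) := by
    have : PU 0 = (1 / 2 : ℂ) • (A 0)⁻¹ := by simp [hPU, momentum, h.U'_zero]
    rw [this, Matrix.smul_mulVec, dotProduct_smul, smul_eq_mul]
    ring
  have e1 : d ⬝ᵥ (PU ((τ : ℂ) ^ 2) * Hm τ).mulVec d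
      = d ⬝ᵥ (PU ((τ : ℂ) ^ 2) * Hm τ - PU 0).mulVec d + d ⬝ᵥ (PU 0).mulVec d := by
    rw [Matrix.sub_mulVec, dotProduct_sub, sub_add_cancel]
  change ‖1 / 2 * (d ⬝ᵥ (PU ((τ : ℂ) ^ 2) * Hm τ).mulVec d) + _ + _ + _ - _‖ ≤ _
  rw [e0, e1]
  set M₁ := PU ((τ : ℂ) ^ 2) * Hm τ - PU 0
  have b1 := norm_dotProduct_mulVec_le M₁ d d
  have b2 := norm_dotProduct_mulVec_le
    ((τ : ℂ) • PV ((τ : ℂ) ^ 2) - PU ((τ : ℂ) ^ 2) * Hm τ * v τ) d y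
  have b3 := norm_dotProduct_mulVec_le (p τ * Hm τ) y d
  have b4 := norm_dotProduct_mulVec_le (PV ((τ : ℂ) ^ 2) - PV 0 - p τ * Hm τ * v τ) y y
  have hd := norm_nonneg d
  have hy := norm_nonneg y
  have key : ∀ {a b c e f : ℂ} {n₁ n₂ n₃ n₄ : ℝ}, 0 ≤ n₁ → 0 ≤ n₂ → 0 ≤ n₃ → 0 ≤ n₄ →
      ‖a‖ ≤ ν * n₁ * (‖d‖ * ‖d‖) → ‖b‖ ≤ ν * n₂ * (‖d‖ * ‖y‖) → ‖c‖ ≤ ν * n₃ * (‖y‖ * ‖d‖) →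
      ‖e‖ ≤ ν * n₄ * (‖y‖ * ‖y‖) →
      ‖1 / 2 * (a + f) + 1 / 2 * b + 1 / 2 * c + 1 / 2 * e - 1 / 2 * f‖
        ≤ ν * (n₁ + n₂ + n₃ + n₄) * (‖d‖ + ‖y‖) ^ 2 := by
    intro a b c e f n₁ n₂ n₃ n₄ g1 g2 g3 g4 ha hb hc he
    have hν : (0 : ℝ) ≤ ν := Nat.cast_nonneg ν
    have e2 : 1 / 2 * (a + f) + 1 / 2 * b + 1 / 2 * c + 1 / 2 * e - 1 / 2 * f
        = (1 / 2 : ℂ) * (a + b + c + e) := by ring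
    have e3 : ‖a + b + c + e‖ ≤ ‖a‖ + ‖b‖ + ‖c‖ + ‖e‖ := by
      exact norm_add₄_le
    have e4 : ∀ {n s : ℝ}, 0 ≤ n → s ≤ (‖d‖ + ‖y‖) ^ 2 →
        ν * n * s ≤ ν * n * (‖d‖ + ‖y‖) ^ 2 := fun hn hs =>
      mul_le_mul_of_nonneg_left hs (mul_nonneg hν hn)
    have f1 := ha.trans (e4 g1 (by nlinarith))
    have f2 := hb.trans (e4 g2 (by nlinarith))
    have f3 := hc.trans (e4 g3 (by nlinarith))
    have f4 := he.trans (e4 g4 (by nlinarith))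
    rw [e2, norm_mul]
    have : ‖(1 / 2 : ℂ)‖ = 1 / 2 := by norm_num
    rw [this]
    have := norm_nonneg (a + b + c + e)
    nlinarith
  exact key (norm_nonneg _) (norm_nonneg _) (norm_nonneg _) (norm_nonneg _) b1 b2 b3 b4

end Flow

end ShortTime

end

end HeatDeformation

namespace HeatDeformation

noncomputable section

set_option linter.unusedSectionVars false

section Gaussian

/-! ### The initial condition -/

variable {ν : ℕ} {A : ℂ → Matrix (Fin ν) (Fin ν) ℂ}

open scoped MatrixOrder in
theorem exists_symm_sqrt {A₀ : Matrix (Fin ν) (Fin ν) ℝ} (h : A₀.PosDef) :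
    ∃ L : Matrix (Fin ν) (Fin ν) ℝ, L.transpose = L ∧ L * L = A₀ := by
  refine ⟨CFC.sqrt A₀, ?_, CFC.sqrt_mul_sqrt_self A₀ h.posSemidef.nonneg⟩
  have h1 := (Matrix.nonneg_iff_posSemidef.1 (CFC.sqrt_nonneg A₀)).isHermitian
  rwa [Matrix.IsHermitian, Matrix.conjTranspose_eq_transpose_of_trivial] at h1

theorem exists_sqrtMap (hA0 : ∃ A₀ : Matrix (Fin ν) (Fin ν) ℝ, A₀.PosDef ∧
    A 0 = A₀.map Complex.ofReal) :
    ∃ ℓ : EuclideanSpace ℝ (Fin ν) →L[ℝ] EuclideanSpace ℝ (Fin ν), ℓ.det ≠ 0 ∧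
      (A 0).det = ((|ℓ.det| : ℝ) : ℂ) ^ 2 ∧
      ∀ v, toC (ℓ v) ⬝ᵥ (A 0)⁻¹.mulVec (toC (ℓ v)) = ((‖v‖ : ℝ) : ℂ) ^ 2 := by
  obtain ⟨A₀, hpos, hA⟩ := hA0
  obtain ⟨L, hLt, hL⟩ := exists_symm_sqrt hpos
  set ℓ := (Matrix.toLpLin 2 2 L).toContinuousLinearMap with hℓ
  have hdet : ℓ.det = L.det := by
    rw [ContinuousLinearMap.det, hℓ, LinearMap.coe_toContinuousLinearMap, Matrix.toLpLin_eq_toLin,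
      LinearMap.det_toLin]
  have hL0 : L.det ≠ 0 := fun h0 => hpos.det_pos.ne' (by rw [← hL, Matrix.det_mul, h0, zero_mul])
  have hmap : A 0 = L.map Complex.ofReal * L.map Complex.ofReal := by
    rw [hA, ← hL]
    exact Matrix.map_mul (f := Complex.ofRealHom)
  have hdc : (L.map Complex.ofReal).det = (L.det : ℂ) :=
    (RingHom.map_det Complex.ofRealHom L).symm
  refine ⟨ℓ, hdet ▸ hL0, ?_, fun v => ?_⟩
  · rw [hmap, Matrix.det_mul, hdc, hdet, ← Complex.ofReal_pow, sq_abs, pow_two, Complex.ofReal_mul]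
  · have hu : IsUnit (L.map Complex.ofReal).det := by
      rw [hdc]
      exact isUnit_iff_ne_zero.2 (Complex.ofReal_ne_zero.2 hL0)
    have e1 : toC (ℓ v) = (L.map Complex.ofReal).mulVec (toC v) := by
      funext i
      have : ℓ v i = L.mulVec v.ofLp i := rfl
      simp [toC, this, Matrix.mulVec, dotProduct]
    have e2 : (L.map Complex.ofReal).transpose = L.map Complex.ofReal := by
      rw [← Matrix.transpose_map, hLt]
    rw [e1, hmap, Matrix.mul_inv_rev, Matrix.mulVec_mulVec, mul_assoc, Matrix.nonsing_inv_mul _ hu,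
      mul_one, dotProduct_comm, Matrix.dotProduct_mulVec, ← Matrix.mulVec_transpose, e2,
      Matrix.mulVec_mulVec, Matrix.mul_nonsing_inv _ hu, Matrix.one_mulVec,
      EuclideanSpace.norm_eq, ← Complex.ofReal_pow, Real.sq_sqrt (by positivity)]
    simp [toC, dotProduct, pow_two]

theorem integral_comp_affine {F : Type*} [NormedAddCommGroup F] [NormedSpace ℝ F]
    {ℓ : EuclideanSpace ℝ (Fin ν) →L[ℝ] EuclideanSpace ℝ (Fin ν)} (hℓ : ℓ.det ≠ 0)
    (b : EuclideanSpace ℝ (Fin ν)) {s : ℝ} (hs : s ≠ 0) (f : EuclideanSpace ℝ (Fin ν) → F) :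
    ∫ x, f x = ∫ v, (|s| ^ ν * |ℓ.det|) • f (b + s • ℓ v) := by
  have hdet : (s • ℓ).det = s ^ ν * ℓ.det := by
    have : LinearMap.det (s • (ℓ : EuclideanSpace ℝ (Fin ν) →ₗ[ℝ] EuclideanSpace ℝ (Fin ν)))
      = s ^ ν * ℓ.det := by rw [LinearMap.det_smul]; simp
    exact this
  have hd : LinearMap.det ((s • ℓ : EuclideanSpace ℝ (Fin ν) →L[ℝ] EuclideanSpace ℝ (Fin ν)) :
      EuclideanSpace ℝ (Fin ν) →ₗ[ℝ] EuclideanSpace ℝ (Fin ν)) ≠ 0 := by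
    change (s • ℓ).det ≠ 0
    rw [hdet]
    exact mul_ne_zero (pow_ne_zero _ hs) hℓ
  set e := LinearEquiv.ofBijective _ ((Module.End.isUnit_iff _).1
    ((LinearMap.isUnit_iff_isUnit_det _).2 (isUnit_iff_ne_zero.2 hd))) with he
  have hev : ∀ v, e v = s • ℓ v := fun v => rfl
  have h1 := integral_image_eq_integral_abs_det_fderiv_smul volume MeasurableSet.univ
    (f := fun v => b + s • ℓ v) (f' := fun _ => s • ℓ)
    (fun v _ => ((s • ℓ).hasFDerivAt.const_add b).hasFDerivWithinAt)
    (fun u _ v _ huv => e.injective (by simpa [hev] using huv)) f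
  have h2 : (fun v => b + s • ℓ v) '' Set.univ = Set.univ := by
    rw [Set.image_univ, Set.range_eq_univ]
    intro x
    obtain ⟨v, hv⟩ := e.surjective (x - b)
    exact ⟨v, by rw [hev] at hv; simp [hv]⟩
  rw [h2, Measure.restrict_univ] at h1
  rw [h1, hdet, abs_mul, abs_pow]

theorem tendsto_gaussian {F : Type*} [NormedAddCommGroup F] [NormedSpace ℂ F] [CompleteSpace F]
    {S : ℝ → EuclideanSpace ℝ (Fin ν) → ℂ} {ε : ℝ → ℝ} {Ψ : ℝ → EuclideanSpace ℝ (Fin ν) → F}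
    {Ψ₀ : F} {M c : ℝ} (hε : Tendsto ε (𝓝[>] 0) (𝓝 0))
    (hS : ∀ᶠ τ in 𝓝[>] 0, ∀ v, ‖S τ v - 1 / 4 * ((‖v‖ : ℝ) : ℂ) ^ 2‖ ≤ ε τ * (‖v‖ + c) ^ 2)
    (hb : ∀ᶠ τ in 𝓝[>] 0, ∀ v, ‖Ψ τ v‖ ≤ M)
    (hm : ∀ᶠ τ in 𝓝[>] 0, Continuous fun v => Complex.exp (-S τ v) • Ψ τ v)
    (hl : ∀ v, Tendsto (fun τ => Ψ τ v) (𝓝[>] 0) (𝓝 Ψ₀)) :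
    Tendsto (fun τ => ∫ v, Complex.exp (-S τ v) • Ψ τ v) (𝓝[>] 0)
      (𝓝 (((Real.pi / ((1 / 4 : ℝ) : ℂ)) ^ ((ν : ℂ) / 2)) • Ψ₀)) := by
  have hi : Integrable fun v : EuclideanSpace ℝ (Fin ν) =>
      Real.exp (-(1 / 8) * ‖v‖ ^ 2) * (Real.exp (1 / 8 * c ^ 2) * |M|) := by
    have h1 := GaussianFourier.integrable_cexp_neg_mul_sq_norm_add (b := ((1 / 8 : ℝ) : ℂ))
      (by norm_num) 0 (0 : EuclideanSpace ℝ (Fin ν))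
    refine (h1.norm.congr (Eventually.of_forall fun v => ?_)).mul_const _
    simp only [zero_mul, add_zero, Complex.norm_exp, ← Complex.ofReal_pow, ← Complex.ofReal_mul,
      ← Complex.ofReal_neg, Complex.ofReal_re]
  have e1 : ∫ v : EuclideanSpace ℝ (Fin ν), Complex.exp (-((1 / 4 : ℝ) : ℂ) * ‖v‖ ^ 2) • Ψ₀
      = ((Real.pi / ((1 / 4 : ℝ) : ℂ)) ^ ((ν : ℂ) / 2)) • Ψ₀ := by
    rw [integral_smul_const, GaussianFourier.integral_cexp_neg_mul_sq_norm (by norm_num),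
      finrank_euclideanSpace, Fintype.card_fin]
  rw [← e1]
  refine tendsto_integral_filter_of_dominated_convergence _
    (hm.mono fun τ h => h.aestronglyMeasurable) ?_ hi (Eventually.of_forall fun v => ?_)
  · filter_upwards [hS, hb, hε.eventually (eventually_le_nhds (show (0 : ℝ) < 1 / 16 by norm_num))]
      with τ h1 h2 h3
    refine Eventually.of_forall fun v => ?_
    rw [norm_smul, Complex.norm_exp, ← mul_assoc, ← Real.exp_add]
    refine mul_le_mul (Real.exp_le_exp.2 ?_) ((h2 v).trans (le_abs_self M)) (norm_nonneg _)
      (Real.exp_nonneg _)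
    have h4 := (Complex.abs_re_le_norm _).trans (h1 v)
    rw [show (1 / 4 * ((‖v‖ : ℝ) : ℂ) ^ 2) = ((1 / 4 * ‖v‖ ^ 2 : ℝ) : ℂ) by push_cast; ring,
      Complex.sub_re, Complex.ofReal_re] at h4
    have h5 := (abs_le.1 h4).1
    have h6 : ε τ * (‖v‖ + c) ^ 2 ≤ 1 / 16 * (‖v‖ + c) ^ 2 :=
      mul_le_mul_of_nonneg_right h3 (sq_nonneg _)
    rw [Complex.neg_re]
    nlinarith [sq_nonneg (‖v‖ - c)]
  · refine Tendsto.smul ?_ (hl v)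
    have h1 : Tendsto (fun τ => S τ v - 1 / 4 * ((‖v‖ : ℝ) : ℂ) ^ 2) (𝓝[>] 0) (𝓝 0) := by
      refine squeeze_zero_norm' (hS.mono fun τ h => h v) ?_
      simpa using hε.mul_const ((‖v‖ + c) ^ 2)
    have h2 := (h1.add_const (1 / 4 * ((‖v‖ : ℝ) : ℂ) ^ 2)).neg.cexp
    simp only [sub_add_cancel, zero_add] at h2
    convert h2 using 3
    push_cast
    ring

theorem cpow_half_sq {a : ℝ} (ha : 0 ≤ a) : ((a : ℂ) ^ 2) ^ (1 / 2 : ℂ) = a := by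
  have h1 : ((1 / 2 : ℝ) : ℂ) = 1 / 2 := by push_cast; rfl
  rw [← Complex.ofReal_pow, ← h1, ← Complex.ofReal_cpow (by positivity), ← Real.sqrt_eq_rpow,
    Real.sqrt_sq ha]

theorem gaussian_const (ν : ℕ) : ((Real.pi : ℂ) / ((1 / 4 : ℝ) : ℂ)) ^ ((ν : ℂ) / 2)
    = ((Real.sqrt (4 * Real.pi) : ℝ) : ℂ) ^ ν := by
  have h1 : (Real.pi : ℂ) / ((1 / 4 : ℝ) : ℂ) = ((Real.sqrt (4 * Real.pi) : ℝ) : ℂ) ^ 2 := by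
    rw [← Complex.ofReal_pow, Real.sq_sqrt (by positivity)]
    push_cast
    ring
  rw [h1, div_eq_mul_one_div (ν : ℂ) 2, Complex.cpow_nat_mul, cpow_half_sq (Real.sqrt_nonneg _)]

end Gaussian

end

end HeatDeformation

namespace HeatDeformation

noncomputable section

set_option linter.unusedSectionVars false

variable {ν : ℕ} {𝓜 : Type*} [NormedRing 𝓜] [NormedAlgebra ℂ 𝓜] [NormOneClass 𝓜]
  [FiniteDimensional ℂ 𝓜] [MeasurableSpace 𝓜] [BorelSpace 𝓜]
  {A B C G W V H G₀ U' V₀ V' : ℂ → Matrix (Fin ν) (Fin ν) ℂ} {r K Tb T r₀ : ℝ}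
  {c : ℂ → (Fin ν → ℂ) → 𝓜} {m : Measure (EuclideanSpace ℝ (Fin ν))}
  {g : ℂ → EuclideanSpace ℝ (Fin ν) → 𝓜}

section Initial

theorem pConj_zero (x y : Fin ν → ℂ) : pConj A B C c 0 x y = 1 := by
  simp [pConj, vTerm]

theorem continuous_act (t : ℂ) :
    Continuous fun p : (Fin ν → ℂ) × (Fin ν → ℂ) => act A B G U' V t p.1 p.2 := by
  unfold act dotProduct Matrix.mulVec dotProduct
  fun_prop

theorem Flow.pZero_sq_eq (h : Flow A B C r G U' V V') {Θ : ℂ → ℂ} {δ τ : ℝ} (hδ : 0 ≤ δ)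
    (hτ : 0 < τ) (hdet : (A 0).det = (δ : ℂ) ^ 2) (ht : (τ : ℂ) ^ 2 ∈ Metric.ball (0 : ℂ) r)
    (hΘ : (τ : ℂ) ^ 2 * (∫ s in (0 : ℝ)..1, theta A B C ((τ : ℂ) ^ 2 * s)) = Θ ((τ : ℂ) ^ 2))
    (x y : Fin ν → ℂ) :
    pZero A B C ((τ : ℂ) ^ 2) x y = (δ : ℂ)⁻¹ * ((τ : ℂ) ^ ν)⁻¹ *
      (((Real.sqrt (4 * Real.pi) : ℝ) : ℂ) ^ ν)⁻¹ * Complex.exp (Θ ((τ : ℂ) ^ 2)) *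
      Complex.exp (-act A B G U' V ((τ : ℂ) ^ 2) x y) := by
  have h0 : (τ : ℂ) ^ 2 ≠ 0 := pow_ne_zero 2 (Complex.ofReal_ne_zero.2 hτ.ne')
  have e1 : 4 * (Real.pi : ℂ) * (τ : ℂ) ^ 2
      = ((Real.sqrt (4 * Real.pi) * τ : ℝ) : ℂ) ^ 2 := by
    rw [Complex.ofReal_mul, mul_pow, ← Complex.ofReal_pow (Real.sqrt (4 * Real.pi)),
      Real.sq_sqrt (by positivity)]
    push_cast
    ring
  rw [h.pZero_eq ht h0 hΘ, hdet, cpow_half_sq hδ, e1, cpow_half_sq (by positivity), sub_eq_add_neg,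
    Complex.exp_add, Complex.ofReal_mul, mul_pow, mul_inv]
  ring

namespace Deformation

variable (h : Deformation A B C c r K Tb T G W V H m g)
include h

theorem tendsto_integral_pZero_smul_pConj (hf : Flow A B C r₀ G₀ U' V₀ V')
    (hA0 : ∃ A₀ : Matrix (Fin ν) (Fin ν) ℝ, A₀.PosDef ∧ A 0 = A₀.map Complex.ofReal)
    {α γ : ℝ} (hγ : γ * γ = 1) {φ : EuclideanSpace ℝ (Fin ν) → ℂ} (hφ : Continuous φ)
    (hφc : HasCompactSupport φ) (b : EuclideanSpace ℝ (Fin ν)) :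
    Tendsto (fun t : ℝ => ∫ z, φ z •
      (pZero A B C t (toC (b + ((1 - α) * γ) • (z - b))) (toC (b - (α * γ) • (z - b)))
        • pConj A B C c t (toC (b + ((1 - α) * γ) • (z - b))) (toC (b - (α * γ) • (z - b)))))
      (𝓝[>] 0) (𝓝 (φ b • (1 : 𝓜))) := by
  have : CompleteSpace 𝓜 := FiniteDimensional.complete ℂ 𝓜
  obtain ⟨ℓ, hℓ, hdet, hnorm⟩ := exists_sqrtMap hA0
  obtain ⟨Θ, hΘ0, hΘc, hΘ⟩ := hf.exists_thetaPrimitive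
  obtain ⟨ε, hε, hact⟩ := hf.exists_act_expansion
  have hγ0 : γ ≠ 0 := fun h0 => by simp [h0] at hγ
  set κ : ℝ × EuclideanSpace ℝ (Fin ν) → 𝓜 := fun q => φ (b + γ • q.2) •
    pConj A B C c ((q.1 : ℂ) ^ 2) (toC (b + (1 - α) • q.2)) (toC (b - α • q.2)) with hκ
  have htoC : Continuous (toC (ν := ν)) := (toCL ν).continuous
  set δ := min 1 (T / 4) with hδ
  have hδ0 : 0 < δ := lt_min one_pos (by have := h.pos; positivity)
  have hmem : ∀ τ ∈ Set.Icc (0 : ℝ) δ, (τ : ℂ) ^ 2 ∈ halfDiscBar (T / 2) := by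
    intro τ hτ
    have h1 : τ ≤ 1 := hτ.2.trans (min_le_left _ _)
    have h2 : τ ≤ T / 4 := hτ.2.trans (min_le_right _ _)
    refine ⟨?_, ?_⟩
    · rw [norm_pow, Complex.norm_real, Real.norm_of_nonneg hτ.1]
      nlinarith [h.pos, hτ.1]
    · rw [← Complex.ofReal_pow, Complex.ofReal_re]
      positivity
  have hκc : ContinuousOn κ (Set.Icc 0 δ ×ˢ Set.univ) := by
    refine ContinuousOn.smul (by fun_prop) (h.contDiffOn_pConj.continuousOn.comp
      (f := fun q : ℝ × EuclideanSpace ℝ (Fin ν) => ((q.1 : ℂ) ^ 2,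
        toC (b + (1 - α) • q.2), toC (b - α • q.2))) (by fun_prop) fun q hq =>
          ⟨hmem q.1 hq.1, trivial⟩)
  obtain ⟨M, hM⟩ : ∃ M, ∀ q ∈ Set.Icc (0 : ℝ) δ ×ˢ (Set.univ : Set (EuclideanSpace ℝ (Fin ν))),
      ‖κ q‖ ≤ M := by
    have hc : IsCompact ((fun z => γ • (z - b)) '' tsupport φ) :=
      hφc.isCompact.image (by fun_prop)
    obtain ⟨M, hM⟩ := ((isCompact_Icc (a := (0 : ℝ)) (b := δ)).prod hc).exists_bound_of_continuousOn
      (hκc.mono (Set.prod_mono le_rfl (Set.subset_univ _)))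
    refine ⟨max M 0, fun q hq => ?_⟩
    by_cases hz : φ (b + γ • q.2) = 0
    · simp [hκ, hz]
    · refine (hM q ⟨hq.1, b + γ • q.2, subset_tsupport φ hz, ?_⟩).trans (le_max_left _ _)
      simp only [add_sub_cancel_left, smul_smul, hγ, one_smul]
  have hsmall : ∀ᶠ τ : ℝ in 𝓝[>] 0, τ ∈ Set.Icc 0 δ := by
    filter_upwards [Ioo_mem_nhdsGT hδ0] with τ hτ using Set.Ioo_subset_Icc_self hτ
  set X : ℝ → EuclideanSpace ℝ (Fin ν) → EuclideanSpace ℝ (Fin ν) := fun τ v =>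
    b + (1 - α) • τ • ℓ v with hX
  set Y : ℝ → EuclideanSpace ℝ (Fin ν) → EuclideanSpace ℝ (Fin ν) := fun τ v =>
    b - α • τ • ℓ v with hY
  have hXY : ∀ τ v, toC (X τ v) = toC (Y τ v) + (τ : ℂ) • toC (ℓ v) := by
    intro τ v
    have e : X τ v = Y τ v + τ • ℓ v := by
      change b + (1 - α) • τ • ℓ v = b - α • τ • ℓ v + τ • ℓ v
      rw [sub_smul, one_smul]
      abel
    rw [e]
    funext i
    simp [toC]
  set c₀ := ‖ℓ‖ + ‖b‖ + |α| * ‖ℓ‖ + 1 with hc₀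
  have hlim := tendsto_gaussian (S := fun τ v => act A B G₀ U' V₀ ((τ : ℂ) ^ 2) (toC (X τ v))
    (toC (Y τ v))) (ε := fun τ => |ε τ| * c₀ ^ 2) (Ψ := fun τ v => κ (τ, τ • ℓ v))
    (Ψ₀ := φ b • 1) (M := M) (c := 1) (by simpa using hε.abs.mul_const (c₀ ^ 2))
    (by
      filter_upwards [hact, hsmall] with τ h1 h2 v
      have h3 := h1 (toC (ℓ v)) (toC (Y τ v))
      rw [← hXY, hnorm] at h3
      refine h3.trans ((mul_le_mul_of_nonneg_right (le_abs_self _) (sq_nonneg _)).trans ?_)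
      rw [mul_assoc, ← mul_pow]
      refine mul_le_mul_of_nonneg_left (pow_le_pow_left₀ (by positivity) ?_ 2) (abs_nonneg _)
      have h4 : ‖ℓ v‖ ≤ ‖ℓ‖ * ‖v‖ := ℓ.le_opNorm v
      have h5 : ‖Y τ v‖ ≤ ‖b‖ + |α| * (‖ℓ‖ * ‖v‖) := by
        refine (norm_sub_le _ _).trans ?_
        rw [norm_smul, norm_smul, Real.norm_eq_abs, Real.norm_of_nonneg h2.1]
        have : τ * ‖ℓ v‖ ≤ 1 * (‖ℓ‖ * ‖v‖) :=
          mul_le_mul (h2.2.trans (min_le_left _ _)) h4 (norm_nonneg _) zero_le_one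
        rw [one_mul] at this
        gcongr
      have h6 := norm_toC_le (ℓ v)
      have h7 := norm_toC_le (Y τ v)
      have h8 := norm_nonneg v
      have h9 := norm_nonneg b
      have h10 := mul_nonneg (abs_nonneg α) (norm_nonneg ℓ)
      have h11 := norm_nonneg ℓ
      rw [hc₀]
      nlinarith)
    (by filter_upwards [hsmall] with τ h1 v using hM _ ⟨h1, trivial⟩)
    (by
      filter_upwards [hsmall] with τ h1
      refine Continuous.smul (Complex.continuous_exp.comp ((continuous_act _).comp
        (f := fun v => (toC (X τ v), toC (Y τ v))) (by fun_prop)).neg) ?_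
      exact continuousOn_univ.1 (hκc.comp (f := fun v => (τ, τ • ℓ v)) (by fun_prop)
        fun v _ => ⟨h1, trivial⟩))
    (fun v => by
      have h1 : ContinuousWithinAt κ (Set.Icc 0 δ ×ˢ Set.univ) (0, 0) :=
        hκc _ ⟨⟨le_rfl, hδ0.le⟩, trivial⟩
      have h2 : κ (0, 0) = φ b • 1 := by simp [hκ, pConj_zero]
      have h3 : Tendsto (fun τ : ℝ => (τ, τ • ℓ v)) (𝓝[>] 0)
          (𝓝[Set.Icc 0 δ ×ˢ Set.univ] (0, 0)) := by
        refine tendsto_nhdsWithin_iff.2 ⟨?_, hsmall.mono fun τ hτ => ⟨hτ, trivial⟩⟩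
        have : Continuous fun τ : ℝ => (τ, τ • ℓ v) := by fun_prop
        exact (this.tendsto' 0 (0, 0) (by simp)).mono_left nhdsWithin_le_nhds
      rw [← h2]
      exact h1.tendsto.comp h3)
  have hexp : Tendsto (fun τ : ℝ => (((Real.sqrt (4 * Real.pi) : ℝ) : ℂ) ^ ν)⁻¹ *
      Complex.exp (Θ ((τ : ℂ) ^ 2))) (𝓝[>] 0)
      (𝓝 ((((Real.sqrt (4 * Real.pi) : ℝ) : ℂ) ^ ν)⁻¹)) := by
    have h1 : Tendsto (fun τ : ℝ => (τ : ℂ) ^ 2) (𝓝[>] 0) (𝓝 0) := by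
      have : Continuous fun τ : ℝ => (τ : ℂ) ^ 2 := by fun_prop
      exact (this.tendsto' 0 0 (by simp)).mono_left nhdsWithin_le_nhds
    simpa [hΘ0] using ((hΘc.tendsto.comp h1).cexp).const_mul
      ((((Real.sqrt (4 * Real.pi) : ℝ) : ℂ) ^ ν)⁻¹)
  have hs0 : ((Real.sqrt (4 * Real.pi) : ℝ) : ℂ) ^ ν ≠ 0 :=
    pow_ne_zero _ (Complex.ofReal_ne_zero.2 (by positivity))
  have hprod := hexp.smul hlim
  rw [gaussian_const, smul_smul, inv_mul_cancel₀ hs0, one_smul] at hprod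
  have hsqrt : Tendsto Real.sqrt (𝓝[>] 0) (𝓝[>] 0) := by
    refine tendsto_nhdsWithin_iff.2 ⟨?_, ?_⟩
    · exact (Real.continuous_sqrt.tendsto' 0 0 Real.sqrt_zero).mono_left nhdsWithin_le_nhds
    · filter_upwards [self_mem_nhdsWithin] with t ht using Real.sqrt_pos.2 ht
  refine (hprod.comp hsqrt).congr' ?_
  have hball : ∀ᶠ τ : ℝ in 𝓝[>] 0, (τ : ℂ) ^ 2 ∈ Metric.ball (0 : ℂ) r₀ := by
    have : Continuous fun τ : ℝ => (τ : ℂ) ^ 2 := by fun_prop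
    exact ((this.tendsto' 0 0 (by simp)).mono_left nhdsWithin_le_nhds)
      (Metric.ball_mem_nhds 0 hf.pos)
  filter_upwards [self_mem_nhdsWithin, hsqrt.eventually hball] with t ht hb
  have ht : 0 < t := ht
  have hτ : 0 < Real.sqrt t := Real.sqrt_pos.2 ht
  have etc : (t : ℂ) = ((Real.sqrt t : ℝ) : ℂ) ^ 2 := by
    rw [← Complex.ofReal_pow, Real.sq_sqrt ht.le]
  rw [etc, Function.comp_apply]
  generalize Real.sqrt t = τ at hτ hb
  have hτ0 : (τ : ℂ) ≠ 0 := Complex.ofReal_ne_zero.2 hτ.ne'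
  have hd0 : (|ℓ.det| : ℝ) ≠ 0 := abs_ne_zero.2 hℓ
  have hdc : ((|ℓ.det| : ℝ) : ℂ) ≠ 0 := Complex.ofReal_ne_zero.2 hd0
  symm
  rw [integral_comp_affine hℓ b (s := γ * τ) (mul_ne_zero hγ0 hτ.ne'),
    ← integral_smul]
  refine integral_congr_ae (Eventually.of_forall fun v => ?_)
  have habs : |γ * τ| = τ := by
    have : |γ| = 1 := by
      have h1 := abs_mul_abs_self γ
      rw [hγ] at h1
      nlinarith [abs_nonneg γ]
    rw [abs_mul, this, one_mul, abs_of_pos hτ]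
  have e1 : b + ((1 - α) * γ) • (b + (γ * τ) • ℓ v - b) = X τ v := by
    rw [add_sub_cancel_left, smul_smul, ← mul_assoc, mul_assoc (1 - α), hγ, mul_one, ← smul_smul]
  have e2 : b - (α * γ) • (b + (γ * τ) • ℓ v - b) = Y τ v := by
    rw [add_sub_cancel_left, smul_smul, ← mul_assoc, mul_assoc α, hγ, mul_one, ← smul_smul]
  have e3 : κ (τ, τ • ℓ v) = φ (b + (γ * τ) • ℓ v) •
      pConj A B C c ((τ : ℂ) ^ 2) (toC (X τ v)) (toC (Y τ v)) := by
    simp only [hκ, hX, hY, smul_smul]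
  simp only [habs, e1, e2, e3]
  rw [hf.pZero_sq_eq (abs_nonneg _) hτ hdet hb
    (hΘ _ hb (pow_ne_zero 2 hτ0)).2, ← Complex.coe_smul]
  simp only [smul_smul]
  congr 1
  push_cast
  field_simp

end Deformation

end Initial

end

end HeatDeformation

theorem mainTheorem1 {ν : ℕ} (hν : 1 ≤ ν)
    {𝓜 : Type*} [NormedRing 𝓜] [NormedAlgebra ℂ 𝓜] [NormOneClass 𝓜] [FiniteDimensional ℂ 𝓜]
    [MeasurableSpace 𝓜] [BorelSpace 𝓜]
    (A B C : ℂ → Matrix (Fin ν) (Fin ν) ℂ)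
    (hA : ∀ j k, AnalyticAt ℂ (fun t => A t j k) 0)
    (hB : ∀ j k, AnalyticAt ℂ (fun t => B t j k) 0)
    (hC : ∀ j k, AnalyticAt ℂ (fun t => C t j k) 0)
    (hAsymm : ∀ᶠ t in 𝓝 (0 : ℂ), (A t).IsSymm)
    (hCsymm : ∀ᶠ t in 𝓝 (0 : ℂ), (C t).IsSymm)
    (hA0 : ∃ A₀ : Matrix (Fin ν) (Fin ν) ℝ, A₀.PosDef ∧ A 0 = A₀.map Complex.ofReal)
    (hreal : ∀ᶠ τ : ℝ in 𝓝 0, ∀ j k,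
      (A (Complex.I * τ) j k).im = 0 ∧
      (Complex.I * B (Complex.I * τ) j k).im = 0 ∧
      (C (Complex.I * τ) j k).im = 0)
    (Tb : ℝ) (hTb : 0 < Tb)
    (f : ℂ → EuclideanSpace ℝ (Fin ν) → 𝓜)
    (hfmeas : Measurable
      fun p : Metric.ball (0 : ℂ) Tb × EuclideanSpace ℝ (Fin ν) => f p.1 p.2)
    (hfan : ∀ ξ, AnalyticOnNhd ℂ (fun t => f t ξ) (Metric.ball 0 Tb))
    (μ : Measure (EuclideanSpace ℝ (Fin ν)))
    (hμ : ∀ R : ℝ, 0 < R →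
      ∫⁻ ξ, ENNReal.ofReal (Real.exp (R * ‖ξ‖)) * ⨆ t ∈ Metric.ball (0 : ℂ) Tb, ‖f t ξ‖ₑ ∂μ < ⊤) :
    ∃ Tc : ℝ, 0 < Tc ∧ Tc ≤ Tb ∧
      -- the series is well defined on the closed half-disc
      (∀ t ∈ halfDiscBar Tc, ∀ x y, SeriesWellDefined A B C (potential μ f) t x y) ∧
      -- regularity
      AnalyticOnNhd ℂ
        (fun p : ℂ × (Fin ν → ℂ) × (Fin ν → ℂ) =>
          pConj A B C (potential μ f) p.1 p.2.1 p.2.2)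
        (halfDisc Tc ×ˢ Set.univ) ∧
      SmoothEntireValued (halfDiscBar Tc)
        (fun (t : ℂ) (p : (Fin ν → ℂ) × (Fin ν → ℂ)) =>
          pConj A B C (potential μ f) t p.1 p.2) ∧
      CInftyB1 Tc
        (fun (t : ℂ) (p : EuclideanSpace ℝ (Fin ν) × EuclideanSpace ℝ (Fin ν)) =>
          pConj A B C (potential μ f) t (toC p.1) (toC p.2)) ∧
      -- the partial differential equation for `u = p⁰ p^conj`
      (∀ t ∈ halfDiscBar Tc, t ≠ 0 → ∀ x y : Fin ν → ℂ,
        HasDerivWithinAt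
          (fun t' => pZero A B C t' x y • pConj A B C (potential μ f) t' x y)
          (opP0 A B C t
              (fun x' => pZero A B C t x' y • pConj A B C (potential μ f) t x' y) x
            + potential μ f t x *
              (pZero A B C t x y • pConj A B C (potential μ f) t x y))
          (halfDiscBar Tc) t) ∧
      -- the initial condition: `u → δ_{x=y}` as `t → 0⁺`, in either variable
      (∀ φ : EuclideanSpace ℝ (Fin ν) → ℂ, Continuous φ → HasCompactSupport φ →
        (∀ y : EuclideanSpace ℝ (Fin ν),
          Tendsto
            (fun t : ℝ => ∫ x, φ x •
              (pZero A B C t (toC x) (toC y) • pConj A B C (potential μ f) t (toC x) (toC y)))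
            (𝓝[>] 0) (𝓝 (φ y • (1 : 𝓜)))) ∧
        ∀ x : EuclideanSpace ℝ (Fin ν),
          Tendsto
            (fun t : ℝ => ∫ y, φ y •
              (pZero A B C t (toC x) (toC y) • pConj A B C (potential μ f) t (toC x) (toC y)))
            (𝓝[>] 0) (𝓝 (φ x • (1 : 𝓜)))) := by
  obtain ⟨A₀, hA₀, hA₀'⟩ := hA0
  have hunit : IsUnit (A 0) := by
    rw [Matrix.isUnit_iff_isUnit_det, hA₀',
      show (A₀.map Complex.ofReal).det = (A₀.det : ℂ) from
        (RingHom.map_det Complex.ofRealHom A₀).symm]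
    exact isUnit_iff_ne_zero.2 (Complex.ofReal_ne_zero.2 hA₀.det_pos.ne')
  obtain ⟨r₀, G₀, U', V₀, V', hflow⟩ := exists_flow hA hB hC hAsymm hCsymm hunit hreal
  obtain ⟨r, K, G, W, V, H, -, hr, -, -, hphase⟩ := hflow.exists_phase ⟨A₀, hA₀, hA₀'⟩
  obtain ⟨m, g, hpot⟩ := exists_fourierPotential hTb hfmeas hfan hμ
  obtain ⟨T, -, h⟩ := hphase.exists_deformation hpot hTb one_pos
  have hT := h.pos
  refine ⟨T / 2, half_pos hT, by linarith [h.le_Tb], fun t ht x y => h.seriesWellDefined ht x y,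
    h.analyticOnNhd_pConj, h.smoothEntireValued_pConj, h.cInftyB1_pConj,
    fun t ht h0 x y => h.hasDerivWithinAt_pZero_smul_pConj hflow hr.le ht h0 x y,
    fun φ hφ hφc => ⟨fun y => ?_, fun x => ?_⟩⟩
  · simpa using h.tendsto_integral_pZero_smul_pConj hflow ⟨A₀, hA₀, hA₀'⟩ (α := 0) (γ := 1)
      (by norm_num) hφ hφc y
  · simpa using h.tendsto_integral_pZero_smul_pConj hflow ⟨A₀, hA₀, hA₀'⟩ (α := 1) (γ := -1)
      (by norm_num) hφ hφc x
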